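/- All graphs are finite and simple. A graph $G$ is \emph{sparse} if every edge is incident with at least one vertex of degree at most $2$. A vertex of $G$ is \emph{free} if it has degree $2$ and both of its neighbours have degree $2$. A \emph{hole} is a chordless cycle of length at least $4$; a \emph{ring} of $G$ is a hole of $G$ with at most one vertex whose degree in $G$ is at least $3$. A \emph{small theta} of $G$ is an induced subgraph of $G$ isomorphic to $K_{2,3}$. A set $S$ of $k$ vertices, $1\le k\le 3$, is \emph{good} if (i) at most one vertex of $S$ is of degree $2$ and not free; (ii) if $k=3$, then $S$ is not contained in a ring of $G$ of length $5$; (iii) if $k=3$ and some $w\in S$ is of degree $2$ and not free, then the two vertices of $S\setminus\{w\}$ are not adjacent. An \emph{$s$-edge-coloring} of $G$ is a map from $E(G)$ to $\{1,\dots,s\}$ that gives distinct colors to any two distinct edges with a common end. \textbf{Lemma.} Let $G$ be a triangle-free sparse graph with minimum degree $\delta(G)=2$, let $s=\max\{3,\Delta(G)\}$, where $\Delta(G)$ is the maximum degree of $G$, and let $v_1,\dots,v_k\in V(G)$, $1\le k\le 3$, be distinct vertices such that $\{v_1,\dots,v_k\}$ does not induce a path of length $2$ (a path with three vertices). Let lists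 of colors $L_i\subseteq\{1,\dots,s\}$ with $|L_i|\ge \deg(v_i)$, $1\le i\le k$, be given such that $L_i\cap L_j\ne\emptyset$ whenever $v_i$ and $v_j$ are adjacent. Suppose that one of the following holds: \begin{itemize} \item[(1)] $k=3$, $\{v_1,v_2,v_3\}$ is contained in a ring of $G$ of length $5$, and $|L_1\cup L_2\cup L_3|\ge 3$; \item[(2)] the set $\{v_1,\dots,v_k\}$ is good; \item[(3)] $k=2$, and if $v_1$ and $v_2$ are both of degree $2$, then $\{v_1,v_2\}$ is not contained in a small theta of $G$. \end{itemize} Then there is an $s$-edge-coloring of $G$ such that, for $1\le i\le k$, every edge incident with $v_i$ is colored with a color from $L_i$. Furthermore, there is an $\mathcal O(nm)$-time algorithm that finds such an edge-coloring, where $n=|V(G)|$ and $m=|E(G)|$: a single program for a word RAM with words of $\mathcal O(\log n)$ bits that, given $n$, $m$, $k$, the edges of $G$ in any order, the vertices $v_i$ and the lists $L_i$ (satisfying the hypotheses above), halts after at most $C\cdot nm$ unit-cost steps, for an absolute constant $C$, and outputs such an edge-coloring. -/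

import Mathlib

/-! ## Graph notions -/

namespace SparseGraph

variable {V : Type*}

/-- Every edge is incident with at least one vertex of degree at most 2. -/
def IsSparse [Fintype V] (G : SimpleGraph V) [DecidableRel G.Adj] : Prop :=
  ∀ ⦃u v : V⦄, G.Adj u v → G.degree u ≤ 2 ∨ G.degree v ≤ 2

/-- A vertex is free if it has degree 2 and both of its neighbours have degree 2. -/
def IsFree [Fintype V] (G : SimpleGraph V) [DecidableRel G.Adj] (v : V) : Prop :=
  G.degree v = 2 ∧ ∀ ⦃w : V⦄, G.Adj v w → G.degree w = 2

/-- A hole: a chordless cycle of length at least 4. -/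
structure IsHole (G : SimpleGraph V) {u : V} (p : G.Walk u u) : Prop where
  isCycle : p.IsCycle
  four_le_length : 4 ≤ p.length
  isChordless : p.IsChordless

/-- A ring: a hole with at most one vertex that has degree at least 3 in `G`. -/
structure IsRing [Fintype V] (G : SimpleGraph V) [DecidableRel G.Adj] {u : V}
    (p : G.Walk u u) : Prop where
  isHole : IsHole G p
  atMostOne : ∀ ⦃x⦄, x ∈ p.support → ∀ ⦃y⦄, y ∈ p.support →
    3 ≤ G.degree x → 3 ≤ G.degree y → x = y

/-- The set `S` is contained in a ring of length 5 of `G`. -/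
def InRingFive [Fintype V] (G : SimpleGraph V) [DecidableRel G.Adj] (S : Set V) : Prop :=
  ∃ (u : V) (p : G.Walk u u), IsRing G p ∧ p.length = 5 ∧ ∀ x ∈ S, x ∈ p.support

/-- The set `S` is contained in a small theta of `G`, that is,
in an induced subgraph isomorphic to `K_{2,3}`. -/
def InSmallTheta (G : SimpleGraph V) (S : Set V) : Prop :=
  ∃ T : Set V, S ⊆ T ∧ Nonempty (G.induce T ≃g completeBipartiteGraph (Fin 2) (Fin 3))

/-- The set `S` induces a path of length 2 (a path with two edges and three vertices). -/
def InducesPathTwo (G : SimpleGraph V) (S : Set V) : Prop :=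
  Nonempty (G.induce S ≃g SimpleGraph.pathGraph 3)

/-- Good sets of one, two or three vertices. -/
structure IsGood [Fintype V] (G : SimpleGraph V) [DecidableRel G.Adj] (S : Set V) : Prop where
  one_le_ncard : 1 ≤ S.ncard
  ncard_le_three : S.ncard ≤ 3
  atMostOne : ∀ ⦃x⦄, x ∈ S → ∀ ⦃y⦄, y ∈ S →
    (G.degree x = 2 ∧ ¬ IsFree G x) → (G.degree y = 2 ∧ ¬ IsFree G y) → x = y
  not_inRingFive : S.ncard = 3 → ¬ InRingFive G S
  not_adj : S.ncard = 3 → ∀ ⦃x⦄, x ∈ S → G.degree x = 2 → ¬ IsFree G x →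
    ∀ ⦃y⦄, y ∈ S \ {x} → ∀ ⦃z⦄, z ∈ S \ {x} → ¬ G.Adj y z

/-- The number `s = max {3, Δ(G)}` of colours. -/
def numColors [Fintype V] (G : SimpleGraph V) [DecidableRel G.Adj] : ℕ :=
  max 3 G.maxDegree

/-- The instances of the problem: a graph, `k` distinct vertices `v i`, and lists `L i`. -/
structure IsInstance [Fintype V] (G : SimpleGraph V) [DecidableRel G.Adj] {k : ℕ}
    (v : Fin k → V) (L : Fin k → Finset ℕ) : Prop where
  triangleFree : G.CliqueFree 3
  sparse : IsSparse G
  minDegree_eq : G.minDegree = 2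
  one_le : 1 ≤ k
  le_three : k ≤ 3
  injective : Function.Injective v
  not_inducesPathTwo : ¬ InducesPathTwo G (Set.range v)
  list_subset : ∀ i, L i ⊆ Finset.Icc 1 (numColors G)
  degree_le_card : ∀ i, G.degree (v i) ≤ (L i).card
  inter_nonempty : ∀ i j, G.Adj (v i) (v j) → (L i ∩ L j).Nonempty
  cases :
    (k = 3 ∧ InRingFive G (Set.range v) ∧ 3 ≤ (Finset.univ.biUnion L).card) ∨
    IsGood G (Set.range v) ∨
    (k = 2 ∧ ((∀ i, G.degree (v i) = 2) → ¬ InSmallTheta G (Set.range v)))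

/-- `c` is an `s`-edge-colouring of `G` with colours `1, …, s`; only the values of `c` on the
edges of `G` matter. -/
def IsEdgeColoring (G : SimpleGraph V) (s : ℕ) (c : Sym2 V → ℕ) : Prop :=
  (∀ e ∈ G.edgeSet, c e ∈ Finset.Icc 1 s) ∧
  ∀ ⦃u v w : V⦄, G.Adj u v → G.Adj u w → v ≠ w → c s(u, v) ≠ c s(u, w)

/-- Every edge incident with `v i` is coloured with a colour from `L i`. -/
def RespectsLists (G : SimpleGraph V) {k : ℕ} (v : Fin k → V) (L : Fin k → Finset ℕ)
    (c : Sym2 V → ℕ) : Prop :=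
  ∀ (i : Fin k) ⦃w : V⦄, G.Adj (v i) w → c s(v i, w) ∈ L i

/-- `e` lists every edge of `G` exactly once (in arbitrary order and orientation). -/
def IsEdgeList (G : SimpleGraph V) {m : ℕ} (e : Fin m → V × V) : Prop :=
  Function.Injective (fun i => s((e i).1, (e i).2)) ∧
  Set.range (fun i => s((e i).1, (e i).2)) = G.edgeSet

end SparseGraph

/-! ## Random access machines

A word RAM in structured form: a finite program works on word-valued variables and on
random access arrays, all of them named by numbers that are fixed in the program. -/

namespace RAM

/-- Expressions. Comparisons have value 1 (true) or 0 (false). -/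
inductive Expr : Type
  | const (a : ℕ)
  | var (x : ℕ)
  | load (a : ℕ) (i : Expr)
  | add (p q : Expr)
  | sub (p q : Expr)
  | mul (p q : Expr)
  | lt (p q : Expr)
  | eq (p q : Expr)

/-- Programs. -/
inductive Prog : Type
  | skip
  | assign (x : ℕ) (p : Expr)
  | store (a : ℕ) (i p : Expr)
  | seq (P Q : Prog)
  | cond (p : Expr) (P Q : Prog)
  | loop (p : Expr) (P : Prog)

/-- Memory contents: the variables, and the arrays `arr a` with cells `arr a 0, arr a 1, …`. -/
structure State : Type where
  var : ℕ → ℕ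
  arr : ℕ → ℕ → ℕ

/-- Value of an expression (subtraction is truncated at 0). -/
def Expr.eval (σ : State) : Expr → ℕ
  | .const a => a
  | .var x => σ.var x
  | .load a i => σ.arr a (i.eval σ)
  | .add p q => p.eval σ + q.eval σ
  | .sub p q => p.eval σ - q.eval σ
  | .mul p q => p.eval σ * q.eval σ
  | .lt p q => if p.eval σ < q.eval σ then 1 else 0
  | .eq p q => if p.eval σ = q.eval σ then 1 else 0

/-- The number of operations that the evaluation of an expression takes. -/
def Expr.cost : Expr → ℕ
  | .const _ => 1
  | .var _ => 1
  | .load _ i => i.cost + 1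
  | .add p q => p.cost + q.cost + 1
  | .sub p q => p.cost + q.cost + 1
  | .mul p q => p.cost + q.cost + 1
  | .lt p q => p.cost + q.cost + 1
  | .eq p q => p.cost + q.cost + 1

def State.setVar (σ : State) (x w : ℕ) : State :=
  { σ with var := Function.update σ.var x w }

def State.setArr (σ : State) (a i w : ℕ) : State :=
  { σ with arr := Function.update σ.arr a (Function.update (σ.arr a) i w) }

/-- `Run W P σ t τ`: started in `σ`, the program `P` halts in `τ` after exactly `t` unit-cost
steps, and every value that it writes and every address that it writes to is at most `W`.
A step that would exceed `W` has no successor, so that such a run does not count as halting.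
(An expression of a fixed program has a fixed size, so its intermediate values are bounded by a
fixed polynomial in `W`.) -/
inductive Run (W : ℕ) : Prog → State → ℕ → State → Prop
  | skip (σ : State) : Run W .skip σ 1 σ
  | assign (x : ℕ) (p : Expr) (σ : State) (h : p.eval σ ≤ W) :
      Run W (.assign x p) σ (p.cost + 1) (σ.setVar x (p.eval σ))
  | store (a : ℕ) (i p : Expr) (σ : State) (hi : i.eval σ ≤ W) (h : p.eval σ ≤ W) :
      Run W (.store a i p) σ (i.cost + p.cost + 1) (σ.setArr a (i.eval σ) (p.eval σ))
  | seq {P Q : Prog} {σ τ υ : State} {t t' : ℕ} (h : Run W P σ t τ) (h' : Run W Q τ t' υ) :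
      Run W (.seq P Q) σ (t + t') υ
  | cond_true {p : Expr} {P Q : Prog} {σ τ : State} {t : ℕ} (hp : p.eval σ ≠ 0)
      (h : Run W P σ t τ) : Run W (.cond p P Q) σ (p.cost + 1 + t) τ
  | cond_false {p : Expr} {P Q : Prog} {σ τ : State} {t : ℕ} (hp : p.eval σ = 0)
      (h : Run W Q σ t τ) : Run W (.cond p P Q) σ (p.cost + 1 + t) τ
  | loop_true {p : Expr} {P : Prog} {σ τ υ : State} {t t' : ℕ} (hp : p.eval σ ≠ 0)
      (h : Run W P σ t τ) (h' : Run W (.loop p P) τ t' υ) :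
      Run W (.loop p P) σ (p.cost + 1 + t + t') υ
  | loop_false {p : Expr} {P : Prog} {σ : State} (hp : p.eval σ = 0) :
      Run W (.loop p P) σ (p.cost + 1) σ

/-- The initial memory for a graph with vertices `0, …, n - 1` that is given by the list `e` of
its `m` edges, together with the vertices `v j` and the lists `l j` of colours, `j < k`:
variables 0, 1, 2 hold `n`, `m`, `k`; arrays 0 and 1 hold the first and the second ends of the
edges; array 2 holds the vertices `v j`; array 3 holds the lengths of the lists; array `4 + j`
holds the list `l j`. All the rest of the memory is 0. -/
def input {n m k : ℕ} (e : Fin m → Fin n × Fin n) (v : Fin k → Fin n) (l : Fin k → List ℕ) :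
    State where
  var x := match x with
    | 0 => n
    | 1 => m
    | 2 => k
    | _ => 0
  arr a i := match a with
    | 0 => if h : i < m then (e ⟨i, h⟩).1 else 0
    | 1 => if h : i < m then (e ⟨i, h⟩).2 else 0
    | 2 => if h : i < k then v ⟨i, h⟩ else 0
    | 3 => if h : i < k then (l ⟨i, h⟩).length else 0
    | j + 4 => if h : j < k then (l ⟨j, h⟩).getD i 0 else 0

/-- The output: on halting, cell `i` of array 0 holds the colour of the `i`-th edge of the
input. -/
def Outputs {n m : ℕ} (σ : State) (e : Fin m → Fin n × Fin n) (c : Sym2 (Fin n) → ℕ) : Prop :=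
  ∀ i : Fin m, σ.arr 0 i = c s((e i).1, (e i).2)

end RAM

/-! ## Structured commands with bounded loops -/

namespace RAM

/-! Call the vertices of degree at least 3 and the listed vertices `v j` centers. A few edges near
the `v j` are precoloured, so that no remaining edge joins two centers. The remaining edges at
centers then form a bipartite graph: its left vertices are centers, its right vertices have degree 2
and carry no lists. Edges without a center are coloured last; each of them meets at most two others,
so three colours suffice (`Data.Part.step`).

The bipartite graph is coloured by Galvin's method. The colours are treated one after the other,
each colour class is a stable matching for suitable preferences, and an edge stays uncoloured only
if every colour available to it has been taken by an edge that dominates it; fewer dominators than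
available colours is therefore enough (`Galvin.Inv.complete`). An edge from a center `x` has about
`deg x` colours, but its potential dominators are the `deg x - 1` other edges at `x` and one edge at
the right end, which is one too many. The remedy is a matching that saturates the left vertices: its
edges come last at their left ends and first at their right ends. A matching edge is then dominated
from the left only, and every other edge is no longer dominated by the matching edge at its left end
(`Data.IsPre.count`). Unlisted vertices of degree less than `s` have a spare colour and need no
matching edge.

Since right vertices have degree at most 2, Hall's condition for this matching holds if every left
vertex has two useful edges, with a total deficit of one allowed (`Data.NotCen.hall_one`). For the
same reason the matching can be found greedily, by serving first a left vertex that has a single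
edge left (`Peel.Inv.step`).

It remains to choose precolourings with a deficit of at most one. The cases are: no adjacent listed
vertices and none that is non-free of degree 2 (nothing is precoloured); exactly one such non-free
vertex (both its edges); two adjacent free vertices (the edge between them, where the only
obstruction is a ring of length 5); a ring of length 5 (all its edges); and two non-free vertices
(all their edges, where the obstruction leads to a small theta or to a configuration that is
repaired by repeating one colour). They are collected in `Data.exists_pre`.

For the algorithm, each of these precolourings is described by seven digits to base 5, so a constant
number of trials, each verified, is enough. Each trial consists of loops of length at most `m`,
nested at most twice, and `n ≤ m ≤ 2 * n`, which gives time of order `n * m`. -/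

/-- Programs all of whose loops run through `0, …, b - 1` for a variable `b`. -/
inductive Cmd : Type
  | skip
  | assign (x : ℕ) (p : Expr)
  | store (a : ℕ) (i p : Expr)
  | seq (P Q : Cmd)
  | ite (p : Expr) (P Q : Cmd)
  | loop (i b : ℕ) (P : Cmd)

theorem State.setVar_arr (σ : State) (x w : ℕ) : (σ.setVar x w).arr = σ.arr := rfl

theorem State.setArr_var (σ : State) (a i w : ℕ) : (σ.setArr a i w).var = σ.var := rfl

theorem State.setVar_var (σ : State) (x w y : ℕ) :
    (σ.setVar x w).var y = if y = x then w else σ.var y := by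
  simp [State.setVar, Function.update_apply]

theorem State.setArr_arr (σ : State) (a i w b j : ℕ) :
    (σ.setArr a i w).arr b j = if b = a ∧ j = i then w else σ.arr b j := by
  by_cases hb : b = a
  · subst hb; simp [State.setArr, Function.update_apply]
  · simp [State.setArr, hb]

/-- Iterate `f`, with variable `i` counting the iterations. -/
def iter (f : State → State) (i : ℕ) : ℕ → State → State
  | 0, σ => σ.setVar i 0
  | k + 1, σ => (f (iter f i k σ)).setVar i (k + 1)

namespace Cmd

def toProg : Cmd → Prog
  | skip => .skip
  | assign x p => .assign x p
  | store a i p => .store a i p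
  | seq P Q => .seq P.toProg Q.toProg
  | ite p P Q => .cond p P.toProg Q.toProg
  | loop i b P => .seq (.assign i (.const 0)) (.loop (.lt (.var i) (.var b))
      (.seq P.toProg (.assign i (.add (.var i) (.const 1)))))

/-- The state transformer computed by a command. -/
def den : Cmd → State → State
  | skip, σ => σ
  | assign x p, σ => σ.setVar x (p.eval σ)
  | store a i p, σ => σ.setArr a (i.eval σ) (p.eval σ)
  | seq P Q, σ => Q.den (P.den σ)
  | ite p P Q, σ => if p.eval σ ≠ 0 then P.den σ else Q.den σ
  | loop i b P, σ => iter P.den i (σ.var b) σ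

/-- Variables written. -/
def wv : Cmd → List ℕ
  | skip => []
  | assign x _ => [x]
  | store _ _ _ => []
  | seq P Q => P.wv ++ Q.wv
  | ite _ P Q => P.wv ++ Q.wv
  | loop i _ P => i :: P.wv

/-- Arrays written. -/
def wa : Cmd → List ℕ
  | skip => []
  | assign _ _ => []
  | store a _ _ => [a]
  | seq P Q => P.wa ++ Q.wa
  | ite _ P Q => P.wa ++ Q.wa
  | loop _ _ P => P.wa

/-- Loop bounds lie in `B`, no variable of `B` is written, loop counters are not written by
the loop bodies. -/
def wf (B : List ℕ) : Cmd → Bool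
  | skip => true
  | assign x _ => decide (x ∉ B)
  | store _ _ _ => true
  | seq P Q => P.wf B && Q.wf B
  | ite _ P Q => P.wf B && Q.wf B
  | loop i b P => decide (b ∈ B) && decide (i ∉ B) && decide (i ∉ P.wv) && P.wf B

/-- Time bound when every loop has at most `N` iterations. -/
def tb (N : ℕ) : Cmd → ℕ
  | skip => 1
  | assign _ p => p.cost + 1
  | store _ i p => i.cost + p.cost + 1
  | seq P Q => P.tb N + Q.tb N
  | ite p P Q => p.cost + 1 + (P.tb N + Q.tb N)
  | loop _ _ P => 2 + (N + 1) * (8 + P.tb N)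

/-- Nesting depth of loops. -/
def depth : Cmd → ℕ
  | skip => 0
  | assign _ _ => 0
  | store _ _ _ => 0
  | seq P Q => max P.depth Q.depth
  | ite _ P Q => max P.depth Q.depth
  | loop _ _ P => P.depth + 1

/-- Each level of nesting costs a factor of at most `2 * N` in place of `N + 1`. For `N = 1` this is
the factor `1 + 1` in `tb 1`, which is why `C.tb 1` serves as the constant. -/
theorem tb_le (C : Cmd) {N : ℕ} (hN : 1 ≤ N) {d : ℕ} (hd : C.depth ≤ d) :
    C.tb N ≤ C.tb 1 * N ^ d := by
  induction C generalizing d with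
  | skip => exact le_mul_of_one_le_right (Nat.zero_le _) (Nat.one_le_pow _ _ hN)
  | assign x p => exact le_mul_of_one_le_right (Nat.zero_le _) (Nat.one_le_pow _ _ hN)
  | store a i p => exact le_mul_of_one_le_right (Nat.zero_le _) (Nat.one_le_pow _ _ hN)
  | seq P Q hP hQ =>
    simp only [depth, max_le_iff] at hd
    have h1 := hP hd.1
    have h2 := hQ hd.2
    simp only [tb]
    nlinarith
  | ite p P Q hP hQ =>
    simp only [depth, max_le_iff] at hd
    have h1 := hP hd.1
    have h2 := hQ hd.2
    have h3 : p.cost + 1 ≤ (p.cost + 1) * N ^ d :=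
      le_mul_of_one_le_right (Nat.zero_le _) (Nat.one_le_pow _ _ hN)
    simp only [tb]
    nlinarith
  | loop i b P hP =>
    obtain ⟨d, rfl⟩ : ∃ e, d = e + 1 := ⟨d - 1, by simp only [depth] at hd; omega⟩
    have h1 := hP (d := d) (by simp only [depth] at hd; omega)
    have h2 : 1 ≤ N ^ d := Nat.one_le_pow _ _ hN
    have h3 : 8 + P.tb N ≤ (8 + P.tb 1) * N ^ d := by nlinarith
    simp only [tb]
    calc 2 + (N + 1) * (8 + P.tb N) ≤ 2 * (N * N ^ d) + (2 * N) * ((8 + P.tb 1) * N ^ d) := by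
          have : 1 ≤ N * N ^ d := Nat.one_le_iff_ne_zero.2 (by positivity)
          have h4 : (N + 1) * (8 + P.tb N) ≤ (2 * N) * ((8 + P.tb 1) * N ^ d) :=
            Nat.mul_le_mul (by omega) h3
          omega
      _ = (2 + (1 + 1) * (8 + P.tb 1)) * N ^ (d + 1) := by ring

theorem den_var (C : Cmd) {x : ℕ} (hx : x ∉ C.wv) (σ : State) : (C.den σ).var x = σ.var x := by
  induction C generalizing σ with
  | skip => rfl
  | assign y p =>
    simp only [wv, List.mem_singleton] at hx
    simp [den, State.setVar, Function.update_of_ne hx]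
  | store a i p => rfl
  | seq P Q hP hQ =>
    simp only [wv, List.mem_append, not_or] at hx
    simp only [den]
    rw [hQ hx.2, hP hx.1]
  | ite p P Q hP hQ =>
    simp only [wv, List.mem_append, not_or] at hx
    simp only [den]
    split_ifs
    · exact hP hx.1 σ
    · exact hQ hx.2 σ
  | loop i b P hP =>
    simp only [wv, List.mem_cons, not_or] at hx
    simp only [den]
    induction σ.var b with
    | zero => simp [iter, State.setVar, Function.update_of_ne hx.1]
    | succ k ih =>
      simp only [iter, State.setVar, Function.update_of_ne hx.1]
      rw [hP hx.2, ih]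

theorem den_arr (C : Cmd) {a : ℕ} (ha : a ∉ C.wa) (σ : State) : (C.den σ).arr a = σ.arr a := by
  induction C generalizing σ with
  | skip => rfl
  | assign y p => rfl
  | store b i p =>
    simp only [wa, List.mem_singleton] at ha
    simp [den, State.setArr, Function.update_of_ne ha]
  | seq P Q hP hQ =>
    simp only [wa, List.mem_append, not_or] at ha
    simp only [den]
    rw [hQ ha.2, hP ha.1]
  | ite p P Q hP hQ =>
    simp only [wa, List.mem_append, not_or] at ha
    simp only [den]
    split_ifs
    · exact hP ha.1 σ
    · exact hQ ha.2 σ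
  | loop i b P hP =>
    simp only [wa] at ha
    simp only [den]
    induction σ.var b with
    | zero => rfl
    | succ k ih =>
      simp only [iter, State.setVar]
      rw [hP ha, ih]

theorem wf_wv {B : List ℕ} (C : Cmd) (h : C.wf B) {b : ℕ} (hb : b ∈ B) : b ∉ C.wv := by
  induction C with
  | skip => simp [wv]
  | assign x p =>
    simp only [wf, decide_eq_true_eq] at h
    simp only [wv, List.mem_singleton]
    rintro rfl
    exact h hb
  | store a i p => simp [wv]
  | seq P Q hP hQ =>
    simp only [wf, Bool.and_eq_true] at h
    simp [wv, hP h.1, hQ h.2]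
  | ite p P Q hP hQ =>
    simp only [wf, Bool.and_eq_true] at h
    simp [wv, hP h.1, hQ h.2]
  | loop i c P hP =>
    simp only [wf, Bool.and_eq_true, decide_eq_true_eq] at h
    simp only [wv, List.mem_cons, not_or]
    refine ⟨?_, hP h.2⟩
    rintro rfl
    exact h.1.1.2 hb

end Cmd

/-! ### Simulation of commands by programs -/

theorem Run.mono {W W' : ℕ} (hW : W ≤ W') {P : Prog} {σ τ : State} {t : ℕ}
    (h : Run W P σ t τ) : Run W' P σ t τ := by
  induction h with
  | skip σ => exact .skip σ
  | assign x p σ h => exact .assign x p σ (h.trans hW)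
  | store a i p σ hi h => exact .store a i p σ (hi.trans hW) (h.trans hW)
  | seq _ _ h h' => exact .seq h h'
  | cond_true hp _ h => exact .cond_true hp h
  | cond_false hp _ h => exact .cond_false hp h
  | loop_true hp _ _ h h' => exact .loop_true hp h h'
  | loop_false hp => exact .loop_false hp

namespace Cmd

/-- Well-formedness protects the loop bound and the counter from the body, so the while loop of
`toProg` makes exactly the rounds of `iter`. The word size is left open here and is bounded by
`Run.bdd`. -/
theorem run_den {B : List ℕ} {N : ℕ} (C : Cmd) (h : C.wf B) (σ : State)
    (hσ : ∀ b ∈ B, σ.var b ≤ N) : ∃ W t, Run W C.toProg σ t (C.den σ) ∧ t ≤ C.tb N := by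
  induction C generalizing σ with
  | skip => exact ⟨0, 1, .skip σ, le_rfl⟩
  | assign x p => exact ⟨_, _, .assign x p σ le_rfl, le_rfl⟩
  | store a i p =>
    exact ⟨_, _, .store a i p σ (le_max_left _ (p.eval σ)) (le_max_right _ _), le_rfl⟩
  | seq P Q hP hQ =>
    simp only [wf, Bool.and_eq_true] at h
    obtain ⟨W, t, h1, h2⟩ := hP h.1 σ hσ
    obtain ⟨W', t', h3, h4⟩ := hQ h.2 (P.den σ) (fun b hb => by
      rw [den_var P (wf_wv P h.1 hb)]; exact hσ b hb)
    exact ⟨max W W', _, .seq (h1.mono (le_max_left _ _)) (h3.mono (le_max_right _ _)),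
      Nat.add_le_add h2 h4⟩
  | ite p P Q hP hQ =>
    simp only [wf, Bool.and_eq_true] at h
    simp only [den, tb, toProg]
    split_ifs with hp
    · obtain ⟨W, t, h1, h2⟩ := hP h.1 σ hσ
      exact ⟨W, _, .cond_true hp h1, by omega⟩
    · obtain ⟨W, t, h1, h2⟩ := hQ h.2 σ hσ
      exact ⟨W, _, .cond_false (not_not.1 hp) h1, by omega⟩
  | loop i b P hP =>
    have h' := h
    simp only [wf, Bool.and_eq_true, decide_eq_true_eq] at h
    obtain ⟨⟨⟨hb, hi⟩, hiP⟩, hPw⟩ := h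
    have hvar : ∀ k, ∀ c ∈ B, (iter P.den i k σ).var c = σ.var c := by
      intro k c hc
      have hci : c ≠ i := by rintro rfl; exact hi hc
      induction k with
      | zero => simp [iter, State.setVar, Function.update_of_ne hci]
      | succ k ih =>
        simp only [iter, State.setVar, Function.update_of_ne hci]
        rw [den_var P (wf_wv P hPw hc), ih]
    have hcnt : ∀ k, (iter P.den i k σ).var i = k := by
      intro k
      cases k <;> simp [iter, State.setVar]
    -- Here `r` counts the rounds still to come. A round costs 8 steps beyond its body, 4 for the
    -- test and 4 for the increment; the last, failing test costs 4.
    have key : ∀ r k, k + r = σ.var b → ∃ W t, Run W (.loop (.lt (.var i) (.var b))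
        (.seq P.toProg (.assign i (.add (.var i) (.const 1))))) (iter P.den i k σ) t
          (iter P.den i (σ.var b) σ) ∧ t ≤ 4 + r * (8 + P.tb N) := by
      intro r
      induction r with
      | zero =>
        intro k hk
        obtain rfl : k = σ.var b := by omega
        refine ⟨0, _, .loop_false ?_, by simp [Expr.cost]⟩
        simp [Expr.eval, hcnt, hvar _ b hb]
      | succ r ih =>
        intro k hk
        obtain ⟨W', t', h3, h4⟩ := ih (k + 1) (by omega)
        obtain ⟨W, t, h1, h2⟩ := hP hPw (iter P.den i k σ) (fun c hc => by
          rw [hvar k c hc]; exact hσ c hc)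
        have h5 : Run (k + 1) (.assign i (.add (.var i) (.const 1))) (P.den (iter P.den i k σ))
            ((Expr.add (.var i) (.const 1)).cost + 1) (iter P.den i (k + 1) σ) := by
          have : (Expr.add (.var i) (.const 1)).eval (P.den (iter P.den i k σ)) = k + 1 := by
            simp [Expr.eval, den_var P hiP, hcnt]
          have h6 := Run.assign (W := k + 1) i (.add (.var i) (.const 1))
            (P.den (iter P.den i k σ)) (by omega)
          rw [this] at h6
          exact h6
        refine ⟨max (max W (k + 1)) W', _, .loop_true ?_ (.seq (h1.mono (by simp))
          (h5.mono (by simp))) (h3.mono (by simp)), ?_⟩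
        · simp only [Expr.eval, hcnt, hvar _ b hb]
          rw [if_pos (by omega)]; omega
        · simp only [Expr.cost]
          rw [Nat.add_mul]
          omega
    obtain ⟨W, t, h1, h2⟩ := key (σ.var b) 0 (by omega)
    refine ⟨W, _, .seq (.assign i (.const 0) σ (Nat.zero_le _)) h1, ?_⟩
    have h3 : σ.var b * (8 + P.tb N) ≤ N * (8 + P.tb N) := Nat.mul_le_mul_right _ (hσ b hb)
    simp only [Expr.cost, tb]
    rw [Nat.add_mul N]
    omega

end Cmd

/-! ### Word size -/

/-- Expressions whose value exceeds the contents of memory by at most their cost. -/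
def Expr.slow : Expr → Bool
  | .const a => decide (a ≤ 8)
  | .var _ => true
  | .load _ _ => true
  | .add p (.const 1) => p.slow
  | .lt _ _ => true
  | .eq _ _ => true
  | _ => false

/-- Conditions are unrestricted because their values are never written. -/
def Prog.slow : Prog → Bool
  | .skip => true
  | .assign _ p => p.slow
  | .store _ i p => i.slow && p.slow
  | .seq P Q => P.slow && Q.slow
  | .cond _ P Q => P.slow && Q.slow
  | .loop _ P => P.slow

/-- All memory cells are at most `M`. -/
def Bdd (M : ℕ) (σ : State) : Prop := (∀ x, σ.var x ≤ M) ∧ ∀ a i, σ.arr a i ≤ M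

theorem Bdd.mono {M M' : ℕ} (h : M ≤ M') {σ : State} (hσ : Bdd M σ) : Bdd M' σ :=
  ⟨fun x => (hσ.1 x).trans h, fun a i => (hσ.2 a i).trans h⟩

theorem Bdd.setVar {M : ℕ} {σ : State} (hσ : Bdd M σ) (x : ℕ) {w : ℕ} (hw : w ≤ M) :
    Bdd M (σ.setVar x w) := by
  refine ⟨fun y => ?_, hσ.2⟩
  by_cases h : y = x
  · subst h; simpa [State.setVar] using hw
  · simpa [State.setVar, h] using hσ.1 y

theorem Bdd.setArr {M : ℕ} {σ : State} (hσ : Bdd M σ) (a i : ℕ) {w : ℕ} (hw : w ≤ M) :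
    Bdd M (σ.setArr a i w) := by
  refine ⟨hσ.1, fun b j => ?_⟩
  by_cases h : b = a
  · subst h
    by_cases h' : j = i
    · subst h'; simpa [State.setArr] using hw
    · simpa [State.setArr, h'] using hσ.2 b j
  · simpa [State.setArr, h] using hσ.2 b j

theorem Expr.eval_le {M : ℕ} (hM : 8 ≤ M) {σ : State} (hσ : Bdd M σ) (p : Expr) (hp : p.slow) :
    p.eval σ ≤ M + p.cost := by
  induction p with
  | const a =>
    simp only [Expr.slow, decide_eq_true_eq] at hp
    simp only [Expr.eval]; omega
  | var x => exact (hσ.1 x).trans (Nat.le_add_right _ _)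
  | load a i => exact (hσ.2 a _).trans (Nat.le_add_right _ _)
  | add p q ih _ =>
    cases q with
    | const a =>
      match a, hp with
      | 1, hp =>
        have := ih hp
        simp only [Expr.eval, Expr.cost] at this ⊢
        omega
      | 0, hp => simp [Expr.slow] at hp
      | a + 2, hp => simp [Expr.slow] at hp
    | _ => simp [Expr.slow] at hp
  | sub p q => simp [Expr.slow] at hp
  | mul p q => simp [Expr.slow] at hp
  | lt p q => simp only [Expr.eval]; split_ifs <;> omega
  | eq p q => simp only [Expr.eval]; split_ifs <;> omega

/-- A write raises the maximum of the memory by at most the cost of the written expression, so a run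
of `t` steps raises it by at most `t`. This turns a time bound into a bound on the word size. -/
theorem Run.bdd {W : ℕ} {P : Prog} {σ τ : State} {t : ℕ} (h : Run W P σ t τ) (hP : P.slow)
    {M : ℕ} (hM : 8 ≤ M) (hσ : Bdd M σ) : Run (M + t) P σ t τ ∧ Bdd (M + t) τ := by
  induction h generalizing M with
  | skip σ => exact ⟨.skip σ, hσ.mono (Nat.le_add_right _ _)⟩
  | assign x p σ h =>
    have := Expr.eval_le hM hσ p hP
    exact ⟨.assign x p σ (by omega), (hσ.mono (by omega)).setVar x (by omega)⟩
  | store a i p σ hi h =>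
    simp only [Prog.slow, Bool.and_eq_true] at hP
    have := Expr.eval_le hM hσ p hP.2
    have := Expr.eval_le hM hσ i hP.1
    exact ⟨.store a i p σ (by omega) (by omega), (hσ.mono (by omega)).setArr a _ (by omega)⟩
  | seq _ _ h h' =>
    simp only [Prog.slow, Bool.and_eq_true] at hP
    obtain ⟨h1, h2⟩ := h hP.1 hM hσ
    obtain ⟨h3, h4⟩ := h' hP.2 (by omega) h2
    exact ⟨.seq (h1.mono (by omega)) (h3.mono (by omega)), h4.mono (by omega)⟩
  | cond_true hp _ h =>
    simp only [Prog.slow, Bool.and_eq_true] at hP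
    obtain ⟨h1, h2⟩ := h hP.1 hM hσ
    exact ⟨.cond_true hp (h1.mono (by omega)), h2.mono (by omega)⟩
  | cond_false hp _ h =>
    simp only [Prog.slow, Bool.and_eq_true] at hP
    obtain ⟨h1, h2⟩ := h hP.2 hM hσ
    exact ⟨.cond_false hp (h1.mono (by omega)), h2.mono (by omega)⟩
  | loop_true hp _ _ h h' =>
    have hP' := hP
    simp only [Prog.slow] at hP
    obtain ⟨h1, h2⟩ := h hP hM hσ
    obtain ⟨h3, h4⟩ := h' hP' (by omega) h2
    exact ⟨.loop_true hp (h1.mono (by omega)) (h3.mono (by omega)), h4.mono (by omega)⟩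
  | loop_false hp => exact ⟨.loop_false hp, hσ.mono (Nat.le_add_right _ _)⟩

theorem Cmd.run_bdd {B : List ℕ} {N M : ℕ} (C : Cmd) (h : C.wf B) (hs : C.toProg.slow)
    (σ : State) (hσ : ∀ b ∈ B, σ.var b ≤ N) (hM : 8 ≤ M) (hb : Bdd M σ) {W : ℕ}
    (hW : M + C.tb N ≤ W) : ∃ t, Run W C.toProg σ t (C.den σ) ∧ t ≤ C.tb N := by
  obtain ⟨W', t, h1, h2⟩ := C.run_den h σ hσ
  exact ⟨t, (h1.bdd hs hM hb).1.mono (by omega), h2⟩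

/-! ### Bulk operations -/

/-- The invariant rule for counted loops: `I k` describes the memory just after the counter has been
set to `k`. -/
theorem den_loop_induction (i b : ℕ) (P : Cmd) (σ : State) (I : ℕ → State → Prop)
    (h0 : I 0 (σ.setVar i 0))
    (hs : ∀ k < σ.var b, ∀ τ, I k τ → τ.var i = k → I (k + 1) ((P.den τ).setVar i (k + 1))) :
    I (σ.var b) ((Cmd.loop i b P).den σ) := by
  simp only [Cmd.den]
  have : ∀ k ≤ σ.var b, I k (iter P.den i k σ) := by
    intro k
    induction k with
    | zero => exact fun _ => h0
    | succ k ih =>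
      intro hk
      refine hs k (by omega) _ (ih (by omega)) ?_
      cases k <;> simp [iter, State.setVar]
  exact this _ le_rfl

namespace Expr

/-- The expression does not read array `a`. -/
def noArr (a : ℕ) : Expr → Bool
  | const _ => true
  | var _ => true
  | load b i => decide (b ≠ a) && i.noArr a
  | add p q => p.noArr a && q.noArr a
  | sub p q => p.noArr a && q.noArr a
  | mul p q => p.noArr a && q.noArr a
  | lt p q => p.noArr a && q.noArr a
  | eq p q => p.noArr a && q.noArr a

/-- The expression does not read variable `x`. -/
def noVar (x : ℕ) : Expr → Bool
  | const _ => true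
  | var y => decide (y ≠ x)
  | load _ i => i.noVar x
  | add p q => p.noVar x && q.noVar x
  | sub p q => p.noVar x && q.noVar x
  | mul p q => p.noVar x && q.noVar x
  | lt p q => p.noVar x && q.noVar x
  | eq p q => p.noVar x && q.noVar x

theorem eval_congr_arr {a : ℕ} {σ τ : State} (hv : σ.var = τ.var)
    (ha : ∀ b, b ≠ a → σ.arr b = τ.arr b) (p : Expr) (hp : p.noArr a) : p.eval σ = p.eval τ := by
  induction p with
  | const _ => rfl
  | var x => simp [eval, hv]
  | load b i ih =>
    simp only [noArr, Bool.and_eq_true, decide_eq_true_eq] at hp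
    simp only [eval]
    rw [ih hp.2, ha b hp.1]
  | add p q hp' hq' | sub p q hp' hq' | mul p q hp' hq' | lt p q hp' hq' | eq p q hp' hq' =>
    simp only [noArr, Bool.and_eq_true] at hp
    simp only [eval]
    rw [hp' hp.1, hq' hp.2]

theorem eval_congr_var {x : ℕ} {σ τ : State} (hv : ∀ y, y ≠ x → σ.var y = τ.var y)
    (ha : σ.arr = τ.arr) (p : Expr) (hp : p.noVar x) : p.eval σ = p.eval τ := by
  induction p with
  | const _ => rfl
  | var y =>
    simp only [noVar, decide_eq_true_eq] at hp
    exact hv y hp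
  | load b i ih =>
    simp only [noVar] at hp
    simp only [eval]
    rw [ih hp, ha]
  | add p q hp' hq' | sub p q hp' hq' | mul p q hp' hq' | lt p q hp' hq' | eq p q hp' hq' =>
    simp only [noVar, Bool.and_eq_true] at hp
    simp only [eval]
    rw [hp' hp.1, hq' hp.2]

end Expr

namespace Cmd

/-- For `i < b`: if `cnd` then store `val` in cell `idx` of array `a`. -/
def scatter (i b a : ℕ) (cnd idx val : Expr) : Cmd :=
  loop i b (ite cnd (store a idx val) skip)

/-- Set `x` to the last `i < b` that satisfies `cnd`, if there is one. -/
def last (i b x : ℕ) (cnd : Expr) : Cmd :=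
  loop i b (ite cnd (assign x (.var i)) skip)

/-- For `i < b`: if `cnd` then increase cell `idx` of array `a` by one. -/
def count (i b a : ℕ) (cnd idx : Expr) : Cmd :=
  loop i b (ite cnd (store a idx (.add (.load a idx) (.const 1))) skip)

/-- The expressions do not read the array that is written, so they can be evaluated in the initial
memory. If several iterations write to cell `y`, it is left open which of them wins: no use of the
lemma depends on it. -/
theorem den_scatter {i b a : ℕ} {cnd idx val : Expr} (σ : State)
    (hc : cnd.noArr a) (hi : idx.noArr a) (hv : val.noArr a) (y : ℕ) :
    (∃ j < σ.var b, cnd.eval (σ.setVar i j) ≠ 0 ∧ idx.eval (σ.setVar i j) = y ∧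
      ((scatter i b a cnd idx val).den σ).arr a y = val.eval (σ.setVar i j)) ∨
    ((∀ j < σ.var b, cnd.eval (σ.setVar i j) ≠ 0 → idx.eval (σ.setVar i j) ≠ y) ∧
      ((scatter i b a cnd idx val).den σ).arr a y = σ.arr a y) := by
  have key := den_loop_induction i b (ite cnd (store a idx val) skip) σ
    (fun k τ => τ.var = (σ.setVar i k).var ∧ (∀ a', a' ≠ a → τ.arr a' = σ.arr a') ∧
      ((∃ j < k, cnd.eval (σ.setVar i j) ≠ 0 ∧ idx.eval (σ.setVar i j) = y ∧
        τ.arr a y = val.eval (σ.setVar i j)) ∨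
      ((∀ j < k, cnd.eval (σ.setVar i j) ≠ 0 → idx.eval (σ.setVar i j) ≠ y) ∧
        τ.arr a y = σ.arr a y)))
    ⟨rfl, fun _ _ => rfl, .inr ⟨by simp, rfl⟩⟩ ?_
  · exact key.2.2
  rintro k hk τ ⟨h1, h2, h3⟩ -
  have e : ∀ p : Expr, p.noArr a → p.eval τ = p.eval (σ.setVar i k) := fun p hp =>
    Expr.eval_congr_arr h1 h2 p hp
  simp only [den]
  split_ifs with hcnd
  · rw [e cnd hc] at hcnd
    rw [e idx hi, e val hv]
    refine ⟨?_, ?_, ?_⟩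
    · simp [State.setVar, State.setArr, h1]
    · intro a' ha'
      simp [State.setVar, State.setArr, ha', h2 a' ha']
    · by_cases hy : idx.eval (σ.setVar i k) = y
      · left
        exact ⟨k, by omega, hcnd, hy, by rw [State.setVar_arr, State.setArr_arr, if_pos ⟨rfl, hy.symm⟩]⟩
      · have hy' : y ≠ idx.eval (σ.setVar i k) := fun h => hy h.symm
        rw [State.setVar_arr, State.setArr_arr, if_neg (fun h => hy' h.2)]
        rcases h3 with ⟨j, hj, h4, h5, h6⟩ | ⟨h4, h5⟩
        · exact .inl ⟨j, by omega, h4, h5, h6⟩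
        · refine .inr ⟨fun j hj hcj => ?_, h5⟩
          rcases Nat.lt_succ_iff_lt_or_eq.1 hj with hj | rfl
          · exact h4 j hj hcj
          · exact hy
  · rw [e cnd hc] at hcnd
    refine ⟨by simp [State.setVar, h1], h2, ?_⟩
    rcases h3 with ⟨j, hj, h4, h5, h6⟩ | ⟨h4, h5⟩
    · exact .inl ⟨j, by omega, h4, h5, h6⟩
    · refine .inr ⟨fun j hj hcj => ?_, h5⟩
      rcases Nat.lt_succ_iff_lt_or_eq.1 hj with hj | rfl
      · exact h4 j hj hcj
      · exact absurd hcj hcnd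

theorem den_last {i b x : ℕ} {cnd : Expr} (σ : State) (hc : cnd.noVar x) (hix : i ≠ x) :
    (∃ j < σ.var b, cnd.eval (σ.setVar i j) ≠ 0 ∧ ((last i b x cnd).den σ).var x = j) ∨
    ((∀ j < σ.var b, ¬ cnd.eval (σ.setVar i j) ≠ 0) ∧
      ((last i b x cnd).den σ).var x = σ.var x) := by
  have key := den_loop_induction i b (ite cnd (assign x (.var i)) skip) σ
    (fun k τ => (∀ y, y ≠ x → τ.var y = (σ.setVar i k).var y) ∧ τ.arr = σ.arr ∧
      ((∃ j < k, cnd.eval (σ.setVar i j) ≠ 0 ∧ τ.var x = j) ∨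
      ((∀ j < k, ¬ cnd.eval (σ.setVar i j) ≠ 0) ∧ τ.var x = σ.var x)))
    ⟨fun _ _ => rfl, rfl, .inr ⟨by simp, by
      simp [State.setVar, Function.update_of_ne hix.symm]⟩⟩ ?_
  · exact key.2.2
  rintro k hk τ ⟨h1, h2, h3⟩ hki
  have e : cnd.eval τ = cnd.eval (σ.setVar i k) := Expr.eval_congr_var h1 h2 cnd hc
  have hu : ∀ (ρ : State) (w : ℕ), (ρ.setVar i w).var x = ρ.var x := fun ρ w => by
    simp [State.setVar, Function.update_of_ne hix.symm]
  simp only [den]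
  split_ifs with hcnd
  · rw [e] at hcnd
    refine ⟨?_, h2, .inl ⟨k, by omega, hcnd, ?_⟩⟩
    · intro y hy
      by_cases hyi : y = i
      · subst hyi; simp [State.setVar]
      · have := h1 y hy
        simp only [State.setVar, Function.update_of_ne hyi] at this
        simp [State.setVar, Function.update_of_ne hyi, Function.update_of_ne hy, this]
    · rw [hu]; simp [State.setVar, Expr.eval, hki]
  · rw [e] at hcnd
    refine ⟨?_, h2, ?_⟩
    · intro y hy
      by_cases hyi : y = i
      · subst hyi; simp [State.setVar]
      · have := h1 y hy
        simp only [State.setVar, Function.update_of_ne hyi] at this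
        simp [State.setVar, Function.update_of_ne hyi, this]
    · rw [hu]
      rcases h3 with ⟨j, hj, h4, h5⟩ | ⟨h4, h5⟩
      · exact .inl ⟨j, by omega, h4, h5⟩
      · refine .inr ⟨fun j hj => ?_, h5⟩
        rcases Nat.lt_succ_iff_lt_or_eq.1 hj with hj | rfl
        · exact h4 j hj
        · exact hcnd

theorem den_count {i b a : ℕ} {cnd idx : Expr} (σ : State)
    (hc : cnd.noArr a) (hi : idx.noArr a) (y : ℕ) :
    ((count i b a cnd idx).den σ).arr a y = σ.arr a y +
      ((Finset.range (σ.var b)).filter (fun j => cnd.eval (σ.setVar i j) ≠ 0 ∧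
        idx.eval (σ.setVar i j) = y)).card := by
  have key := den_loop_induction i b
    (ite cnd (store a idx (.add (.load a idx) (.const 1))) skip) σ
    (fun k τ => τ.var = (σ.setVar i k).var ∧ (∀ a', a' ≠ a → τ.arr a' = σ.arr a') ∧
      τ.arr a y = σ.arr a y + ((Finset.range k).filter (fun j => cnd.eval (σ.setVar i j) ≠ 0 ∧
        idx.eval (σ.setVar i j) = y)).card)
    ⟨rfl, fun _ _ => rfl, by rw [Finset.range_zero, Finset.filter_empty]; rfl⟩ ?_
  · exact key.2.2
  rintro k hk τ ⟨h1, h2, h3⟩ -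
  have e : ∀ p : Expr, p.noArr a → p.eval τ = p.eval (σ.setVar i k) := fun p hp =>
    Expr.eval_congr_arr h1 h2 p hp
  rw [Finset.range_add_one, Finset.filter_insert]
  simp only [den]
  split_ifs with hcnd hh hh
  · refine ⟨by simp [State.setVar, State.setArr, h1], fun a' ha' => by
      simp [State.setVar, State.setArr, ha', h2 a' ha'], ?_⟩
    rw [Finset.card_insert_of_notMem (by simp), State.setVar_arr, State.setArr_arr, e idx hi,
      if_pos ⟨rfl, hh.2.symm⟩]
    simp only [Expr.eval, e idx hi, hh.2, h3]
    omega
  · rw [e cnd hc] at hcnd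
    have hy : y ≠ idx.eval (σ.setVar i k) := fun h => hh ⟨hcnd, h.symm⟩
    refine ⟨by simp [State.setVar, State.setArr, h1], fun a' ha' => by
      simp [State.setVar, State.setArr, ha', h2 a' ha'], ?_⟩
    rw [e idx hi]
    rw [State.setVar_arr, State.setArr_arr, if_neg (fun h => hy h.2)]
    exact h3
  · rw [e cnd hc] at hcnd
    exact absurd hh.1 hcnd
  · exact ⟨by simp [State.setVar, h1], h2, h3⟩

end Cmd

end RAM

/-! ## Galvin's colouring procedure for bipartite graphs -/

namespace Galvin

open Finset

open scoped Classical

/-- `j` may dominate `i`: the edges are adjacent, the edges of the matching `E` come last at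
their left ends and first at their right ends. -/
def Dom (X Y : ℕ → ℕ) (E : ℕ → Prop) (j i : ℕ) : Prop :=
  (E i ∧ X j = X i) ∨ (¬ E i ∧ ((X j = X i ∧ ¬ E j) ∨ Y j = Y i))

/-- The edges are the `i` with `R i`, with ends `X i` and `Y i`; colours `A i c` are available
at `i`; `E` is a matching; `q` is a partial colouring (0 means uncoloured) with the colours up
to `c`. -/
structure Inv (X Y : ℕ → ℕ) (R E : ℕ → Prop) (A : ℕ → ℕ → Prop) (q : ℕ → ℕ) (c : ℕ) :
    Prop where
  pos : 1 ≤ c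
  proper : ∀ i j, R i → R j → i ≠ j → q i ≠ 0 → q i = q j → X i ≠ X j ∧ Y i ≠ Y j
  avail : ∀ i, R i → q i ≠ 0 → A i (q i) ∧ q i ≤ c
  past : ∀ i, R i → q i = 0 ∨ q i = c → ∀ d < c, A i d →
    ∃ j, R j ∧ j ≠ i ∧ Dom X Y E j i ∧ q j = d
  cur : ∀ j i, E j → q j = c → R i → i ≠ j → X i = X j → A i c → q i = 0 →
    ∃ l, R l ∧ Y l = Y i ∧ q l = c

/-- An edge outside of the matching that can get colour `c`. -/
def Cand (X Y : ℕ → ℕ) (R E : ℕ → Prop) (A : ℕ → ℕ → Prop) (q : ℕ → ℕ) (c g : ℕ) : Prop :=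
  R g ∧ ¬ E g ∧ q g = 0 ∧ A g c ∧ ∀ j, R j → q j = c → X j ≠ X g ∧ Y j ≠ Y g

/-- A matching edge that can get colour `c`. -/
def CandE (X : ℕ → ℕ) (R E : ℕ → Prop) (A : ℕ → ℕ → Prop) (q : ℕ → ℕ) (c g : ℕ) : Prop :=
  R g ∧ E g ∧ q g = 0 ∧ A g c ∧ ∀ j, R j → q j = c → X j ≠ X g

/-- One round of the procedure. -/
def Step (X Y : ℕ → ℕ) (R E : ℕ → Prop) (A : ℕ → ℕ → Prop) (q : ℕ → ℕ) (c : ℕ)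
    (q' : ℕ → ℕ) (c' : ℕ) : Prop :=
  (∃ g, Cand X Y R E A q c g ∧ c' = c ∧ ∀ i, R i → q' i = if i = g then c else q i) ∨
  ((∀ g, ¬ Cand X Y R E A q c g) ∧ ∃ g, CandE X R E A q c g ∧ c' = c ∧
    ∀ i, R i → q' i = if i = g then c else if q i = c ∧ Y i = Y g then 0 else q i) ∨
  ((∀ g, ¬ Cand X Y R E A q c g) ∧ (∀ g, ¬ CandE X R E A q c g) ∧ c' = c + 1 ∧
    ∀ i, R i → q' i = q i)

/-- A quantity that increases in every round. -/
noncomputable def pot (m : ℕ) (R E : ℕ → Prop) (q : ℕ → ℕ) (c : ℕ) : ℕ :=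
  c + ∑ i ∈ range m, if R i ∧ q i ≠ 0 then (if E i then 2 else 1) else 0

variable {m : ℕ} {X Y : ℕ → ℕ} {R E : ℕ → Prop} {A : ℕ → ℕ → Prop} {q q' : ℕ → ℕ} {c c' : ℕ}

theorem inv_init (hA : ∀ i c, A i c → 1 ≤ c) (hER : ∀ i, E i → R i) (hq : ∀ i, R i → q i = 0) :
    Inv X Y R E A q 1 where
  pos := le_rfl
  proper i _ hi _ _ h := absurd (hq i hi) h
  avail i hi h := absurd (hq i hi) h
  past i _ _ d hd hAd := by have := hA i d hAd; omega
  cur j _ hj h := by have := hq j (hER j hj); omega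

/-- Edges of the current colour are included in `past` because they may still be displaced. The
clause `cur` prepares for the change of colour: an edge of `E` does not dominate the other edges at
its left end, so an edge passed over there must find a dominator at its right end. -/
theorem Inv.step (hA : ∀ i c, A i c → 1 ≤ c) (hER : ∀ i, E i → R i)
    (hEX : ∀ i j, E i → E j → i ≠ j → X i ≠ X j)
    (h : Inv X Y R E A q c) (hs : Step X Y R E A q c q' c') : Inv X Y R E A q' c' := by
  have hpos := h.pos
  rcases hs with ⟨g, ⟨hg1, hg2, hg3, hg4, hg5⟩, rfl, hq⟩ |
    ⟨hno, g, ⟨hg1, hg2, hg3, hg4, hg5⟩, rfl, hq⟩ | ⟨hno, hnoE, rfl, hq⟩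
  · refine ⟨hpos, ?_, ?_, ?_, ?_⟩
    · intro i j hi hj hij h1 h2
      rw [hq i hi] at h1 h2
      rw [hq j hj] at h2
      by_cases hig : i = g
      · subst hig
        have hji : j ≠ i := fun h => hij h.symm
        rw [if_pos rfl, if_neg hji] at h2
        exact ⟨(hg5 j hj h2.symm).1.symm, (hg5 j hj h2.symm).2.symm⟩
      · rw [if_neg hig] at h1 h2
        by_cases hjg : j = g
        · subst hjg
          rw [if_pos rfl] at h2
          exact hg5 i hi h2
        · rw [if_neg hjg] at h2
          exact h.proper i j hi hj hij h1 h2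
    · intro i hi h1
      rw [hq i hi] at h1 ⊢
      split_ifs with hig
      · subst hig; exact ⟨hg4, le_rfl⟩
      · rw [if_neg hig] at h1; exact h.avail i hi h1
    · intro i hi h1 d hd hAd
      have h2 : q i = 0 ∨ q i = c' := by
        rw [hq i hi] at h1
        by_cases hig : i = g
        · subst hig; exact .inl hg3
        · rwa [if_neg hig] at h1
      obtain ⟨j, hj, hji, hdom, hqj⟩ := h.past i hi h2 d hd hAd
      refine ⟨j, hj, hji, hdom, ?_⟩
      have := hA i d hAd
      rw [hq j hj, if_neg (by rintro rfl; omega), hqj]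
    · intro j i hj hjc hi hij hX hAi hqi
      have hjg : j ≠ g := by rintro rfl; exact hg2 hj
      rw [hq j (hER j hj), if_neg hjg] at hjc
      have hig : i ≠ g := by
        rintro rfl
        rw [hq i hi, if_pos rfl] at hqi
        omega
      rw [hq i hi, if_neg hig] at hqi
      obtain ⟨l, hl, hYl, hql⟩ := h.cur j i hj hjc hi hij hX hAi hqi
      refine ⟨l, hl, hYl, ?_⟩
      rw [hq l hl]; split_ifs <;> simp [hql]
  · have hkick : ∀ i, R i → i ≠ g → q' i ≠ 0 → q' i = q i ∧ ¬ (q i = c' ∧ Y i = Y g) := by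
      intro i hi hig h1
      rw [hq i hi, if_neg hig] at h1 ⊢
      split_ifs at h1 ⊢ with h2
      · exact absurd rfl h1
      · exact ⟨rfl, h2⟩
    have hqg : q' g = c' := by rw [hq g hg1, if_pos rfl]
    refine ⟨hpos, ?_, ?_, ?_, ?_⟩
    · have aux : ∀ i, R i → i ≠ g → q' i = c' → X i ≠ X g ∧ Y i ≠ Y g := by
        intro i hi hig h1
        obtain ⟨h2, h3⟩ := hkick i hi hig (by omega)
        rw [h1] at h2
        exact ⟨hg5 i hi h2.symm, fun hY => h3 ⟨h2.symm, hY⟩⟩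
      intro i j hi hj hij h1 h2
      by_cases hig : i = g
      · subst hig
        have := aux j hj (fun h => hij h.symm) (by omega)
        exact ⟨this.1.symm, this.2.symm⟩
      · by_cases hjg : j = g
        · subst hjg
          exact aux i hi hig (by omega)
        · obtain ⟨h3, -⟩ := hkick i hi hig h1
          obtain ⟨h4, -⟩ := hkick j hj hjg (by omega)
          exact h.proper i j hi hj hij (by omega) (by omega)
    · intro i hi h1
      by_cases hig : i = g
      · subst hig; rw [hqg]; exact ⟨hg4, le_rfl⟩
      · obtain ⟨h3, -⟩ := hkick i hi hig h1
        rw [h3] at h1 ⊢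
        exact h.avail i hi h1
    · intro i hi h1 d hd hAd
      have h2 : q i = 0 ∨ q i = c' := by
        rw [hq i hi] at h1
        by_cases hig : i = g
        · subst hig; exact .inl hg3
        · rw [if_neg hig] at h1
          split_ifs at h1 with h3
          · exact .inr h3.1
          · exact h1
      obtain ⟨j, hj, hji, hdom, hqj⟩ := h.past i hi h2 d hd hAd
      refine ⟨j, hj, hji, hdom, ?_⟩
      have := hA i d hAd
      rw [hq j hj, if_neg (by rintro rfl; omega), if_neg (by omega), hqj]
    · intro j i hj hjc hi hij hX hAi hqi
      have hig : i ≠ g := by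
        rintro rfl
        omega
      have hcases : q i = 0 ∨ q i = c' ∧ Y i = Y g := by
        rw [hq i hi, if_neg hig] at hqi
        split_ifs at hqi with h3
        · exact .inr h3
        · exact .inl hqi
      rcases hcases with h0 | ⟨h0, hY⟩
      -- If `j` is the new edge, then nothing at its left end had the colour before; since `i` was
      -- no candidate, the colour occurs at the right end of `i`.
      · have : ∃ l, R l ∧ Y l = Y i ∧ q l = c' := by
          by_cases hjg : j = g
          · subst hjg
            have hiE : ¬ E i := fun hiE => hEX i j hiE hj hij hX
            have := hno i
            simp only [Cand, not_and] at this
            have := this hi hiE h0 hAi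
            push Not at this
            obtain ⟨l, hl, hlc, hl2⟩ := this
            exact ⟨l, hl, hl2 (by rw [hX]; exact hg5 l hl hlc), hlc⟩
          · obtain ⟨h2, -⟩ := hkick j (hER j hj) hjg (by omega)
            exact h.cur j i hj (by omega) hi hij hX hAi h0
        obtain ⟨l, hl, hYl, hql⟩ := this
        -- The edge `l` may have been displaced, but only at `Y g`, and there `g` itself takes its
        -- place.
        by_cases hY : Y i = Y g
        · exact ⟨g, hg1, hY.symm, hqg⟩
        · refine ⟨l, hl, hYl, ?_⟩
          rw [hq l hl, hYl]
          simp [hY, hql]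
      · exact ⟨g, hg1, hY.symm, hqg⟩
  · refine ⟨by omega, ?_, ?_, ?_, ?_⟩
    · intro i j hi hj hij h1 h2
      rw [hq i hi] at h1 h2
      rw [hq j hj] at h2
      exact h.proper i j hi hj hij h1 h2
    · intro i hi h1
      rw [hq i hi] at h1 ⊢
      have := h.avail i hi h1
      exact ⟨this.1, by omega⟩
    · intro i hi h1 d hd hAd
      rw [hq i hi] at h1
      -- No edge has the new colour yet.
      have h0 : q i = 0 := by
        rcases h1 with h1 | h1
        · exact h1
        · by_contra h0
          have := (h.avail i hi h0).2
          omega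
      rcases Nat.lt_succ_iff_lt_or_eq.1 hd with hd | rfl
      · obtain ⟨j, hj, hji, hdom, hqj⟩ := h.past i hi (.inl h0) d hd hAd
        exact ⟨j, hj, hji, hdom, by rw [hq j hj, hqj]⟩
      · suffices ∃ j, R j ∧ Dom X Y E j i ∧ q j = d by
          obtain ⟨j, hj, h1, h2⟩ := this
          exact ⟨j, hj, by rintro rfl; omega, h1, by rw [hq j hj, h2]⟩
        by_cases hE : E i
        · have := hnoE i
          simp only [CandE, not_and] at this
          have := this hi hE h0 hAd
          push Not at this
          obtain ⟨j, hj, hjd, hX⟩ := this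
          exact ⟨j, hj, .inl ⟨hE, hX⟩, hjd⟩
        · have := hno i
          simp only [Cand, not_and] at this
          have := this hi hE h0 hAd
          push Not at this
          obtain ⟨j, hj, hjd, hXY⟩ := this
          by_cases hX : X j = X i
          · by_cases hjE : E j
            -- The colour at `X i` is held by a matching edge, which does not dominate `i`; `cur`
            -- provides a dominator at `Y i` instead.
            · obtain ⟨l, hl, hYl, hql⟩ := h.cur j i hjE hjd hi
                (by rintro rfl; exact hE hjE) hX.symm hAd h0
              exact ⟨l, hl, .inr ⟨hE, .inr hYl⟩, hql⟩
            · exact ⟨j, hj, .inr ⟨hE, .inl ⟨hX, hjE⟩⟩, hjd⟩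
          · exact ⟨j, hj, .inr ⟨hE, .inr (hXY hX)⟩, hjd⟩
    · intro j i hj hjc
      rw [hq j (hER j hj)] at hjc
      have := (h.avail j (hER j hj) (by omega)).2
      omega

/-- A displacement gains 2 for the matching edge and loses at most 1: at most one edge at the right
end has the colour, and it lies outside `E`, which has only one edge there. -/
theorem pot_step (hR : ∀ i, R i → i < m) (hEY : ∀ i j, E i → E j → i ≠ j → Y i ≠ Y j)
    (h : Inv X Y R E A q c) (hs : Step X Y R E A q c q' c') :
    pot m R E q c + 1 ≤ pot m R E q' c' := by
  have hpos := h.pos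
  rcases hs with ⟨g, ⟨hg1, hg2, hg3, hg4, hg5⟩, rfl, hq⟩ |
    ⟨hno, g, ⟨hg1, hg2, hg3, hg4, hg5⟩, rfl, hq⟩ | ⟨hno, hnoE, rfl, hq⟩
  · simp only [pot, Nat.add_assoc]
    refine Nat.add_le_add_left (Nat.succ_le_of_lt (sum_lt_sum ?_ ⟨g, by simp [hR g hg1], ?_⟩)) _
    · intro i _
      by_cases hi : R i
      · rw [hq i hi]
        by_cases hig : i = g
        · subst hig; simp [hg3]
        · simp [hig]
      · simp [hi]
    · have : c' ≠ 0 := by omega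
      simp [hq g hg1, hg3, hg1, hg2, this]
  · have hqg : q' g = c' := by rw [hq g hg1, if_pos rfl]
    simp only [pot, Nat.add_assoc]
    refine Nat.add_le_add_left ?_ _
    by_cases hl : ∃ l, R l ∧ q l = c' ∧ Y l = Y g
    · obtain ⟨l, hl, hlc, hlY⟩ := hl
      have hlg : l ≠ g := by rintro rfl; omega
      have hlE : ¬ E l := fun hlE => hEY l g hlE hg2 hlg hlY
      -- Only `g` and `l` change, and the added summands balance the two sides edge by edge.
      have key : ∀ i ∈ range m, (if R i ∧ q' i ≠ 0 then (if E i then 2 else 1) else 0) +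
          (if i = l then 1 else 0) = (if R i ∧ q i ≠ 0 then (if E i then 2 else 1) else 0) +
          (if i = g then 2 else 0) := by
        intro i _
        by_cases hi : R i
        · by_cases hig : i = g
          · subst hig
            have hil : i ≠ l := fun h => hlg h.symm
            have : c' ≠ 0 := by omega
            simp [hqg, hg3, hg1, hg2, hil, this]
          · by_cases hil : i = l
            · subst hil
              have : c' ≠ 0 := by omega
              simp [hq i hi, hlc, hlY, hig, hi, hlE, this]
            · have : ¬ (q i = c' ∧ Y i = Y g) := fun ⟨h1, h2⟩ =>
                (h.proper i l hi hl hil (by omega) (by omega)).2 (by rw [h2, hlY])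
              simp [hq i hi, hig, hil, this]
        · have hig : i ≠ g := by rintro rfl; exact hi hg1
          have hil : i ≠ l := by rintro rfl; exact hi hl
          simp [hi, hig, hil]
      have := sum_congr rfl key
      rw [sum_add_distrib, sum_add_distrib, sum_ite_eq', sum_ite_eq'] at this
      simp only [mem_range, hR l hl, hR g hg1, if_true] at this
      omega
    · refine Nat.succ_le_of_lt (sum_lt_sum ?_ ⟨g, by simp [hR g hg1], ?_⟩)
      · intro i _
        by_cases hi : R i
        · by_cases hig : i = g
          · subst hig; simp [hg3]
          · have : ¬ (q i = c' ∧ Y i = Y g) := fun h1 => hl ⟨i, hi, h1⟩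
            simp [hq i hi, hig, this]
        · simp [hi]
      · have : c' ≠ 0 := by omega
        simp [hqg, hg3, hg1, hg2, this]
  · have : ∀ i ∈ range m, (if R i ∧ q' i ≠ 0 then (if E i then 2 else 1) else 0) =
        (if R i ∧ q i ≠ 0 then (if E i then 2 else 1) else 0) := by
      intro i _
      by_cases hi : R i
      · simp [hq i hi]
      · simp [hi]
    simp only [pot]
    rw [sum_congr rfl this]
    omega

theorem pot_le : pot m R E q c ≤ c + 2 * m := by
  simp only [pot]
  refine Nat.add_le_add_left ?_ _
  calc _ ≤ ∑ i ∈ range m, 2 := sum_le_sum (fun i _ => by split_ifs <;> omega)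
    _ = 2 * m := by simp [mul_comm]

/-- An uncoloured edge would have a dominator of each colour available to it, and dominators of
different colours are different edges. -/
theorem Inv.complete (hR : ∀ i, R i → i < m) (h : Inv X Y R E A q c)
    (hcount : ∀ i, R i → ((range m).filter (fun j => R j ∧ j ≠ i ∧ Dom X Y E j i)).card <
      ((range c).filter (A i)).card) (i : ℕ) (hi : R i) : q i ≠ 0 := by
  intro h0
  have hex : ∀ d ∈ (range c).filter (A i), ∃ j ∈ (range m).filter (fun j => R j ∧ j ≠ i ∧
      Dom X Y E j i), q j = d := by
    intro d hd
    simp only [mem_filter, mem_range] at hd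
    obtain ⟨j, h1, h2, h3, h4⟩ := h.past i hi (.inl h0) d hd.1 hd.2
    exact ⟨j, by simp [h1, h2, h3, hR j h1], h4⟩
  have := card_le_card_of_surjOn q (fun d hd => by
    obtain ⟨j, h1, h2⟩ := hex d hd
    exact ⟨j, h1, h2⟩)
  have := hcount i hi
  omega

end Galvin

/-! ## Peeling: a matching that saturates the left side -/

namespace Peel

open Finset

open scoped Classical

/-- Edge `i` can match a new left vertex to a new right vertex. -/
def Av (X Y : ℕ → ℕ) (RY : ℕ → Prop) (sl : ℕ → Prop) (E : ℕ → Prop) (i : ℕ) : Prop :=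
  RY i ∧ ¬ sl (X i) ∧ (∀ j, E j → X j ≠ X i) ∧ ∀ j, E j → Y j ≠ Y i

/-- In a `Setting`, an edge of `F` shares its right end with no other edge of `R`, so matching it
takes nothing away from other left vertices. -/
def CandF (X : ℕ → ℕ) (F : ℕ → Prop) (sl : ℕ → Prop) (E : ℕ → Prop) (i : ℕ) : Prop :=
  F i ∧ ¬ sl (X i) ∧ ∀ j, E j → X j ≠ X i

/-- Hall's condition for the left vertices that have an edge in `R`, are not in `sl`, and have
no edge in `F`. -/
def Hall (m : ℕ) (X Y : ℕ → ℕ) (R RY F : ℕ → Prop) (sl : ℕ → Prop) (E : ℕ → Prop) : Prop :=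
  ∀ T : Finset ℕ, (∀ x ∈ T, (∃ i, R i ∧ X i = x) ∧ ¬ sl x ∧ (∀ i, F i → X i ≠ x) ∧
      ∀ i, E i → X i ≠ x) →
    T.card ≤ (((range m).filter (fun i => RY i ∧ X i ∈ T ∧ ∀ j, E j → Y j ≠ Y i)).image Y).card

/-- The setting: `R` are the edges, `RY` those whose right end has two edges, `F` some of those
whose right end has only one edge. -/
structure Setting (m : ℕ) (Y : ℕ → ℕ) (R RY F : ℕ → Prop) : Prop where
  lt : ∀ i, R i → i < m
  sub : ∀ i, RY i → R i
  subF : ∀ i, F i → R i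
  fib : ∀ y, ((range m).filter (fun i => RY i ∧ Y i = y)).card ≤ 2
  sep : ∀ i j, F i → R j → i ≠ j → Y i ≠ Y j

structure Inv (m : ℕ) (X Y : ℕ → ℕ) (R RY F : ℕ → Prop) (sl : ℕ → Prop) (E : ℕ → Prop) :
    Prop where
  sub : ∀ i, E i → F i ∨ RY i
  nsl : ∀ i, E i → ¬ sl (X i)
  injX : ∀ i j, E i → E j → i ≠ j → X i ≠ X j
  injY : ∀ i j, E i → E j → i ≠ j → Y i ≠ Y j
  hall : Hall m X Y R RY F sl E

/-- The order of preference is essential: edges of `F` first, then edges that are the only ones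
available at their left end, and arbitrary edges only if there are none of these. -/
def Step (m : ℕ) (X Y : ℕ → ℕ) (RY F : ℕ → Prop) (sl : ℕ → Prop) (E E' : ℕ → Prop) : Prop :=
  (∃ g, CandF X F sl E g ∧ ∀ i, E' i ↔ E i ∨ i = g) ∨
  ((∀ g, ¬ CandF X F sl E g) ∧ ∃ g, Av X Y RY sl E g ∧
    ((∃ g', Av X Y RY sl E g' ∧
      ((range m).filter (fun i => Av X Y RY sl E i ∧ X i = X g')).card = 1) →
      ((range m).filter (fun i => Av X Y RY sl E i ∧ X i = X g)).card = 1) ∧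
    ∀ i, E' i ↔ E i ∨ i = g) ∨
  ((∀ g, ¬ CandF X F sl E g) ∧ (∀ g, ¬ Av X Y RY sl E g) ∧ ∀ i, E' i ↔ E i)

variable {m n : ℕ} {X Y : ℕ → ℕ} {R RY F : ℕ → Prop} {sl : ℕ → Prop} {E E' : ℕ → Prop}

/-- Hall's condition for a single vertex that is left over would provide an available edge. -/
theorem Inv.done (h : Inv m X Y R RY F sl E)
    (h1 : ∀ g, ¬ CandF X F sl E g) (h2 : ∀ g, ¬ Av X Y RY sl E g) (i : ℕ) (hi : R i) :
    sl (X i) ∨ ∃ j, E j ∧ X j = X i := by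
  by_contra hc
  push Not at hc
  have := h.hall {X i} (by
    intro x hx
    rw [mem_singleton] at hx
    subst hx
    refine ⟨⟨i, hi, rfl⟩, hc.1, fun j hj hjx => h1 j ⟨hj, by rw [hjx]; exact hc.1, ?_⟩, hc.2⟩
    rw [hjx]; exact hc.2)
  rw [card_singleton] at this
  obtain ⟨y, hy⟩ := card_pos.1 (Nat.lt_of_lt_of_le Nat.zero_lt_one this)
  rw [mem_image] at hy
  obtain ⟨j, hj, -⟩ := hy
  simp only [mem_filter, mem_range, mem_singleton] at hj
  obtain ⟨-, h3, h4, h5⟩ := hj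
  exact h2 j ⟨h3, by rw [h4]; exact hc.1, by rw [h4]; exact hc.2, h5⟩

/-- The substance is that Hall's condition survives. The greedy choice does no harm because right
vertices have at most two edges. -/
theorem Inv.step (hS : Setting m Y R RY F) (h : Inv m X Y R RY F sl E)
    (hs : Step m X Y RY F sl E E') : Inv m X Y R RY F sl E' := by
  have ins : ∀ g, (∀ i, E' i ↔ E i ∨ i = g) → (F g ∨ RY g) → ¬ sl (X g) →
      (∀ j, E j → X j ≠ X g) → (∀ j, E j → Y j ≠ Y g) → Hall m X Y R RY F sl E' →
      Inv m X Y R RY F sl E' := by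
    intro g hE h1 h2 h3 h4 h5
    refine ⟨?_, ?_, ?_, ?_, h5⟩
    · intro i hi
      rcases (hE i).1 hi with hi | rfl
      exacts [h.sub i hi, h1]
    · intro i hi
      rcases (hE i).1 hi with hi | rfl
      exacts [h.nsl i hi, h2]
    · intro i j hi hj hij
      rcases (hE i).1 hi with hi | rfl <;> rcases (hE j).1 hj with hj | rfl
      exacts [h.injX i j hi hj hij, h3 i hi, (h3 j hj).symm, absurd rfl hij]
    · intro i j hi hj hij
      rcases (hE i).1 hi with hi | rfl <;> rcases (hE j).1 hj with hj | rfl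
      exacts [h.injY i j hi hj hij, h4 i hi, (h4 j hj).symm, absurd rfl hij]
  have hRR : ∀ i, E i → R i := fun i hi => by
    rcases h.sub i hi with h | h
    exacts [hS.subF i h, hS.sub i h]
  rcases hs with ⟨g, ⟨hg1, hg2, hg3⟩, hE⟩ | ⟨hno, g, ⟨hg1, hg2, hg3, hg4⟩, huniq, hE⟩ |
    ⟨-, -, hE⟩
  · refine ins g hE (.inl hg1) hg2 hg3 (fun j hj => ?_) ?_
    · exact (hS.sep g j hg1 (hRR j hj) (by rintro rfl; exact hg3 g hj rfl)).symm
    · intro T hT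
      refine (h.hall T fun x hx => ?_).trans (card_le_card (image_subset_image ?_))
      · obtain ⟨h1, h2, h3, h4⟩ := hT x hx
        exact ⟨h1, h2, h3, fun i hi => h4 i ((hE i).2 (.inl hi))⟩
      · intro i hi
        simp only [mem_filter] at hi ⊢
        refine ⟨hi.1, hi.2.1, hi.2.2.1, fun j hj => ?_⟩
        rcases (hE j).1 hj with hj | rfl
        · exact hi.2.2.2 j hj
        · refine hS.sep j i hg1 (hS.sub i hi.2.1) ?_
          rintro rfl
          exact (hT _ hi.2.2.1).2.2.2 j ((hE j).2 (.inr rfl)) rfl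
  · refine ins g hE (.inr hg1) hg2 hg3 hg4 ?_
    intro T hT
    have hgT : X g ∉ T := fun hx => (hT _ hx).2.2.2 g ((hE g).2 (.inr rfl)) rfl
    have hTE : ∀ x ∈ T, (∃ i, R i ∧ X i = x) ∧ ¬ sl x ∧ (∀ i, F i → X i ≠ x) ∧
        ∀ i, E i → X i ≠ x := by
      intro x hx
      obtain ⟨h1, h2, h3, h4⟩ := hT x hx
      exact ⟨h1, h2, h3, fun i hi => h4 i ((hE i).2 (.inl hi))⟩
    set S' := (range m).filter (fun i => RY i ∧ X i ∈ T ∧ ∀ j, E' j → Y j ≠ Y i) with hS'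
    have hgR : g < m := hS.lt g (hS.sub g hg1)
    by_cases hu : ∃ g', Av X Y RY sl E g' ∧
      ((range m).filter (fun i => Av X Y RY sl E i ∧ X i = X g')).card = 1
    · have h1 := huniq hu
      -- The edge `g` is the only available one at `X g`. Adding `X g` to `T` gives one more right
      -- vertex than `T` requires, and the loss of `Y g` is paid with it.
      have hall := h.hall (insert (X g) T) (by
        intro x hx
        rcases mem_insert.1 hx with rfl | hx
        · refine ⟨⟨g, hS.sub g hg1, rfl⟩, hg2, fun i hi hix => hno i ⟨hi, ?_, ?_⟩, hg3⟩
          · rw [hix]; exact hg2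
          · rw [hix]; exact hg3
        · exact hTE x hx)
      rw [card_insert_of_notMem hgT] at hall
      have hsub : ((range m).filter (fun i => RY i ∧ X i ∈ insert (X g) T ∧
          ∀ j, E j → Y j ≠ Y i)).image Y ⊆ insert (Y g) (S'.image Y) := by
        intro y hy
        rw [mem_image] at hy
        obtain ⟨i, hi, rfl⟩ := hy
        simp only [mem_filter, mem_range, mem_insert] at hi
        obtain ⟨h2, h3, h4, h5⟩ := hi
        rw [mem_insert]
        by_cases hY : Y i = Y g
        · exact .inl hY
        right
        rcases h4 with h4 | h4
        · exfalso
          have hig : i ∈ (range m).filter (fun i => Av X Y RY sl E i ∧ X i = X g) := by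
            simp only [mem_filter, mem_range]
            exact ⟨h2, ⟨h3, by rw [h4]; exact hg2, by rw [h4]; exact hg3, h5⟩, h4⟩
          have hgg : g ∈ (range m).filter (fun i => Av X Y RY sl E i ∧ X i = X g) := by
            simp only [mem_filter, mem_range]
            exact ⟨hgR, ⟨hg1, hg2, hg3, hg4⟩, trivial⟩
          obtain ⟨z, hz⟩ := card_eq_one.1 h1
          rw [hz, mem_singleton] at hig hgg
          exact hY (by rw [hig, hgg])
        · refine mem_image_of_mem Y ?_
          simp only [hS', mem_filter, mem_range]
          refine ⟨h2, h3, h4, fun j hj => ?_⟩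
          rcases (hE j).1 hj with hj | rfl
          · exact h5 j hj
          · exact fun h => hY h.symm
      have := (card_le_card hsub).trans (card_insert_le _ _)
      omega
    -- Every vertex of `T` has an available edge by Hall's condition for one vertex, and a single
    -- one is excluded, so there are at least `2 * T.card` edges. At `Y g` there is at most one edge
    -- besides `g`, so at least `2 * T.card - 1` survive; as right vertices take at most two each,
    -- `T.card` right vertices remain.
    · have hcnt : ∀ x ∈ T, 2 ≤ ((range m).filter (fun i => RY i ∧ X i = x ∧
          ∀ j, E j → Y j ≠ Y i)).card := by
        intro x hx
        have h1 := h.hall {x} (by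
          intro z hz
          rw [mem_singleton] at hz
          subst hz
          exact hTE z hx)
        rw [card_singleton] at h1
        obtain ⟨y, hy⟩ := card_pos.1 (Nat.lt_of_lt_of_le Nat.zero_lt_one h1)
        rw [mem_image] at hy
        obtain ⟨i, hi, -⟩ := hy
        simp only [mem_filter, mem_range, mem_singleton] at hi
        obtain ⟨h2, h3, h4, h5⟩ := hi
        subst h4
        obtain ⟨-, hx2, -, hx4⟩ := hTE _ hx
        have heq : (range m).filter (fun j => RY j ∧ X j = X i ∧ ∀ l, E l → Y l ≠ Y j) =
            (range m).filter (fun j => Av X Y RY sl E j ∧ X j = X i) := by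
          ext j
          rw [mem_filter, mem_filter]
          refine and_congr_right fun _ => ?_
          constructor
          · rintro ⟨a, d, e⟩
            exact ⟨⟨a, by rw [d]; exact hx2, by rw [d]; exact hx4, e⟩, d⟩
          · rintro ⟨⟨a, -, -, e⟩, d⟩
            exact ⟨a, d, e⟩
        rw [heq]
        have hne : ((range m).filter (fun j => Av X Y RY sl E j ∧ X j = X i)).card ≠ 1 :=
          fun h1 => hu ⟨i, ⟨h3, hx2, hx4, h5⟩, h1⟩
        have : 0 < ((range m).filter (fun j => Av X Y RY sl E j ∧ X j = X i)).card :=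
          card_pos.2 ⟨i, by
            simp only [mem_filter, mem_range]
            exact ⟨h2, ⟨h3, hx2, hx4, h5⟩, trivial⟩⟩
        omega
      set S := (range m).filter (fun i => RY i ∧ X i ∈ T ∧ ∀ j, E j → Y j ≠ Y i) with hSdef
      have h2 : 2 * T.card ≤ S.card := by
        have := card_eq_sum_card_fiberwise (f := X) (s := S) (t := T) (by
          intro i hi
          simp only [hSdef, coe_filter, Set.mem_ofPred_eq] at hi
          exact hi.2.2.1)
        rw [this, mul_comm, ← smul_eq_mul, ← sum_const]
        refine sum_le_sum fun x hx => (hcnt x hx).trans (card_le_card ?_)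
        intro i hi
        simp only [hSdef, mem_filter] at hi ⊢
        obtain ⟨a, b, d, e⟩ := hi
        exact ⟨⟨a, b, by rw [d]; exact hx, e⟩, d⟩
      have h3 : S.card ≤ S'.card + 1 := by
        have hsub : S ⊆ S' ∪ ((range m).filter (fun i => RY i ∧ Y i = Y g)).erase g := by
          intro i hi
          simp only [hSdef, mem_filter] at hi
          simp only [mem_union, mem_erase, hS', mem_filter]
          by_cases hY : Y i = Y g
          · right
            refine ⟨?_, hi.1, hi.2.1, hY⟩
            rintro rfl
            exact hgT hi.2.2.1
          · left
            refine ⟨hi.1, hi.2.1, hi.2.2.1, fun j hj => ?_⟩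
            rcases (hE j).1 hj with hj | rfl
            · exact hi.2.2.2 j hj
            · exact fun h => hY h.symm
        have h4 := (card_le_card hsub).trans (card_union_le _ _)
        rw [card_erase_of_mem (by simp [hgR, hg1])] at h4
        have := hS.fib (Y g)
        omega
      have h4 : S'.card ≤ 2 * (S'.image Y).card := by
        refine card_le_mul_card_image S' 2 fun y _ => ?_
        refine (card_le_card ?_).trans (hS.fib y)
        intro i hi
        simp only [hS', mem_filter] at hi ⊢
        exact ⟨hi.1.1, hi.1.2.1, hi.2⟩
      omega
  · have : E' = E := funext fun i => propext (hE i)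
    rw [this]
    exact h

/-- Either nothing can be done, or the matching grows. -/
theorem Step.card (hS : Setting m Y R RY F) (hs : Step m X Y RY F sl E E') :
    ((∀ g, ¬ CandF X F sl E g) ∧ (∀ g, ¬ Av X Y RY sl E g) ∧ E' = E) ∨
    ((range m).filter E).card + 1 ≤ ((range m).filter E').card := by
  have ins : ∀ g, R g → (∀ j, E j → X j ≠ X g) → (∀ i, E' i ↔ E i ∨ i = g) →
      ((range m).filter E).card + 1 ≤ ((range m).filter E').card := by
    intro g hg h1 hE
    have hlt : (range m).filter E ⊂ (range m).filter E' := by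
      rw [ssubset_iff_of_subset]
      · refine ⟨g, by simp [hS.lt g hg, hE], ?_⟩
        simp only [mem_filter, not_and]
        exact fun _ hgE => h1 g hgE rfl
      · intro i hi
        simp only [mem_filter] at hi ⊢
        exact ⟨hi.1, (hE i).2 (.inl hi.2)⟩
    exact card_lt_card hlt
  rcases hs with ⟨g, ⟨hg1, hg2, hg3⟩, hE⟩ | ⟨hno, g, ⟨hg1, hg2, hg3, hg4⟩, huniq, hE⟩ |
    ⟨h1, h2, hE⟩
  · exact .inr (ins g (hS.subF g hg1) hg3 hE)
  · exact .inr (ins g (hS.sub g hg1) hg3 hE)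
  · exact .inl ⟨h1, h2, funext fun i => propext (hE i)⟩

theorem Step.mono (hs : Step m X Y RY F sl E E') {i : ℕ} (hi : E i) : E' i := by
  rcases hs with ⟨g, -, hE⟩ | ⟨-, g, -, -, hE⟩ | ⟨-, -, hE⟩
  exacts [(hE i).2 (.inl hi), (hE i).2 (.inl hi), (hE i).2 hi]

theorem Inv.card_le (hS : Setting m Y R RY F) (h : Inv m X Y R RY F sl E)
    (hX : ∀ i, R i → X i < n) : ((range m).filter E).card ≤ n := by
  rw [← card_range n]
  refine card_le_card_of_injOn X (fun i hi => ?_) (fun i hi j hj hij => ?_)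
  · simp only [coe_filter, Set.mem_ofPred_eq] at hi
    simp only [coe_range, Set.mem_Iio]
    rcases h.sub i hi.2 with h | h
    exacts [hX i (hS.subF i h), hX i (hS.sub i h)]
  · simp only [coe_filter, Set.mem_ofPred_eq] at hi hj
    by_contra hne
    exact h.injX i j hi.2 hj.2 hne hij

end Peel

/-! ## Graphs given by the ends of numbered edges -/

open Finset in
/-- A graph with vertices `< n` whose `m` edges join `a i` and `b i`, vertices `v j`, `j < k`,
and lists `l j` of colours. -/
structure Data where
  n : ℕ
  m : ℕ
  k : ℕ
  a : ℕ → ℕ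
  b : ℕ → ℕ
  v : ℕ → ℕ
  l : ℕ → List ℕ

namespace Data

open Finset

open scoped Classical

variable (D : Data)

def inc (i x : ℕ) : Prop := D.a i = x ∨ D.b i = x

noncomputable def deg (x : ℕ) : ℕ := ((range D.m).filter (fun i => D.inc i x)).card

/-- The number of colours. -/
noncomputable def s : ℕ := max 3 ((range D.n).sup D.deg)

def S (x : ℕ) : Prop := ∃ j < D.k, D.v j = x

/-- Centers: the vertices of degree at least 3 and the vertices with lists. -/
def cen (x : ℕ) : Prop := 3 ≤ D.deg x ∨ D.S x

/-- Colour `c` is allowed at `x`. -/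
def ok (x c : ℕ) : Prop := (¬ D.S x ∧ 1 ≤ c ∧ c ≤ D.s) ∨ ∃ j < D.k, D.v j = x ∧ c ∈ D.l j

def Adj (x y : ℕ) : Prop := x ≠ y ∧ ∃ i < D.m, D.inc i x ∧ D.inc i y

structure Valid : Prop where
  a_lt : ∀ i < D.m, D.a i < D.n
  b_lt : ∀ i < D.m, D.b i < D.n
  ne : ∀ i < D.m, D.a i ≠ D.b i
  simple : ∀ i < D.m, ∀ j < D.m, ∀ x y, x ≠ y → D.inc i x → D.inc i y → D.inc j x →
    D.inc j y → i = j
  two_le_deg : ∀ x < D.n, 2 ≤ D.deg x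
  sparse : ∀ i < D.m, D.deg (D.a i) = 2 ∨ D.deg (D.b i) = 2
  triangleFree : ∀ x y z, D.Adj x y → D.Adj y z → ¬ D.Adj x z
  v_lt : ∀ j < D.k, D.v j < D.n
  v_inj : ∀ i < D.k, ∀ j < D.k, D.v i = D.v j → i = j
  k_le : D.k ≤ 3
  l_nodup : ∀ j < D.k, (D.l j).Nodup
  l_mem : ∀ j < D.k, ∀ c ∈ D.l j, 1 ≤ c ∧ c ≤ D.s
  l_len : ∀ j < D.k, D.deg (D.v j) ≤ (D.l j).length
  l_common : ∀ i < D.k, ∀ j < D.k, D.Adj (D.v i) (D.v j) → ∃ c, c ∈ D.l i ∧ c ∈ D.l j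
  no_path : ∀ i < D.k, ∀ j < D.k, ∀ h < D.k, i ≠ h → D.Adj (D.v i) (D.v j) →
    ¬ D.Adj (D.v j) (D.v h)

/-- `c` is a colouring as required. -/
structure IsSol (c : ℕ → ℕ) : Prop where
  range : ∀ i < D.m, 1 ≤ c i ∧ c i ≤ D.s
  proper : ∀ i < D.m, ∀ j < D.m, i ≠ j → ∀ x, D.inc i x → D.inc j x → c i ≠ c j
  lists : ∀ i < D.m, ∀ j < D.k, D.inc i (D.v j) → c i ∈ D.l j

/-- The end of edge `i` that is a center, and the other end. -/
noncomputable def X (i : ℕ) : ℕ := if D.cen (D.a i) then D.a i else D.b i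

noncomputable def Y (i : ℕ) : ℕ := if D.cen (D.a i) then D.b i else D.a i

variable (p : ℕ → ℕ)

/-- The edges without a precolour (`p i = 0`) that have a center as an end. -/
def R (i : ℕ) : Prop := i < D.m ∧ p i = 0 ∧ (D.cen (D.a i) ∨ D.cen (D.b i))

def RY (i : ℕ) : Prop := D.R p i ∧ ∃ j, j ≠ i ∧ D.R p j ∧ D.Y j = D.Y i

/-- The edge at the end `Y i` other than `i` is no obstacle for colouring `i` last at `X i`. -/
def Fr (i : ℕ) : Prop := D.R p i ∧ ((∃ j < D.m, p j = 0 ∧ ¬ D.R p j ∧ D.inc j (D.Y i)) ∨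
  ∃ j < D.m, p j ≠ 0 ∧ D.inc j (D.Y i) ∧ ∃ h < D.m, D.inc h (D.X i) ∧ p h = p j)

/-- Such vertices have a colour to spare and need no matching edge. -/
def sl (x : ℕ) : Prop := ¬ D.S x ∧ D.deg x < D.s

/-- Lists matter at `X i` only: when no uncoloured edge joins two centers, the other end is
unlisted. -/
def A (i c : ℕ) : Prop := D.ok (D.X i) c ∧ ∀ j < D.m, p j = c → ¬ D.inc j (D.X i) ∧
  ¬ D.inc j (D.Y i)

/-- A precolouring that the procedure extends to a solution. -/
structure IsPre : Prop where
  le : ∀ i < D.m, p i ≤ D.s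
  proper : ∀ i < D.m, ∀ j < D.m, i ≠ j → ∀ x, D.inc i x → D.inc j x → p i ≠ 0 → p i ≠ p j
  lists : ∀ i < D.m, p i ≠ 0 → ∀ j < D.k, D.inc i (D.v j) → p i ∈ D.l j
  not_cen : ∀ i < D.m, p i = 0 → ¬ (D.cen (D.a i) ∧ D.cen (D.b i))
  hall : Peel.Hall D.m D.X D.Y (D.R p) (D.RY p) (D.Fr p) D.sl (fun _ => False)

variable {D} {p}

theorem three_le_s : 3 ≤ D.s := le_max_left _ _

theorem deg_le_s {x : ℕ} (hx : x < D.n) : D.deg x ≤ D.s :=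
  (Finset.le_sup (f := D.deg) (mem_range.2 hx)).trans (le_max_right _ _)

theorem inc_X (i : ℕ) : D.inc i (D.X i) := by
  unfold inc X; split_ifs <;> simp

theorem inc_Y (i : ℕ) : D.inc i (D.Y i) := by
  unfold inc Y; split_ifs <;> simp

theorem inc_iff (i x : ℕ) : D.inc i x ↔ x = D.X i ∨ x = D.Y i := by
  unfold inc X Y; split_ifs <;> simp only [eq_comm (a := x)]
  exact or_comm

theorem Valid.lt_of_inc (hD : D.Valid) {i x : ℕ} (hi : i < D.m) (h : D.inc i x) : x < D.n := by
  rcases h with rfl | rfl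
  exacts [hD.a_lt i hi, hD.b_lt i hi]

theorem Valid.X_ne_Y (hD : D.Valid) {i : ℕ} (hi : i < D.m) : D.X i ≠ D.Y i := by
  have := hD.ne i hi
  unfold X Y; split_ifs
  exacts [this, this.symm]

theorem R.cen_X {i : ℕ} (h : D.R p i) : D.cen (D.X i) := by
  have := h.2.2
  unfold X; split_ifs with h1
  · exact h1
  · exact this.resolve_left h1

theorem IsPre.not_cen_Y (hp : D.IsPre p) {i : ℕ} (h : D.R p i) : ¬ D.cen (D.Y i) := by
  have := hp.not_cen i h.1 h.2.1
  unfold Y; split_ifs with h1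
  · exact fun h2 => this ⟨h1, h2⟩
  · exact h1

theorem IsPre.R_of_inc (hp : D.IsPre p) {i x : ℕ} (hi : i < D.m) (h0 : p i = 0)
    (hx : D.cen x) (h : D.inc i x) : D.R p i ∧ D.X i = x := by
  have h1 : D.R p i := by
    refine ⟨hi, h0, ?_⟩
    rcases h with rfl | rfl
    exacts [.inl hx, .inr hx]
  refine ⟨h1, ?_⟩
  rcases (inc_iff i x).1 h with rfl | rfl
  · rfl
  · exact absurd hx (hp.not_cen_Y h1)

theorem IsPre.deg_Y (hp : D.IsPre p) {i : ℕ} (h : D.R p i) : D.deg (D.Y i) ≤ 2 := by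
  have := hp.not_cen_Y h
  unfold cen at this
  push Not at this
  omega

theorem card_three_le_deg {x i j h : ℕ} (hi : i < D.m) (hj : j < D.m) (hh : h < D.m)
    (hij : i ≠ j) (hih : i ≠ h) (hjh : j ≠ h) (h1 : D.inc i x) (h2 : D.inc j x)
    (h3 : D.inc h x) : 3 ≤ D.deg x := by
  have : ({i, j, h} : Finset ℕ) ⊆ (range D.m).filter (fun i => D.inc i x) := by
    intro z hz
    simp only [mem_insert, mem_singleton] at hz
    simp only [mem_filter, mem_range]
    rcases hz with rfl | rfl | rfl
    exacts [⟨hi, h1⟩, ⟨hj, h2⟩, ⟨hh, h3⟩]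
  have h4 := card_le_card this
  rwa [card_eq_three.2 ⟨i, j, h, hij, hih, hjh, rfl⟩] at h4

/-- Right ends have degree at most 2. An edge of `Fr` has at its right end a partner outside `R`, so
a second edge of `R` there would be a third edge. -/
theorem IsPre.setting (hp : D.IsPre p) :
    Peel.Setting D.m D.Y (D.R p) (D.RY p) (D.Fr p) where
  lt i h := h.1
  sub i h := h.1
  subF i h := h.1
  fib y := by
    rcases eq_empty_or_nonempty ((range D.m).filter (fun i => D.RY p i ∧ D.Y i = y)) with
      h | ⟨i, hi⟩
    · rw [h]; simp
    · simp only [mem_filter] at hi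
      have := hp.deg_Y hi.2.1.1
      rw [hi.2.2] at this
      refine (card_le_card ?_).trans this
      intro j hj
      simp only [mem_filter] at hj ⊢
      refine ⟨hj.1, ?_⟩
      rw [← hj.2.2]
      exact inc_Y j
  sep i j hi hj hij hY := by
    have hdY := hp.deg_Y hj
    obtain ⟨h, hh, hhY, hhi, hhj⟩ : ∃ h < D.m, D.inc h (D.Y j) ∧ h ≠ i ∧ h ≠ j := by
      rcases hi.2 with ⟨h, h1, h2, h3, h4⟩ | ⟨h, h1, h2, h3, -⟩
      · exact ⟨h, h1, by rwa [← hY], by rintro rfl; exact h3 hi.1, by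
          rintro rfl; exact h3 hj⟩
      · exact ⟨h, h1, by rwa [← hY], by rintro rfl; exact h2 hi.1.2.1, by
          rintro rfl; exact h2 hj.2.1⟩
    have := card_three_le_deg hi.1.1 hj.1 hh hij hhi.symm hhj.symm
      (by rw [← hY]; exact inc_Y i) (inc_Y j) hhY
    omega

/-- A listed vertex can use its list, which has at least `deg` colours; any other vertex can use all
`s` colours, one more than its degree if it is slack. -/
theorem Valid.ok_card (hD : D.Valid) {x : ℕ} (hx : x < D.n) {c : ℕ} (hc : D.s < c) :
    D.deg x + (if D.sl x then 1 else 0) ≤ ((range c).filter (D.ok x)).card := by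
  by_cases hS : D.S x
  · have h1 : ¬ D.sl x := fun h => h.1 hS
    obtain ⟨j, hj, rfl⟩ := hS
    rw [if_neg h1, Nat.add_zero]
    refine (hD.l_len j hj).trans ?_
    rw [← List.toFinset_card_of_nodup (hD.l_nodup j hj)]
    refine card_le_card fun d hd => ?_
    rw [List.mem_toFinset] at hd
    have := hD.l_mem j hj d hd
    simp only [mem_filter, mem_range]
    exact ⟨by omega, .inr ⟨j, hj, rfl, hd⟩⟩
  · have h1 : D.s ≤ ((range c).filter (D.ok x)).card := by
      have : Icc 1 D.s ⊆ (range c).filter (D.ok x) := by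
        intro d hd
        rw [mem_Icc] at hd
        simp only [mem_filter, mem_range]
        exact ⟨by omega, .inl ⟨hS, hd⟩⟩
      have := card_le_card this
      rwa [Nat.card_Icc, Nat.add_sub_cancel] at this
    have h2 := deg_le_s hx
    split_ifs with h3
    · have := h3.2; omega
    · omega

/-- The counting condition for Galvin's procedure. -/
theorem IsPre.count (hD : D.Valid) (hp : D.IsPre p) {E : ℕ → Prop}
    (hE : ∀ i, E i → D.Fr p i ∨ D.RY p i)
    (hdone : ∀ i, D.R p i → D.sl (D.X i) ∨ ∃ j, E j ∧ D.X j = D.X i) {c : ℕ} (hc : D.s < c)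
    (i : ℕ) (hi : D.R p i) :
    ((range D.m).filter (fun j => D.R p j ∧ j ≠ i ∧ Galvin.Dom D.X D.Y E j i)).card <
      ((range c).filter (D.A p i)).card := by
  have hER : ∀ i, E i → D.R p i := fun i h => by
    rcases hE i h with h | h
    exacts [h.1, h.1]
  set x := D.X i with hx
  set y := D.Y i with hy
  set P := (range D.m).filter (fun j => D.inc j x ∧ p j ≠ 0) with hP
  set Rx := (range D.m).filter (fun j => D.R p j ∧ D.X j = x) with hRx
  set Py := (range D.m).filter (fun j => D.inc j y ∧ p j ≠ 0) with hPy
  set Ry := (range D.m).filter (fun j => D.R p j ∧ j ≠ i ∧ D.Y j = y) with hRy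
  have hxn : x < D.n := hD.lt_of_inc hi.1 (inc_X i)
  have hiRx : i ∈ Rx := by simp [hRx, hi.1, hi, hx]
  have hdeg : D.deg x = P.card + Rx.card := by
    rw [deg, ← card_union_of_disjoint]
    · congr 1
      ext j
      simp only [hP, hRx, mem_filter, mem_union, mem_range]
      constructor
      · rintro ⟨h1, h2⟩
        by_cases h0 : p j = 0
        · exact .inr ⟨h1, hp.R_of_inc h1 h0 hi.cen_X h2⟩
        · exact .inl ⟨h1, h2, h0⟩
      · rintro (⟨h1, h2, -⟩ | ⟨h1, h2, h3⟩)
        · exact ⟨h1, h2⟩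
        · exact ⟨h1, by rw [← h3]; exact inc_X j⟩
    · rw [disjoint_left]
      intro j h1 h2
      simp only [hP, hRx, mem_filter] at h1 h2
      exact h1.2.2 h2.2.1.2.1
  -- Besides `i` the right end has at most one edge, which costs either a colour or a dominator but
  -- not both.
  have hy1 : Py.card + Ry.card ≤ 1 := by
    rw [← card_union_of_disjoint]
    · have h1 : insert i (Py ∪ Ry) ⊆ (range D.m).filter (fun j => D.inc j y) := by
        intro j hj
        simp only [mem_insert, mem_union, hPy, hRy, mem_filter, mem_range] at hj ⊢
        rcases hj with rfl | ⟨h1, h2, -⟩ | ⟨h1, h2, h3, h4⟩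
        · exact ⟨hi.1, inc_Y j⟩
        · exact ⟨h1, h2⟩
        · exact ⟨h1, by rw [← h4]; exact inc_Y j⟩
      have h2 := (card_le_card h1).trans (hp.deg_Y hi)
      rw [card_insert_of_notMem] at h2
      · omega
      · simp [hPy, hRy, hi.2.1]
    · rw [disjoint_left]
      intro j h1 h2
      simp only [hPy, hRy, mem_filter] at h1 h2
      exact h1.2.2 h2.2.1.2.1
  -- The only colours of `X i` that `i` loses are those of precoloured edges at its two ends.
  have hA : ((range c).filter (D.ok x)).card ≤ ((range c).filter (D.A p i)).card +
      ((P.image p) ∪ (Py.image p)).card := by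
    rw [← card_union_add_card_inter]
    refine le_trans (card_le_card ?_) (Nat.le_add_right _ _)
    intro d hd
    simp only [mem_filter, mem_range, mem_union] at hd ⊢
    by_cases h1 : D.A p i d
    · exact .inl ⟨hd.1, h1⟩
    · right
      simp only [A, not_and, not_forall] at h1
      obtain ⟨j, hj, hjd, h2⟩ := h1 hd.2
      have hd0 : d ≠ 0 := by
        rcases hd.2 with h | ⟨j', hj', -, h⟩
        · omega
        · have := hD.l_mem j' hj' d h; omega
      by_cases h3 : D.inc j x
      · left
        exact mem_image.2 ⟨j, by simp [hP, hj, h3, hjd, hd0], hjd⟩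
      · right
        have h4 : D.inc j y := not_not.1 (h2 h3)
        exact mem_image.2 ⟨j, by simp [hPy, hj, h4, hjd, hd0], hjd⟩
  have hok := hD.ok_card hxn hc
  have hPi : (P.image p).card ≤ P.card := card_image_le
  by_cases hEi : E i
  · have hdom : ((range D.m).filter (fun j => D.R p j ∧ j ≠ i ∧
        Galvin.Dom D.X D.Y E j i)).card + 1 ≤ Rx.card := by
      rw [← card_erase_add_one hiRx]
      refine Nat.add_le_add_right (card_le_card fun j hj => ?_) 1
      simp only [mem_filter, mem_erase, hRx] at hj ⊢
      rcases hj.2.2.2 with h | h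
      · exact ⟨hj.2.2.1, hj.1, hj.2.1, h.2⟩
      · exact absurd hEi h.1
    -- For a matching edge the right end costs no further colour. If its partner there is
    -- precoloured, the edge belongs to `Fr` through a colour that already occurs at `X i`;
    -- otherwise the right end has no precoloured edge.
    have hPP : (P.image p) ∪ (Py.image p) ⊆ P.image p := by
      refine union_subset (Subset.refl _) fun d hd => ?_
      obtain ⟨j, hj, rfl⟩ := mem_image.1 hd
      rcases hE i hEi with h | h
      · rcases h.2 with ⟨g, h1, h2, h3, h4⟩ | ⟨g, h1, h2, h3, f, h4, h5, h6⟩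
        · simp only [hPy, mem_filter, mem_range] at hj
          have := card_three_le_deg hi.1 hj.1 h1 (by rintro rfl; exact hj.2.2 hi.2.1)
            (by rintro rfl; exact h3 hi) (by rintro rfl; exact hj.2.2 h2) (inc_Y i) hj.2.1 h4
          have := hp.deg_Y hi
          omega
        · have hg : g ∈ Py := by simp [hPy, h1, h2, h3, hy]
          have : g = j := card_le_one.1 (show Py.card ≤ 1 by omega) g hg j hj
          subst this
          rw [← h6]
          exact mem_image.2 ⟨f, by simp [hP, h4, h5, h6, h2, hx], rfl⟩
      · obtain ⟨-, g, hgi, hg, hgY⟩ := h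
        have h1 : 0 < Ry.card := card_pos.2 ⟨g, by simp [hRy, hg, hg.1, hgi, hgY, hy]⟩
        have h2 : 0 < Py.card := card_pos.2 ⟨j, hj⟩
        omega
    have := card_le_card hPP
    split_ifs at hok <;> omega
  · have hun := (card_union_le (P.image p) (Py.image p))
    have hPyi : (Py.image p).card ≤ Py.card := card_image_le
    -- Outside the matching, the edge at the right end has to be paid for: by the spare colour of a
    -- slack vertex, or by the matching edge at `X i`, which does not dominate `i` from there.
    rcases hdone i hi with hsl | ⟨e, he, heX⟩
    · have hdom : ((range D.m).filter (fun j => D.R p j ∧ j ≠ i ∧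
          Galvin.Dom D.X D.Y E j i)).card + 1 ≤ Rx.card + Ry.card := by
        rw [← card_erase_add_one hiRx]
        have : (range D.m).filter (fun j => D.R p j ∧ j ≠ i ∧
          Galvin.Dom D.X D.Y E j i) ⊆ Rx.erase i ∪ Ry := by
          intro j hj
          simp only [mem_filter, mem_erase, hRx, hRy, mem_union] at hj ⊢
          rcases hj.2.2.2 with h | h
          · exact absurd h.1 hEi
          · rcases h.2 with h | h
            · exact .inl ⟨hj.2.2.1, hj.1, hj.2.1, h.1⟩
            · exact .inr ⟨hj.1, hj.2.1, hj.2.2.1, h⟩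
        have := (card_le_card this).trans (card_union_le _ _)
        omega
      rw [if_pos hsl] at hok
      omega
    · have heR : e ∈ Rx := by
        simp only [hRx, mem_filter, mem_range]
        exact ⟨(hER e he).1, hER e he, heX⟩
      have hei : e ≠ i := by rintro rfl; exact hEi he
      have hdom : ((range D.m).filter (fun j => D.R p j ∧ j ≠ i ∧
          Galvin.Dom D.X D.Y E j i)).card + 2 ≤ Rx.card + Ry.card := by
        have h1 := card_erase_add_one hiRx
        have h2 := card_erase_add_one (show e ∈ Rx.erase i from mem_erase.2 ⟨hei, heR⟩)
        have : (range D.m).filter (fun j => D.R p j ∧ j ≠ i ∧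
          Galvin.Dom D.X D.Y E j i) ⊆ (Rx.erase i).erase e ∪ Ry := by
          intro j hj
          simp only [mem_filter, mem_erase, hRx, hRy, mem_union] at hj ⊢
          rcases hj.2.2.2 with h | h
          · exact absurd h.1 hEi
          · rcases h.2 with h | h
            · exact .inl ⟨by rintro rfl; exact h.2 he, hj.2.2.1, hj.1, hj.2.1, h.1⟩
            · exact .inr ⟨hj.1, hj.2.1, hj.2.2.1, h⟩
        have := (card_le_card this).trans (card_union_le _ _)
        omega
      split_ifs at hok <;> omega

/-! ### Finishing: the edges without centers -/

/-- A partial solution that leaves out only edges without centers. -/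
structure Part (D : Data) (c : ℕ → ℕ) : Prop where
  le : ∀ i < D.m, c i ≤ D.s
  proper : ∀ i < D.m, ∀ j < D.m, i ≠ j → ∀ x, D.inc i x → D.inc j x → c i ≠ 0 → c i ≠ c j
  lists : ∀ i < D.m, c i ≠ 0 → ∀ j < D.k, D.inc i (D.v j) → c i ∈ D.l j
  unc : ∀ i < D.m, c i = 0 → ∀ x, D.inc i x → ¬ D.cen x

/-- The edges `i`, `j` have a common end. -/
def Meet (D : Data) (i j : ℕ) : Prop := ∃ x, D.inc i x ∧ D.inc j x

def FinStep (D : Data) (c c' : ℕ → ℕ) : Prop :=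
  (∃ g < D.m, c g = 0 ∧ ∃ d, (d = 1 ∨ d = 2 ∨ d = 3) ∧
    ((∃ e, (e = 1 ∨ e = 2 ∨ e = 3) ∧ ∀ i < D.m, D.Meet i g → c i ≠ e) →
      ∀ i < D.m, D.Meet i g → c i ≠ d) ∧ ∀ i < D.m, c' i = if i = g then d else c i) ∨
  ((∀ g < D.m, c g ≠ 0) ∧ ∀ i < D.m, c' i = c i)

/-- Both ends of an edge without center have degree at most 2, so it meets at most two other edges
and one of three colours is free. Lists are not concerned, since listed vertices are centers. -/
theorem Part.step {c c' : ℕ → ℕ} (h : D.Part c) (hs : D.FinStep c c') : D.Part c' := by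
  have hs3 : 3 ≤ D.s := three_le_s
  rcases hs with ⟨g, hg, hg0, d, hd, hfree, hc⟩ | ⟨-, hc⟩
  · have hga := h.unc g hg hg0 (D.a g) (.inl rfl)
    have hgb := h.unc g hg hg0 (D.b g) (.inr rfl)
    have hfree' : ∀ i < D.m, D.Meet i g → c i ≠ d := by
      refine hfree ?_
      by_contra hcon
      push Not at hcon
      obtain ⟨i1, h11, h12, h13⟩ := hcon 1 (by simp)
      obtain ⟨i2, h21, h22, h23⟩ := hcon 2 (by simp)
      obtain ⟨i3, h31, h32, h33⟩ := hcon 3 (by simp)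
      have h12' : i1 ≠ i2 := by rintro rfl; omega
      have h13' : i1 ≠ i3 := by rintro rfl; omega
      have h23' : i2 ≠ i3 := by rintro rfl; omega
      have hg1 : g ≠ i1 := by rintro rfl; omega
      have hg2 : g ≠ i2 := by rintro rfl; omega
      have hg3 : g ≠ i3 := by rintro rfl; omega
      have hda : D.deg (D.a g) < 3 := by unfold cen at hga; push Not at hga; exact hga.1
      have hdb : D.deg (D.b g) < 3 := by unfold cen at hgb; push Not at hgb; exact hgb.1
      have hend : ∀ i, D.Meet i g → D.inc i (D.a g) ∨ D.inc i (D.b g) := by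
        rintro i ⟨x, hx, rfl | rfl⟩
        exacts [.inl hx, .inr hx]
      have two : ∀ i j, i < D.m → j < D.m → i ≠ j → g ≠ i → g ≠ j →
          (D.inc i (D.a g) → ¬ D.inc j (D.a g)) ∧ (D.inc i (D.b g) → ¬ D.inc j (D.b g)) := by
        intro i j hi hj hij hgi hgj
        constructor
        · intro h1 h2
          have := card_three_le_deg hg hi hj hgi hgj hij (.inl rfl) h1 h2
          omega
        · intro h1 h2
          have := card_three_le_deg hg hi hj hgi hgj hij (.inr rfl) h1 h2
          omega
      have t1 := two i1 i2 h11 h21 h12' hg1 hg2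
      have t2 := two i1 i3 h11 h31 h13' hg1 hg3
      have t3 := two i2 i3 h21 h31 h23' hg2 hg3
      have e1 := hend i1 h12
      have e2 := hend i2 h22
      have e3 := hend i3 h32
      rcases e1 with e1 | e1 <;> rcases e2 with e2 | e2 <;> rcases e3 with e3 | e3 <;>
        first
        | exact t1.1 e1 e2
        | exact t1.2 e1 e2
        | exact t2.1 e1 e3
        | exact t2.2 e1 e3
        | exact t3.1 e2 e3
        | exact t3.2 e2 e3
    have hinc : ∀ x, D.inc g x → ¬ D.cen x := h.unc g hg hg0
    refine ⟨?_, ?_, ?_, ?_⟩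
    · intro i hi
      rw [hc i hi]
      split_ifs
      · omega
      · exact h.le i hi
    · intro i hi j hj hij x hix hjx h0
      rw [hc i hi] at h0
      rw [hc i hi, hc j hj]
      by_cases hig : i = g
      · subst hig
        rw [if_pos rfl, if_neg (fun h => hij h.symm)]
        exact (hfree' j hj ⟨x, hjx, hix⟩).symm
      · rw [if_neg hig] at h0 ⊢
        by_cases hjg : j = g
        · subst hjg
          rw [if_pos rfl]
          exact hfree' i hi ⟨x, hix, hjx⟩
        · rw [if_neg hjg]
          exact h.proper i hi j hj hij x hix hjx h0
    · intro i hi h0 j hj hij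
      rw [hc i hi] at h0 ⊢
      by_cases hig : i = g
      · subst hig
        exact absurd (.inr ⟨j, hj, rfl⟩) (hinc _ hij)
      · rw [if_neg hig] at h0 ⊢
        exact h.lists i hi h0 j hj hij
    · intro i hi h0
      rw [hc i hi] at h0
      by_cases hig : i = g
      · subst hig
        rw [if_pos rfl] at h0
        omega
      · rw [if_neg hig] at h0
        exact h.unc i hi h0
  · refine ⟨fun i hi => ?_, fun i hi j hj => ?_, fun i hi => ?_, fun i hi => ?_⟩
    · rw [hc i hi]; exact h.le i hi
    · rw [hc i hi, hc j hj]; exact h.proper i hi j hj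
    · rw [hc i hi]; exact h.lists i hi
    · rw [hc i hi]; exact h.unc i hi

theorem FinStep.card {c c' : ℕ → ℕ} (hs : D.FinStep c c') :
    (∀ g < D.m, c' g ≠ 0) ∨ ((range D.m).filter (fun i => c i ≠ 0)).card + 1 ≤
      ((range D.m).filter (fun i => c' i ≠ 0)).card := by
  rcases hs with ⟨g, hg, hg0, d, hd, -, hc⟩ | ⟨h1, hc⟩
  · right
    refine card_lt_card ?_
    rw [ssubset_iff_of_subset]
    · refine ⟨g, ?_, by simp [hg0]⟩
      simp only [mem_filter, mem_range]
      refine ⟨hg, ?_⟩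
      rw [hc g hg, if_pos rfl]; omega
    · intro i hi
      simp only [mem_filter, mem_range] at hi ⊢
      refine ⟨hi.1, ?_⟩
      rw [hc i hi.1]
      split_ifs
      · omega
      · exact hi.2
  · left
    intro g hg
    rw [hc g hg]
    exact h1 g hg

theorem Part.isSol {c : ℕ → ℕ} (h : D.Part c) (h0 : ∀ i < D.m, c i ≠ 0) : D.IsSol c where
  range i hi := ⟨Nat.one_le_iff_ne_zero.2 (h0 i hi), h.le i hi⟩
  proper i hi j hj hij x hix hjx := h.proper i hi j hj hij x hix hjx (h0 i hi)
  lists i hi j hj hij := h.lists i hi (h0 i hi) j hj hij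

/-- Combining the precolours and the colours found by Galvin's procedure. -/
theorem IsPre.part (hD : D.Valid) (hp : D.IsPre p) {E : ℕ → Prop} {q : ℕ → ℕ} {c : ℕ}
    (hq : Galvin.Inv D.X D.Y (D.R p) E (D.A p) q c) (h0 : ∀ i, D.R p i → q i ≠ 0)
    {col : ℕ → ℕ} (hcol : ∀ i < D.m, col i = if p i ≠ 0 then p i else
      if D.R p i then q i else 0) : D.Part col := by
  have hpR : ∀ i j, i < D.m → j < D.m → p i ≠ 0 → D.R p j → ∀ x, D.inc i x → D.inc j x →
      p i ≠ q j := by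
    intro i j hi hj h1 h2 x hix hjx h3
    have := (hq.avail j h2 (h0 j h2)).1.2 i hi h3
    rcases (inc_iff j x).1 hjx with rfl | rfl
    exacts [this.1 hix, this.2 hix]
  refine ⟨?_, ?_, ?_, ?_⟩
  · intro i hi
    rw [hcol i hi]
    split_ifs with h1 h2
    · exact hp.le i hi
    · rcases (hq.avail i h2 (h0 i h2)).1.1 with h | ⟨j, hj, -, h⟩
      · exact h.2.2
      · exact (hD.l_mem j hj _ h).2
    · omega
  · intro i hi j hj hij x hix hjx h1
    rw [hcol i hi] at h1
    rw [hcol i hi, hcol j hj]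
    by_cases hpi : p i = 0
    · rw [if_neg (not_not.2 hpi)] at h1 ⊢
      have hRi : D.R p i := by
        by_contra hR; rw [if_neg hR] at h1; exact h1 rfl
      rw [if_pos hRi] at h1 ⊢
      by_cases hpj : p j = 0
      · rw [if_neg (not_not.2 hpj)]
        split_ifs with hRj
        · intro h2
          have h3 := hq.proper i j hRi hRj hij h1 h2
          rcases (inc_iff i x).1 hix with rfl | rfl <;> rcases (inc_iff j _).1 hjx with h | h
          · exact h3.1 h
          · exact hp.not_cen_Y hRj (h ▸ hRi.cen_X)
          · exact hp.not_cen_Y hRi (h ▸ hRj.cen_X)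
          · exact h3.2 h
        · exact h1
      · rw [if_pos hpj]
        exact (hpR j i hj hi hpj hRi x hjx hix).symm
    · rw [if_pos hpi]
      by_cases hpj : p j = 0
      · rw [if_neg (not_not.2 hpj)]
        split_ifs with hRj
        · exact hpR i j hi hj hpi hRj x hix hjx
        · exact hpi
      · rw [if_pos hpj]
        exact hp.proper i hi j hj hij x hix hjx hpi
  · intro i hi h1 j hj hij
    rw [hcol i hi] at h1 ⊢
    split_ifs at h1 ⊢ with h2 h3
    · exact hp.lists i hi h2 j hj hij
    · have hS : D.S (D.v j) := ⟨j, hj, rfl⟩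
      have hX : D.v j = D.X i := by
        rcases (inc_iff i _).1 hij with h | h
        · exact h
        · exact absurd (h ▸ .inr hS) (hp.not_cen_Y h3)
      rcases (hq.avail i h3 (h0 i h3)).1.1 with h | ⟨j', hj', h4, h⟩
      · exact absurd (hX ▸ hS) h.1
      · rw [← hX] at h4
        have := hD.v_inj j' hj' j hj h4
        subst this
        exact h
    · exact absurd rfl h1
  · intro i hi h1 x hx hcx
    rw [hcol i hi] at h1
    have hpi : p i = 0 := by
      by_contra h; rw [if_pos h] at h1; exact h h1
    have := (hp.R_of_inc hi hpi hcx hx).1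
    rw [if_neg (not_not.2 hpi), if_pos this] at h1
    exact h0 i this h1

theorem A_pos (hD : D.Valid) (i c : ℕ) (h : D.A p i c) : 1 ≤ c := by
  rcases h.1 with h | ⟨j, hj, -, h⟩
  · exact h.2.1
  · exact (hD.l_mem j hj _ h).1

end Data

/-! ## Precolourings -/

namespace Data

open Finset

open scoped Classical

variable {D : Data} {p : ℕ → ℕ}

theorem Adj.symm {x y : ℕ} (h : D.Adj x y) : D.Adj y x := by
  obtain ⟨h1, i, hi, h2, h3⟩ := h
  exact ⟨h1.symm, i, hi, h3, h2⟩

theorem Valid.adj_of_inc (hD : D.Valid) {i x : ℕ} (hi : i < D.m) (h : D.inc i x) :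
    ∃ y, D.inc i y ∧ D.Adj x y ∧ ∀ z, D.inc i z → z = x ∨ z = y := by
  have := hD.ne i hi
  rcases h with rfl | rfl
  · refine ⟨D.b i, .inr rfl, ⟨this, i, hi, .inl rfl, .inr rfl⟩, ?_⟩
    rintro z (h | h) <;> simp [h]
  · refine ⟨D.a i, .inl rfl, ⟨this.symm, i, hi, .inr rfl, .inl rfl⟩, ?_⟩
    rintro z (h | h) <;> simp [h]

theorem Adj.lt (hD : D.Valid) {x y : ℕ} (h : D.Adj x y) : x < D.n := by
  obtain ⟨-, i, hi, h1, -⟩ := h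
  exact hD.lt_of_inc hi h1

/-- Two edges with the same two ends are equal. -/
theorem Valid.edge_unique (hD : D.Valid) {i j x y : ℕ} (hi : i < D.m) (hj : j < D.m)
    (h : x ≠ y) (h1 : D.inc i x) (h2 : D.inc i y) (h3 : D.inc j x) (h4 : D.inc j y) : i = j :=
  hD.simple i hi j hj x y h h1 h2 h3 h4

/-- A vertex of degree at most 2 has no more than two neighbours. -/
theorem Valid.nbr_two (hD : D.Valid) {x y z t : ℕ} (hx : D.deg x ≤ 2) (hy : D.Adj x y)
    (hz : D.Adj x z) (ht : D.Adj x t) (hyz : y ≠ z) : t = y ∨ t = z := by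
  by_contra hc
  push Not at hc
  obtain ⟨n1, i, hi, h1, h2⟩ := hy
  obtain ⟨n2, j, hj, h3, h4⟩ := hz
  obtain ⟨n3, h, hh, h5, h6⟩ := ht
  have key : ∀ {e f s t : ℕ}, e < D.m → s ≠ t → x ≠ s → x ≠ t → D.inc e x → D.inc e s →
      D.inc f t → e ≠ f := by
    rintro e f s t he hst hxs hxt a1 a2 a3 rfl
    obtain ⟨w, -, -, hw⟩ := hD.adj_of_inc he a1
    have := hw s a2
    have := hw t a3
    omega
  have := card_three_le_deg hi hj hh (key hi hyz n1 n2 h1 h2 h4)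
    (key hi hc.1.symm n1 n3 h1 h2 h6) (key hj hc.2.symm n2 n3 h3 h4 h6) h1 h3 h5
  omega

/-- The two edges and neighbours of a vertex of degree 2. -/
theorem Valid.two_edges (hD : D.Valid) {x : ℕ} (hx : D.deg x = 2) :
    ∃ i j y z, i < D.m ∧ j < D.m ∧ i ≠ j ∧ y ≠ z ∧ D.inc i x ∧ D.inc i y ∧ D.inc j x ∧
      D.inc j z ∧ D.Adj x y ∧ D.Adj x z ∧ (∀ h < D.m, D.inc h x → h = i ∨ h = j) := by
  obtain ⟨i, j, hij, h⟩ := card_eq_two.1 hx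
  have hi : i ∈ (range D.m).filter (fun i => D.inc i x) := by rw [h]; simp
  have hj : j ∈ (range D.m).filter (fun i => D.inc i x) := by rw [h]; simp
  simp only [mem_filter, mem_range] at hi hj
  obtain ⟨y, h1, h2, -⟩ := hD.adj_of_inc hi.1 hi.2
  obtain ⟨z, h3, h4, -⟩ := hD.adj_of_inc hj.1 hj.2
  refine ⟨i, j, y, z, hi.1, hj.1, hij, ?_, hi.2, h1, hj.2, h3, h2, h4, ?_⟩
  · rintro rfl
    exact hij (hD.edge_unique hi.1 hj.1 h2.1 hi.2 h1 hj.2 h3)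
  · intro e he hex
    have : e ∈ (range D.m).filter (fun i => D.inc i x) := by simp [he, hex]
    rw [h] at this
    simpa using this

/-- Degree 2, with a neighbour of another degree. -/
def NF (D : Data) (x : ℕ) : Prop := D.deg x = 2 ∧ ∃ y, D.Adj x y ∧ D.deg y ≠ 2

theorem Valid.deg_ne_two (hD : D.Valid) {x y : ℕ} (h : D.Adj x y) (h2 : D.deg y ≠ 2) :
    3 ≤ D.deg y := by
  have := hD.two_le_deg y (h.symm.lt hD)
  omega

theorem Valid.adj_deg (hD : D.Valid) {x y : ℕ} (h : D.Adj x y) : D.deg x = 2 ∨ D.deg y = 2 := by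
  obtain ⟨h1, i, hi, h2, h3⟩ := h
  have := hD.sparse i hi
  obtain ⟨w, hw, -, hwx⟩ := hD.adj_of_inc hi h2
  have hy := hwx y h3
  have ha := hwx _ (.inl rfl : D.inc i (D.a i))
  have hb := hwx _ (.inr rfl : D.inc i (D.b i))
  have : y = w := by omega
  subst this
  rcases ha with ha | ha <;> rcases hb with hb | hb <;> rw [ha, hb] at this <;> tauto

/-! ### Verifying Hall's condition -/

/-- The number of edges at `x` whose other end has two edges without precolour. -/
noncomputable def yd (D : Data) (p : ℕ → ℕ) (x : ℕ) : ℕ :=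
  ((range D.m).filter (fun i => D.RY p i ∧ D.X i = x)).card

/-- The vertices that have to be saturated. -/
def Need (D : Data) (p : ℕ → ℕ) (x : ℕ) : Prop :=
  (∃ i, D.R p i ∧ D.X i = x) ∧ ¬ D.sl x ∧ ∀ i, D.Fr p i → D.X i ≠ x

/-- Precoloured edges at `x`, and edges at `x` that lead to a precoloured edge. -/
noncomputable def con (D : Data) (p : ℕ → ℕ) (x : ℕ) : Finset ℕ :=
  (range D.m).filter (fun i => D.inc i x ∧ (p i ≠ 0 ∨ ∃ y, D.inc i y ∧ ¬ D.cen y ∧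
    ∃ j < D.m, j ≠ i ∧ D.inc j y ∧ p j ≠ 0))

/-- No edge without precolour joins two centers. -/
def NotCen (D : Data) (p : ℕ → ℕ) : Prop :=
  ∀ i < D.m, p i = 0 → ¬ (D.cen (D.a i) ∧ D.cen (D.b i))

theorem Need.lt (hD : D.Valid) {x : ℕ} (h : D.Need p x) : x < D.n := by
  obtain ⟨⟨i, h1, rfl⟩, -⟩ := h
  exact hD.lt_of_inc h1.1 (inc_X i)

theorem Need.cen {x : ℕ} (h : D.Need p x) : D.cen x := by
  obtain ⟨⟨i, h1, rfl⟩, -⟩ := h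
  exact h1.cen_X

theorem Need.exists_edge {x : ℕ} (h : D.Need p x) : ∃ i < D.m, D.inc i x ∧ p i = 0 := by
  obtain ⟨⟨i, h1, rfl⟩, -⟩ := h
  exact ⟨i, h1.1, inc_X i, h1.2.1⟩

theorem NotCen.Y (hn : D.NotCen p) {i : ℕ} (h : D.R p i) : ¬ D.cen (D.Y i) := by
  have := hn i h.1 h.2.1
  unfold Data.Y; split_ifs with h1
  · exact fun h2 => this ⟨h1, h2⟩
  · exact h1

theorem NotCen.R_of_inc (hn : D.NotCen p) {i x : ℕ} (hi : i < D.m) (h0 : p i = 0)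
    (hx : D.cen x) (h : D.inc i x) : D.R p i ∧ D.X i = x := by
  have h1 : D.R p i := by
    refine ⟨hi, h0, ?_⟩
    rcases h with rfl | rfl
    exacts [.inl hx, .inr hx]
  refine ⟨h1, ?_⟩
  rcases (inc_iff i x).1 h with rfl | rfl
  · rfl
  · exact absurd hx (hn.Y h1)

theorem deg_le_two_of_not_cen {x : ℕ} (h : ¬ D.cen x) : D.deg x ≤ 2 := by
  unfold Data.cen at h
  push Not at h
  omega

theorem Valid.deg_of_not_cen (hD : D.Valid) {x : ℕ} (hx : x < D.n) (h : ¬ D.cen x) :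
    D.deg x = 2 := by
  have := hD.two_le_deg x hx
  have := deg_le_two_of_not_cen h
  omega

/-- The other end of an uncoloured edge at `x` is no center, so it has exactly one further edge. If
that edge is in `R`, the edge at `x` counts for `yd`; if it is precoloured, the edge at `x` is in
`con`; if it is neither, the edge at `x` would be in `Fr`, which `Need` excludes. -/
theorem NotCen.deg_le (hD : D.Valid) (hn : D.NotCen p) {x : ℕ} (h : D.Need p x) :
    D.deg x ≤ D.yd p x + (D.con p x).card := by
  rw [deg, yd]
  refine le_trans (card_le_card ?_) (card_union_le _ _)
  intro i hi
  simp only [mem_filter, mem_range] at hi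
  simp only [mem_union, con, mem_filter, mem_range]
  by_cases h0 : p i = 0
  · obtain ⟨hR, hX⟩ := hn.R_of_inc hi.1 h0 h.cen hi.2
    have hY := hn.Y hR
    obtain ⟨e, f, y, z, he, hf, hef, -, h1, -, h2, -, -, -, h3⟩ :=
      hD.two_edges (hD.deg_of_not_cen (hD.lt_of_inc hi.1 (inc_Y i)) hY)
    obtain ⟨j, hj, hji, hjY⟩ : ∃ j < D.m, j ≠ i ∧ D.inc j (D.Y i) := by
      by_cases hei : e = i
      · exact ⟨f, hf, by rw [← hei]; exact hef.symm, h2⟩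
      · exact ⟨e, he, hei, h1⟩
    by_cases hpj : p j = 0
    · by_cases hRj : D.R p j
      · left
        refine ⟨hi.1, ⟨hR, j, hji, hRj, ?_⟩, hX⟩
        rcases (inc_iff j _).1 hjY with h | h
        · exact absurd (h ▸ hRj.cen_X) hY
        · exact h.symm
      · exact absurd hX (h.2.2 i ⟨hR, .inl ⟨j, hj, hpj, hRj, hjY⟩⟩)
    · exact .inr ⟨hi.1, hi.2, .inr ⟨D.Y i, inc_Y i, hY, j, hj, hji, hjY, hpj⟩⟩
  · exact .inr ⟨hi.1, hi.2, .inl h0⟩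

/-- At most two of the counted edges share a right end, because right ends are not centers. -/
theorem NotCen.card_image (hn : D.NotCen p) (T : Finset ℕ) :
    ∑ x ∈ T, D.yd p x ≤
      2 * (((range D.m).filter (fun i => D.RY p i ∧ D.X i ∈ T)).image D.Y).card := by
  have h1 : ∑ x ∈ T, D.yd p x = ((range D.m).filter (fun i => D.RY p i ∧ D.X i ∈ T)).card := by
    rw [card_eq_sum_card_fiberwise (f := D.X) (t := T) (by
      intro i hi
      simp only [coe_filter, Set.mem_ofPred_eq] at hi
      exact hi.2.2)]
    refine sum_congr rfl fun x hx => ?_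
    rw [yd]
    congr 1
    ext i
    simp only [mem_filter]
    constructor
    · rintro ⟨a, b, rfl⟩
      exact ⟨⟨a, b, hx⟩, rfl⟩
    · rintro ⟨⟨a, b, -⟩, d⟩
      exact ⟨a, b, d⟩
  rw [h1]
  refine card_le_mul_card_image _ 2 fun y hy => ?_
  obtain ⟨i, hi, rfl⟩ := mem_image.1 hy
  simp only [mem_filter] at hi
  refine (card_le_card ?_).trans (deg_le_two_of_not_cen (hn.Y hi.2.1.1))
  intro j hj
  simp only [mem_filter] at hj ⊢
  refine ⟨hj.1.1, ?_⟩
  rw [← hj.2]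
  exact inc_Y j

/-- A deficit of one is harmless by parity: an even number that is at least `2 * T.card - 1` is at
least `2 * T.card`. -/
theorem NotCen.hall (hn : D.NotCen p)
    (h : ∀ T : Finset ℕ, (∀ x ∈ T, D.Need p x) → 2 * T.card ≤ ∑ x ∈ T, D.yd p x + 1 ∨
      T.card ≤ (((range D.m).filter (fun i => D.RY p i ∧ D.X i ∈ T)).image D.Y).card) :
    Peel.Hall D.m D.X D.Y (D.R p) (D.RY p) (D.Fr p) D.sl (fun _ => False) := by
  intro T hT
  simp only [IsEmpty.forall_iff, implies_true, and_true] at hT ⊢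
  rcases h T hT with h | h
  · have := hn.card_image T
    omega
  · exact h

/-- Hall's condition if at most one vertex has fewer than two useful edges, and that one has
at least one. -/
theorem NotCen.hall_one (hn : D.NotCen p) (x₀ : ℕ) (h0 : D.Need p x₀ → 1 ≤ D.yd p x₀)
    (h : ∀ x, D.Need p x → x ≠ x₀ → 2 ≤ D.yd p x) :
    Peel.Hall D.m D.X D.Y (D.R p) (D.RY p) (D.Fr p) D.sl (fun _ => False) := by
  refine hn.hall fun T hT => .inl ?_
  by_cases hx : x₀ ∈ T
  · have h1 : ∑ x ∈ T.erase x₀, 2 ≤ ∑ x ∈ T.erase x₀, D.yd p x :=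
      sum_le_sum fun x hx => h x (hT x (mem_of_mem_erase hx)) (ne_of_mem_erase hx)
    have h2 := add_sum_erase T (D.yd p) hx
    have h3 := card_erase_add_one hx
    have h4 := h0 (hT _ hx)
    simp only [sum_const, smul_eq_mul] at h1
    omega
  · have h1 : ∑ x ∈ T, 2 ≤ ∑ x ∈ T, D.yd p x :=
      sum_le_sum fun x hxT => h x (hT x hxT) (by rintro rfl; exact hx hxT)
    simp only [sum_const, smul_eq_mul] at h1
    omega

/-! ### Colours -/

/-- Colours that the program tries for the edges at `v j`. -/
def Code (D : Data) (cc j c : ℕ) : Prop := c = cc ∨ c ∈ (D.l j).take 3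

/-- The precolouring uses such colours, at vertices of degree 2 only. -/
structure Coded (D : Data) (cc : ℕ) (p : ℕ → ℕ) : Prop where
  supp : ∀ i < D.m, p i ≠ 0 → ∃ j < D.k, D.deg (D.v j) = 2 ∧ D.inc i (D.v j)
  code : ∀ j < D.k, D.deg (D.v j) = 2 → ∀ i < D.m, D.inc i (D.v j) → p i ≠ 0 →
    D.Code cc j (p i)

/-- `cc` is a common colour of adjacent vertices with lists. -/
def IsCommon (D : Data) (cc : ℕ) : Prop :=
  ∀ i < D.k, ∀ j < D.k, D.Adj (D.v i) (D.v j) → cc ∈ D.l i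

theorem Valid.two_le_length (hD : D.Valid) {j : ℕ} (hj : j < D.k) : 2 ≤ (D.l j).length :=
  (hD.two_le_deg _ (hD.v_lt j hj)).trans (hD.l_len j hj)

theorem Valid.take_card (hD : D.Valid) {j : ℕ} (hj : j < D.k) :
    ((D.l j).take 3).toFinset.card = min 3 (D.l j).length := by
  rw [List.toFinset_card_of_nodup ((hD.l_nodup j hj).sublist (List.take_sublist _ _)),
    List.length_take]

/-- Two colours suffice to avoid a given one, so the trials may be restricted to the head of each
list. -/
theorem Valid.exists_color (hD : D.Valid) {j : ℕ} (hj : j < D.k) (c : ℕ) :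
    ∃ d ∈ (D.l j).take 3, d ≠ c := by
  have h1 := hD.take_card hj
  have h2 := hD.two_le_length hj
  have h3 : 1 < ((D.l j).take 3).toFinset.card := by omega
  obtain ⟨d, hd, hdc⟩ := exists_mem_ne h3 c
  exact ⟨d, List.mem_toFinset.1 hd, hdc⟩

theorem mem_of_take {j d : ℕ} (h : d ∈ (D.l j).take 3) : d ∈ D.l j := List.mem_of_mem_take h

/-- A sufficient condition for `NotCen`. -/
theorem Valid.notCen (hD : D.Valid)
    (h : ∀ i < D.m, p i = 0 → ∀ j < D.k, D.inc i (D.v j) → D.deg (D.v j) = 2 →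
      ∀ y, D.inc i y → D.Adj (D.v j) y → ¬ D.cen y) : D.NotCen p := by
  intro i hi h0 ⟨ha, hb⟩
  have hadj : D.Adj (D.a i) (D.b i) := ⟨hD.ne i hi, i, hi, .inl rfl, .inr rfl⟩
  rcases hD.sparse i hi with h2 | h2
  · rcases ha with h3 | ⟨j, hj, h3⟩
    · omega
    · exact h i hi h0 j hj (.inl h3.symm) (h3 ▸ h2) _ (.inr rfl) (h3 ▸ hadj) hb
  · rcases hb with h3 | ⟨j, hj, h3⟩
    · omega
    · exact h i hi h0 j hj (.inr h3.symm) (h3 ▸ h2) _ (.inl rfl) (h3 ▸ hadj.symm) ha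

theorem isPre_mk (hD : D.Valid) (hn : D.NotCen p)
    (hl : ∀ i < D.m, p i ≠ 0 → (∃ j < D.k, D.inc i (D.v j) ∧ p i ∈ D.l j) ∨ p i ≤ D.s)
    (hl' : ∀ i < D.m, p i ≠ 0 → ∀ j < D.k, D.inc i (D.v j) → p i ∈ D.l j)
    (hp : ∀ i < D.m, ∀ j < D.m, i ≠ j → ∀ x, D.inc i x → D.inc j x → p i ≠ 0 → p j ≠ 0 →
      p i ≠ p j)
    (hH : Peel.Hall D.m D.X D.Y (D.R p) (D.RY p) (D.Fr p) D.sl (fun _ => False)) :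
    D.IsPre p where
  le i hi := by
    by_cases h0 : p i = 0
    · omega
    · rcases hl i hi h0 with ⟨j, hj, h1, h2⟩ | h
      · exact (hD.l_mem j hj _ h2).2
      · exact h
  proper i hi j hj hij x hix hjx h0 := by
    by_cases h1 : p j = 0
    · rw [h1]; exact h0
    · exact hp i hi j hj hij x hix hjx h0 h1
  lists := hl'
  not_cen := hn
  hall := hH

/-! ### No precolours -/

/-- No two centers are adjacent and nothing is precoloured, so each vertex keeps all of its edges,
at least two. -/
theorem exists_pre_zero (hD : D.Valid) (cc : ℕ) (hNF : ∀ j < D.k, ¬ D.NF (D.v j))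
    (hadj : ∀ i < D.k, ∀ j < D.k, ¬ D.Adj (D.v i) (D.v j)) :
    D.IsPre (fun _ => 0) ∧ D.Coded cc (fun _ => 0) := by
  have hn : D.NotCen (fun _ => 0) := by
    refine hD.notCen fun i _ _ j hj _ hd y _ hA hc => ?_
    rcases hc with hc | ⟨j', hj', rfl⟩
    · exact hNF j hj ⟨hd, y, hA, by omega⟩
    · exact hadj j hj j' hj' hA
  -- The number `D.n` belongs to no vertex: no exceptional vertex is needed.
  refine ⟨isPre_mk hD hn (by simp) (by simp) (by simp) (hn.hall_one D.n ?_ ?_),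
    ⟨by simp, by simp⟩⟩
  · exact fun h => absurd (h.lt hD) (by omega)
  · intro x hx _
    have h1 := hn.deg_le hD hx
    have h2 : (D.con (fun _ => 0) x) = ∅ := by
      rw [con]
      simp
    have h3 := hD.two_le_deg x (hx.lt hD)
    rw [h2, card_empty] at h1
    omega

/-! ### One vertex of degree 2 that is not free -/

/-- Both edges at the non-free vertex `v w` are precoloured. Any other vertex loses at most one edge
by this, so vertices of degree at least 3 keep two. A vertex of degree 2 that loses an edge is the
neighbour of `v w` of degree 2 or the vertex behind it; since `v w` also has a neighbour of degree
at least 3, at most one vertex is affected in this way. -/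
theorem exists_pre_one (hD : D.Valid) {cc : ℕ} (hcc : D.IsCommon cc) {w : ℕ} (hw : w < D.k)
    (hNF : D.NF (D.v w)) (hNF' : ∀ j < D.k, j ≠ w → ¬ D.NF (D.v j))
    (hadj : ∀ i < D.k, ∀ j < D.k, i ≠ w → j ≠ w → ¬ D.Adj (D.v i) (D.v j)) :
    ∃ p, D.IsPre p ∧ D.Coded cc p := by
  -- The neighbours are named so that `z` is unlisted: two listed neighbours would form a forbidden
  -- path with `v w`.
  obtain ⟨e, f, y, z, he, hf, hef, hyz, hew, hey, hfw, hfz, hwy, hwz, hall, hzS⟩ :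
      ∃ i j y z, i < D.m ∧ j < D.m ∧ i ≠ j ∧ y ≠ z ∧ D.inc i (D.v w) ∧ D.inc i y ∧
      D.inc j (D.v w) ∧ D.inc j z ∧ D.Adj (D.v w) y ∧ D.Adj (D.v w) z ∧
      (∀ h < D.m, D.inc h (D.v w) → h = i ∨ h = j) ∧ ¬ D.S z := by
    obtain ⟨e, f, y, z, he, hf, hef, hyz, hew, hey, hfw, hfz, hwy, hwz, hall⟩ :=
      hD.two_edges hNF.1
    by_cases hz : D.S z
    · refine ⟨f, e, z, y, hf, he, hef.symm, hyz.symm, hfw, hfz, hew, hey, hwz, hwy,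
        fun h hh hi => (hall h hh hi).symm, ?_⟩
      rintro ⟨j, hj, rfl⟩
      obtain ⟨j', hj', rfl⟩ := hz
      exact hD.no_path j hj w hw j' hj' (by rintro rfl; exact hyz rfl) hwy.symm hwz
    · exact ⟨e, f, y, z, he, hf, hef, hyz, hew, hey, hfw, hfz, hwy, hwz, hall, hz⟩
  -- If `y` is listed, its edge to `v w` has to respect both lists, and `cc` does.
  obtain ⟨c, hc, hcl, hcy⟩ : ∃ c, D.Code cc w c ∧ c ∈ D.l w ∧
      ∀ j < D.k, D.v j = y → D.Code cc j c ∧ c ∈ D.l j := by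
    by_cases hy : D.S y
    · obtain ⟨j, hj, rfl⟩ := hy
      refine ⟨cc, .inl rfl, hcc w hw j hj hwy, fun j' hj' h => ⟨.inl rfl, ?_⟩⟩
      have := hD.v_inj j' hj' j hj h
      subst this
      exact hcc j' hj' w hw hwy.symm
    · obtain ⟨c, hc, -⟩ := hD.exists_color hw 0
      exact ⟨c, .inr hc, mem_of_take hc, fun j hj h => absurd ⟨j, hj, h⟩ hy⟩
  obtain ⟨d, hd, hdc⟩ := hD.exists_color hw c
  have hc0 : c ≠ 0 := by have := hD.l_mem w hw c hcl; omega
  have hd0 : d ≠ 0 := by have := hD.l_mem w hw d (mem_of_take hd); omega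
  obtain ⟨ye, hye, hyeA, hye'⟩ := hD.adj_of_inc he hew
  obtain ⟨zf, hzf, hzfA, hzf'⟩ := hD.adj_of_inc hf hfw
  have hende : ∀ x, D.inc e x → x = D.v w ∨ x = y := by
    intro x hx
    have h1 := hye' x hx
    have h2 := hye' y hey
    have := hwy.1
    omega
  have hendf : ∀ x, D.inc f x → x = D.v w ∨ x = z := by
    intro x hx
    have h1 := hzf' x hx
    have h2 := hzf' z hfz
    have := hwz.1
    omega
  set p : ℕ → ℕ := fun i => if i = e then c else if i = f then d else 0 with hp
  have hpe : p e = c := by simp [hp]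
  have hpf : p f = d := by simp [hp, hef.symm]
  have hp0 : ∀ i, p i ≠ 0 → i = e ∨ i = f := by
    intro i h
    by_contra hcon
    push Not at hcon
    simp [hp, hcon] at h
  have hp0' : ∀ i < D.m, p i = 0 → ¬ D.inc i (D.v w) := by
    intro i hi h0 hiw
    rcases hall i hi hiw with rfl | rfl <;> omega
  have hn : D.NotCen p := by
    refine hD.notCen fun i hi h0 j hj hij hd y' hiy hA hcy' => ?_
    have hjw : j ≠ w := by rintro rfl; exact hp0' i hi h0 hij
    rcases hcy' with hcy' | ⟨j', hj', rfl⟩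
    · exact hNF' j hj hjw ⟨hd, y', hA, by omega⟩
    · refine hadj j hj j' hj' hjw ?_ hA
      rintro rfl
      exact hp0' i hi h0 hiy
  have hcode : ∀ i, p i ≠ 0 → ∀ j < D.k, D.inc i (D.v j) → D.Code cc j (p i) ∧ p i ∈ D.l j := by
    intro i h0 j hj hij
    rcases hp0 i h0 with rfl | rfl
    · rw [hpe]
      rcases hende _ hij with h | h
      · have := hD.v_inj j hj w hw h
        subst this
        exact ⟨hc, hcl⟩
      · exact hcy j hj h
    · rw [hpf]
      rcases hendf _ hij with h | h
      · have := hD.v_inj j hj w hw h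
        subst this
        exact ⟨.inr hd, mem_of_take hd⟩
      · exact absurd ⟨j, hj, h⟩ hzS
  have hcw : D.cen (D.v w) := .inr ⟨w, hw, rfl⟩
  -- the neighbours of `v w`
  obtain ⟨u, hwu, hu⟩ := hNF.2
  have hu3 := hD.deg_ne_two hwu hu
  have hsmall : ∀ t t', D.Adj (D.v w) t → D.Adj (D.v w) t' → D.deg t = 2 → D.deg t' = 2 →
      t = t' := by
    intro t t' h1 h2 h3 h4
    rcases hD.nbr_two (by rw [hNF.1]) hwu h1 h2 (by rintro rfl; exact hu h3) with h | h
    · exact absurd (h ▸ h4) hu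
    · exact h.symm
  have hcon : ∀ x, D.Need p x → ∀ i ∈ D.con p x, ∃ t, D.Adj (D.v w) t ∧
      ((D.inc i t ∧ ¬ D.cen t ∧ D.Adj t x) ∨ (t = x ∧ D.inc i (D.v w))) := by
    intro x hx i hi
    simp only [con, mem_filter, mem_range] at hi
    obtain ⟨him, hix, hi⟩ := hi
    have hxw : x ≠ D.v w := by
      rintro rfl
      obtain ⟨j, hj, h1, h2⟩ := hx.exists_edge
      exact hp0' j hj h2 h1
    by_cases h0 : p i = 0
    · rcases hi with hi | ⟨t, hit, hct, j, hj, hji, hjt, hpj⟩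
      · exact absurd h0 hi
      · have hjw : D.inc j (D.v w) := by rcases hp0 j hpj with rfl | rfl <;> assumption
        refine ⟨t, ⟨?_, j, hj, hjw, hjt⟩, .inl ⟨hit, hct, ?_, i, him, hit, hix⟩⟩
        · rintro rfl; exact hct hcw
        · rintro rfl; exact hct hx.cen
    · have hiw : D.inc i (D.v w) := by rcases hp0 i h0 with rfl | rfl <;> assumption
      exact ⟨x, ⟨hxw.symm, i, him, hiw, hix⟩, .inr ⟨rfl, hiw⟩⟩
  -- Two lost edges at `x` would close a triangle, or lead to two neighbours of `v w` of degree 2.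
  have hcon1 : ∀ x, D.Need p x → (D.con p x).card ≤ 1 := by
    intro x hx
    rw [card_le_one]
    intro i hi j hj
    have hi' := hi
    have hj' := hj
    simp only [con, mem_filter, mem_range] at hi' hj'
    obtain ⟨t, ht, h1⟩ := hcon x hx i hi
    obtain ⟨t', ht', h2⟩ := hcon x hx j hj
    rcases h1 with ⟨h1, h1c, h1A⟩ | ⟨rfl, h1⟩ <;> rcases h2 with ⟨h2, h2c, h2A⟩ | ⟨rfl, h2⟩
    · have := hsmall t t' ht ht' (hD.deg_of_not_cen (ht.symm.lt hD) h1c)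
        (hD.deg_of_not_cen (ht'.symm.lt hD) h2c)
      subst this
      exact hD.edge_unique hi'.1 hj'.1 h1A.1 h1 hi'.2.1 h2 hj'.2.1
    · exact absurd ht' (hD.triangleFree _ _ _ ht h1A)
    · exact absurd ht (hD.triangleFree _ _ _ ht' h2A)
    · exact hD.edge_unique hi'.1 hj'.1 ht.1 h1 hi'.2.1 h2 hj'.2.1
  have hdef : ∀ x x', D.Need p x → D.Need p x' → D.deg x = 2 → D.deg x' = 2 →
      (D.con p x).Nonempty → (D.con p x').Nonempty → x = x' := by
    rintro x x' hx hx' hd hd' ⟨i, hi⟩ ⟨j, hj⟩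
    obtain ⟨t, ht, h1⟩ := hcon x hx i hi
    obtain ⟨t', ht', h2⟩ := hcon x' hx' j hj
    have e1 : D.deg t = 2 := by
      rcases h1 with ⟨-, h, -⟩ | ⟨rfl, -⟩
      exacts [hD.deg_of_not_cen (ht.symm.lt hD) h, hd]
    have e2 : D.deg t' = 2 := by
      rcases h2 with ⟨-, h, -⟩ | ⟨rfl, -⟩
      exacts [hD.deg_of_not_cen (ht'.symm.lt hD) h, hd']
    have := hsmall t t' ht ht' e1 e2
    subst this
    rcases h1 with ⟨h1, h1c, h1A⟩ | ⟨rfl, h1⟩ <;> rcases h2 with ⟨h2, h2c, h2A⟩ | ⟨rfl, h2⟩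
    · have hxw : x ≠ D.v w := by
        rintro rfl
        obtain ⟨j, hj, h1, h2⟩ := hx.exists_edge
        exact hp0' j hj h2 h1
      have hxw' : x' ≠ D.v w := by
        rintro rfl
        obtain ⟨j, hj, h1, h2⟩ := hx'.exists_edge
        exact hp0' j hj h2 h1
      rcases hD.nbr_two e1.le ht.symm h1A h2A hxw.symm with h | h
      · exact absurd h hxw'
      · exact h.symm
    · exact absurd hx'.cen h1c
    · exact absurd hx.cen h2c
    · rfl
  refine ⟨p, isPre_mk hD hn ?_ ?_ ?_ ?_, ⟨?_, ?_⟩⟩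
  · intro i hi h0
    left
    rcases hp0 i h0 with rfl | rfl
    · exact ⟨w, hw, hew, (hcode _ h0 w hw hew).2⟩
    · exact ⟨w, hw, hfw, (hcode _ h0 w hw hfw).2⟩
  · exact fun i hi h0 j hj hij => (hcode i h0 j hj hij).2
  · intro i hi j hj hij x hix hjx h1 h2
    rcases hp0 i h1 with rfl | rfl <;> rcases hp0 j h2 with rfl | rfl
    · exact absurd rfl hij
    · rw [hpe, hpf]; exact hdc.symm
    · rw [hpe, hpf]; exact hdc
    · exact absurd rfl hij
  · by_cases hex : ∃ x, D.Need p x ∧ D.deg x = 2 ∧ (D.con p x).Nonempty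
    · obtain ⟨x₀, h1, h2, h3⟩ := hex
      refine hn.hall_one x₀ (fun _ => ?_) (fun x hx hne => ?_)
      · have := hn.deg_le hD h1
        have := hcon1 x₀ h1
        omega
      · have h4 := hn.deg_le hD hx
        have h5 := hcon1 x hx
        have h6 := hD.two_le_deg x (hx.lt hD)
        by_cases h7 : D.deg x = 2
        · have : D.con p x = ∅ := by
            by_contra h8
            exact hne (hdef x x₀ hx h1 h7 h2 (nonempty_iff_ne_empty.2 h8) h3)
          rw [this, card_empty] at h4
          omega
        · omega
    · refine hn.hall_one D.n (fun h => absurd (h.lt hD) (by omega)) (fun x hx _ => ?_)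
      have h4 := hn.deg_le hD hx
      have h5 := hcon1 x hx
      have h6 := hD.two_le_deg x (hx.lt hD)
      by_cases h7 : D.deg x = 2
      · have : D.con p x = ∅ := by
          by_contra h8
          exact hex ⟨x, hx, h7, nonempty_iff_ne_empty.2 h8⟩
        rw [this, card_empty] at h4
        omega
      · omega
  · intro i hi h0
    refine ⟨w, hw, hNF.1, ?_⟩
    rcases hp0 i h0 with rfl | rfl <;> assumption
  · exact fun j hj _ i hi hij h0 => (hcode i h0 j hj hij).1

end Data

/-! ### Precolourings for two adjacent free vertices and for rings of length 5 -/

namespace Data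

open Finset

set_option synthInstance.maxHeartbeats 400000 in
set_option synthInstance.maxSize 2000 in
set_option maxRecDepth 4000 in
-- Three vertices of a cycle of length 5 that do not form a path are the ends of an edge and the
-- vertex opposite to it. The six cases are the ways to name them.
theorem ring_position : ∀ a b c : Fin 5, a ≠ b → a ≠ c → b ≠ c →
    ¬ ((b = a + 1 ∨ a = b + 1) ∧ (c = b + 1 ∨ b = c + 1)) →
    ¬ ((b = a + 1 ∨ a = b + 1) ∧ (c = a + 1 ∨ a = c + 1)) →
    ¬ ((c = a + 1 ∨ a = c + 1) ∧ (c = b + 1 ∨ b = c + 1)) →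
    (b = a + 1 ∧ c = a + 3) ∨ (c = a + 1 ∧ b = a + 3) ∨ (a = b + 1 ∧ c = b + 3) ∨
    (c = b + 1 ∧ a = b + 3) ∨ (a = c + 1 ∧ b = c + 3) ∨ (b = c + 1 ∧ a = c + 3) := by
  decide

theorem injective_vec5 {a b c d e : ℕ} (h : [a, b, c, d, e].Nodup) :
    Function.Injective ![a, b, c, d, e] :=
  List.nodup_ofFn.1 (by simpa [List.ofFn_succ] using h)

theorem fin5_cases : ∀ t t' : Fin 5, t ≠ t' → (t = t' ∨ t = t' + 1 ∨ t + 1 = t' ∨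
    t + 1 = t' + 1) → t' = t + 1 ∨ t = t' + 1 := by decide

theorem fin5_cycle : ∀ t t' : Fin 5, (t = t' ∨ t = t' + 1) → (t + 1 = t' ∨ t + 1 = t' + 1) →
    t = t' := by decide

theorem fin5_ne_sub_one : ∀ t : Fin 5, t ≠ t - 1 := by decide

theorem fin5_succ : ∀ t : Fin 5, (t + 1 = 0 → t = 4) ∧ (t + 1 = 1 → t = 0) ∧
    (t + 1 = 3 → t = 2) := by decide

open scoped Classical

variable {D : Data} {p : ℕ → ℕ}

/-- The vertices `v j` lie on a chordless cycle of length 5 with at most one vertex of degree at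
least 3. -/
def InRing (D : Data) : Prop := ∃ z : Fin 5 → ℕ, Function.Injective z ∧
  (∀ i, D.Adj (z i) (z (i + 1))) ∧ (∀ i j, 3 ≤ D.deg (z i) → 3 ≤ D.deg (z j) → i = j) ∧
  ∀ j < D.k, ∃ i, z i = D.v j

/-- There is only one pair of adjacent vertices with lists. -/
theorem Valid.adj_unique (hD : D.Valid) {i₀ j₀ i j : ℕ} (hi₀ : i₀ < D.k) (hj₀ : j₀ < D.k)
    (hi : i < D.k) (hj : j < D.k) (h₀ : D.Adj (D.v i₀) (D.v j₀)) (h : D.Adj (D.v i) (D.v j)) :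
    (i = i₀ ∧ j = j₀) ∨ (i = j₀ ∧ j = i₀) := by
  have hk := hD.k_le
  have n0 : i₀ ≠ j₀ := by rintro rfl; exact h₀.1 rfl
  have n1 : i ≠ j := by rintro rfl; exact h.1 rfl
  by_contra hc
  have : (i = i₀ ∧ j ≠ j₀) ∨ (i = j₀ ∧ j ≠ i₀) ∨ (j = i₀ ∧ i ≠ j₀) ∨ (j = j₀ ∧ i ≠ i₀) := by
    omega
  rcases this with ⟨rfl, h1⟩ | ⟨rfl, h1⟩ | ⟨rfl, h1⟩ | ⟨rfl, h1⟩
  · exact hD.no_path j hj i hi j₀ hj₀ h1 h.symm h₀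
  · exact hD.no_path j hj i hi i₀ hi₀ h1 h.symm h₀.symm
  · exact hD.no_path i hi j hj j₀ hj₀ h1 h h₀
  · exact hD.no_path i hi j hj i₀ hi₀ h1 h h₀.symm

theorem exists_yd {x : ℕ} (h : 1 ≤ D.yd p x) : ∃ i < D.m, D.RY p i ∧ D.X i = x := by
  obtain ⟨i, hi⟩ := card_pos.1 h
  simp only [mem_filter, mem_range] at hi
  exact ⟨i, hi⟩

theorem RY.adj (hD : D.Valid) {i : ℕ} (h : D.RY p i) : D.Adj (D.X i) (D.Y i) :=
  ⟨hD.X_ne_Y h.1.1, i, h.1.1, inc_X i, inc_Y i⟩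

/-! ### Two adjacent free vertices -/

set_option maxHeartbeats 1000000 in
-- The edge between the two listed vertices is precoloured with the common colour, and only its two
-- ends lose an edge. Hall's condition can fail only for a set `T` that contains both ends and no
-- vertex of degree at least 3. Then `T` has at most one further vertex, which is the third listed
-- one, and failure would place its two neighbours next to the pair, closing a ring of length 5.
theorem exists_pre_two (hD : D.Valid) {cc : ℕ} (hcc : D.IsCommon cc)
    (hNF : ∀ j < D.k, ¬ D.NF (D.v j)) {i₀ j₀ : ℕ} (hi₀ : i₀ < D.k) (hj₀ : j₀ < D.k)
    (hadj : D.Adj (D.v i₀) (D.v j₀))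
    (hring : D.k = 3 → (∀ j < D.k, D.deg (D.v j) = 2) → ¬ D.InRing) :
    ∃ p, D.IsPre p ∧ D.Coded cc p := by
  have hdeg : D.deg (D.v i₀) = 2 ∧ D.deg (D.v j₀) = 2 := by
    rcases hD.adj_deg hadj with h | h
    · refine ⟨h, ?_⟩
      by_contra h'
      exact hNF i₀ hi₀ ⟨h, _, hadj, h'⟩
    · refine ⟨?_, h⟩
      by_contra h'
      exact hNF j₀ hj₀ ⟨h, _, hadj.symm, h'⟩
  have hij : i₀ ≠ j₀ := by rintro rfl; exact hadj.1 rfl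
  obtain ⟨hne, f, hf, hfi, hfj⟩ := id hadj
  have hfend : ∀ x, D.inc f x → x = D.v i₀ ∨ x = D.v j₀ := by
    intro x hx
    obtain ⟨y, -, -, hy⟩ := hD.adj_of_inc hf hfi
    have h1 := hy x hx
    have h2 := hy _ hfj
    omega
  have hci := hcc i₀ hi₀ j₀ hj₀ hadj
  have hcj := hcc j₀ hj₀ i₀ hi₀ hadj.symm
  have hc0 := hD.l_mem i₀ hi₀ cc hci
  set p : ℕ → ℕ := fun i => if i = f then cc else 0 with hp
  have hpf : p f = cc := by simp [hp]
  have hp0 : ∀ i, p i ≠ 0 → i = f := by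
    intro i h
    by_contra hcon
    simp [hp, hcon] at h
  have hn : D.NotCen p := by
    refine hD.notCen fun i hi h0 j hj hij' hd y hiy hA hc => ?_
    rcases hc with hc | ⟨j', hj', rfl⟩
    · exact hNF j hj ⟨hd, y, hA, by omega⟩
    · have : i = f := by
        rcases hD.adj_unique hi₀ hj₀ hj hj' hadj hA with ⟨rfl, rfl⟩ | ⟨rfl, rfl⟩
        · exact hD.edge_unique hi hf hne hij' hiy hfi hfj
        · exact hD.edge_unique hi hf hne hiy hij' hfi hfj
      subst this
      omega
  have hcon : ∀ x, D.con p x ⊆ {f} := by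
    intro x i hi
    simp only [con, mem_filter, mem_range] at hi
    rw [mem_singleton]
    rcases hi.2.2 with h | ⟨y, -, hy, j, hj, -, hjy, hpj⟩
    · exact hp0 i h
    · have := hp0 j hpj
      subst this
      rcases hfend y hjy with rfl | rfl
      · exact absurd (.inr ⟨_, hi₀, rfl⟩) hy
      · exact absurd (.inr ⟨_, hj₀, rfl⟩) hy
  have hcon' : ∀ x, x ≠ D.v i₀ → x ≠ D.v j₀ → D.con p x = ∅ := by
    intro x h1 h2
    rw [eq_empty_iff_forall_notMem]
    intro i hi
    have := mem_singleton.1 (hcon x hi)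
    subst this
    simp only [con, mem_filter, mem_range] at hi
    rcases hfend x hi.2.1 with h | h <;> contradiction
  have hyd : ∀ x, D.Need p x → D.deg x ≤ D.yd p x + 1 := fun x hx => by
    have := card_le_card (hcon x)
    rw [card_singleton] at this
    have := hn.deg_le hD hx
    omega
  have hyd' : ∀ x, D.Need p x → x ≠ D.v i₀ → x ≠ D.v j₀ → D.deg x ≤ D.yd p x :=
    fun x hx h1 h2 => by
      have := hn.deg_le hD hx
      rw [hcon' x h1 h2, card_empty] at this
      exact this
  have hyd2 : ∀ x, D.Need p x → x ≠ D.v i₀ → x ≠ D.v j₀ → 2 ≤ D.yd p x :=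
    fun x hx h1 h2 => (hD.two_le_deg x (hx.lt hD)).trans (hyd' x hx h1 h2)
  refine ⟨p, isPre_mk hD hn ?_ ?_ ?_ (hn.hall fun T hT => ?_), ⟨?_, ?_⟩⟩
  · intro i hi h0
    have := hp0 i h0
    subst this
    exact .inl ⟨i₀, hi₀, hfi, by rw [hpf]; exact hci⟩
  · intro i hi h0 j hj hij'
    have := hp0 i h0
    subst this
    rw [hpf]
    rcases hfend _ hij' with h | h
    · have := hD.v_inj j hj i₀ hi₀ h
      subst this; exact hci
    · have := hD.v_inj j hj j₀ hj₀ h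
      subst this; exact hcj
  · intro i hi j hj hij' x _ _ h1 h2
    exact absurd ((hp0 i h1).trans (hp0 j h2).symm) hij'
  · set T' := (T.erase (D.v i₀)).erase (D.v j₀) with hT'
    have hsum : ∀ U : Finset ℕ, (∀ x ∈ U, x ∈ T ∧ x ≠ D.v i₀ ∧ x ≠ D.v j₀) →
        2 * U.card ≤ ∑ x ∈ U, D.yd p x := by
      intro U hU
      rw [mul_comm, ← smul_eq_mul, ← sum_const]
      exact sum_le_sum fun x hx => hyd2 x (hT x (hU x hx).1) (hU x hx).2.1 (hU x hx).2.2
    have hT'm : ∀ x ∈ T', x ∈ T ∧ x ≠ D.v i₀ ∧ x ≠ D.v j₀ := by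
      intro x hx
      simp only [hT', mem_erase] at hx
      exact ⟨hx.2.2, hx.2.1, hx.1⟩
    have hs := hsum T' hT'm
    by_cases hiT : D.v i₀ ∈ T
    · have e1 := add_sum_erase T (D.yd p) hiT
      have e2 := card_erase_add_one hiT
      have hyi := hyd _ (hT _ hiT)
      by_cases hjT : D.v j₀ ∈ T
      · have hjT' : D.v j₀ ∈ T.erase (D.v i₀) := mem_erase.2 ⟨hne.symm, hjT⟩
        have e3 := add_sum_erase (T.erase (D.v i₀)) (D.yd p) hjT'
        have e4 := card_erase_add_one hjT'
        rw [← hT'] at e3 e4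
        have hyj := hyd _ (hT _ hjT)
        -- The two ends cause a deficit of two; a vertex of degree at least 3 makes up for one of
        -- them.
        by_cases hbig : ∃ x ∈ T', 3 ≤ D.deg x
        · left
          obtain ⟨x, hx, hx3⟩ := hbig
          have e5 := add_sum_erase T' (D.yd p) hx
          have e6 := card_erase_add_one hx
          have := hsum (T'.erase x) (fun z hz => hT'm z (mem_of_mem_erase hz))
          have := hyd' x (hT x (hT'm x hx).1) (hT'm x hx).2.1 (hT'm x hx).2.2
          omega
        · right
          push Not at hbig
          obtain ⟨e, he, heR, heX⟩ := exists_yd (D := D) (p := p) (x := D.v i₀) (by omega)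
          obtain ⟨g, hg, hgR, hgX⟩ := exists_yd (D := D) (p := p) (x := D.v j₀) (by omega)
          have heA := heR.adj hD
          have hgA := hgR.adj hD
          rw [heX] at heA
          rw [hgX] at hgA
          -- A common neighbour of two adjacent vertices would give a triangle.
          have hY12 : D.Y e ≠ D.Y g := fun h =>
            hD.triangleFree _ _ _ hadj hgA (h ▸ heA)
          set I := ((range D.m).filter (fun i => D.RY p i ∧ D.X i ∈ T)).image D.Y with hI
          have hmem : ∀ i, D.RY p i → D.X i ∈ T → D.Y i ∈ I := fun i h1 h2 =>
            mem_image_of_mem _ (by simp [h1, h1.1.1, h2])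
          have m1 := hmem e heR (by rw [heX]; exact hiT)
          have m2 := hmem g hgR (by rw [hgX]; exact hjT)
          rcases eq_empty_or_nonempty T' with hem | ⟨x, hx⟩
          · have : ({D.Y e, D.Y g} : Finset ℕ) ⊆ I := by
              intro z hz
              simp only [mem_insert, mem_singleton] at hz
              rcases hz with rfl | rfl <;> assumption
            have := card_le_card this
            rw [card_pair hY12] at this
            rw [hem, card_empty] at e4
            omega
          · have hidx : ∀ x ∈ T', ∃ h < D.k, D.v h = x ∧ h ≠ i₀ ∧ h ≠ j₀ := by
              intro x hx
              obtain ⟨hx1, hx2, hx3⟩ := hT'm x hx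
              rcases (hT x hx1).cen with h | ⟨h, hh, rfl⟩
              · have := hbig x hx; omega
              · exact ⟨h, hh, rfl, by rintro rfl; exact hx2 rfl, by rintro rfl; exact hx3 rfl⟩
            obtain ⟨h, hh, rfl, hh1, hh2⟩ := hidx x hx
            have hk := hD.k_le
            have hone : T' ⊆ {D.v h} := by
              intro z hz
              obtain ⟨h', hh', rfl, hh1', hh2'⟩ := hidx z hz
              have : h' = h := by omega
              rw [this, mem_singleton]
            have hcard := card_le_card hone
            rw [card_singleton] at hcard
            obtain ⟨hx1, hx2, hx3⟩ := hT'm _ hx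
            have hxdeg : D.deg (D.v h) = 2 := by
              have := hbig _ hx
              have := hD.two_le_deg _ (hD.v_lt h hh)
              omega
            have hyx := hyd2 _ (hT _ hx1) hx2 hx3
            obtain ⟨c, hc, d, hd, hcd⟩ := one_lt_card.1 (show 1 < _ from hyx)
            simp only [mem_filter, mem_range] at hc hd
            have hcA := hc.2.1.adj hD
            have hdA := hd.2.1.adj hD
            rw [hc.2.2] at hcA
            rw [hd.2.2] at hdA
            have hY34 : D.Y c ≠ D.Y d := fun hY => hcd (hD.edge_unique hc.1 hd.1 hcA.1
              (hc.2.2 ▸ inc_X c) (inc_Y c) (hd.2.2 ▸ inc_X d) (hY ▸ inc_Y d))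
            have m3 := hmem c hc.2.1 (by rw [hc.2.2]; exact hx1)
            have m4 := hmem d hd.2.1 (by rw [hd.2.2]; exact hx1)
            have three : ∀ y ∈ I, y ≠ D.Y e → y ≠ D.Y g → T.card ≤ I.card := by
              intro y hy h1 h2
              have : ({y, D.Y e, D.Y g} : Finset ℕ) ⊆ I := by
                intro z hz
                simp only [mem_insert, mem_singleton] at hz
                rcases hz with rfl | rfl | rfl <;> assumption
              have := card_le_card this
              rw [card_eq_three.2 ⟨_, _, _, h1, h2, hY12, rfl⟩] at this
              omega
            -- If there is no third right end, then both edges at `v h` lead to `D.Y e` and `D.Y g`,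
            -- which closes a cycle of length 5.
            by_contra hcon
            have q3 : D.Y c = D.Y e ∨ D.Y c = D.Y g := by
              by_contra hq
              push Not at hq
              exact hcon (three _ m3 hq.1 hq.2)
            have q4 : D.Y d = D.Y e ∨ D.Y d = D.Y g := by
              by_contra hq
              push Not at hq
              exact hcon (three _ m4 hq.1 hq.2)
            have hA1 : D.Adj (D.v h) (D.Y e) := by
              rcases q3 with q | q
              · exact q ▸ hcA
              · rcases q4 with q' | q'
                · exact q' ▸ hdA
                · exact absurd (q.trans q'.symm) hY34
            have hA2 : D.Adj (D.v h) (D.Y g) := by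
              rcases q3 with q | q
              · rcases q4 with q' | q'
                · exact absurd (q.trans q'.symm) hY34
                · exact q' ▸ hdA
              · exact q ▸ hcA
            have hk3 : D.k = 3 := by omega
            have dY : ∀ i, D.RY p i → D.deg (D.Y i) = 2 := fun i hi =>
              hD.deg_of_not_cen (hD.lt_of_inc hi.1.1 (inc_Y i)) (hn.Y hi.1)
            have nY : ∀ i, D.RY p i → ∀ j < D.k, D.Y i ≠ D.v j := fun i hi j hj h' =>
              hn.Y hi.1 (.inr ⟨j, hj, h'.symm⟩)
            have hall : ∀ j < D.k, j = i₀ ∨ j = j₀ ∨ j = h := fun j hj => by omega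
            refine hring hk3 (fun j hj => ?_) ⟨![D.v i₀, D.v j₀, D.Y g, D.v h, D.Y e],
              ?_, ?_, ?_, ?_⟩
            · rcases hall j hj with rfl | rfl | rfl
              exacts [hdeg.1, hdeg.2, hxdeg]
            · have a1 := nY e heR i₀ hi₀
              have a2 := nY e heR j₀ hj₀
              have a3 := nY e heR h hh
              have b1 := nY g hgR i₀ hi₀
              have b2 := nY g hgR j₀ hj₀
              have b3 := nY g hgR h hh
              refine injective_vec5 ?_
              simp only [List.nodup_cons, List.mem_cons, List.not_mem_nil, or_false, not_or,
                List.nodup_nil, and_true, not_false_eq_true]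
              omega
            · intro s
              fin_cases s
              exacts [hadj, hgA, hA2.symm, hA1, heA.symm]
            · intro s t h3
              have := dY e heR
              have := dY g hgR
              have := hbig _ hx
              fin_cases s
              · exact absurd hdeg.1 (by change 3 ≤ D.deg (D.v i₀) at h3; omega)
              · exact absurd hdeg.2 (by change 3 ≤ D.deg (D.v j₀) at h3; omega)
              · change 3 ≤ D.deg (D.Y g) at h3; omega
              · change 3 ≤ D.deg (D.v h) at h3; omega
              · change 3 ≤ D.deg (D.Y e) at h3; omega
            · intro j hj
              rcases hall j hj with rfl | rfl | rfl
              exacts [⟨0, rfl⟩, ⟨1, rfl⟩, ⟨3, rfl⟩]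
      · left
        have : T.erase (D.v i₀) = T' := by
          rw [hT', erase_eq_of_notMem (s := T.erase _)]
          exact fun h => hjT (mem_of_mem_erase h)
        rw [this] at e1 e2
        omega
    · left
      have e0 : T.erase (D.v i₀) = T := erase_eq_of_notMem hiT
      by_cases hjT : D.v j₀ ∈ T
      · have e3 := add_sum_erase T (D.yd p) hjT
        have e4 := card_erase_add_one hjT
        have hyj := hyd _ (hT _ hjT)
        rw [hT', e0] at hs
        omega
      · rw [hT', e0, erase_eq_of_notMem hjT] at hs
        omega
  · intro i hi h0
    have := hp0 i h0
    subst this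
    exact ⟨i₀, hi₀, hdeg.1, hfi⟩
  · intro j hj _ i hi _ h0
    have := hp0 i h0
    subst this
    exact .inl hpf

/-! ### Rings of length 5 -/

/-- `g t` is meant for the edge from position `t` to position `t + 1`, with listed vertices in
positions 0, 1 and 3. If there are different colours `a` and `b` for the edges 4 and 1 that also
differ from `cc`, then one of the two orders of two colours of `T₃` fits between them. Otherwise
`T₁` and `T₂` are the same pair, `T₃` has a colour `r` outside of it, and `r` is used for edge 2. -/
theorem ring_colors {T₁ T₂ T₃ : Finset ℕ} (cc : ℕ) (h₁ : 2 ≤ T₁.card) (h₂ : 2 ≤ T₂.card)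
    (h₃ : 2 ≤ T₃.card) (hU : 3 ≤ (T₁ ∪ T₂ ∪ T₃).card) :
    ∃ g : Fin 5 → ℕ, (g 0 = cc ∨ (g 0 ∈ T₁ ∧ g 0 ∈ T₂)) ∧ (g 1 = cc ∧ cc ∈ T₂ ∨ g 1 ∈ T₂) ∧
      g 2 ∈ T₃ ∧ g 3 ∈ T₃ ∧ (g 4 = cc ∧ cc ∈ T₁ ∨ g 4 ∈ T₁) ∧ ∀ t, g t ≠ g (t + 1) := by
  have mk : ∀ a b c d e : ℕ, a ≠ b → b ≠ c → c ≠ d → d ≠ e → e ≠ a →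
      ∀ t, (![a, b, c, d, e] : Fin 5 → ℕ) t ≠ (![a, b, c, d, e] : Fin 5 → ℕ) (t + 1) := by
    intro a b c d e h1 h2 h3 h4 h5 t
    fin_cases t
    exacts [h1, h2, h3, h4, h5]
  by_cases h : ∃ a ∈ T₁, ∃ b ∈ T₂, a ≠ cc ∧ b ≠ cc ∧ a ≠ b
  · obtain ⟨a, ha, b, hb, hac, hbc, hab⟩ := h
    obtain ⟨x, hx, y, hy, hxy⟩ := one_lt_card.1 (show 1 < T₃.card from h₃)
    by_cases hxb : x ≠ b ∧ y ≠ a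
    · exact ⟨![cc, b, x, y, a], .inl rfl, .inr hb, hx, hy, .inr ha,
        mk _ _ _ _ _ hbc.symm hxb.1.symm hxy hxb.2 hac⟩
    · exact ⟨![cc, b, y, x, a], .inl rfl, .inr hb, hy, hx, .inr ha,
        mk _ _ _ _ _ hbc.symm (by omega) hxy.symm (by omega) hac⟩
  · push Not at h
    obtain ⟨a, ha, hac⟩ := exists_mem_ne (show 1 < T₁.card from h₁) cc
    obtain ⟨b, hb, hbc⟩ := exists_mem_ne (show 1 < T₂.card from h₂) cc
    have hab := h a ha b hb hac hbc
    subst hab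
    have s1 : T₁ ⊆ {cc, a} := by
      intro x hx
      by_cases hxc : x = cc
      · simp [hxc]
      · simp [h x hx a hb hxc hac]
    have s2 : T₂ ⊆ {cc, a} := by
      intro x hx
      by_cases hxc : x = cc
      · simp [hxc]
      · simp [← h a ha x hx hac hxc]
    have hc2 : ({cc, a} : Finset ℕ).card = 2 := card_pair hac.symm
    have e1 : T₁ = {cc, a} := eq_of_subset_of_card_le s1 (by omega)
    have e2 : T₂ = {cc, a} := eq_of_subset_of_card_le s2 (by omega)
    obtain ⟨r, hr, hra⟩ : ∃ r ∈ T₃, r ∉ ({cc, a} : Finset ℕ) := by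
      by_contra hcon
      push Not at hcon
      have : T₁ ∪ T₂ ∪ T₃ ⊆ {cc, a} := union_subset (union_subset s1 s2) hcon
      have := card_le_card this
      omega
    simp only [mem_insert, mem_singleton, not_or] at hra
    obtain ⟨r', hr', hrr⟩ := exists_mem_ne (show 1 < T₃.card from h₃) r
    -- If the second colour of `T₃` is `a`, it conflicts with `a` on edge 4, and the roles of `cc`
    -- and `a` are exchanged.
    by_cases hra' : r' = a
    · subst hra'
      refine ⟨![r', cc, r, r', cc], .inr ⟨ha, hb⟩, .inl ⟨rfl, ?_⟩, hr, hr', .inl ⟨rfl, ?_⟩,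
        mk _ _ _ _ _ hac (fun h => hra.1 h.symm) hrr.symm hac hac.symm⟩
      · rw [e2]; simp
      · rw [e1]; simp
    · exact ⟨![cc, a, r, r', a], .inl rfl, .inr hb, hr, hr', .inr ha,
        mk _ _ _ _ _ hac.symm (fun h => hra.2 h.symm) hrr.symm hra' hac⟩

/-- The listed vertices do not form a path, so `ring_position` applies and a rotation of the ring
brings them to positions 0, 1 and 3. -/
theorem Valid.ring_cases (hD : D.Valid) (hk : D.k = 3) (hring : D.InRing) :
    ∃ z : Fin 5 → ℕ, Function.Injective z ∧ (∀ i, D.Adj (z i) (z (i + 1))) ∧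
      (∀ i j, 3 ≤ D.deg (z i) → 3 ≤ D.deg (z j) → i = j) ∧
      ∃ j₁ < D.k, ∃ j₂ < D.k, ∃ j₃ < D.k, j₁ ≠ j₂ ∧ j₁ ≠ j₃ ∧ j₂ ≠ j₃ ∧ z 0 = D.v j₁ ∧
        z 1 = D.v j₂ ∧ z 3 = D.v j₃ := by
  obtain ⟨z, hz, hadj, hbig, hv⟩ := hring
  obtain ⟨a, ha⟩ := hv 0 (by omega)
  obtain ⟨b, hb⟩ := hv 1 (by omega)
  obtain ⟨c, hc⟩ := hv 2 (by omega)
  have ne : ∀ {i j : ℕ} {s t : Fin 5}, i < D.k → j < D.k → z s = D.v i → z t = D.v j → i ≠ j →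
      s ≠ t := by
    rintro i j s t hi hj hs ht hij rfl
    exact hij (hD.v_inj i hi j hj (hs.symm.trans ht))
  have adj : ∀ {i j : ℕ} {s t : Fin 5}, z s = D.v i → z t = D.v j → (t = s + 1 ∨ s = t + 1) →
      D.Adj (D.v i) (D.v j) := by
    rintro i j s t hs ht (rfl | rfl)
    · rw [← hs, ← ht]; exact hadj s
    · rw [← hs, ← ht]; exact (hadj t).symm
  have h0 : 0 < D.k := by omega
  have h1 : 1 < D.k := by omega
  have h2 : 2 < D.k := by omega
  have mk : ∀ (s : Fin 5) (j₁ j₂ j₃ : ℕ), j₁ < D.k → j₂ < D.k → j₃ < D.k → j₁ ≠ j₂ → j₁ ≠ j₃ →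
      j₂ ≠ j₃ → z s = D.v j₁ → z (s + 1) = D.v j₂ → z (s + 3) = D.v j₃ →
      ∃ z : Fin 5 → ℕ, Function.Injective z ∧ (∀ i, D.Adj (z i) (z (i + 1))) ∧
      (∀ i j, 3 ≤ D.deg (z i) → 3 ≤ D.deg (z j) → i = j) ∧
      ∃ j₁ < D.k, ∃ j₂ < D.k, ∃ j₃ < D.k, j₁ ≠ j₂ ∧ j₁ ≠ j₃ ∧ j₂ ≠ j₃ ∧ z 0 = D.v j₁ ∧
        z 1 = D.v j₂ ∧ z 3 = D.v j₃ := by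
    intro s j₁ j₂ j₃ g1 g2 g3 n1 n2 n3 e1 e2 e3
    refine ⟨fun t => z (s + t), fun t t' h => add_left_cancel (hz h), fun t => ?_,
      fun t t' h h' => add_left_cancel (hbig _ _ h h'), j₁, g1, j₂, g2, j₃, g3, n1, n2, n3, ?_,
      e2, e3⟩
    · have := hadj (s + t)
      rwa [add_assoc] at this
    · simpa using e1
  have key := ring_position a b c (ne h0 h1 ha hb (by omega)) (ne h0 h2 ha hc (by omega))
    (ne h1 h2 hb hc (by omega))
    (fun h => hD.no_path 0 h0 1 h1 2 h2 (by omega) (adj ha hb h.1) (adj hb hc h.2))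
    (fun h => hD.no_path 1 h1 0 h0 2 h2 (by omega) (adj ha hb h.1).symm (adj ha hc h.2))
    (fun h => hD.no_path 0 h0 2 h2 1 h1 (by omega) (adj ha hc h.1) (adj hb hc h.2).symm)
  rcases key with ⟨e1, e2⟩ | ⟨e1, e2⟩ | ⟨e1, e2⟩ | ⟨e1, e2⟩ | ⟨e1, e2⟩ | ⟨e1, e2⟩
  · exact mk a 0 1 2 h0 h1 h2 (by omega) (by omega) (by omega) ha (e1 ▸ hb) (e2 ▸ hc)
  · exact mk a 0 2 1 h0 h2 h1 (by omega) (by omega) (by omega) ha (e1 ▸ hc) (e2 ▸ hb)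
  · exact mk b 1 0 2 h1 h0 h2 (by omega) (by omega) (by omega) hb (e1 ▸ ha) (e2 ▸ hc)
  · exact mk b 1 2 0 h1 h2 h0 (by omega) (by omega) (by omega) hb (e1 ▸ hc) (e2 ▸ ha)
  · exact mk c 2 0 1 h2 h0 h1 (by omega) (by omega) (by omega) hc (e1 ▸ ha) (e2 ▸ hb)
  · exact mk c 2 1 0 h2 h1 h0 (by omega) (by omega) (by omega) hc (e1 ▸ hb) (e2 ▸ ha)

/-- The whole ring is precoloured. Its vertices of degree 2 then have no uncoloured edge, and
nothing beyond the ring loses an edge. The one possible vertex of larger degree loses two edges and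
keeps at least one, which is the deficit that is allowed. -/
theorem exists_pre_ring (hD : D.Valid) {cc : ℕ} (hcc : D.IsCommon cc) (hk : D.k = 3)
    (hdeg : ∀ j < D.k, D.deg (D.v j) = 2) (hring : D.InRing)
    (hU : 3 ≤ ((range 3).biUnion fun j => (D.l j).toFinset).card) :
    ∃ p, D.IsPre p ∧ D.Coded cc p := by
  obtain ⟨z, hz, hadj, hbig, j₁, hj₁, j₂, hj₂, j₃, hj₃, n12, n13, n23, e1, e2, e3⟩ :=
    hD.ring_cases hk hring
  have hidx : ∀ j < D.k, j = j₁ ∨ j = j₂ ∨ j = j₃ := fun j hj => by omega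
  have hc1 : cc ∈ D.l j₁ := hcc j₁ hj₁ j₂ hj₂ (by rw [← e1, ← e2]; exact hadj 0)
  have hc2 : cc ∈ D.l j₂ := hcc j₂ hj₂ j₁ hj₁ (by rw [← e1, ← e2]; exact (hadj 0).symm)
  have htake : ∀ j < D.k, 2 ≤ ((D.l j).take 3).toFinset.card := fun j hj => by
    have := hD.take_card hj
    have := hD.two_le_length hj
    omega
  -- Shortening the lists keeps three colours in their union: a list with three colours provides
  -- them alone, and shorter lists are not cut.
  have hU' : 3 ≤ (((D.l j₁).take 3).toFinset ∪ ((D.l j₂).take 3).toFinset ∪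
      ((D.l j₃).take 3).toFinset).card := by
    by_cases hlong : ∃ j < D.k, 3 ≤ (D.l j).length
    · obtain ⟨j, hj, hl⟩ := hlong
      have h1 := hD.take_card hj
      have h2 : 3 ≤ ((D.l j).take 3).toFinset.card := by omega
      refine h2.trans (card_le_card ?_)
      intro x hx
      simp only [mem_union]
      rcases hidx j hj with rfl | rfl | rfl <;> tauto
    · push Not at hlong
      refine hU.trans (card_le_card ?_)
      intro x hx
      simp only [mem_biUnion, mem_range, List.mem_toFinset] at hx
      obtain ⟨j, hj, hx⟩ := hx
      rw [← hk] at hj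
      rw [← List.take_of_length_le (hlong j hj).le] at hx
      simp only [mem_union, List.mem_toFinset]
      rcases hidx j hj with rfl | rfl | rfl <;> tauto
  obtain ⟨g, hg0, hg1, hg2, hg3, hg4, hgn⟩ := ring_colors cc (htake j₁ hj₁) (htake j₂ hj₂)
    (htake j₃ hj₃) hU'
  simp only [List.mem_toFinset] at hg0 hg1 hg2 hg3 hg4
  have code : ∀ t j, j < D.k → (z t = D.v j ∨ z (t + 1) = D.v j) →
      D.Code cc j (g t) ∧ g t ∈ D.l j := by
    have a01 : D.Code cc j₁ (g 0) ∧ g 0 ∈ D.l j₁ := by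
      rcases hg0 with h | h
      · exact ⟨.inl h, h ▸ hc1⟩
      · exact ⟨.inr h.1, mem_of_take h.1⟩
    have a02 : D.Code cc j₂ (g 0) ∧ g 0 ∈ D.l j₂ := by
      rcases hg0 with h | h
      · exact ⟨.inl h, h ▸ hc2⟩
      · exact ⟨.inr h.2, mem_of_take h.2⟩
    have a12 : D.Code cc j₂ (g 1) ∧ g 1 ∈ D.l j₂ := by
      rcases hg1 with h | h
      · exact ⟨.inl h.1, h.1 ▸ hc2⟩
      · exact ⟨.inr h, mem_of_take h⟩
    have a41 : D.Code cc j₁ (g 4) ∧ g 4 ∈ D.l j₁ := by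
      rcases hg4 with h | h
      · exact ⟨.inl h.1, h.1 ▸ hc1⟩
      · exact ⟨.inr h, mem_of_take h⟩
    have a23 : D.Code cc j₃ (g 2) ∧ g 2 ∈ D.l j₃ := ⟨.inr hg2, mem_of_take hg2⟩
    have a33 : D.Code cc j₃ (g 3) ∧ g 3 ∈ D.l j₃ := ⟨.inr hg3, mem_of_take hg3⟩
    intro t j hj h
    have zz : ∀ s, z s = D.v j → (j = j₁ ∧ s = 0) ∨ (j = j₂ ∧ s = 1) ∨ (j = j₃ ∧ s = 3) := by
      intro s hs
      rcases hidx j hj with rfl | rfl | rfl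
      · exact .inl ⟨rfl, hz (hs.trans e1.symm)⟩
      · exact .inr (.inl ⟨rfl, hz (hs.trans e2.symm)⟩)
      · exact .inr (.inr ⟨rfl, hz (hs.trans e3.symm)⟩)
    rcases h with h | h <;> rcases zz _ h with ⟨rfl, hs⟩ | ⟨rfl, hs⟩ | ⟨rfl, hs⟩
    · rw [hs]; exact a01
    · rw [hs]; exact a12
    · rw [hs]; exact a33
    · rw [(fin5_succ t).1 hs]; exact a41
    · rw [(fin5_succ t).2.1 hs]; exact a02
    · rw [(fin5_succ t).2.2 hs]; exact a23
  have hex : ∀ t : Fin 5, ∃ j < D.k, z t = D.v j ∨ z (t + 1) = D.v j := by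
    intro t
    fin_cases t
    exacts [⟨j₁, hj₁, .inl e1⟩, ⟨j₂, hj₂, .inl e2⟩, ⟨j₃, hj₃, .inr e3⟩, ⟨j₃, hj₃, .inl e3⟩,
      ⟨j₁, hj₁, .inr e1⟩]
  choose E hE using fun t => (hadj t).2
  have hEm : ∀ t, E t < D.m := fun t => (hE t).1
  have hEend : ∀ t x, D.inc (E t) x ↔ x = z t ∨ x = z (t + 1) := by
    intro t x
    constructor
    · intro hx
      obtain ⟨y, -, -, hy⟩ := hD.adj_of_inc (hEm t) (hE t).2.1
      have h1 := hy x hx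
      have h2 := hy _ (hE t).2.2
      have := (hadj t).1
      omega
    · rintro (rfl | rfl)
      exacts [(hE t).2.1, (hE t).2.2]
  have hEinj : Function.Injective E := by
    intro t t' h
    have h1 := (hEend t' (z t)).1 (h ▸ (hE t).2.1)
    have h2 := (hEend t' (z (t + 1))).1 (h ▸ (hE t).2.2)
    exact fin5_cycle t t' (h1.imp (fun h => hz h) (fun h => hz h))
      (h2.imp (fun h => hz h) (fun h => hz h))
  set p : ℕ → ℕ := fun i => if h : ∃ t, E t = i then g h.choose else 0 with hp
  have hpE : ∀ t, p (E t) = g t := by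
    intro t
    have h : ∃ t', E t' = E t := ⟨t, rfl⟩
    simp only [hp, dif_pos h]
    rw [hEinj h.choose_spec]
  have hp0 : ∀ i, p i ≠ 0 → ∃ t, i = E t := by
    intro i h
    by_contra hcon
    have : ¬ ∃ t, E t = i := fun ⟨t, ht⟩ => hcon ⟨t, ht.symm⟩
    simp [hp, this] at h
  have hg00 : ∀ t, g t ≠ 0 := by
    intro t
    obtain ⟨j, hj, h⟩ := hex t
    have := hD.l_mem j hj _ (code t j hj h).2
    omega
  have hsm : ∀ t, D.deg (z t) ≤ 2 → ∀ i < D.m, D.inc i (z t) → i = E t ∨ i = E (t - 1) := by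
    intro t ht i hi hit
    by_contra hc
    push Not at hc
    have h1 : E t ≠ E (t - 1) := fun h => fin5_ne_sub_one t (hEinj h)
    have := card_three_le_deg hi (hEm t) (hEm (t - 1)) hc.1 hc.2 h1 hit (hE t).2.1
      ((hEend _ _).2 (.inr (by rw [sub_add_cancel])))
    omega
  have hpS : ∀ t, D.deg (z t) ≤ 2 → ∀ i < D.m, D.inc i (z t) → p i ≠ 0 := by
    intro t ht i hi hit
    rcases hsm t ht i hi hit with rfl | rfl <;> rw [hpE] <;> exact hg00 _
  have hzv : ∀ j < D.k, ∃ t, z t = D.v j := by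
    intro j hj
    rcases hidx j hj with rfl | rfl | rfl
    exacts [⟨0, e1⟩, ⟨1, e2⟩, ⟨3, e3⟩]
  have hn : D.NotCen p := by
    refine hD.notCen fun i hi h0 j hj hij hd y hiy hA hc => ?_
    obtain ⟨t, ht⟩ := hzv j hj
    exact hpS t (by rw [ht, hd]) i hi (by rw [ht]; exact hij) h0
  have hcode : ∀ i, p i ≠ 0 → ∀ j < D.k, D.inc i (D.v j) → D.Code cc j (p i) ∧ p i ∈ D.l j := by
    intro i h0 j hj hij
    obtain ⟨t, rfl⟩ := hp0 i h0
    rw [hpE]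
    refine code t j hj ?_
    rcases (hEend t _).1 hij with h | h
    exacts [.inl h.symm, .inr h.symm]
  have hcon : ∀ x, D.Need p x → ∀ i ∈ D.con p x, ∃ t, x = z t ∧ 3 ≤ D.deg x ∧
      (i = E t ∨ i = E (t - 1)) := by
    intro x hx i hi
    simp only [con, mem_filter, mem_range] at hi
    obtain ⟨him, hix, hi⟩ := hi
    have hxz : ∀ t, x = z t → 3 ≤ D.deg x := by
      rintro t rfl
      by_contra hlt
      obtain ⟨j, hj, h1, h2⟩ := hx.exists_edge
      exact hpS t (by omega) j hj h1 h2
    by_cases h0 : p i = 0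
    -- A lost edge that is uncoloured would be attached to the ring at a vertex of degree 2, all of
    -- whose edges are precoloured.
    · exfalso
      rcases hi with hi | ⟨y, hiy, hy, j, hj, hji, hjy, hpj⟩
      · exact hi h0
      · obtain ⟨t, rfl⟩ := hp0 j hpj
        have : ∃ s, y = z s := by
          rcases (hEend t y).1 hjy with h | h
          exacts [⟨_, h⟩, ⟨_, h⟩]
        obtain ⟨s, rfl⟩ := this
        exact hpS s (deg_le_two_of_not_cen hy) i him hiy h0
    · obtain ⟨t, rfl⟩ := hp0 i h0
      rcases (hEend t x).1 hix with h | h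
      · exact ⟨t, h, hxz _ h, .inl rfl⟩
      · exact ⟨t + 1, h, hxz _ h, .inr (by rw [add_sub_cancel_right])⟩
  refine ⟨p, isPre_mk hD hn ?_ ?_ ?_ ?_, ⟨?_, ?_⟩⟩
  · intro i hi h0
    left
    obtain ⟨t, rfl⟩ := hp0 i h0
    obtain ⟨j, hj, h⟩ := hex t
    have hinc : D.inc (E t) (D.v j) := (hEend _ _).2 (h.imp Eq.symm Eq.symm)
    exact ⟨j, hj, hinc, (hcode _ h0 j hj hinc).2⟩
  · exact fun i hi h0 j hj hij => (hcode i h0 j hj hij).2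
  · intro i hi j hj hij x hix hjx h1 h2
    obtain ⟨t, rfl⟩ := hp0 i h1
    obtain ⟨t', rfl⟩ := hp0 j h2
    have htt : t ≠ t' := fun h => hij (by rw [h])
    rw [hpE, hpE]
    have : t' = t + 1 ∨ t = t' + 1 := by
      refine fin5_cases t t' htt ?_
      rcases (hEend t x).1 hix with h | h <;> rcases (hEend t' x).1 hjx with h' | h'
      · exact .inl (hz (h.symm.trans h'))
      · exact .inr (.inl (hz (h.symm.trans h')))
      · exact .inr (.inr (.inl (hz (h.symm.trans h'))))
      · exact .inr (.inr (.inr (hz (h.symm.trans h'))))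
    rcases this with rfl | rfl
    · exact hgn t
    · exact (hgn t').symm
  · have hcard : ∀ x, D.Need p x → (D.con p x).card ≤ 2 := by
      intro x hx
      rcases eq_empty_or_nonempty (D.con p x) with h | ⟨i, hi⟩
      · rw [h]; simp
      · obtain ⟨t, rfl, -, -⟩ := hcon x hx i hi
        have : D.con p (z t) ⊆ {E t, E (t - 1)} := by
          intro j hj
          obtain ⟨t', h1, -, h2⟩ := hcon _ hx j hj
          have := hz h1
          subst this
          simpa using h2
        exact (card_le_card this).trans card_le_two
    by_cases hb : ∃ t, 3 ≤ D.deg (z t)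
    · obtain ⟨t, ht⟩ := hb
      refine hn.hall_one (z t) (fun hx => ?_) (fun x hx hne => ?_)
      · have := hn.deg_le hD hx
        have := hcard _ hx
        omega
      · have h1 := hn.deg_le hD hx
        have h2 : D.con p x = ∅ := by
          rw [eq_empty_iff_forall_notMem]
          intro i hi
          obtain ⟨t', rfl, h3, -⟩ := hcon x hx i hi
          exact hne (by rw [hbig t' t h3 ht])
        rw [h2, card_empty] at h1
        have := hD.two_le_deg x (hx.lt hD)
        omega
    · refine hn.hall_one D.n (fun h => absurd (h.lt hD) (by omega)) (fun x hx _ => ?_)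
      have h1 := hn.deg_le hD hx
      have h2 : D.con p x = ∅ := by
        rw [eq_empty_iff_forall_notMem]
        intro i hi
        obtain ⟨t', rfl, h3, -⟩ := hcon x hx i hi
        exact hb ⟨t', h3⟩
      rw [h2, card_empty] at h1
      have := hD.two_le_deg x (hx.lt hD)
      omega
  · intro i hi h0
    obtain ⟨t, rfl⟩ := hp0 i h0
    obtain ⟨j, hj, h⟩ := hex t
    exact ⟨j, hj, hdeg j hj, (hEend _ _).2 (h.imp Eq.symm Eq.symm)⟩
  · exact fun j hj _ i hi hij h0 => (hcode i h0 j hj hij).1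

end Data

/-! ## Two vertices of degree 2 that are not free -/

namespace Data

open Finset

open scoped Classical

variable {D : Data} {p : ℕ → ℕ}

/-- `x` is a neighbour of `w`, or `w` and `x` have a common neighbour that is not a center. -/
def Reach (D : Data) (w x : ℕ) : Prop :=
  D.Adj w x ∨ ∃ t, ¬ D.cen t ∧ D.Adj w t ∧ D.Adj t x

/-- The last edge of such a path. -/
def ReachBy (D : Data) (w x i : ℕ) : Prop :=
  i < D.m ∧ D.inc i x ∧ (D.inc i w ∨ ∃ t, D.inc i t ∧ ¬ D.cen t ∧ D.Adj w t)

theorem ReachBy.cases {w x i : ℕ} (h : D.ReachBy w x i) (hx : D.cen x)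
    (hxw : x ≠ w) : ∃ t, D.Adj w t ∧ ((D.inc i t ∧ ¬ D.cen t ∧ D.Adj t x) ∨
      (t = x ∧ D.inc i w)) := by
  obtain ⟨hi, hix, hiw | ⟨t, hit, htc, hwt⟩⟩ := h
  · exact ⟨x, ⟨hxw.symm, i, hi, hiw, hix⟩, .inr ⟨rfl, hiw⟩⟩
  · exact ⟨t, hwt, .inl ⟨hit, htc, by rintro rfl; exact htc hx, i, hi, hit, hix⟩⟩

theorem ReachBy.reach {w x i : ℕ} (h : D.ReachBy w x i) (hx : D.cen x)
    (hxw : x ≠ w) : D.Reach w x := by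
  obtain ⟨t, h1, ⟨-, h2, h3⟩ | ⟨rfl, -⟩⟩ := h.cases hx hxw
  exacts [.inr ⟨t, h2, h1, h3⟩, .inl h1]

/-- One of the two neighbours of a non-free vertex has degree other than 2. -/
theorem NF.small_unique (hD : D.Valid) {w : ℕ} (hw : D.NF w) {t t' : ℕ} (h1 : D.Adj w t)
    (h2 : D.Adj w t') (h3 : D.deg t = 2) (h4 : D.deg t' = 2) : t = t' := by
  obtain ⟨u, hwu, hu⟩ := hw.2
  rcases hD.nbr_two (by rw [hw.1]) hwu h1 h2 (by rintro rfl; exact hu h3) with h | h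
  · exact absurd (h ▸ h4) hu
  · exact h.symm

theorem NF.reachBy_unique (hD : D.Valid) {w : ℕ} (hw : D.NF w) {x i j : ℕ} (hx : D.cen x)
    (hxw : x ≠ w) (hi : D.ReachBy w x i) (hj : D.ReachBy w x j) : i = j := by
  obtain ⟨t, ht, h1⟩ := hi.cases hx hxw
  obtain ⟨t', ht', h2⟩ := hj.cases hx hxw
  rcases h1 with ⟨h1, h1c, h1A⟩ | ⟨rfl, h1⟩ <;> rcases h2 with ⟨h2, h2c, h2A⟩ | ⟨rfl, h2⟩
  · have := hw.small_unique hD ht ht' (hD.deg_of_not_cen (ht.symm.lt hD) h1c)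
      (hD.deg_of_not_cen (ht'.symm.lt hD) h2c)
    subst this
    exact hD.edge_unique hi.1 hj.1 h1A.1 h1 hi.2.1 h2 hj.2.1
  · exact absurd ht' (hD.triangleFree _ _ _ ht h1A)
  · exact absurd ht (hD.triangleFree _ _ _ ht' h2A)
  · exact hD.edge_unique hi.1 hj.1 ht.1 h1 hi.2.1 h2 hj.2.1

/-- The shape of the paths from `w` to two vertices of degree at least 3. -/
theorem NF.reach_two (hD : D.Valid) {w : ℕ} (hw : D.NF w) {u u' : ℕ} (hu : 3 ≤ D.deg u)
    (hu' : 3 ≤ D.deg u') (hne : u ≠ u') (h : D.Reach w u) (h' : D.Reach w u') :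
    ((D.Adj w u ∧ D.Adj w u') ∨ (D.Adj w u ∧ ∃ t, ¬ D.cen t ∧ D.Adj w t ∧ D.Adj t u') ∨
      (D.Adj w u' ∧ ∃ t, ¬ D.cen t ∧ D.Adj w t ∧ D.Adj t u)) ∧
    ∀ x, 3 ≤ D.deg x → D.Reach w x → x = u ∨ x = u' := by
  -- A neighbour `t` of `w` that is no center has only one neighbour besides `w`.
  have hwt : ∀ t x, ¬ D.cen t → D.Adj w t → D.Adj t x → ∀ x', 3 ≤ D.deg x → 3 ≤ D.deg x' →
      D.Adj t x' → x = x' := by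
    intro t x htc h1 h2 x' hx hx' h3
    have hxw : w ≠ x := by rintro rfl; rw [hw.1] at hx; omega
    rcases hD.nbr_two (deg_le_two_of_not_cen htc) h1.symm h2 h3 hxw with h | h
    · rw [h, hw.1] at hx'; omega
    · exact h.symm
  have small : ∀ {t}, ¬ D.cen t → D.Adj w t → D.deg t = 2 := fun htc h1 =>
    hD.deg_of_not_cen (h1.symm.lt hD) htc
  have hw2 : D.deg w ≤ 2 := hw.1.le
  rcases h with h | ⟨t, htc, h1, h2⟩ <;> rcases h' with h' | ⟨t', htc', h1', h2'⟩
  · refine ⟨.inl ⟨h, h'⟩, fun x hx hr => ?_⟩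
    rcases hr with hr | ⟨y, hyc, hy1, hy2⟩
    · exact hD.nbr_two hw2 h h' hr hne
    · have := small hyc hy1
      rcases hD.nbr_two hw2 h h' hy1 hne with rfl | rfl <;> omega
  · refine ⟨.inr (.inl ⟨h, t', htc', h1', h2'⟩), fun x hx hr => ?_⟩
    have hut : u ≠ t' := by
      rintro rfl
      exact htc' (.inl hu)
    rcases hr with hr | ⟨y, hyc, hy1, hy2⟩
    · rcases hD.nbr_two hw2 h h1' hr hut with rfl | rfl
      · exact .inl rfl
      · exact absurd (.inl hx) htc'
    · have := hw.small_unique hD hy1 h1' (small hyc hy1) (small htc' h1')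
      subst this
      exact .inr (hwt y x hyc hy1 hy2 u' hx hu' h2')
  · refine ⟨.inr (.inr ⟨h', t, htc, h1, h2⟩), fun x hx hr => ?_⟩
    have hut : u' ≠ t := by
      rintro rfl
      exact htc (.inl hu')
    rcases hr with hr | ⟨y, hyc, hy1, hy2⟩
    · rcases hD.nbr_two hw2 h' h1 hr hut with rfl | rfl
      · exact .inr rfl
      · exact absurd (.inl hx) htc
    · have := hw.small_unique hD hy1 h1 (small hyc hy1) (small htc h1)
      subst this
      exact .inl (hwt y x hyc hy1 hy2 u hx hu h2)
  · have := hw.small_unique hD h1 h1' (small htc h1) (small htc' h1')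
    subst this
    exact absurd (hwt t u htc h1 h2 u' hu hu' h2') hne

/-- Precolourings of all the edges at the vertices `v j`. -/
structure Full (D : Data) (cc : ℕ) (p : ℕ → ℕ) : Prop where
  supp : ∀ i, p i ≠ 0 → i < D.m ∧ ∃ j < D.k, D.inc i (D.v j)
  code : ∀ j < D.k, ∀ i < D.m, D.inc i (D.v j) → D.Code cc j (p i) ∧ p i ∈ D.l j
  proper : ∀ i < D.m, ∀ j < D.m, i ≠ j → ∀ x, D.inc i x → D.inc j x → p i ≠ 0 → p j ≠ 0 →
    p i ≠ p j

theorem Full.ne_zero (hD : D.Valid) {cc : ℕ} (h : D.Full cc p) {i j : ℕ} (hj : j < D.k)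
    (hi : i < D.m) (hij : D.inc i (D.v j)) : p i ≠ 0 := by
  have := hD.l_mem j hj _ (h.code j hj i hi hij).2
  omega

theorem Full.coded {cc : ℕ} (h : D.Full cc p) (hdeg : ∀ j < D.k, D.deg (D.v j) = 2) :
    D.Coded cc p where
  supp i _ h0 := by
    obtain ⟨-, j, hj, hij⟩ := h.supp i h0
    exact ⟨j, hj, hdeg j hj, hij⟩
  code j hj _ i hi hij _ := (h.code j hj i hi hij).1

/-- If the two vertices are adjacent, their common edge gets `cc` and the other two edges, which do
not meet in a triangle-free graph, get arbitrary different colours. Otherwise two colours are chosen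
at each vertex, and their order at `v 1` is chosen to avoid conflicts at common neighbours. -/
theorem exists_full (hD : D.Valid) {cc : ℕ} (hcc : D.IsCommon cc) (hk : D.k = 2)
    (hdeg : ∀ j < D.k, D.deg (D.v j) = 2) : ∃ p, D.Full cc p := by
  have h0 : 0 < D.k := by omega
  have h1 : 1 < D.k := by omega
  have hidx : ∀ j < D.k, j = 0 ∨ j = 1 := fun j hj => by omega
  have hne : D.v 0 ≠ D.v 1 := fun h => by
    have := hD.v_inj 0 h0 1 h1 h
    omega
  have mk : ∀ g : ℕ → ℕ,
      (∀ j < D.k, ∀ i < D.m, D.inc i (D.v j) → D.Code cc j (g i) ∧ g i ∈ D.l j) →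
      (∀ i < D.m, ∀ j < D.m, i ≠ j → ∀ x, D.inc i x → D.inc j x →
        (∃ h < D.k, D.inc i (D.v h)) → (∃ h < D.k, D.inc j (D.v h)) → g i ≠ g j) →
      ∃ p, D.Full cc p := by
    intro g hg1 hg2
    refine ⟨fun i => if i < D.m ∧ ∃ j < D.k, D.inc i (D.v j) then g i else 0,
      fun i hi => ?_, fun j hj i hi hij => ?_, fun i hi j hj hij x hix hjx n1 n2 => ?_⟩
    · by_contra hc
      exact hi (if_neg hc)
    · rw [if_pos ⟨hi, j, hj, hij⟩]
      exact hg1 j hj i hi hij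
    · have c1 : i < D.m ∧ ∃ j < D.k, D.inc i (D.v j) := by
        by_contra hc
        exact n1 (if_neg hc)
      have c2 : j < D.m ∧ ∃ h < D.k, D.inc j (D.v h) := by
        by_contra hc
        exact n2 (if_neg hc)
      simp only [if_pos c1, if_pos c2]
      exact hg2 i hi j hj hij x hix hjx c1.2 c2.2
  by_cases hadj : D.Adj (D.v 0) (D.v 1)
  · obtain ⟨d0, hd0, hd0c⟩ := hD.exists_color h0 cc
    obtain ⟨d1, hd1, hd1c⟩ := hD.exists_color h1 cc
    obtain ⟨-, f, hf, hf0, hf1⟩ := id hadj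
    refine mk (fun i => if i = f then cc else if D.inc i (D.v 0) then d0 else d1) ?_ ?_
    · intro j hj i hi hij
      by_cases hif : i = f
      · simp only [if_pos hif]
        refine ⟨.inl rfl, ?_⟩
        rcases hidx j hj with rfl | rfl
        · exact hcc 0 h0 1 h1 hadj
        · exact hcc 1 h1 0 h0 hadj.symm
      · simp only [if_neg hif]
        rcases hidx j hj with rfl | rfl
        · rw [if_pos hij]
          exact ⟨.inr hd0, mem_of_take hd0⟩
        · rw [if_neg fun h => hif (hD.edge_unique hi hf hne h hij hf0 hf1)]
          exact ⟨.inr hd1, mem_of_take hd1⟩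
    · intro i hi j hj hij x hix hjx hiv hjv
      by_cases hif : i = f
      · rw [if_pos hif, if_neg (fun h => hij (hif.trans h.symm))]
        split_ifs
        exacts [hd0c.symm, hd1c.symm]
      by_cases hjf : j = f
      · rw [if_neg hif, if_pos hjf]
        split_ifs
        exacts [hd0c, hd1c]
      rw [if_neg hif, if_neg hjf]
      exfalso
      -- `i` and `j` are not both at the same `v h`
      have two : ∀ h < D.k, D.inc i (D.v h) → ¬ D.inc j (D.v h) := by
        intro h hh hi' hj'
        have hfh : D.inc f (D.v h) := by
          rcases hidx h hh with rfl | rfl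
          exacts [hf0, hf1]
        have := card_three_le_deg hi hj hf hij hif hjf hi' hj' hfh
        have := hdeg h hh
        omega
      -- If the two outer edges met, they would form a triangle with `f`.
      have tri : ∀ {e g : ℕ}, e < D.m → g < D.m → D.inc e (D.v 0) → D.inc g (D.v 1) →
          e ≠ f → g ≠ f → D.inc e x → D.inc g x → False := by
        intro e g he hg he0 hg1 hef hgf hex hgx
        have n0 : x ≠ D.v 0 := by
          rintro rfl
          exact hgf (hD.edge_unique hg hf hne hgx hg1 hf0 hf1)
        have n1 : x ≠ D.v 1 := by
          rintro rfl
          exact hef (hD.edge_unique he hf hne he0 hex hf0 hf1)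
        exact hD.triangleFree _ _ _ hadj ⟨n1.symm, g, hg, hg1, hgx⟩ ⟨n0.symm, e, he, he0, hex⟩
      obtain ⟨h, hh, hi'⟩ := hiv
      obtain ⟨h', hh', hj'⟩ := hjv
      rcases hidx h hh with rfl | rfl <;> rcases hidx h' hh' with rfl | rfl
      · exact two 0 hh hi' hj'
      · exact tri hi hj hi' hj' hif hjf hix hjx
      · exact tri hj hi hj' hi' hjf hif hjx hix
      · exact two 1 hh hi' hj'
  · have hdis : ∀ i < D.m, D.inc i (D.v 0) → ¬ D.inc i (D.v 1) := fun i hi a b =>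
      hadj ⟨hne, i, hi, a, b⟩
    obtain ⟨e0, f0, y0, z0, he0, hf0, hef0, hyz0, hew0, hey0, hfw0, hfz0, hwy0, hwz0, hall0⟩ :=
      hD.two_edges (hdeg 0 h0)
    obtain ⟨e1, f1, y1, z1, he1, hf1, hef1, hyz1, hew1, hey1, hfw1, hfz1, hwy1, hwz1, hall1⟩ :=
      hD.two_edges (hdeg 1 h1)
    obtain ⟨a, ha, -⟩ := hD.exists_color h0 0
    obtain ⟨b, hb, hba⟩ := hD.exists_color h0 a
    obtain ⟨c, hc, -⟩ := hD.exists_color h1 0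
    obtain ⟨d, hd, hdc⟩ := hD.exists_color h1 c
    -- edges at `v 0` and at `v 1` that have a common end
    set M : ℕ → ℕ → Prop := fun e g => ∃ x, D.inc e x ∧ D.inc g x with hM
    have hMx : ∀ {e g x}, e < D.m → g < D.m → D.inc e (D.v 0) → D.inc g (D.v 1) → D.inc e x →
        D.inc g x → D.Adj (D.v 0) x ∧ D.Adj (D.v 1) x := by
      intro e g x he hg a b ex gx
      refine ⟨⟨?_, e, he, a, ex⟩, ⟨?_, g, hg, b, gx⟩⟩
      · rintro rfl; exact hdis g hg gx b
      · rintro rfl; exact hdis e he a ex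
    have m1 : ∀ {e e' g}, e < D.m → e' < D.m → g < D.m → D.inc e (D.v 0) → D.inc e' (D.v 0) →
        D.inc g (D.v 1) → e ≠ e' → M e g → ¬ M e' g := by
      rintro e e' g he he' hg a a' b hee ⟨x, ex, gx⟩ ⟨x', ex', gx'⟩
      obtain ⟨p1, p2⟩ := hMx he hg a b ex gx
      obtain ⟨p1', p2'⟩ := hMx he' hg a' b ex' gx'
      obtain ⟨w, -, -, hw⟩ := hD.adj_of_inc hg b
      have hx := (hw x gx).resolve_left p2.1.symm
      have hx' := (hw x' gx').resolve_left p2'.1.symm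
      have : x = x' := hx.trans hx'.symm
      subst this
      exact hee (hD.edge_unique he he' p1.1 a ex a' ex')
    have m2 : ∀ {e g g'}, e < D.m → g < D.m → g' < D.m → D.inc e (D.v 0) → D.inc g (D.v 1) →
        D.inc g' (D.v 1) → g ≠ g' → M e g → ¬ M e g' := by
      rintro e g g' he hg hg' a b b' hgg ⟨x, ex, gx⟩ ⟨x', ex', gx'⟩
      obtain ⟨p1, p2⟩ := hMx he hg a b ex gx
      obtain ⟨p1', p2'⟩ := hMx he hg' a b' ex' gx'
      obtain ⟨w, -, -, hw⟩ := hD.adj_of_inc he a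
      have hx := (hw x ex).resolve_left p1.1.symm
      have hx' := (hw x' ex').resolve_left p1'.1.symm
      have : x = x' := hx.trans hx'.symm
      subst this
      exact hgg (hD.edge_unique hg hg' p2.1 b gx b' gx')
    -- By `m1` and `m2` the meeting pairs form a matching between the edges at `v 0` and those at `v
    -- 1`. Therefore a conflict for one order of `c` and `d` excludes every conflict for the other
    -- order.
    obtain ⟨c', d', hc', hd', hcd', q1, q2, q3, q4⟩ : ∃ c' d', c' ∈ (D.l 1).take 3 ∧
        d' ∈ (D.l 1).take 3 ∧ c' ≠ d' ∧ (M e0 e1 → a ≠ c') ∧ (M e0 f1 → a ≠ d') ∧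
        (M f0 e1 → b ≠ c') ∧ (M f0 f1 → b ≠ d') := by
      by_cases hg : (M e0 e1 → a ≠ c) ∧ (M e0 f1 → a ≠ d) ∧ (M f0 e1 → b ≠ c) ∧ (M f0 f1 → b ≠ d)
      · exact ⟨c, d, hc, hd, hdc.symm, hg.1, hg.2.1, hg.2.2.1, hg.2.2.2⟩
      · have x1 := m1 he0 hf0 he1 hew0 hfw0 hew1 hef0
        have x2 := m1 he0 hf0 hf1 hew0 hfw0 hfw1 hef0
        have x3 := m2 he0 he1 hf1 hew0 hew1 hfw1 hef1
        have x4 := m2 hf0 he1 hf1 hfw0 hew1 hfw1 hef1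
        refine ⟨d, c, hd, hc, hdc, ?_, ?_, ?_, ?_⟩
        · intro hm h
          refine hg ⟨fun _ h' => hdc (h.symm.trans h'), fun h' => absurd h' (x3 hm),
            fun h' => absurd h' (x1 hm), fun h' h'' => hba (h''.trans h.symm)⟩
        · intro hm h
          refine hg ⟨fun h' => absurd hm (x3 h'), fun _ h' => hdc (h'.symm.trans h),
            fun h' h'' => hba (h''.trans h.symm), fun h' => absurd h' (x2 hm)⟩
        · intro hm h
          refine hg ⟨fun h' => absurd hm (x1 h'), fun h' h'' => hba (h.trans h''.symm),
            fun _ h' => hdc (h.symm.trans h'), fun h' => absurd h' (x4 hm)⟩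
        · intro hm h
          refine hg ⟨fun h' h'' => hba (h.trans h''.symm), fun h' => absurd hm (x2 h'),
            fun h' => absurd hm (x4 h'), fun _ h' => hdc (h'.symm.trans h)⟩
    have hgv : ∀ i < D.m, D.inc i (D.v 1) → i ≠ e0 ∧ i ≠ f0 := by
      intro i hi hi1
      constructor
      · rintro rfl; exact hdis _ hi hew0 hi1
      · rintro rfl; exact hdis _ hi hfw0 hi1
    set g : ℕ → ℕ := fun i => if i = e0 then a else if i = f0 then b else
      if i = e1 then c' else d' with hg
    have ge0 : g e0 = a := by simp [hg]
    have gf0 : g f0 = b := by simp [hg, hef0.symm]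
    have ge1 : g e1 = c' := by simp [hg, hgv e1 he1 hew1]
    have gf1 : g f1 = d' := by simp [hg, hgv f1 hf1 hfw1, hef1.symm]
    have key : ∀ i < D.m, ∀ j < D.m, D.inc i (D.v 0) → D.inc j (D.v 1) → M i j → g i ≠ g j := by
      intro i hi j hj hi0 hj1 hm
      rcases hall0 i hi hi0 with rfl | rfl <;> rcases hall1 j hj hj1 with rfl | rfl
      · rw [ge0, ge1]; exact q1 hm
      · rw [ge0, gf1]; exact q2 hm
      · rw [gf0, ge1]; exact q3 hm
      · rw [gf0, gf1]; exact q4 hm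
    refine mk g ?_ ?_
    · intro j hj i hi hij
      have : g i ∈ (D.l j).take 3 := by
        rcases hidx j hj with rfl | rfl
        · rcases hall0 i hi hij with rfl | rfl
          · rwa [ge0]
          · rwa [gf0]
        · rcases hall1 i hi hij with rfl | rfl
          · rwa [ge1]
          · rwa [gf1]
      exact ⟨.inr this, mem_of_take this⟩
    · rintro i hi j hj hij x hix hjx ⟨h, hh, hi'⟩ ⟨h', hh', hj'⟩
      rcases hidx h hh with rfl | rfl <;> rcases hidx h' hh' with rfl | rfl
      · rcases hall0 i hi hi' with rfl | rfl <;> rcases hall0 j hj hj' with rfl | rfl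
        · exact absurd rfl hij
        · rw [ge0, gf0]; exact hba.symm
        · rw [ge0, gf0]; exact hba
        · exact absurd rfl hij
      · exact key i hi j hj hi' hj' ⟨x, hix, hjx⟩
      · exact (key j hj i hi hj' hi' ⟨x, hjx, hix⟩).symm
      · rcases hall1 i hi hi' with rfl | rfl <;> rcases hall1 j hj hj' with rfl | rfl
        · exact absurd rfl hij
        · rw [ge1, gf1]; exact hcd'
        · rw [ge1, gf1]; exact hcd'.symm
        · exact absurd rfl hij

theorem Valid.notCen_of_ne_zero (hD : D.Valid)
    (h : ∀ j < D.k, ∀ i < D.m, D.inc i (D.v j) → p i ≠ 0) : D.NotCen p :=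
  hD.notCen fun i hi h0 j hj hij _ _ _ _ _ => h j hj i hi hij h0

theorem Need.ne_v (h : ∀ j < D.k, ∀ i < D.m, D.inc i (D.v j) → p i ≠ 0) {x j : ℕ}
    (hx : D.Need p x) (hj : j < D.k) : x ≠ D.v j := by
  rintro rfl
  obtain ⟨i, hi, h1, h2⟩ := hx.exists_edge
  exact h j hj i hi h1 h2

theorem Need.three_le (h : ∀ j < D.k, ∀ i < D.m, D.inc i (D.v j) → p i ≠ 0) {x : ℕ}
    (hx : D.Need p x) : 3 ≤ D.deg x := by
  rcases hx.cen with h3 | ⟨j, hj, rfl⟩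
  · exact h3
  · exact absurd rfl (hx.ne_v h hj)

theorem con_cases {x i : ℕ} (hi : i ∈ D.con p x) : i < D.m ∧ D.inc i x ∧ ∃ f < D.m, p f ≠ 0 ∧
    (f = i ∨ ∃ y, ¬ D.cen y ∧ D.inc i y ∧ D.inc f y) := by
  simp only [con, mem_filter, mem_range] at hi
  obtain ⟨h1, h2, h | ⟨y, h3, h4, j, h5, -, h6, h7⟩⟩ := hi
  · exact ⟨h1, h2, i, h1, h, .inl rfl⟩
  · exact ⟨h1, h2, j, h5, h7, .inr ⟨y, h4, h3, h6⟩⟩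

theorem reachBy_of {x i f j : ℕ} (hj : j < D.k) (hi : i < D.m) (hf : f < D.m)
    (hix : D.inc i x) (hfv : D.inc f (D.v j))
    (h : f = i ∨ ∃ y, ¬ D.cen y ∧ D.inc i y ∧ D.inc f y) : D.ReachBy (D.v j) x i := by
  rcases h with rfl | ⟨y, hy, hiy, hfy⟩
  · exact ⟨hi, hix, .inl hfv⟩
  · refine ⟨hi, hix, .inr ⟨y, hiy, hy, ?_, f, hf, hfv, hfy⟩⟩
    rintro rfl
    exact hy (.inr ⟨j, hj, rfl⟩)

theorem Full.isPre (hD : D.Valid) {cc : ℕ} (hp : D.Full cc p)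
    (hH : Peel.Hall D.m D.X D.Y (D.R p) (D.RY p) (D.Fr p) D.sl (fun _ => False)) :
    D.IsPre p := by
  refine isPre_mk hD (hD.notCen_of_ne_zero fun j hj i hi h => hp.ne_zero hD hj hi h) ?_ ?_
    hp.proper hH
  · intro i hi h0
    obtain ⟨-, j, hj, h⟩ := hp.supp i h0
    exact .inl ⟨j, hj, h, (hp.code j hj i hi h).2⟩
  · exact fun i hi _ j hj h => (hp.code j hj i hi h).2

/-- Listed vertices have no uncoloured edge, so a vertex in need has degree at least 3. Each `v j`
deprives it of at most one useful edge, and of none if it does not reach it. -/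
theorem Full.yd_bound (hD : D.Valid) {cc : ℕ} (hp : D.Full cc p) (hk : D.k = 2)
    (hNF : ∀ j < D.k, D.NF (D.v j)) {x : ℕ} (hx : D.Need p x) :
    1 ≤ D.yd p x ∧ (D.yd p x < 2 → D.deg x = 3 ∧ ∀ j < D.k, D.Reach (D.v j) x) ∧
      ((∃ j < D.k, ¬ D.Reach (D.v j) x) → 2 ≤ D.yd p x) ∧
      ((∀ j < D.k, ¬ D.Reach (D.v j) x) → 3 ≤ D.yd p x) := by
  have hfull : ∀ j < D.k, ∀ i < D.m, D.inc i (D.v j) → p i ≠ 0 :=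
    fun j hj i hi h => hp.ne_zero hD hj hi h
  have hn := hD.notCen_of_ne_zero hfull
  have h3 := hx.three_le hfull
  have hdeg := hn.deg_le hD hx
  have hidx : ∀ j < D.k, j = 0 ∨ j = 1 := fun j hj => by omega
  have hcon : D.con p x ⊆ (D.con p x).filter (fun i => D.ReachBy (D.v 0) x i) ∪
      (D.con p x).filter (fun i => D.ReachBy (D.v 1) x i) := by
    intro i hi
    obtain ⟨him, hix, f, hf, hpf, h⟩ := con_cases hi
    obtain ⟨-, j, hj, hfj⟩ := hp.supp f hpf
    have := reachBy_of hj him hf hix hfj h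
    simp only [mem_union, mem_filter]
    rcases hidx j hj with rfl | rfl
    exacts [.inl ⟨hi, this⟩, .inr ⟨hi, this⟩]
  have hle : ∀ j < D.k, ((D.con p x).filter (fun i => D.ReachBy (D.v j) x i)).card ≤ 1 := by
    intro j hj
    rw [card_le_one]
    intro a ha b hb
    exact (hNF j hj).reachBy_unique hD hx.cen (hx.ne_v hfull hj) (mem_filter.1 ha).2
      (mem_filter.1 hb).2
  have hz : ∀ j < D.k, ¬ D.Reach (D.v j) x →
      ((D.con p x).filter (fun i => D.ReachBy (D.v j) x i)).card = 0 := by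
    intro j hj hr
    rw [card_eq_zero, filter_eq_empty_iff]
    exact fun i _ h => hr (h.reach hx.cen (hx.ne_v hfull hj))
  have hc := (card_le_card hcon).trans (card_union_le _ _)
  have h0 := hle 0 (by omega)
  have h1 := hle 1 (by omega)
  refine ⟨by omega, fun hlt => ⟨by omega, fun j hj => ?_⟩, ?_, fun hr => ?_⟩
  · by_contra hr
    have := hz j hj hr
    rcases hidx j hj with rfl | rfl <;> omega
  · rintro ⟨j, hj, hr⟩
    have := hz j hj hr
    rcases hidx j hj with rfl | rfl <;> omega
  · have := hz 0 (by omega) (hr 0 (by omega))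
    have := hz 1 (by omega) (hr 1 (by omega))
    omega

/-- Trouble requires two vertices with a single useful edge; they have degree 3 and both are reached
from both `v j`. By `reach_two` nothing else of degree at least 3 is reached, so all other vertices
in need keep three useful edges and any of them repairs the count. For the pair alone Hall's
condition fails only if its two right ends coincide, and `s = 3` because the pair is not slack. -/
theorem Full.isPre_or (hD : D.Valid) {cc : ℕ} (hp : D.Full cc p) (hk : D.k = 2)
    (hNF : ∀ j < D.k, D.NF (D.v j)) :
    D.IsPre p ∨ ∃ u u' y, u ≠ u' ∧ D.deg u = 3 ∧ D.deg u' = 3 ∧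
      (∀ j < D.k, D.Reach (D.v j) u ∧ D.Reach (D.v j) u') ∧ ¬ D.cen y ∧ D.Adj u y ∧
      D.Adj u' y ∧ D.s = 3 := by
  have hfull : ∀ j < D.k, ∀ i < D.m, D.inc i (D.v j) → p i ≠ 0 :=
    fun j hj i hi h => hp.ne_zero hD hj hi h
  have hn := hD.notCen_of_ne_zero hfull
  by_cases hlow : ∃ u u', u ≠ u' ∧ D.Need p u ∧ D.Need p u' ∧ D.yd p u < 2 ∧ D.yd p u' < 2
  · obtain ⟨u, u', hne, hu, hu', hyu, hyu'⟩ := hlow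
    obtain ⟨a1, a2, -, -⟩ := hp.yd_bound hD hk hNF hu
    obtain ⟨b1, b2, -, -⟩ := hp.yd_bound hD hk hNF hu'
    obtain ⟨hdu, hru⟩ := a2 hyu
    obtain ⟨hdu', hru'⟩ := b2 hyu'
    by_contra hcon
    rw [not_or] at hcon
    refine hcon.1 (hp.isPre hD (hn.hall fun T hT => ?_))
    set T' := (T.erase u).erase u' with hT'
    have hs : 3 * T'.card ≤ ∑ x ∈ T', D.yd p x := by
      rw [mul_comm, ← smul_eq_mul, ← sum_const]
      refine sum_le_sum fun x hx => ?_
      simp only [hT', mem_erase] at hx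
      have hxN := hT x hx.2.2
      refine (hp.yd_bound hD hk hNF hxN).2.2.2 fun j hj hr => ?_
      have := ((hNF j hj).reach_two hD (by omega) (by omega) hne (hru j hj) (hru' j hj)).2 x
        (hxN.three_le hfull) hr
      tauto
    by_cases huT : u ∈ T
    · have e1 := add_sum_erase T (D.yd p) huT
      have e2 := card_erase_add_one huT
      by_cases huT' : u' ∈ T
      · have hmem : u' ∈ T.erase u := mem_erase.2 ⟨hne.symm, huT'⟩
        have e3 := add_sum_erase (T.erase u) (D.yd p) hmem
        have e4 := card_erase_add_one hmem
        rw [← hT'] at e3 e4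
        -- With `T'` nonempty, the sum is at least `2 + 3 * T'.card`, which is at least `2 * T.card
        -- - 1`.
        by_cases h0 : T'.card = 0
        · right
          obtain ⟨e, he, heR, heX⟩ := exists_yd (D := D) (p := p) a1
          obtain ⟨g, hg, hgR, hgX⟩ := exists_yd (D := D) (p := p) b1
          have heA := heR.adj hD
          have hgA := hgR.adj hD
          rw [heX] at heA
          rw [hgX] at hgA
          have hY : D.Y e ≠ D.Y g := by
            intro h
            refine hcon.2 ⟨u, u', D.Y e, hne, hdu, hdu', fun j hj => ⟨hru j hj, hru' j hj⟩,
              hn.Y heR.1, heA, h ▸ hgA, ?_⟩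
            by_contra hs3
            refine hu.2.1 ⟨?_, ?_⟩
            · rintro ⟨j, hj, h⟩
              exact hu.ne_v hfull hj h.symm
            · have := D.three_le_s
              omega
          set I := ((range D.m).filter (fun i => D.RY p i ∧ D.X i ∈ T)).image D.Y with hI
          have hsub : ({D.Y e, D.Y g} : Finset ℕ) ⊆ I := by
            intro z hz
            simp only [mem_insert, mem_singleton] at hz
            rcases hz with rfl | rfl
            · exact mem_image_of_mem _ (by simp [heR, he, heX, huT])
            · exact mem_image_of_mem _ (by simp [hgR, hg, hgX, huT'])
          have := card_le_card hsub
          rw [card_pair hY] at this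
          omega
        · left
          omega
      · left
        have : T.erase u = T' := by
          rw [hT', erase_eq_of_notMem (s := T.erase _)]
          exact fun h => huT' (mem_of_mem_erase h)
        rw [this] at e1 e2
        omega
    · left
      have e0 : T.erase u = T := erase_eq_of_notMem huT
      by_cases huT' : u' ∈ T
      · have e3 := add_sum_erase T (D.yd p) huT'
        have e4 := card_erase_add_one huT'
        rw [hT', e0] at hs
        omega
      · rw [hT', e0, erase_eq_of_notMem huT'] at hs
        omega
  · left
    refine hp.isPre hD ?_
    by_cases h1 : ∃ u, D.Need p u ∧ D.yd p u < 2
    · obtain ⟨u, hu, hyu⟩ := h1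
      refine hn.hall_one u (fun _ => (hp.yd_bound hD hk hNF hu).1) fun x hx hne => ?_
      by_contra hlt
      exact hlow ⟨x, u, hne, hx, hu, by omega, hyu⟩
    · push Not at h1
      exact hn.hall_one D.n (fun h => absurd (h.lt hD) (by omega)) fun x hx _ => h1 x hx

/-- The precolouring where `x` is used at the edges `ei` and `ej`. -/
theorem exists_full_of_two (hD : D.Valid) (cc : ℕ) (hk : D.k = 2)
    (hdeg : ∀ j < D.k, D.deg (D.v j) = 2) {i j x ei ej : ℕ} (hi : i < D.k) (hj : j < D.k)
    (hij : i ≠ j) (hx : ∀ j < D.k, x ∈ (D.l j).take 3) (hadj : ¬ D.Adj (D.v i) (D.v j))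
    (hei : ei < D.m) (hej : ej < D.m) (hiv : D.inc ei (D.v i)) (hjv : D.inc ej (D.v j))
    (h1 : ∀ z, D.inc ei z → ¬ D.inc ej z)
    (h2 : ∀ e < D.m, ∀ f < D.m, e ≠ ei → f ≠ ej → D.inc e (D.v i) → D.inc f (D.v j) →
      ∀ z, D.inc e z → ¬ D.inc f z) :
    ∃ p, D.Full cc p ∧ p ei = x ∧ p ej = x ∧ ∀ e, p e = x → e = ei ∨ e = ej := by
  obtain ⟨c, hc, hcx⟩ := hD.exists_color hi x
  obtain ⟨d, hd, hdx⟩ := hD.exists_color hj x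
  have hidx : ∀ h < D.k, h = i ∨ h = j := fun h hh => by omega
  have hne : D.v i ≠ D.v j := fun h => hij (hD.v_inj i hi j hj h)
  have hdis : ∀ e < D.m, D.inc e (D.v i) → ¬ D.inc e (D.v j) := fun e he a b =>
    hadj ⟨hne, e, he, a, b⟩
  have hx0 : x ≠ 0 := by
    have := hD.l_mem i hi x (mem_of_take (hx i hi))
    omega
  have hc0 : c ≠ 0 := by
    have := hD.l_mem i hi c (mem_of_take hc)
    omega
  have hd0 : d ≠ 0 := by
    have := hD.l_mem j hj d (mem_of_take hd)
    omega
  set p : ℕ → ℕ := fun e => if e = ei ∨ e = ej then x else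
    if e < D.m ∧ D.inc e (D.v i) then c else if e < D.m ∧ D.inc e (D.v j) then d else 0 with hp
  have pi : p ei = x := by simp [hp]
  have pj : p ej = x := by simp [hp]
  have pi' : ∀ e < D.m, D.inc e (D.v i) → e ≠ ei → p e = c := by
    intro e he hev hne'
    have : e ≠ ej := by rintro rfl; exact hdis _ he hev hjv
    simp [hp, this, hne', he, hev]
  have pj' : ∀ e < D.m, D.inc e (D.v j) → e ≠ ej → p e = d := by
    intro e he hev hne'
    have h3 : e ≠ ei := by rintro rfl; exact hdis _ he hiv hev
    have h4 : ¬ D.inc e (D.v i) := fun h => hdis e he h hev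
    simp [hp, h3, hne', he, hev, h4]
  have key : ∀ e < D.m, ∀ f < D.m, D.inc e (D.v i) → D.inc f (D.v j) → ∀ z, D.inc e z →
      D.inc f z → p e ≠ p f := by
    intro e he f hf hev hfv z hez hfz
    by_cases a : e = ei
    · subst a
      rw [pi, pj' f hf hfv (by rintro rfl; exact h1 z hez hfz)]
      exact hdx.symm
    · rw [pi' e he hev a]
      by_cases b : f = ej
      · rw [b, pj]; exact hcx
      · exact absurd hfz (h2 e he f hf a b hev hfv z hez)
  have two : ∀ h < D.k, ∀ e < D.m, ∀ f < D.m, ∀ g < D.m, e ≠ f → e ≠ g → f ≠ g →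
      D.inc e (D.v h) → D.inc f (D.v h) → ¬ D.inc g (D.v h) := by
    intro h hh e he f hf g hg a b c a' b' c'
    have := card_three_le_deg he hf hg a b c a' b' c'
    have := hdeg h hh
    omega
  refine ⟨p, ⟨?_, ?_, ?_⟩, pi, pj, ?_⟩
  · intro e he
    by_contra hcon
    apply he
    have h3 : e ≠ ei := by rintro rfl; exact hcon ⟨hei, i, hi, hiv⟩
    have h4 : e ≠ ej := by rintro rfl; exact hcon ⟨hej, j, hj, hjv⟩
    have h5 : ¬ (e < D.m ∧ D.inc e (D.v i)) := fun h => hcon ⟨h.1, i, hi, h.2⟩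
    have h6 : ¬ (e < D.m ∧ D.inc e (D.v j)) := fun h => hcon ⟨h.1, j, hj, h.2⟩
    simp only [hp, h3, h4, h5, h6, or_self, if_false]
  · intro h hh e he hev
    have : p e ∈ (D.l h).take 3 := by
      rcases hidx h hh with rfl | rfl
      · by_cases a : e = ei
        · rw [a, pi]; exact hx _ hi
        · rw [pi' e he hev a]; exact hc
      · by_cases a : e = ej
        · rw [a, pj]; exact hx _ hj
        · rw [pj' e he hev a]; exact hd
    exact ⟨.inr this, mem_of_take this⟩
  · intro e he f hf hef z hez hfz n1 n2
    have supp : ∀ e < D.m, p e ≠ 0 → D.inc e (D.v i) ∨ D.inc e (D.v j) := by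
      intro e he h0
      by_contra hcon
      rw [not_or] at hcon
      have h3 : e ≠ ei := by rintro rfl; exact hcon.1 hiv
      have h4 : e ≠ ej := by rintro rfl; exact hcon.2 hjv
      exact h0 (by simp only [hp, h3, h4, hcon.1, hcon.2, or_self, and_false, if_false])
    rcases supp e he n1 with a | a <;> rcases supp f hf n2 with b | b
    · by_cases h3 : e = ei
      · rw [h3, pi, pi' f hf b (fun h => hef (h3.trans h.symm))]; exact hcx.symm
      · by_cases h4 : f = ei
        · rw [h4, pi, pi' e he a h3]; exact hcx
        · exact absurd hiv (two i hi e he f hf ei hei hef h3 h4 a b)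
    · exact key e he f hf a b z hez hfz
    · exact (key f hf e he b a z hfz hez).symm
    · by_cases h3 : e = ej
      · rw [h3, pj, pj' f hf b (fun h => hef (h3.trans h.symm))]; exact hdx.symm
      · by_cases h4 : f = ej
        · rw [h4, pj, pj' e he a h3]; exact hdx
        · exact absurd hjv (two j hj e he f hf ej hej hef h3 h4 a b)
  · intro e he
    by_contra hcon
    simp only [hp, hcon, if_false] at he
    split_ifs at he
    exacts [hcx he, hdx he, hx0 he.symm]

end Data

/-! ### The exceptional configuration of two non-free vertices -/

namespace Data

open Finset

theorem fin5_succ_ne_pred : ∀ t : Fin 5, t + 1 ≠ t - 1 := by decide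

open scoped Classical

variable {D : Data} {p : ℕ → ℕ}

def Com (D : Data) (u : ℕ) : Prop := D.Adj (D.v 0) u ∧ D.Adj (D.v 1) u

def NbCom (D : Data) (y : ℕ) : Prop := y ≠ D.v 0 ∧ y ≠ D.v 1 ∧ ∃ u, D.Com u ∧ D.Adj u y

/-- Edges that leave the neighbourhood of the common neighbours of `v 0` and `v 1`. -/
def Ext (D : Data) (i : ℕ) : Prop := i < D.m ∧
  ((D.NbCom (D.a i) ∧ ¬ D.Com (D.b i)) ∨ (D.NbCom (D.b i) ∧ ¬ D.Com (D.a i)))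

theorem ext_iff (i : ℕ) : D.Ext i ↔ i < D.m ∧ ∃ y z, D.inc i y ∧ D.inc i z ∧
    ((D.a i = y ∧ D.b i = z) ∨ (D.a i = z ∧ D.b i = y)) ∧ D.NbCom y ∧ ¬ D.Com z := by
  constructor
  · rintro ⟨h, ⟨h1, h2⟩ | ⟨h1, h2⟩⟩
    exacts [⟨h, _, _, .inl rfl, .inr rfl, .inl ⟨rfl, rfl⟩, h1, h2⟩,
      ⟨h, _, _, .inr rfl, .inl rfl, .inr ⟨rfl, rfl⟩, h1, h2⟩]
  · rintro ⟨h, y, z, -, -, ⟨rfl, rfl⟩ | ⟨rfl, rfl⟩, h1, h2⟩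
    exacts [⟨h, .inl ⟨h1, h2⟩⟩, ⟨h, .inr ⟨h1, h2⟩⟩]

/-- An edge `i` from `x` to a vertex `y` of degree 2 is free if the other edge at `y` has the
colour of an edge at `x`. -/
theorem NotCen.fr (hn : D.NotCen p) {i x y f h : ℕ} (hi : i < D.m) (h0 : p i = 0)
    (hx : D.cen x) (hxy : x ≠ y) (hix : D.inc i x) (hiy : D.inc i y) (hf : f < D.m)
    (hfy : D.inc f y) (hpf : p f ≠ 0) (hh : h < D.m) (hhx : D.inc h x) (hph : p h = p f) :
    D.Fr p i ∧ D.X i = x := by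
  obtain ⟨hR, hX⟩ := hn.R_of_inc hi h0 hx hix
  have hY : D.Y i = y := by
    rcases (inc_iff i y).1 hiy with h | h
    · exact absurd (hX.symm.trans h.symm) hxy
    · exact h.symm
  exact ⟨⟨hR, .inr ⟨f, hf, hpf, by rwa [hY], h, hh, by rwa [hX], hph⟩⟩, hX⟩

theorem inc_pair (hD : D.Valid) {i x y z : ℕ} (hi : i < D.m) (hxy : x ≠ y) (hx : D.inc i x)
    (hy : D.inc i y) (hz : D.inc i z) : z = x ∨ z = y := by
  obtain ⟨w, -, -, hw⟩ := hD.adj_of_inc hi hx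
  have := hw z hz
  have := hw y hy
  omega

/-- Two vertices `v i` and `v j` with paths to the vertices `u` and `u'`. -/
structure Config (D : Data) (i j u u' d y : ℕ) : Prop where
  k_eq : D.k = 2
  nf : ∀ j < D.k, D.NF (D.v j)
  i_lt : i < D.k
  j_lt : j < D.k
  i_ne : i ≠ j
  ne : u ≠ u'
  deg_u : D.deg u = 3
  deg_u' : D.deg u' = 3
  reach : ∀ j < D.k, D.Reach (D.v j) u ∧ D.Reach (D.v j) u'
  adj_ju : D.Adj (D.v j) u
  not_cen_d : ¬ D.cen d
  adj_jd : D.Adj (D.v j) d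
  adj_du' : D.Adj d u'
  not_cen_y : ¬ D.cen y
  adj_uy : D.Adj u y
  adj_u'y : D.Adj u' y
  s_eq : D.s = 3

namespace Config

variable {i j u u' d y : ℕ}

/-- Two subsets of three colours with at least two elements each intersect, and lists of at most
three colours are not shortened. -/
theorem exists_common (hD : D.Valid) (h : D.Config i j u u' d y) :
    ∃ x, ∀ j < D.k, x ∈ (D.l j).take 3 := by
  have hk := h.k_eq
  have hcard : ∀ j < D.k, 2 ≤ (D.l j).toFinset.card ∧ (D.l j).toFinset ⊆ Icc 1 3 := by
    intro j hj
    refine ⟨?_, fun c hc => ?_⟩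
    · rw [List.toFinset_card_of_nodup (hD.l_nodup j hj)]
      exact hD.two_le_length hj
    · have := hD.l_mem j hj c (List.mem_toFinset.1 hc)
      rw [h.s_eq] at this
      exact mem_Icc.2 this
  have htake : ∀ j < D.k, (D.l j).take 3 = D.l j := by
    intro j hj
    refine List.take_of_length_le ?_
    rw [← List.toFinset_card_of_nodup (hD.l_nodup j hj)]
    simpa using card_le_card (hcard j hj).2
  obtain ⟨h0, h0'⟩ := hcard 0 (by omega)
  obtain ⟨h1, h1'⟩ := hcard 1 (by omega)
  obtain ⟨x, hx⟩ : ((D.l 0).toFinset ∩ (D.l 1).toFinset).Nonempty := by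
    rw [← card_pos]
    have := card_union_add_card_inter (D.l 0).toFinset (D.l 1).toFinset
    have := card_le_card (union_subset h0' h1')
    simp only [Nat.card_Icc] at this
    omega
  simp only [mem_inter, List.mem_toFinset] at hx
  refine ⟨x, fun j hj => ?_⟩
  rw [htake j hj]
  have : j = 0 ∨ j = 1 := by omega
  rcases this with rfl | rfl
  exacts [hx.1, hx.2]

theorem ne_v (h : D.Config i j u u' d y) {x h' : ℕ} (hx : D.deg x = 3) (hj : h' < D.k) :
    x ≠ D.v h' := by
  rintro rfl
  have := (h.nf h' hj).1
  omega

theorem not_cen_ne_v {x h' : ℕ} (hx : ¬ D.cen x) (hj : h' < D.k) : x ≠ D.v h' := by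
  rintro rfl
  exact hx (.inr ⟨h', hj, rfl⟩)

theorem v_ne (hD : D.Valid) (h : D.Config i j u u' d y) : D.v i ≠ D.v j :=
  fun he => h.i_ne (hD.v_inj i h.i_lt j h.j_lt he)

theorem u_ne_d (h : D.Config i j u u' d y) : u ≠ d := by
  rintro rfl
  exact h.not_cen_d (.inl h.deg_u.ge)

theorem u'_ne_d (h : D.Config i j u u' d y) : u' ≠ d := by
  rintro rfl
  exact h.not_cen_d (.inl h.deg_u'.ge)

theorem nbr_j (hD : D.Valid) (h : D.Config i j u u' d y) {z : ℕ} (hz : D.Adj (D.v j) z) :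
    z = u ∨ z = d :=
  hD.nbr_two (h.nf j h.j_lt).1.le h.adj_ju h.adj_jd hz h.u_ne_d

theorem not_adj (hD : D.Valid) (h : D.Config i j u u' d y) : ¬ D.Adj (D.v i) (D.v j) := by
  intro hA
  rcases h.nbr_j hD hA.symm with he | he
  · exact h.ne_v h.deg_u h.i_lt he.symm
  · exact not_cen_ne_v h.not_cen_d h.i_lt he.symm

theorem reach_only (hD : D.Valid) (h : D.Config i j u u' d y) {x : ℕ} (hx : 3 ≤ D.deg x)
    {h' : ℕ} (hh : h' < D.k) (hr : D.Reach (D.v h') x) : x = u ∨ x = u' :=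
  ((h.nf h' hh).reach_two hD h.deg_u.ge h.deg_u'.ge h.ne (h.reach h' hh).1 (h.reach h' hh).2).2
    x hx hr

/-- Here `v j` is adjacent to `u` and `v i` to `u'`, and each reaches the other vertex through one
more vertex. One colour is used both on the edge from `v i` to `t` and on the edge from `v j` to
`u`. The edge from `t` to `u` then loses the same colour at both ends, so it is in `Fr`; `u` needs
no matching edge any more and `u'` is the only vertex with a deficit. -/
theorem exists_pre_cross (hD : D.Valid) (h : D.Config i j u u' d y) (cc : ℕ) {t : ℕ}
    (hiu' : D.Adj (D.v i) u') (htc : ¬ D.cen t) (hit : D.Adj (D.v i) t) (htu : D.Adj t u) :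
    ∃ p, D.IsPre p ∧ D.Full cc p := by
  obtain ⟨x, hx⟩ := h.exists_common hD
  obtain ⟨n1, ei, hei, hei1, hei2⟩ := hit
  obtain ⟨n2, ej, hej, hej1, hej2⟩ := h.adj_ju
  obtain ⟨n3, g, hg, hg1, hg2⟩ := id htu
  have hei' : ∀ z, D.inc ei z → z = D.v i ∨ z = t := fun z => inc_pair hD hei n1 hei1 hei2
  have hej' : ∀ z, D.inc ej z → z = D.v j ∨ z = u := fun z => inc_pair hD hej n2 hej1 hej2
  have htn : t ≠ u' := by
    rintro rfl
    exact htc (.inl h.deg_u'.ge)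
  have htj : ¬ D.Adj (D.v j) t := by
    intro hA
    rcases hD.nbr_two (deg_le_two_of_not_cen htc) htu hA.symm
      (⟨n1.symm, ei, hei, hei2, hei1⟩ : D.Adj t (D.v i)) n2.symm with he | he
    · exact h.ne_v h.deg_u h.i_lt he.symm
    · exact h.v_ne hD he
  obtain ⟨p, hp, pi, pj, -⟩ := exists_full_of_two hD cc h.k_eq (fun j hj => (h.nf j hj).1)
    h.i_lt h.j_lt h.i_ne hx (h.not_adj hD) hei hej hei1 hej1 (by
      intro z hz hz'
      rcases hei' z hz with rfl | rfl <;> rcases hej' _ hz' with he | he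
      · exact h.v_ne hD he
      · exact h.ne_v h.deg_u h.i_lt he.symm
      · exact not_cen_ne_v htc h.j_lt he
      · exact n3 he) (by
      intro e he f hf a b hei hfj z hez hfz
      by_cases c : z = D.v i
      · subst c
        exact h.not_adj hD ⟨h.v_ne hD, f, hf, hfz, hfj⟩
      by_cases c' : z = D.v j
      · subst c'
        exact h.not_adj hD ⟨h.v_ne hD, e, he, hei, hez⟩
      have zi : D.Adj (D.v i) z := ⟨Ne.symm c, e, he, hei, hez⟩
      have zj : D.Adj (D.v j) z := ⟨Ne.symm c', f, hf, hfj, hfz⟩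
      rcases h.nbr_j hD zj with rfl | rfl
      · exact b (hD.edge_unique hf hej n2 hfj hfz hej1 hej2)
      · rcases hD.nbr_two (h.nf i h.i_lt).1.le hiu' (⟨n1, ei, ‹_›, hei1, hei2⟩ :
          D.Adj (D.v i) t) zi htn.symm with he | he
        · exact h.u'_ne_d he.symm
        · exact htj (he ▸ h.adj_jd))
  have hn := hD.notCen_of_ne_zero fun j hj i hi h => hp.ne_zero hD hj hi h
  have pg : p g = 0 := by
    by_contra h0
    obtain ⟨-, h', hh', hgv⟩ := hp.supp g h0
    rcases inc_pair hD hg n3 hg1 hg2 hgv with he | he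
    · exact not_cen_ne_v htc hh' he.symm
    · exact h.ne_v h.deg_u hh' he.symm
  -- The colour of `ei` at `t` is the colour of `ej` at `u`.
  obtain ⟨hF, hFX⟩ := hn.fr hg pg (.inl h.deg_u.ge) n3.symm hg2 hg1 hei hei2
    (hp.ne_zero hD h.i_lt hei hei1) hej hej2 (pj.trans pi.symm)
  refine ⟨p, hp.isPre hD (hn.hall_one u' (fun hN => ?_) fun z hz hne => ?_), hp⟩
  · exact (hp.yd_bound hD h.k_eq h.nf hN).1
  · by_contra hlt
    obtain ⟨hz3, hr⟩ := (hp.yd_bound hD h.k_eq h.nf hz).2.1 (not_le.1 hlt)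
    rcases h.reach_only hD hz3.ge h.j_lt (hr j h.j_lt) with rfl | rfl
    · exact hz.2.2 g hF hFX
    · exact hne rfl

/-- In this configuration `u` is the only common neighbour of `v 0` and `v 1`, and `y` is its only
further neighbour, as `u` has degree 3. So `Ext`, which can be computed without knowing the
configuration, singles out the edge from `y` to `u'`. -/
theorem ext_iff_inc (hD : D.Valid) (h : D.Config i j u u' d y) (hiu : D.Adj (D.v i) u) (e : ℕ) :
    D.Ext e ↔ e < D.m ∧ D.inc e y ∧ D.inc e u' := by
  have hk := h.k_eq
  have hi := h.i_lt
  have hj := h.j_lt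
  have hij := h.i_ne
  have hcom : ∀ z, D.Com z ↔ D.Adj (D.v i) z ∧ D.Adj (D.v j) z := by
    intro z
    unfold Com
    have : (i = 0 ∧ j = 1) ∨ (i = 1 ∧ j = 0) := by omega
    rcases this with ⟨rfl, rfl⟩ | ⟨rfl, rfl⟩
    exacts [Iff.rfl, and_comm]
  have hv : ∀ z, (z ≠ D.v 0 ∧ z ≠ D.v 1) ↔ (z ≠ D.v i ∧ z ≠ D.v j) := by
    intro z
    have : (i = 0 ∧ j = 1) ∨ (i = 1 ∧ j = 0) := by omega
    rcases this with ⟨rfl, rfl⟩ | ⟨rfl, rfl⟩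
    exacts [Iff.rfl, and_comm]
  have hcom' : ∀ z, D.Com z ↔ z = u := by
    intro z
    rw [hcom]
    refine ⟨fun ⟨h1, h2⟩ => ?_, by rintro rfl; exact ⟨hiu, h.adj_ju⟩⟩
    rcases h.nbr_j hD h2 with rfl | rfl
    · rfl
    · rcases hD.nbr_two (deg_le_two_of_not_cen h.not_cen_d) h.adj_du' h.adj_jd.symm h1.symm
        (h.ne_v h.deg_u' h.j_lt) with he | he
      · exact absurd he.symm (h.ne_v h.deg_u' h.i_lt)
      · exact absurd he (h.v_ne hD)
  have hnb : ∀ z, D.NbCom z ↔ z = y := by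
    intro z
    constructor
    · rintro ⟨z0, z1, w, hw, hwz⟩
      obtain rfl : w = u := (hcom' w).1 hw
      obtain ⟨zi, zj⟩ := (hv z).1 ⟨z0, z1⟩
      by_contra hzy
      obtain ⟨-, e1, he1, a1, b1⟩ := id hwz
      obtain ⟨-, e2, he2, a2, b2⟩ := h.adj_uy
      obtain ⟨n3, e3, he3, a3, b3⟩ := hiu.symm
      obtain ⟨n4, e4, he4, a4, b4⟩ := h.adj_ju.symm
      have yi := not_cen_ne_v h.not_cen_y h.i_lt
      have yj := not_cen_ne_v h.not_cen_y h.j_lt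
      have wz : w ≠ z := hwz.1
      have wy : w ≠ y := h.adj_uy.1
      have key : ∀ {e f s t : ℕ}, e < D.m → s ≠ t → w ≠ s → w ≠ t → D.inc e w → D.inc e s →
          D.inc f t → e ≠ f := by
        rintro e f s t he hst hxs hxt a1 a2 a3 rfl
        have := inc_pair hD he hxs a1 a2 a3
        omega
      -- A further neighbour `z` would be the fourth one of `w`.
      have : ({e1, e2, e3, e4} : Finset ℕ) ⊆ (range D.m).filter (fun i => D.inc i w) := by
        intro e he
        simp only [mem_insert, mem_singleton] at he
        rcases he with rfl | rfl | rfl | rfl <;> simp only [mem_filter, mem_range]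
        exacts [⟨he1, a1⟩, ⟨he2, a2⟩, ⟨he3, a3⟩, ⟨he4, a4⟩]
      have := card_le_card this
      rw [card_insert_of_notMem, card_eq_three.2 ⟨e2, e3, e4, ?_, ?_, ?_, rfl⟩] at this
      · have h3 := h.deg_u
        unfold deg at h3
        omega
      · exact key he2 yi wy n3 a2 b2 b3
      · exact key he2 yj wy n4 a2 b2 b4
      · exact key he3 (h.v_ne hD) n3 n4 a3 b3 b4
      · simp only [mem_insert, mem_singleton, not_or]
        exact ⟨key he1 hzy wz wy a1 b1 b2, key he1 zi wz n3 a1 b1 b3,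
          key he1 zj wz n4 a1 b1 b4⟩
    · rintro rfl
      obtain ⟨h1, h2⟩ := (hv z).2 ⟨not_cen_ne_v h.not_cen_y h.i_lt,
        not_cen_ne_v h.not_cen_y h.j_lt⟩
      exact ⟨h1, h2, u, (hcom' u).2 rfl, h.adj_uy⟩
  rw [ext_iff]
  constructor
  · rintro ⟨he, z, w, hz, hw, hzw, h1, h2⟩
    have := (hnb z).1 h1
    subst this
    rw [hcom'] at h2
    refine ⟨he, hz, ?_⟩
    have hne : z ≠ w := by
      have := hD.ne e he
      rcases hzw with ⟨rfl, rfl⟩ | ⟨rfl, rfl⟩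
      exacts [this, this.symm]
    rcases hD.nbr_two (deg_le_two_of_not_cen h.not_cen_y) h.adj_uy.symm h.adj_u'y.symm
      (⟨hne, e, he, hz, hw⟩ : D.Adj z w) h.ne with rfl | rfl
    · exact absurd rfl h2
    · exact hw
  · rintro ⟨he, h1, h2⟩
    refine ⟨he, y, u', h1, h2, ?_, (hnb y).2 rfl, fun h3 => h.ne ((hcom' u').1 h3).symm⟩
    have := h.adj_u'y.1
    rcases h1 with h1 | h1 <;> rcases h2 with h2 | h2
    · omega
    · exact .inl ⟨h1, h2⟩
    · exact .inr ⟨h2, h1⟩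
    · omega

/-- The same colour `x` is put on the edges from `v i` to `u`, from `v j` to `d`, and from `y` to
`u'`. This makes the edge from `u` to `y` and the edge from `d` to `u'` members of `Fr`, so neither
`u` nor `u'` needs a matching edge, and the other vertices lose nothing. -/
theorem exists_pre_ext (hD : D.Valid) (h : D.Config i j u u' d y) (cc : ℕ)
    (hiu : D.Adj (D.v i) u) :
    ∃ p x, x ∈ (D.l 0).take 3 ∧ D.Full cc p ∧ D.IsPre (fun i => if D.Ext i then x else p i) := by
  have hk := h.k_eq
  obtain ⟨x, hx⟩ := h.exists_common hD
  have hx0 : x ≠ 0 := by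
    have := hD.l_mem i h.i_lt x (mem_of_take (hx i h.i_lt))
    omega
  have hxs : x ≤ D.s := (hD.l_mem i h.i_lt x (mem_of_take (hx i h.i_lt))).2
  obtain ⟨n1, ei, hei, hei1, hei2⟩ := id hiu
  obtain ⟨n2, ej, hej, hej1, hej2⟩ := h.adj_jd
  obtain ⟨n3, g, hg, hg1, hg2⟩ := id h.adj_uy
  obtain ⟨n4, g', hg', hg1', hg2'⟩ := id h.adj_u'y
  obtain ⟨n5, f, hf, hf1, hf2⟩ := id h.adj_du'
  have hei' : ∀ z, D.inc ei z → z = D.v i ∨ z = u := fun z => inc_pair hD hei n1 hei1 hei2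
  have hej' : ∀ z, D.inc ej z → z = D.v j ∨ z = d := fun z => inc_pair hD hej n2 hej1 hej2
  have yv : ∀ h' < D.k, y ≠ D.v h' := fun h' => not_cen_ne_v h.not_cen_y
  have dv : ∀ h' < D.k, d ≠ D.v h' := fun h' => not_cen_ne_v h.not_cen_d
  obtain ⟨p, hp, pi, pj, px⟩ := exists_full_of_two hD cc h.k_eq (fun j hj => (h.nf j hj).1)
    h.i_lt h.j_lt h.i_ne hx (h.not_adj hD) hei hej hei1 hej1 (by
      intro z hz hz'
      rcases hei' z hz with rfl | rfl <;> rcases hej' _ hz' with he | he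
      · exact h.v_ne hD he
      · exact dv i h.i_lt he.symm
      · exact h.ne_v h.deg_u h.j_lt he
      · exact h.u_ne_d he) (by
      intro e he f hf a b hei0 hfj z hez hfz
      by_cases c : z = D.v i
      · subst c
        exact h.not_adj hD ⟨h.v_ne hD, f, hf, hfz, hfj⟩
      by_cases c' : z = D.v j
      · subst c'
        exact h.not_adj hD ⟨h.v_ne hD, e, he, hei0, hez⟩
      have zj : D.Adj (D.v j) z := ⟨Ne.symm c', f, hf, hfj, hfz⟩
      rcases h.nbr_j hD zj with rfl | rfl
      · exact a (hD.edge_unique he hei n1 hei0 hez hei1 hei2)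
      · exact b (hD.edge_unique hf hej n2 hfj hfz hej1 hej2))
  refine ⟨p, x, hx 0 (by omega), hp, ?_⟩
  have hext : ∀ e, D.Ext e ↔ e = g' := by
    intro e
    rw [h.ext_iff_inc hD hiu]
    constructor
    · rintro ⟨he, h1, h2⟩
      exact hD.edge_unique he hg' n4 h2 h1 hg1' hg2'
    · rintro rfl
      exact ⟨hg', hg2', hg1'⟩
  simp only [hext]
  set q : ℕ → ℕ := fun i => if i = g' then x else p i with hq
  have hg'v : ∀ h' < D.k, ¬ D.inc g' (D.v h') := by
    intro h' hh hi
    rcases inc_pair hD hg' n4 hg1' hg2' hi with he | he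
    · exact h.ne_v h.deg_u' hh he.symm
    · exact yv h' hh he.symm
  have qg : q g' = x := by simp [hq]
  have qp : ∀ e, e ≠ g' → q e = p e := fun e he => by simp [hq, he]
  have qv : ∀ h' < D.k, ∀ e, D.inc e (D.v h') → q e = p e := fun h' hh e he =>
    qp e (by rintro rfl; exact hg'v h' hh he)
  have hfull : ∀ j < D.k, ∀ i < D.m, D.inc i (D.v j) → q i ≠ 0 := fun j hj i hi hij => by
    rw [qv j hj i hij]
    exact hp.ne_zero hD hj hi hij
  have hn := hD.notCen_of_ne_zero hfull
  have pv : ∀ e, p e ≠ 0 → ∃ h' < D.k, D.inc e (D.v h') := fun e he => (hp.supp e he).2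
  have q0 : ∀ e r s, e < D.m → r ≠ s → D.inc e r → D.inc e s → e ≠ g' →
      (∀ h' < D.k, r ≠ D.v h') → (∀ h' < D.k, s ≠ D.v h') → q e = 0 := by
    intro e r s he hrs h1 h2 h3 h4 h5
    rw [qp e h3]
    by_contra h0
    obtain ⟨h', hh, hi⟩ := pv e h0
    rcases inc_pair hD he hrs h1 h2 hi with h6 | h6
    · exact h4 h' hh h6.symm
    · exact h5 h' hh h6.symm
  have uv : ∀ h' < D.k, u ≠ D.v h' := fun h' hh => h.ne_v h.deg_u hh
  have uv' : ∀ h' < D.k, u' ≠ D.v h' := fun h' hh => h.ne_v h.deg_u' hh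
  have gg : g ≠ g' := by
    rintro rfl
    rcases inc_pair hD hg n3 hg1 hg2 hg1' with he | he
    · exact h.ne he.symm
    · exact n4 he
  have fg : f ≠ g' := by
    rintro rfl
    rcases inc_pair hD hf n5 hf1 hf2 hg2' with he | he
    · subst he
      rcases hD.nbr_two (deg_le_two_of_not_cen h.not_cen_y) h.adj_uy.symm h.adj_u'y.symm
        h.adj_jd.symm h.ne with h' | h'
      · exact uv j h.j_lt h'.symm
      · exact uv' j h.j_lt h'.symm
    · exact n4 he.symm
  have eig : ei ≠ g' := by rintro rfl; exact hg'v i h.i_lt hei1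
  have ejg : ej ≠ g' := by rintro rfl; exact hg'v j h.j_lt hej1
  have qi : q ei = x := by rw [qp _ eig, pi]
  have qj : q ej = x := by rw [qp _ ejg, pj]
  -- The colour `x` occurs at `u` on `ei` and at `y` on `g'`, which frees `g`; it occurs at `u'` on
  -- `g'` and at `d` on `ej`, which frees `f`.
  obtain ⟨hF, hFX⟩ := hn.fr hg (q0 g u y hg n3 hg1 hg2 gg uv yv) (.inl h.deg_u.ge) n3 hg1 hg2
    hg' hg2' (by rw [qg]; exact hx0) hei hei2 (qi.trans qg.symm)
  obtain ⟨hF', hFX'⟩ := hn.fr hf (q0 f d u' hf n5 hf1 hf2 fg dv uv') (.inl h.deg_u'.ge) n5.symm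
    hf2 hf1 hej hej2 (by rw [qj]; exact hx0) hg' hg1' (qg.trans qj.symm)
  -- The edge `g'` meets neither of the other two edges of colour `x`.
  have hug : ∀ z, D.inc g' z → ∀ e < D.m, D.inc e z → e ≠ g' → q e ≠ 0 → q e ≠ x := by
    intro z hz e he hez hne h0 hqx
    rw [qp e hne] at hqx
    rcases px e hqx with rfl | rfl <;> rcases inc_pair hD hg' n4 hg1' hg2' hz with rfl | rfl
    · rcases hei' _ hez with h6 | h6
      exacts [uv' _ h.i_lt h6, h.ne h6.symm]
    · rcases hei' _ hez with h6 | h6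
      exacts [yv _ h.i_lt h6, n3 h6.symm]
    · rcases hej' _ hez with h6 | h6
      exacts [uv' _ h.j_lt h6, n5 h6.symm]
    · rcases hej' _ hez with h6 | h6
      · exact yv _ h.j_lt h6
      · subst h6
        rcases hD.nbr_two (deg_le_two_of_not_cen h.not_cen_y) h.adj_uy.symm h.adj_u'y.symm
          h.adj_jd.symm h.ne with h' | h'
        · exact uv j h.j_lt h'.symm
        · exact uv' j h.j_lt h'.symm
  refine isPre_mk hD hn ?_ ?_ ?_ (hn.hall_one D.n (fun h => absurd (h.lt hD) (by omega)) ?_)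
  · intro e he h0
    by_cases hc : e = g'
    · right; rw [hc, qg]; exact hxs
    · rw [qp e hc] at h0 ⊢
      obtain ⟨h', hh, hi⟩ := pv e h0
      exact .inl ⟨h', hh, hi, (hp.code h' hh e he hi).2⟩
  · intro e he h0 h' hh hi
    rw [qv h' hh e hi]
    exact (hp.code h' hh e he hi).2
  · intro e he e' he' hne z hz hz' h0 h0'
    by_cases hc : e = g'
    · subst hc
      rw [qg]
      exact (hug z hz e' he' hz' hne.symm h0').symm
    · by_cases hc' : e' = g'
      · subst hc'
        rw [qg]
        exact hug z hz' e he hz hc h0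
      · rw [qp e hc, qp e' hc'] at *
        exact hp.proper e he e' he' hne z hz hz' h0 h0'
  · intro z hz _
    have hz3 := hz.three_le hfull
    have hzu : z ≠ u ∧ z ≠ u' := by
      refine ⟨?_, ?_⟩
      · rintro rfl; exact hz.2.2 g hF hFX
      · rintro rfl; exact hz.2.2 f hF' hFX'
    -- Edges at the listed vertices reach only `u` and `u'` among the vertices of degree at least 3;
    -- the additional edge `g'` affects only `u'` and, through `y`, `u`.
    have hcon : D.con q z = ∅ := by
      rw [eq_empty_iff_forall_notMem]
      intro e he
      obtain ⟨hem, hez, e', he', h0, hcase⟩ := con_cases he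
      by_cases hc : e' = g'
      · subst hc
        rcases hcase with rfl | ⟨w, hw, hew, hw'⟩
        · rcases inc_pair hD hg' n4 hg1' hg2' hez with rfl | rfl
          · exact hzu.2 rfl
          · exact h.not_cen_y hz.cen
        · have hwz : w ≠ z := by rintro rfl; exact hw hz.cen
          rcases inc_pair hD hg' n4 hg1' hg2' hw' with rfl | rfl
          · exact hw (.inl h.deg_u'.ge)
          · rcases hD.nbr_two (deg_le_two_of_not_cen hw) h.adj_uy.symm h.adj_u'y.symm
              (⟨hwz, e, hem, hew, hez⟩ : D.Adj w z) h.ne with h' | h'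
            exacts [hzu.1 h', hzu.2 h']
      · rw [qp e' hc] at h0
        obtain ⟨h', hh, hi⟩ := pv e' h0
        have hr := (reachBy_of hh hem he' hez hi hcase).reach hz.cen (hz.ne_v hfull hh)
        rcases h.reach_only hD hz3 hh hr with h6 | h6
        exacts [hzu.1 h6, hzu.2 h6]
    have := hn.deg_le hD hz
    rw [hcon, card_empty] at this
    omega

end Config

/-! ### Choice of a precolouring in all cases -/

/-- The precolourings that the program tries. -/
def Tried (D : Data) (cc : ℕ) (p : ℕ → ℕ) : Prop :=
  ∃ p₀, D.Coded cc p₀ ∧ (p = p₀ ∨ ∃ x ∈ (D.l 0).take 3, p = fun i => if D.Ext i then x else p₀ i)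

/-- `v 0` and `v 1` are in a subgraph `K_{2,3}`. -/
def Theta (D : Data) : Prop := ∃ u u' y, u ≠ u' ∧ (∀ j < D.k, y ≠ D.v j) ∧ D.Adj u y ∧
  D.Adj u' y ∧ ∀ j < D.k, D.Adj (D.v j) u ∧ D.Adj (D.v j) u'

/-- Each `v j` is adjacent to both `u` and `u'`, or to one of them while it reaches the other
through a vertex that is no center. If both vertices are adjacent to both, then `y` completes a
theta. Otherwise one `v j` has a single direct link; the other vertex is adjacent to the same end of
it, which is the case of `exists_pre_ext`, or only to the other one, which is the case of
`exists_pre_cross`. -/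
theorem exists_pre_nf (hD : D.Valid) {cc : ℕ} (hcc : D.IsCommon cc) (hk : D.k = 2)
    (hNF : ∀ j < D.k, D.NF (D.v j)) (hθ : ¬ D.Theta) : ∃ p, D.IsPre p ∧ D.Tried cc p := by
  have hdeg : ∀ j < D.k, D.deg (D.v j) = 2 := fun j hj => (hNF j hj).1
  obtain ⟨p, hp⟩ := exists_full hD hcc hk hdeg
  rcases hp.isPre_or hD hk hNF with h | ⟨u, u', y, hne, hu, hu', hr, hy, huy, huy', hs⟩
  · exact ⟨p, h, p, hp.coded hdeg, .inl rfl⟩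
  have ext : ∀ {i j u u' d}, D.Config i j u u' d y → D.Adj (D.v i) u →
      ∃ p, D.IsPre p ∧ D.Tried cc p := by
    intro i j u u' d hC hA
    obtain ⟨p, x, hx, h1, h2⟩ := hC.exists_pre_ext hD cc hA
    exact ⟨_, h2, p, h1.coded hdeg, .inr ⟨x, hx, rfl⟩⟩
  have cross : ∀ {i j u u' d t}, D.Config i j u u' d y → D.Adj (D.v i) u' → ¬ D.cen t →
      D.Adj (D.v i) t → D.Adj t u → ∃ p, D.IsPre p ∧ D.Tried cc p := by
    intro i j u u' d t hC h1 h2 h3 h4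
    obtain ⟨p, h5, h6⟩ := hC.exists_pre_cross hD cc h1 h2 h3 h4
    exact ⟨p, h5, p, h6.coded hdeg, .inl rfl⟩
  have k0 : 0 < D.k := by omega
  have k1 : 1 < D.k := by omega
  have mk : ∀ {i j d}, i < D.k → j < D.k → i ≠ j → D.Adj (D.v j) u → ¬ D.cen d →
      D.Adj (D.v j) d → D.Adj d u' → D.Config i j u u' d y := fun h1 h2 h3 h4 h5 h6 h7 =>
    ⟨hk, hNF, h1, h2, h3, hne, hu, hu', hr, h4, h5, h6, h7, hy, huy, huy', hs⟩
  have mk' : ∀ {i j d}, i < D.k → j < D.k → i ≠ j → D.Adj (D.v j) u' → ¬ D.cen d →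
      D.Adj (D.v j) d → D.Adj d u → D.Config i j u' u d y := fun h1 h2 h3 h4 h5 h6 h7 =>
    ⟨hk, hNF, h1, h2, h3, hne.symm, hu', hu, fun j hj => (hr j hj).symm, h4, h5, h6, h7, hy,
      huy', huy, hs⟩
  have r0 := ((hNF 0 k0).reach_two hD hu.ge hu'.ge hne (hr 0 k0).1 (hr 0 k0).2).1
  have r1 := ((hNF 1 k1).reach_two hD hu.ge hu'.ge hne (hr 1 k1).1 (hr 1 k1).2).1
  rcases r0 with ⟨a, b⟩ | ⟨a, d, hd, b, c⟩ | ⟨a, d, hd, b, c⟩ <;>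
    rcases r1 with ⟨a', b'⟩ | ⟨a', d', hd', b', c'⟩ | ⟨a', d', hd', b', c'⟩
  · refine absurd ⟨u, u', y, hne, fun j hj => Config.not_cen_ne_v hy hj, huy, huy',
      fun j hj => ?_⟩ hθ
    have : j = 0 ∨ j = 1 := by omega
    rcases this with rfl | rfl
    exacts [⟨a, b⟩, ⟨a', b'⟩]
  · exact ext (mk k0 k1 (by omega) a' hd' b' c') a
  · exact ext (mk' k0 k1 (by omega) a' hd' b' c') b
  · exact ext (mk k1 k0 (by omega) a hd b c) a'
  · exact ext (mk k1 k0 (by omega) a hd b c) a'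
  · exact cross (mk k1 k0 (by omega) a hd b c) a' hd' b' c'
  · exact ext (mk' k1 k0 (by omega) a hd b c) b'
  · exact cross (mk' k1 k0 (by omega) a hd b c) a' hd' b' c'
  · exact ext (mk' k1 k0 (by omega) a hd b c) a'

/-- The hypotheses about the vertices with lists. -/
def Cases (D : Data) : Prop :=
  (D.k = 3 ∧ D.InRing ∧ 3 ≤ ((range 3).biUnion fun j => (D.l j).toFinset).card) ∨
  ((∀ i < D.k, ∀ j < D.k, D.NF (D.v i) → D.NF (D.v j) → i = j) ∧ (D.k = 3 → ¬ D.InRing) ∧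
    (D.k = 3 → ∀ w < D.k, D.NF (D.v w) → ∀ i < D.k, ∀ j < D.k, i ≠ w → j ≠ w →
      ¬ D.Adj (D.v i) (D.v j))) ∨
  (D.k = 2 ∧ ((∀ j < D.k, D.deg (D.v j) = 2) → ¬ D.Theta))

/-- Apart from rings with three listed vertices of degree 2 and from pairs of non-free vertices, the
hypotheses reduce to at most one non-free vertex of degree 2, which is the situation of `main`. -/
theorem exists_pre (hD : D.Valid) (hC : D.Cases) {cc : ℕ} (hcc : D.IsCommon cc) :
    ∃ p, D.IsPre p ∧ D.Tried cc p := by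
  have lift : (∃ p, D.IsPre p ∧ D.Coded cc p) → ∃ p, D.IsPre p ∧ D.Tried cc p :=
    fun ⟨p, h1, h2⟩ => ⟨p, h1, p, h2, .inl rfl⟩
  have main : (∀ i < D.k, ∀ j < D.k, D.NF (D.v i) → D.NF (D.v j) → i = j) →
      (D.k = 3 → (∀ j < D.k, D.deg (D.v j) = 2) → ¬ D.InRing) →
      (D.k = 3 → ∀ w < D.k, D.NF (D.v w) → ∀ i < D.k, ∀ j < D.k, i ≠ w → j ≠ w →
        ¬ D.Adj (D.v i) (D.v j)) → ∃ p, D.IsPre p ∧ D.Tried cc p := by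
    intro h1 h2 h3
    apply lift
    by_cases hw : ∃ w < D.k, D.NF (D.v w)
    · obtain ⟨w, hw, hN⟩ := hw
      refine exists_pre_one hD hcc hw hN (fun j hj hne hN' => hne (h1 j hj w hw hN' hN)) ?_
      intro i hi j hj hiw hjw hA
      have hij : i ≠ j := by rintro rfl; exact hA.1 rfl
      have hk := hD.k_le
      exact h3 (by omega) w hw hN i hi j hj hiw hjw hA
    · push Not at hw
      by_cases hA : ∃ i < D.k, ∃ j < D.k, D.Adj (D.v i) (D.v j)
      · obtain ⟨i, hi, j, hj, hA⟩ := hA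
        exact exists_pre_two hD hcc hw hi hj hA h2
      · push Not at hA
        exact ⟨_, exists_pre_zero hD cc hw hA⟩
  rcases hC with ⟨hk, hR, hU⟩ | ⟨h1, h2, h3⟩ | ⟨hk, hθ⟩
  · by_cases hdeg : ∀ j < D.k, D.deg (D.v j) = 2
    · exact lift (exists_pre_ring hD hcc hk hdeg hR hU)
    · -- a vertex of degree at least 3: the other two are not adjacent
      obtain ⟨z, T, hz, hadj, hbig, hT, j₁, hj₁, j₂, hj₂, j₃, hj₃, n12, n13, n23, e1, e2, e3⟩ :
          ∃ (z : Fin 5 → ℕ) (T : Fin 5), Function.Injective z ∧ (∀ i, D.Adj (z i) (z (i + 1))) ∧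
          (∀ i, D.deg (z i) ≠ 2 → i = T) ∧ (T = 0 ∨ T = 1 ∨ T = 3) ∧
          ∃ j₁ < D.k, ∃ j₂ < D.k, ∃ j₃ < D.k, j₁ ≠ j₂ ∧ j₁ ≠ j₃ ∧ j₂ ≠ j₃ ∧ z 0 = D.v j₁ ∧
            z 1 = D.v j₂ ∧ z 3 = D.v j₃ := by
        obtain ⟨z, hz, hadj, hbig, j₁, hj₁, j₂, hj₂, j₃, hj₃, n12, n13, n23, e1, e2, e3⟩ :=
          hD.ring_cases hk hR
        push Not at hdeg
        obtain ⟨j, hj, hjd⟩ := hdeg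
        obtain ⟨T, hT, hzT⟩ : ∃ T, (T = 0 ∨ T = 1 ∨ T = 3) ∧ z T = D.v j := by
          have : j = j₁ ∨ j = j₂ ∨ j = j₃ := by omega
          rcases this with rfl | rfl | rfl
          exacts [⟨0, .inl rfl, e1⟩, ⟨1, .inr (.inl rfl), e2⟩, ⟨3, .inr (.inr rfl), e3⟩]
        refine ⟨z, T, hz, hadj, fun i hi => hbig i T ?_ ?_, hT, j₁, hj₁, j₂, hj₂, j₃, hj₃,
          n12, n13, n23, e1, e2, e3⟩
        · exact hD.deg_ne_two (hadj i).symm hi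
        · exact hD.deg_ne_two (hadj T).symm (by rwa [hzT])
      -- On the ring only the two neighbours of the large vertex can be non-free of degree 2. With
      -- the listed vertices in positions 0, 1 and 3 this leaves at most one of them, and never the
      -- one in position 3.
      have hN : ∀ t, D.NF (z t) → t = T + 1 ∨ t + 1 = T := by
        rintro t ⟨h2, y, hA, hy⟩
        have hA' : D.Adj (z t) (z (t - 1)) := by
          have := (hadj (t - 1)).symm
          rwa [sub_add_cancel] at this
        have hne : z (t + 1) ≠ z (t - 1) := fun h => fin5_succ_ne_pred t (hz h)
        rcases hD.nbr_two h2.le (hadj t) hA' hA hne with rfl | rfl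
        · exact .inr (hbig _ hy)
        · exact .inl (by rw [← hbig _ hy, sub_add_cancel])
      have hidx : ∀ a < D.k, a = j₁ ∨ a = j₂ ∨ a = j₃ := fun a ha => by omega
      have hN3 : ¬ D.NF (D.v j₃) := by
        rw [← e3]
        intro h
        rcases hT with rfl | rfl | rfl <;> rcases hN 3 h with h | h <;> exact absurd h (by decide)
      have hN01 : D.NF (D.v j₁) → ¬ D.NF (D.v j₂) := by
        rw [← e1, ← e2]
        intro h h'
        rcases hT with rfl | rfl | rfl <;> rcases hN 0 h with h | h <;>
          first
          | exact absurd h (by decide)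
          | (rcases hN 1 h' with h | h <;> exact absurd h (by decide))
      have hA12 : D.Adj (D.v j₁) (D.v j₂) := by rw [← e1, ← e2]; exact hadj 0
      refine main ?_ (fun _ h => absurd h hdeg) ?_
      · intro a ha b hb hNa hNb
        rcases hidx a ha with rfl | rfl | rfl <;> rcases hidx b hb with rfl | rfl | rfl <;>
          first
          | rfl
          | exact absurd hNa hN3
          | exact absurd hNb hN3
          | exact absurd hNb (hN01 hNa)
          | exact absurd hNa (hN01 hNb)
      · intro _ w hw hNw a ha b hb haw hbw hA
        have hab : a ≠ b := by rintro rfl; exact hA.1 rfl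
        -- The vertex in position 3 is adjacent to no other listed vertex, since positions 0 and 1
        -- are adjacent and there is no path of three.
        have key : ∀ a < D.k, ∀ b < D.k, a ≠ w → b ≠ w → a ≠ j₃ → b = j₃ →
            ¬ D.Adj (D.v a) (D.v b) := by
          rintro a ha b hb haw hbw ha3 rfl hA
          rcases hidx a ha with rfl | rfl | rfl
          · exact hD.no_path j₂ hj₂ a ha b hb n23 hA12.symm hA
          · exact hD.no_path j₁ hj₁ a ha b hb n13 hA12 hA
          · exact ha3 rfl
        have hw3 : w ≠ j₃ := by rintro rfl; exact hN3 hNw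
        by_cases h3 : b = j₃
        · exact key a ha b hb haw hbw (by omega) h3 hA
        · exact key b hb a ha hbw haw h3 (by omega) hA.symm
  · exact main h1 (fun hk _ => h2 hk) h3
  · by_cases hN : ∀ j < D.k, D.NF (D.v j)
    · exact exists_pre_nf hD hcc hk hN (hθ fun j hj => (hN j hj).1)
    · push Not at hN
      obtain ⟨j, hj, hjN⟩ := hN
      refine main ?_ (fun h => by omega) (fun h => by omega)
      intro a ha b hb hNa hNb
      have h1 : a ≠ j := by rintro rfl; exact hjN hNa
      have h2 : b ≠ j := by rintro rfl; exact hjN hNb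
      omega

end Data

/-! ## Bulk operations with truth values -/

namespace RAM

namespace Expr

/-- The expression is true. -/
def T (e : Expr) (σ : State) : Prop := e.eval σ ≠ 0

/-- Negation. -/
def neg (e : Expr) : Expr := .eq e (.const 0)

/-- Truth value. -/
def tr (e : Expr) : Expr := .lt (.const 0) e

theorem T_mul {p q : Expr} {σ : State} : (mul p q).T σ ↔ p.T σ ∧ q.T σ := by
  simp [T, eval]

theorem T_add {p q : Expr} {σ : State} : (add p q).T σ ↔ p.T σ ∨ q.T σ := by
  simp only [T, eval]; omega

theorem T_lt {p q : Expr} {σ : State} : (lt p q).T σ ↔ p.eval σ < q.eval σ := by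
  simp [T, eval]

theorem T_eq {p q : Expr} {σ : State} : (eq p q).T σ ↔ p.eval σ = q.eval σ := by
  simp [T, eval]

theorem T_neg {p : Expr} {σ : State} : p.neg.T σ ↔ ¬ p.T σ := by
  simp only [T, neg, eval]
  split_ifs <;> simp_all

theorem T_load {a : ℕ} {p : Expr} {σ : State} : (load a p).T σ ↔ σ.arr a (p.eval σ) ≠ 0 := Iff.rfl

theorem T_var {x : ℕ} {σ : State} : (var x).T σ ↔ σ.var x ≠ 0 := Iff.rfl

theorem T_one {σ : State} : (const 1).T σ ↔ True := by simp [T, eval]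

theorem tr_eval {p : Expr} {σ : State} : p.tr.eval σ ≠ 0 ↔ p.T σ := by
  simp [T, tr, eval, Nat.pos_iff_ne_zero]

theorem eval_load {a : ℕ} {p : Expr} {σ : State} : (load a p).eval σ = σ.arr a (p.eval σ) := rfl

theorem eval_var {x : ℕ} {σ : State} : (var x).eval σ = σ.var x := rfl

theorem eval_const {a : ℕ} {σ : State} : (const a).eval σ = a := rfl

theorem eval_setVar_clear {i a : ℕ} {σ τ : State} (hv : ∀ y, y ≠ i → τ.var y = σ.var y)
    (ha : ∀ b, b ≠ a → τ.arr b = σ.arr b) (p : Expr) (hp : p.noArr a) (j : ℕ) :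
    p.eval (τ.setVar i j) = p.eval (σ.setVar i j) := by
  refine eval_congr_arr (σ := τ.setVar i j) (τ := σ.setVar i j) ?_ ha p hp
  funext y
  rw [State.setVar_var, State.setVar_var]
  split_ifs with h
  · rfl
  · exact hv y h

end Expr

open RAM.Expr

namespace Cmd

/-- For `i < b`: store `val` in cell `i` of array `a`. -/
def fill (i b a : ℕ) (val : Expr) : Cmd := scatter i b a (.const 1) (.var i) val

/-- Mark in array `a`, of length `nb`, the cells `idx` for the `i < b` that satisfy `cnd`. -/
def mark (i b nb a : ℕ) (cnd idx : Expr) : Cmd :=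
  seq (fill i nb a (.const 0)) (scatter i b a cnd idx (.const 1))

/-- The same with two conditions and cells for each `i`. -/
def mark₂ (i b nb a : ℕ) (cnd idx cnd' idx' : Expr) : Cmd :=
  seq (mark i b nb a cnd idx) (scatter i b a cnd' idx' (.const 1))

/-- Count in array `a`, of length `nb`, the `i < b` that satisfy `cnd` by their cells `idx`. -/
def tally (i b nb a : ℕ) (cnd idx : Expr) : Cmd :=
  seq (fill i nb a (.const 0)) (count i b a cnd idx)

/-- Set `x` to the last `i < b` that satisfies `cnd`, and to `b` if there is none. -/
def find (i b x : ℕ) (cnd : Expr) : Cmd := seq (assign x (.var b)) (last i b x cnd)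

/-- Set `x` to 1 if there is an `i < b` that satisfies `cnd`. -/
def flag (i b x : ℕ) (cnd : Expr) : Cmd := loop i b (ite cnd (assign x (.const 1)) skip)

/-- Mark in array `a` the `i < b` for which a `j < b` satisfies `cnd`. -/
def markEx (i j b a : ℕ) (cnd : Expr) : Cmd :=
  loop i b (loop j b (ite cnd (store a (.var i) (.const 1)) skip))

theorem fill_spec {i b a : ℕ} {val : Expr} (σ : State) (hv : val.noArr a) {y : ℕ}
    (hy : y < σ.var b) : ((fill i b a val).den σ).arr a y = val.eval (σ.setVar i y) := by
  rcases den_scatter (i := i) (b := b) (cnd := .const 1) (idx := .var i) σ rfl rfl hv y with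
    ⟨j, -, -, h1, h2⟩ | ⟨h1, -⟩
  · rw [eval_var, State.setVar_var, if_pos rfl] at h1
    subst h1
    exact h2
  · refine absurd ?_ (h1 y hy one_ne_zero)
    rw [eval_var, State.setVar_var, if_pos rfl]

theorem scatter_spec {i b a : ℕ} {cnd idx val : Expr} (σ : State) (hc : cnd.noArr a)
    (hi : idx.noArr a) (hv : val.noArr a) (y : ℕ) :
    (∃ j < σ.var b, cnd.T (σ.setVar i j) ∧ idx.eval (σ.setVar i j) = y ∧
      ((scatter i b a cnd idx val).den σ).arr a y = val.eval (σ.setVar i j)) ∨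
    ((∀ j < σ.var b, cnd.T (σ.setVar i j) → idx.eval (σ.setVar i j) ≠ y) ∧
      ((scatter i b a cnd idx val).den σ).arr a y = σ.arr a y) :=
  den_scatter σ hc hi hv y

theorem scatter_one_spec {i b a : ℕ} {cnd idx : Expr} (σ : State) (hc : cnd.noArr a)
    (hi : idx.noArr a) (y : ℕ) : ((scatter i b a cnd idx (.const 1)).den σ).arr a y ≠ 0 ↔
      σ.arr a y ≠ 0 ∨ ∃ j < σ.var b, cnd.T (σ.setVar i j) ∧ idx.eval (σ.setVar i j) = y := by
  rcases den_scatter (i := i) (b := b) σ hc hi (val := .const 1) rfl y with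
    ⟨j, h1, h2, h3, h4⟩ | ⟨h1, h2⟩
  · rw [h4]
    exact ⟨fun _ => .inr ⟨j, h1, h2, h3⟩, fun _ => one_ne_zero⟩
  · rw [h2]
    refine ⟨.inl, ?_⟩
    rintro (h | ⟨j, h3, h4, h5⟩)
    exacts [h, absurd h5 (h1 j h3 h4)]

theorem mark_spec {i b nb a : ℕ} {cnd idx : Expr} (σ : State) (hc : cnd.noArr a)
    (hi : idx.noArr a) (hib : b ≠ i) {y : ℕ} (hy : y < σ.var nb) :
    ((mark i b nb a cnd idx).den σ).arr a y ≠ 0 ↔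
      ∃ j < σ.var b, cnd.T (σ.setVar i j) ∧ idx.eval (σ.setVar i j) = y := by
  rw [mark, den, scatter_one_spec _ hc hi, fill_spec σ rfl hy]
  have hv : ∀ y, y ≠ i → ((fill i nb a (.const 0)).den σ).var y = σ.var y := fun y hy =>
    den_var _ (by simp [fill, scatter, wv, hy]) σ
  have ha : ∀ c, c ≠ a → ((fill i nb a (.const 0)).den σ).arr c = σ.arr c := fun c hc =>
    den_arr _ (by simp [fill, scatter, wa, hc]) σ
  rw [hv b hib, eval_const]
  simp only [ne_eq, not_true_eq_false, false_or, T, eval_setVar_clear hv ha cnd hc,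
    eval_setVar_clear hv ha idx hi]

theorem mark₂_spec {i b nb a : ℕ} {cnd idx cnd' idx' : Expr} (σ : State) (hc : cnd.noArr a)
    (hi : idx.noArr a) (hc' : cnd'.noArr a) (hi' : idx'.noArr a) (hib : b ≠ i) {y : ℕ}
    (hy : y < σ.var nb) : ((mark₂ i b nb a cnd idx cnd' idx').den σ).arr a y ≠ 0 ↔
      ∃ j < σ.var b, (cnd.T (σ.setVar i j) ∧ idx.eval (σ.setVar i j) = y) ∨
        (cnd'.T (σ.setVar i j) ∧ idx'.eval (σ.setVar i j) = y) := by
  rw [mark₂, den, scatter_one_spec _ hc' hi', mark_spec σ hc hi hib hy]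
  have hv : ∀ y, y ≠ i → ((mark i b nb a cnd idx).den σ).var y = σ.var y := fun y hy =>
    den_var _ (by simp [mark, fill, scatter, wv, hy]) σ
  have ha : ∀ c, c ≠ a → ((mark i b nb a cnd idx).den σ).arr c = σ.arr c := fun c hc =>
    den_arr _ (by simp [mark, fill, scatter, wa, hc]) σ
  rw [hv b hib]
  simp only [T, eval_setVar_clear hv ha cnd' hc', eval_setVar_clear hv ha idx' hi']
  constructor
  · rintro (⟨j, h1, h2⟩ | ⟨j, h1, h2⟩)
    exacts [⟨j, h1, .inl h2⟩, ⟨j, h1, .inr h2⟩]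
  · rintro ⟨j, h1, h2 | h2⟩
    exacts [.inl ⟨j, h1, h2⟩, .inr ⟨j, h1, h2⟩]

open scoped Classical in
theorem count_spec {i b a : ℕ} {cnd idx : Expr} (σ : State) (hc : cnd.noArr a)
    (hi : idx.noArr a) (y : ℕ) : ((count i b a cnd idx).den σ).arr a y = σ.arr a y +
      ((Finset.range (σ.var b)).filter (fun j => cnd.T (σ.setVar i j) ∧
        idx.eval (σ.setVar i j) = y)).card := by
  rw [den_count σ hc hi]
  congr

open scoped Classical in
theorem tally_spec {i b nb a : ℕ} {cnd idx : Expr} (σ : State) (hc : cnd.noArr a)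
    (hi : idx.noArr a) (hib : b ≠ i) {y : ℕ} (hy : y < σ.var nb) :
    ((tally i b nb a cnd idx).den σ).arr a y =
      ((Finset.range (σ.var b)).filter (fun j => cnd.T (σ.setVar i j) ∧
        idx.eval (σ.setVar i j) = y)).card := by
  rw [tally, den, count_spec _ hc hi, fill_spec σ rfl hy]
  have hv : ∀ y, y ≠ i → ((fill i nb a (.const 0)).den σ).var y = σ.var y := fun y hy =>
    den_var _ (by simp [fill, scatter, wv, hy]) σ
  have ha : ∀ c, c ≠ a → ((fill i nb a (.const 0)).den σ).arr c = σ.arr c := fun c hc =>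
    den_arr _ (by simp [fill, scatter, wa, hc]) σ
  rw [hv b hib, eval_const, zero_add]
  refine congrArg Finset.card (Finset.filter_congr fun j _ => ?_)
  simp only [T, eval_setVar_clear hv ha cnd hc, eval_setVar_clear hv ha idx hi]

theorem last_spec {i b x : ℕ} {cnd : Expr} (σ : State) (hc : cnd.noVar x) (hix : i ≠ x) :
    (∃ j < σ.var b, cnd.T (σ.setVar i j) ∧ ((last i b x cnd).den σ).var x = j) ∨
    ((∀ j < σ.var b, ¬ cnd.T (σ.setVar i j)) ∧ ((last i b x cnd).den σ).var x = σ.var x) :=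
  den_last σ hc hix

theorem find_spec {i b x : ℕ} {cnd : Expr} (σ : State) (hc : cnd.noVar x) (hix : i ≠ x)
    (hbx : b ≠ x) :
    (∃ j < σ.var b, cnd.T (σ.setVar i j) ∧ ((find i b x cnd).den σ).var x = j) ∨
    ((∀ j < σ.var b, ¬ cnd.T (σ.setVar i j)) ∧ ((find i b x cnd).den σ).var x = σ.var b) := by
  have h := last_spec (i := i) (b := b) ((assign x (.var b)).den σ) hc hix
  have e1 : ((assign x (.var b)).den σ).var b = σ.var b := den_var _ (by simp [wv, hbx]) σ
  have e2 : ((assign x (.var b)).den σ).var x = σ.var b := by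
    simp [den, State.setVar_var, eval_var]
  have e3 : ∀ j, cnd.T (((assign x (.var b)).den σ).setVar i j) ↔ cnd.T (σ.setVar i j) := by
    intro j
    have : cnd.eval (((assign x (.var b)).den σ).setVar i j) = cnd.eval (σ.setVar i j) := by
      refine eval_congr_var (x := x) (σ := ((assign x (.var b)).den σ).setVar i j)
        (τ := σ.setVar i j) (fun y hy => ?_) rfl cnd hc
      rw [State.setVar_var, State.setVar_var, den_var _ (by simp [wv, hy]) σ]
    rw [T, T, this]
  simp only [e1, e2, e3] at h
  exact h

theorem flag_spec {i b x : ℕ} {cnd : Expr} (σ : State) (hc : cnd.noVar x) (hix : i ≠ x) :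
    ((flag i b x cnd).den σ).var x ≠ 0 ↔
      σ.var x ≠ 0 ∨ ∃ j < σ.var b, cnd.T (σ.setVar i j) := by
  have key := den_loop_induction i b (ite cnd (assign x (.const 1)) skip) σ
    (fun k τ => (∀ y, y ≠ x → τ.var y = (σ.setVar i k).var y) ∧ τ.arr = σ.arr ∧
      (τ.var x ≠ 0 ↔ σ.var x ≠ 0 ∨ ∃ j < k, cnd.T (σ.setVar i j)))
    ⟨fun _ _ => rfl, rfl, by rw [State.setVar_var, if_neg hix.symm]; simp⟩ ?_
  · exact key.2.2
  rintro k hk τ ⟨h1, h2, h3⟩ hki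
  have e : cnd.eval τ = cnd.eval (σ.setVar i k) := Expr.eval_congr_var h1 h2 cnd hc
  have h4 : ∀ (ρ : State), (∀ y, y ≠ x → ρ.var y = τ.var y) → ∀ y, y ≠ x →
      (ρ.setVar i (k + 1)).var y = (σ.setVar i (k + 1)).var y := by
    intro ρ hρ y hy
    rw [State.setVar_var, State.setVar_var]
    split_ifs with hyi
    · rfl
    · rw [hρ y hy, h1 y hy, State.setVar_var, if_neg hyi]
  have h5 : (∃ j < k + 1, cnd.T (σ.setVar i j)) ↔
      (∃ j < k, cnd.T (σ.setVar i j)) ∨ cnd.eval (σ.setVar i k) ≠ 0 := by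
    constructor
    · rintro ⟨j, hj, h⟩
      rcases Nat.lt_succ_iff_lt_or_eq.1 hj with hj | rfl
      exacts [.inl ⟨j, hj, h⟩, .inr h]
    · rintro (⟨j, hj, h⟩ | h)
      exacts [⟨j, by omega, h⟩, ⟨k, by omega, h⟩]
  simp only [den]
  rw [e]
  split_ifs with hcnd
  · refine ⟨h4 _ fun y hy => by rw [State.setVar_var, if_neg hy], h2, ?_⟩
    rw [State.setVar_var, if_neg hix.symm, State.setVar_var, if_pos rfl, eval_const, h5]
    exact ⟨fun _ => .inr (.inr hcnd), fun _ => one_ne_zero⟩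
  · refine ⟨h4 _ fun y hy => rfl, h2, ?_⟩
    rw [State.setVar_var, if_neg hix.symm, h3, h5]
    simp only [hcnd, or_false]

theorem markEx_spec {i j b a : ℕ} {cnd : Expr} (σ : State) (hc : cnd.noArr a) (hij : i ≠ j)
    (hbi : b ≠ i) (hbj : b ≠ j) (y : ℕ) : ((markEx i j b a cnd).den σ).arr a y ≠ 0 ↔
      σ.arr a y ≠ 0 ∨ y < σ.var b ∧ ∃ h < σ.var b, cnd.T ((σ.setVar i y).setVar j h) := by
  have inner : ∀ τ : State, (∀ z, z ≠ j → z ≠ i → τ.var z = σ.var z) →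
      (∀ c, c ≠ a → τ.arr c = σ.arr c) → ∀ z,
      ((loop j b (ite cnd (store a (.var i) (.const 1)) skip)).den τ).arr a z ≠ 0 ↔
        τ.arr a z ≠ 0 ∨ z = τ.var i ∧ ∃ h < σ.var b, cnd.T ((σ.setVar i z).setVar j h) := by
    intro τ hv ha z
    have := scatter_one_spec (i := j) (b := b) (idx := .var i) τ hc rfl z
    rw [scatter] at this
    rw [this, hv b hbj hbi]
    refine or_congr Iff.rfl ?_
    have e : ∀ h, cnd.T (τ.setVar j h) ↔ cnd.T ((σ.setVar i (τ.var i)).setVar j h) := by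
      intro h
      have : cnd.eval (τ.setVar j h) = cnd.eval ((σ.setVar i (τ.var i)).setVar j h) := by
        refine eval_congr_arr (a := a) (σ := τ.setVar j h)
          (τ := (σ.setVar i (τ.var i)).setVar j h) ?_ ha cnd hc
        funext z
        simp only [State.setVar_var]
        split_ifs with h1 h2
        · rfl
        · rw [h2]
        · exact hv z h1 h2
      rw [T, T, this]
    constructor
    · rintro ⟨h, h1, h2, h3⟩
      rw [eval_var, State.setVar_var, if_neg hij] at h3
      subst h3
      exact ⟨rfl, h, h1, (e h).1 h2⟩
    · rintro ⟨rfl, h, h1, h2⟩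
      refine ⟨h, h1, (e h).2 h2, ?_⟩
      rw [eval_var, State.setVar_var, if_neg hij]
  have key := den_loop_induction i b (loop j b (ite cnd (store a (.var i) (.const 1)) skip)) σ
    (fun k τ => (∀ z, z ≠ j → z ≠ i → τ.var z = σ.var z) ∧ (∀ c, c ≠ a → τ.arr c = σ.arr c) ∧
      (τ.arr a y ≠ 0 ↔ σ.arr a y ≠ 0 ∨
        y < k ∧ ∃ h < σ.var b, cnd.T ((σ.setVar i y).setVar j h)))
    ⟨fun z _ hz => by rw [State.setVar_var, if_neg hz], fun _ _ => rfl, by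
      simp [State.setVar_arr]⟩ ?_
  · exact key.2.2
  rintro k hk τ ⟨h1, h2, h3⟩ hki
  refine ⟨fun z hzj hzi => ?_, fun c hc => ?_, ?_⟩
  · rw [State.setVar_var, if_neg hzi, den_var _ (by simp [wv, hzj]), h1 z hzj hzi]
  · rw [State.setVar_arr, den_arr _ (by simp [wa, hc]), h2 c hc]
  · rw [State.setVar_arr, inner τ h1 h2 y, h3, hki]
    constructor
    · rintro ((h | ⟨h, h'⟩) | ⟨rfl, h⟩)
      exacts [.inl h, .inr ⟨by omega, h'⟩, .inr ⟨by omega, h⟩]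
    · rintro (h | ⟨h, h'⟩)
      · exact .inl (.inl h)
      · rcases Nat.lt_succ_iff_lt_or_eq.1 h with h | rfl
        exacts [.inl (.inr ⟨h, h'⟩), .inr ⟨rfl, h'⟩]

theorem den_ite_pos {p : Expr} {P Q : Cmd} {σ : State} (h : p.T σ) :
    (ite p P Q).den σ = P.den σ := if_pos h

theorem den_ite_neg {p : Expr} {P Q : Cmd} {σ : State} (h : ¬ p.T σ) :
    (ite p P Q).den σ = Q.den σ := if_neg h

/-- Repeat `P` for `c` times the value of variable `b`. -/
def times (P : Cmd) : ℕ → Cmd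
  | 0 => skip
  | c + 1 => seq P (times P c)

/-- The factor `c` is unrolled into the body, so the number of rounds is a multiple of a loop bound
although only `0`, `1` and `2` are loop bounds. -/
def rounds (i b c : ℕ) (P : Cmd) : Cmd := loop i b (times P c)

theorem times_spec {P : Cmd} {I : ℕ → State → Prop}
    (hs : ∀ r τ, I r τ → I (r + 1) (P.den τ)) (c : ℕ) {r : ℕ} {τ : State} (h : I r τ) :
    I (r + c) ((times P c).den τ) := by
  induction c generalizing r τ with
  | zero => exact h
  | succ c ih =>
    have := ih (hs r τ h)
    rwa [Nat.add_right_comm] at this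

theorem rounds_spec {i b c : ℕ} {P : Cmd} {σ : State} {I : ℕ → State → Prop}
    (hv : ∀ r τ w, I r τ → I r (τ.setVar i w)) (h0 : I 0 σ)
    (hs : ∀ r τ, I r τ → I (r + 1) (P.den τ)) :
    I (c * σ.var b) ((rounds i b c P).den σ) :=
  den_loop_induction i b (times P c) σ (fun r => I (c * r)) (hv _ _ _ h0)
    fun _ _ _ hτ _ => hv _ _ _ (times_spec hs c hτ)

end Cmd

end RAM

/-! ## The program -/

set_option linter.unusedSimpArgs false

namespace RAM

open RAM.Expr RAM.Cmd

/-- The variable of most loops. -/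
abbrev Expr.I : Expr := .var 10

/-- Edge `i` is incident with `x`. -/
abbrev Expr.inc (i x : Expr) : Expr := .add (.eq (.load 0 i) x) (.eq (.load 1 i) x)

/-- Execute commands one after the other. -/
def Cmd.block : List Cmd → Cmd
  | [] => .skip
  | [C] => C
  | C :: Cs => .seq C (block Cs)

/-- What is known about the memory after the preparations. -/
structure Base (D : Data) (cc : ℕ) (σ : State) : Prop where
  n : σ.var 0 = D.n
  m : σ.var 1 = D.m
  k : σ.var 2 = D.k
  s : σ.var 20 = D.s
  cc : σ.var 21 = cc
  a : ∀ i < D.m, σ.arr 0 i = D.a i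
  b : ∀ i < D.m, σ.arr 1 i = D.b i
  v : ∀ j, σ.arr 2 j = D.v j
  l : ∀ j < 3, ∀ i < (D.l j).length, σ.arr (4 + j) i = (D.l j).getD i 0
  lm : ∀ j < 3, ∀ c, σ.arr (27 + j) c ≠ 0 ↔ c ∈ D.l j
  inS : ∀ x < D.n, σ.arr 11 x ≠ 0 ↔ D.S x
  cen : ∀ x < D.n, σ.arr 12 x ≠ 0 ↔ D.cen x
  X : ∀ i < D.m, σ.arr 14 i = D.X i
  Y : ∀ i < D.m, σ.arr 15 i = D.Y i
  sl : ∀ x < D.n, σ.arr 31 x ≠ 0 ↔ D.sl x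
  slot : ∀ j < D.k, D.deg (D.v j) = 2 → ∀ i < D.m,
    D.inc i (D.v j) ↔ i = σ.var (40 + 2 * j) ∨ i = σ.var (40 + (2 * j + 1))

def baseVars : List ℕ := [0, 1, 2, 20, 21, 40, 41, 42, 43, 44, 45]

def baseArrs : List ℕ := [0, 1, 2, 4, 5, 6, 27, 28, 29, 11, 12, 14, 15, 31]

/-- Neither the variables `xs` nor the arrays `as` are written. -/
def Cmd.keeps (xs as : List ℕ) (C : Cmd) : Bool :=
  xs.all (fun x => decide (x ∉ C.wv)) && as.all (fun a => decide (a ∉ C.wa))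

theorem Cmd.keeps_iff {xs as : List ℕ} {C : Cmd} :
    C.keeps xs as ↔ (∀ x ∈ xs, x ∉ C.wv) ∧ ∀ a ∈ as, a ∉ C.wa := by
  simp [keeps]

theorem Cmd.keeps_var {xs as : List ℕ} {C : Cmd} (h : C.keeps xs as) (σ : State) (x : ℕ)
    (hx : x ∈ xs) : (C.den σ).var x = σ.var x := C.den_var ((keeps_iff.1 h).1 x hx) σ

theorem Cmd.keeps_arr {xs as : List ℕ} {C : Cmd} (h : C.keeps xs as) (σ : State) (a : ℕ)
    (ha : a ∈ as) : (C.den σ).arr a = σ.arr a := C.den_arr ((keeps_iff.1 h).2 a ha) σ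

variable {D : Data} {cc : ℕ} {σ : State}

theorem Base.congr (hk : D.k ≤ 3) (h : Base D cc σ) {τ : State}
    (hv : ∀ x ∈ baseVars, τ.var x = σ.var x) (ha : ∀ a ∈ baseArrs, τ.arr a = σ.arr a) :
    Base D cc τ where
  n := (hv 0 (by decide)).trans h.n
  m := (hv 1 (by decide)).trans h.m
  k := (hv 2 (by decide)).trans h.k
  s := (hv 20 (by decide)).trans h.s
  cc := (hv 21 (by decide)).trans h.cc
  a i hi := by rw [ha 0 (by decide)]; exact h.a i hi
  b i hi := by rw [ha 1 (by decide)]; exact h.b i hi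
  v j := by rw [ha 2 (by decide)]; exact h.v j
  l j hj i hi := by
    rw [ha (4 + j) (by interval_cases j <;> decide)]; exact h.l j hj i hi
  lm j hj c := by
    rw [ha (27 + j) (by interval_cases j <;> decide)]; exact h.lm j hj c
  inS x hx := by rw [ha 11 (by decide)]; exact h.inS x hx
  cen x hx := by rw [ha 12 (by decide)]; exact h.cen x hx
  X i hi := by rw [ha 14 (by decide)]; exact h.X i hi
  Y i hi := by rw [ha 15 (by decide)]; exact h.Y i hi
  sl x hx := by rw [ha 31 (by decide)]; exact h.sl x hx
  slot j hj hd i hi := by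
    have hj3 : j < 3 := by omega
    rw [hv (40 + 2 * j) (by interval_cases j <;> decide),
      hv (40 + (2 * j + 1)) (by interval_cases j <;> decide)]
    exact h.slot j hj hd i hi

/-- `keeps` is a computation on the text of a command, so that each use of this lemma is settled by
evaluation. -/
theorem Base.den (hk : D.k ≤ 3) (h : Base D cc σ) {C : Cmd} (hC : C.keeps baseVars baseArrs) :
    Base D cc (C.den σ) :=
  h.congr hk (fun x hx => keeps_var hC σ x hx) fun a ha => keeps_arr hC σ a ha

/-- What is known about the memory after the preparations for a precolouring `p`. -/
structure Mid (D : Data) (cc : ℕ) (p : ℕ → ℕ) (σ : State) : Prop extends Base D cc σ where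
  pre : ∀ i < D.m, σ.arr 13 i = p i
  R : ∀ i < D.m, σ.arr 16 i ≠ 0 ↔ D.R p i
  Fr : ∀ i < D.m, σ.arr 17 i ≠ 0 ↔ D.Fr p i
  RY : ∀ i < D.m, σ.arr 32 i ≠ 0 ↔ D.RY p i

theorem Mid.den (hk : D.k ≤ 3) {p : ℕ → ℕ} (h : Mid D cc p σ) {C : Cmd}
    (hC : C.keeps baseVars (13 :: 16 :: 17 :: 32 :: baseArrs)) : Mid D cc p (C.den σ) where
  toBase := h.toBase.congr hk (fun x hx => keeps_var hC σ x hx) fun a ha => keeps_arr hC σ a (by simp [ha])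
  pre i hi := by rw [keeps_arr hC σ 13 (by decide)]; exact h.pre i hi
  R i hi := by rw [keeps_arr hC σ 16 (by decide)]; exact h.R i hi
  Fr i hi := by rw [keeps_arr hC σ 17 (by decide)]; exact h.Fr i hi
  RY i hi := by rw [keeps_arr hC σ 32 (by decide)]; exact h.RY i hi

/-! ### The matching -/

def markSat : Cmd := mark 10 1 0 21 (load 18 I) (load 14 I)

def markTaken : Cmd := mark 10 1 0 22 (load 18 I) (load 15 I)

def fillAv : Cmd := fill 10 1 24 (tr (mul (load 32 I) (mul (neg (load 31 (load 14 I)))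
  (mul (neg (load 21 (load 14 I))) (neg (load 22 (load 15 I)))))))

def tallyAv : Cmd := tally 10 1 0 25 (load 24 I) (load 14 I)

def findAv : Cmd := find 10 1 23 (load 24 I)

def lastAvOne : Cmd := last 10 1 23 (mul (load 24 I) (eq (load 25 (load 14 I)) (const 1)))

def lastFree : Cmd := last 10 1 23 (mul (load 17 I) (mul (neg (load 31 (load 14 I)))
  (neg (load 21 (load 14 I)))))

def addEdge : Cmd := ite (lt (var 23) (var 1)) (store 18 (var 23) (const 1)) skip

/-- The three searches write the same variable, and the later ones only if they succeed: an edge of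
`Fr` overrides an edge that is alone at its left end, and this one overrides an arbitrary available
edge. If all fail, the value is `m` and `addEdge` does nothing. -/
def peelRound : Cmd :=
  block [markSat, markTaken, fillAv, tallyAv, findAv, lastAvOne, lastFree, addEdge]

/-- The set of edges marked in array `a`. -/
def marked (D : Data) (a : ℕ) (σ : State) (i : ℕ) : Prop := i < D.m ∧ σ.arr a i ≠ 0

open scoped Classical in
theorem peelRound_spec (hD : D.Valid) {p : ℕ → ℕ} (h : Mid D cc p σ) :
    Mid D cc p (peelRound.den σ) ∧
      Peel.Step D.m D.X D.Y (D.RY p) (D.Fr p) D.sl (marked D 18 σ)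
        (marked D 18 (peelRound.den σ)) := by
  have hk := hD.k_le
  have hX : ∀ i < D.m, D.X i < D.n := fun i hi => hD.lt_of_inc hi (Data.inc_X i)
  have hY : ∀ i < D.m, D.Y i < D.n := fun i hi => hD.lt_of_inc hi (Data.inc_Y i)
  set E := marked D 18 σ with hE
  obtain ⟨σ1, d1⟩ : ∃ τ, τ = markSat.den σ := ⟨_, rfl⟩
  have h1 : Mid D cc p σ1 := d1 ▸ h.den hk (by decide)
  have s1 : ∀ x < D.n, σ1.arr 21 x ≠ 0 ↔ ∃ j, E j ∧ D.X j = x := by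
    intro x hx
    rw [d1, markSat, mark_spec σ rfl rfl (by decide) (by rw [h.n]; exact hx), h.m]
    simp only [T_mul, T_add, T_lt, T_eq, T_neg, T_load, T_var, eval_load, eval_var, eval_const,
      State.setVar_var, State.setVar_arr, ↓reduceIte]
    constructor
    · rintro ⟨j, hj, h2, h3⟩
      exact ⟨j, ⟨hj, h2⟩, by rw [← h.X j hj]; exact h3⟩
    · rintro ⟨j, ⟨hj, h2⟩, h3⟩
      exact ⟨j, hj, h2, by rw [h.X j hj]; exact h3⟩
  have E1 : σ1.arr 18 = σ.arr 18 := d1 ▸ den_arr _ (by decide) σ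
  obtain ⟨σ2, d2⟩ : ∃ τ, τ = markTaken.den σ1 := ⟨_, rfl⟩
  have h2 : Mid D cc p σ2 := d2 ▸ h1.den hk (by decide)
  have s2 : ∀ x < D.n, σ2.arr 22 x ≠ 0 ↔ ∃ j, E j ∧ D.Y j = x := by
    intro x hx
    rw [d2, markTaken, mark_spec σ1 rfl rfl (by decide) (by rw [h1.n]; exact hx), h1.m]
    simp only [T_mul, T_add, T_lt, T_eq, T_neg, T_load, T_var, eval_load, eval_var, eval_const,
      State.setVar_var, State.setVar_arr, ↓reduceIte]
    rw [E1]
    constructor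
    · rintro ⟨j, hj, h2, h3⟩
      exact ⟨j, ⟨hj, h2⟩, by rw [← h1.Y j hj]; exact h3⟩
    · rintro ⟨j, ⟨hj, h2⟩, h3⟩
      exact ⟨j, hj, h2, by rw [h1.Y j hj]; exact h3⟩
  have s12 : σ2.arr 21 = σ1.arr 21 := d2 ▸ den_arr _ (by decide) σ1
  have E2 : σ2.arr 18 = σ.arr 18 := E1 ▸ d2 ▸ den_arr _ (by decide) σ1
  rw [← s12] at s1
  obtain ⟨σ3, d3⟩ : ∃ τ, τ = fillAv.den σ2 := ⟨_, rfl⟩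
  have h3 : Mid D cc p σ3 := d3 ▸ h2.den hk (by decide)
  set Av := Peel.Av D.X D.Y (D.RY p) D.sl E with hAv
  have s3 : ∀ i < D.m, σ3.arr 24 i ≠ 0 ↔ Av i := by
    intro i hi
    rw [d3, fillAv, fill_spec σ2 rfl (by rw [h2.m]; exact hi), tr_eval]
    simp only [T_mul, T_add, T_lt, T_eq, T_neg, T_load, T_var, eval_load, eval_var, eval_const,
      State.setVar_var, State.setVar_arr, ↓reduceIte]
    rw [h2.RY i hi, h2.X i hi, h2.Y i hi, h2.sl _ (hX i hi), s1 _ (hX i hi), s2 _ (hY i hi)]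
    simp only [hAv, Peel.Av, not_exists, not_and]
  have E3 : σ3.arr 18 = σ.arr 18 := E2 ▸ d3 ▸ den_arr _ (by decide) σ2
  have s13 : σ3.arr 21 = σ2.arr 21 := d3 ▸ den_arr _ (by decide) σ2
  rw [← s13] at s1
  obtain ⟨σ4, d4⟩ : ∃ τ, τ = tallyAv.den σ3 := ⟨_, rfl⟩
  have h4 : Mid D cc p σ4 := d4 ▸ h3.den hk (by decide)
  have s4 : ∀ x < D.n, σ4.arr 25 x =
      ((Finset.range D.m).filter (fun j => Av j ∧ D.X j = x)).card := by
    intro x hx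
    rw [d4, tallyAv, tally_spec σ3 rfl rfl (by decide) (by rw [h3.n]; exact hx), h3.m]
    refine congrArg Finset.card (Finset.filter_congr fun j hj => ?_)
    have hj := Finset.mem_range.1 hj
    simp only [T_mul, T_add, T_lt, T_eq, T_neg, T_load, T_var, eval_load, eval_var, eval_const,
      State.setVar_var, State.setVar_arr, ↓reduceIte]
    rw [s3 j hj, h3.X j hj]
  have E4 : σ4.arr 18 = σ.arr 18 := E3 ▸ d4 ▸ den_arr _ (by decide) σ3
  have s14 : σ4.arr 21 = σ3.arr 21 := d4 ▸ den_arr _ (by decide) σ3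
  have s34 : σ4.arr 24 = σ3.arr 24 := d4 ▸ den_arr _ (by decide) σ3
  rw [← s14] at s1
  rw [← s34] at s3
  obtain ⟨σ5, d5⟩ : ∃ τ, τ = findAv.den σ4 := ⟨_, rfl⟩
  have h5 : Mid D cc p σ5 := d5 ▸ h4.den hk (by decide)
  have s5 := find_spec (i := 10) (b := 1) (x := 23) (cnd := load 24 I) σ4 rfl (by decide)
    (by decide)
  rw [← findAv, ← d5, h4.m] at s5
  have a5 : σ5.arr = σ4.arr := funext fun a => d5 ▸ den_arr _ (by simp [findAv, find, last, wa]) σ4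
  obtain ⟨σ6, d6⟩ : ∃ τ, τ = lastAvOne.den σ5 := ⟨_, rfl⟩
  have h6 : Mid D cc p σ6 := d6 ▸ h5.den hk (by decide)
  have s6 := last_spec (i := 10) (b := 1) (x := 23) (cnd := mul (load 24 I)
    (eq (load 25 (load 14 I)) (const 1))) σ5 rfl (by decide)
  rw [← lastAvOne, ← d6, h5.m] at s6
  have a6 : σ6.arr = σ5.arr := funext fun a => d6 ▸ den_arr _ (by simp [lastAvOne, last, wa]) σ5
  obtain ⟨σ7, d7⟩ : ∃ τ, τ = lastFree.den σ6 := ⟨_, rfl⟩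
  have h7 : Mid D cc p σ7 := d7 ▸ h6.den hk (by decide)
  have s7 := last_spec (i := 10) (b := 1) (x := 23) (cnd := mul (load 17 I)
    (mul (neg (load 31 (load 14 I))) (neg (load 21 (load 14 I))))) σ6 rfl (by decide)
  rw [← lastFree, ← d7, h6.m] at s7
  have a7 : σ7.arr = σ6.arr := funext fun a => d7 ▸ den_arr _ (by simp [lastFree, last, wa]) σ6
  simp only [T_mul, T_add, T_lt, T_eq, T_neg, T_load, T_var, eval_load, eval_var, eval_const,
      State.setVar_var, State.setVar_arr, ↓reduceIte] at s5 s6 s7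
  have s5' : (∃ j < D.m, Av j ∧ σ5.var 23 = j) ∨ ((∀ j < D.m, ¬ Av j) ∧ σ5.var 23 = D.m) := by
    refine s5.imp ?_ ?_
    · rintro ⟨j, hj, h, h'⟩
      exact ⟨j, hj, (s3 j hj).1 h, h'⟩
    · rintro ⟨h, h'⟩
      exact ⟨fun j hj h'' => h j hj ((s3 j hj).2 h''), h'⟩
  set One : ℕ → Prop := fun j => Av j ∧
    ((Finset.range D.m).filter (fun i => Av i ∧ D.X i = D.X j)).card = 1 with hOne
  have c6 : ∀ j < D.m, (σ5.arr 24 j ≠ 0 ∧ σ5.arr 25 (σ5.arr 14 j) = 1 ↔ One j) := by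
    intro j hj
    rw [h5.X j hj, a5, s3 j hj, s4 _ (hX j hj)]
  have s6' : (∃ j < D.m, One j ∧ σ6.var 23 = j) ∨
      ((∀ j < D.m, ¬ One j) ∧ σ6.var 23 = σ5.var 23) := by
    refine s6.imp ?_ ?_
    · rintro ⟨j, hj, h, h'⟩
      exact ⟨j, hj, (c6 j hj).1 h, h'⟩
    · rintro ⟨h, h'⟩
      exact ⟨fun j hj h'' => h j hj ((c6 j hj).2 h''), h'⟩
  set CF := Peel.CandF D.X (D.Fr p) D.sl E with hCF
  have c7 : ∀ j < D.m, (σ6.arr 17 j ≠ 0 ∧ ¬ σ6.arr 31 (σ6.arr 14 j) ≠ 0 ∧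
      ¬ σ6.arr 21 (σ6.arr 14 j) ≠ 0 ↔ CF j) := by
    intro j hj
    rw [h6.X j hj, h6.Fr j hj, h6.sl _ (hX j hj), a6, a5, s1 _ (hX j hj)]
    simp only [hCF, Peel.CandF, not_exists, not_and]
  have s7' : (∃ j < D.m, CF j ∧ σ7.var 23 = j) ∨
      ((∀ j < D.m, ¬ CF j) ∧ σ7.var 23 = σ6.var 23) := by
    refine s7.imp ?_ ?_
    · rintro ⟨j, hj, h, h'⟩
      exact ⟨j, hj, (c7 j hj).1 h, h'⟩
    · rintro ⟨h, h'⟩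
      exact ⟨fun j hj h'' => h j hj ((c7 j hj).2 h''), h'⟩
  have hAm : ∀ j, Av j → j < D.m := fun j hj => hj.1.1.1
  have hFm : ∀ j, CF j → j < D.m := fun j hj => hj.1.1.1
  have hτ : peelRound.den σ = addEdge.den σ7 := by
    rw [d7, d6, d5, d4, d3, d2, d1]; rfl
  have E7 : σ7.arr 18 = σ.arr 18 := by rw [a7, a6, a5, E4]
  rw [hτ]
  refine ⟨h7.den hk (by decide), ?_⟩
  -- The three outcomes of the searches correspond to the three alternatives of `Peel.Step`.
  have pick : ∀ g < D.m, σ7.var 23 = g →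
      ∀ i, marked D 18 (addEdge.den σ7) i ↔ E i ∨ i = g := by
    intro g hg h' i
    have : addEdge.den σ7 = σ7.setArr 18 g 1 := by
      simp only [addEdge, den, eval, h', h7.m, hg, if_true]
      rfl
    rw [this, marked, State.setArr_arr, E7]
    simp only [hE, marked, true_and]
    by_cases hi : i = g
    · simp [hi, hg]
    · simp [hi]
  have skip' : σ7.var 23 = D.m → ∀ i, marked D 18 (addEdge.den σ7) i ↔ E i := by
    intro h' i
    have : addEdge.den σ7 = σ7 := by
      simp [addEdge, den, eval, h', h7.m]
    rw [this, marked, E7]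
    exact Iff.rfl
  rcases s7' with ⟨g, hg, hgF, hgv⟩ | ⟨hnF, h7v⟩
  · exact .inl ⟨g, hgF, pick g hg hgv⟩
  have hnF' : ∀ g, ¬ CF g := fun g hg => hnF g (hFm g hg) hg
  rcases s6' with ⟨g, hg, hgO, hgv⟩ | ⟨hnO, h6v⟩
  · exact .inr (.inl ⟨hnF', g, hgO.1, fun _ => hgO.2, pick g hg (h7v.trans hgv)⟩)
  rcases s5' with ⟨g, hg, hgA, hgv⟩ | ⟨hnA, h5v⟩
  · refine .inr (.inl ⟨hnF', g, hgA, ?_, pick g hg (h7v.trans (h6v.trans hgv))⟩)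
    rintro ⟨g', hg', hc⟩
    exact absurd ⟨hg', hc⟩ (hnO g' (hAm g' hg'))
  · exact .inr (.inr ⟨hnF', fun g hg => hnA g (hAm g hg) hg,
      skip' (h7v.trans (h6v.trans h5v))⟩)

theorem Mid.setVar (hk : D.k ≤ 3) {p : ℕ → ℕ} (h : Mid D cc p σ) {x : ℕ} (hx : x ∉ baseVars)
    (w : ℕ) : Mid D cc p (σ.setVar x w) where
  toBase := h.toBase.congr hk (fun y hy => by
    rw [State.setVar_var, if_neg (by rintro rfl; exact hx hy)]) fun _ _ => rfl
  pre := h.pre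
  R := h.R
  Fr := h.Fr
  RY := h.RY

def peel : Cmd := seq (fill 10 1 18 (const 0)) (rounds 12 0 2 peelRound)

/-- Until nothing is left to do, each round enlarges the matching. Its edges have different left
ends, so it has at most `n` edges, and `2 * n` rounds are more than it can grow. -/
theorem peel_spec (hD : D.Valid) {p : ℕ → ℕ} (hp : D.IsPre p) (h : Mid D cc p σ) :
    Mid D cc p (peel.den σ) ∧
      Peel.Inv D.m D.X D.Y (D.R p) (D.RY p) (D.Fr p) D.sl (marked D 18 (peel.den σ)) ∧
      ∀ i, D.R p i → D.sl (D.X i) ∨ ∃ j, marked D 18 (peel.den σ) j ∧ D.X j = D.X i := by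
  classical
  have hk := hD.k_le
  have hS := hp.setting
  obtain ⟨σ1, d1⟩ : ∃ τ, τ = (fill 10 1 18 (const 0)).den σ := ⟨_, rfl⟩
  have h1 : Mid D cc p σ1 := d1 ▸ h.den hk (by decide)
  have e1 : marked D 18 σ1 = fun _ => False := by
    funext i
    refine eq_false ?_
    rintro ⟨hi, h0⟩
    rw [d1, fill_spec σ rfl (by rw [h.m]; exact hi)] at h0
    exact h0 rfl
  have key := rounds_spec (i := 12) (b := 0) (c := 2) (P := peelRound) (σ := σ1)
    (I := fun r τ => Mid D cc p τ ∧
      Peel.Inv D.m D.X D.Y (D.R p) (D.RY p) (D.Fr p) D.sl (marked D 18 τ) ∧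
      ((∀ i, D.R p i → D.sl (D.X i) ∨ ∃ j, marked D 18 τ j ∧ D.X j = D.X i) ∨
        r ≤ ((Finset.range D.m).filter (marked D 18 τ)).card))
    (fun r τ w h => ⟨h.1.setVar hk (by decide) w, h.2⟩) ⟨h1, ?_, .inr (Nat.zero_le _)⟩ ?_
  · have hτ : peel.den σ = (rounds 12 0 2 peelRound).den σ1 := by rw [d1]; rfl
    rw [← hτ, h1.n] at key
    refine ⟨key.1, key.2.1, fun i hi => ?_⟩
    rcases key.2.2 with h | h
    · exact h i hi
    · have hc := key.2.1.card_le hS fun i hi => hD.lt_of_inc hi.1 (Data.inc_X i)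
      have := hD.lt_of_inc hi.1 (Data.inc_X i)
      omega
  · rw [e1]
    exact ⟨fun i h => h.elim, fun i h => h.elim, fun i _ h => h.elim, fun i _ h => h.elim,
      hp.hall⟩
  · rintro r τ ⟨h1, h2, h3⟩
    obtain ⟨g1, g2⟩ := peelRound_spec hD h1
    refine ⟨g1, h2.step hS g2, ?_⟩
    rcases g2.card hS with ⟨a, b, c⟩ | hc
    · rw [c]
      exact .inl (h2.done a b)
    · rcases h3 with h3 | h3
      · left
        intro i hi
        refine (h3 i hi).imp_right ?_
        rintro ⟨j, hj, h⟩
        exact ⟨j, g2.mono hj, h⟩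
      · exact .inr (by omega)

end RAM

set_option linter.unusedSimpArgs false

namespace RAM

open RAM.Expr RAM.Cmd

variable {D : Data} {cc : ℕ} {σ : State}

/-! ### The colouring of the edges with centers -/

/-- Edge `I` has got the current colour. -/
def hasCur : Expr := mul (load 16 I) (eq (load 19 I) (var 22))

def preCur : Expr := eq (load 13 I) (var 22)

def markUsedX : Cmd := mark 10 1 0 21 hasCur (load 14 I)

def markUsedY : Cmd := mark 10 1 0 22 hasCur (load 15 I)

def markPre : Cmd := mark₂ 10 1 0 23 preCur (load 0 I) preCur (load 1 I)

def fillOk : Cmd := fill 10 0 24 (tr (mul (neg (load 11 I))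
  (mul (lt (const 0) (var 22)) (lt (var 22) (add (var 20) (const 1))))))

def setOk (j : ℕ) : Cmd := ite (mul (lt (const j) (var 2)) (load (27 + j) (var 22)))
  (store 24 (load 2 (const j)) (const 1)) skip

/-- Edge `I` is uncoloured, and may get the current colour as far as the lists, the precolours,
and the edges at `X` are concerned. -/
def candX : Expr := mul (load 16 I) (mul (eq (load 19 I) (const 0)) (mul (load 24 (load 14 I))
  (mul (neg (load 23 (load 14 I))) (mul (neg (load 23 (load 15 I))) (neg (load 21 (load 14 I)))))))

def findE : Cmd := find 10 1 23 (mul candX (load 18 I))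

def lastNotE : Cmd := last 10 1 23 (mul candX (mul (neg (load 18 I)) (neg (load 22 (load 15 I)))))

def fillKick : Cmd := fill 10 1 25 (tr (mul (eq (load 19 I) (var 22))
  (eq (load 15 I) (load 15 (var 23)))))

def kick : Cmd := scatter 10 1 19 (load 25 I) I (const 0)

/-- The same command serves both kinds of edges: for an edge outside the matching nothing is
displaced, because the colour is absent from its right end. If no edge was found, variable 23 is `m`
and the next colour is taken up. -/
def update : Cmd := ite (lt (var 23) (var 1)) (seq fillKick (seq kick (store 19 (var 23) (var 22))))
  (assign 22 (add (var 22) (const 1)))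

/-- The search for edges outside the matching comes second and overrides the first one, so that
these edges have priority. -/
def colourRound : Cmd := block [markUsedX, markUsedY, markPre, fillOk, setOk 0, setOk 1, setOk 2,
  findE, lastNotE, update]

theorem setOk_spec (h : Base D cc σ) (j : ℕ) (hj : j < 3) (x : ℕ) :
    ((setOk j).den σ).arr 24 x ≠ 0 ↔
      σ.arr 24 x ≠ 0 ∨ j < D.k ∧ D.v j = x ∧ σ.var 22 ∈ D.l j := by
  have e : (mul (lt (const j) (var 2)) (load (27 + j) (var 22))).T σ ↔
      j < D.k ∧ σ.var 22 ∈ D.l j := by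
    rw [T_mul, T_lt, T_load, eval_var, eval_var, eval_const, h.k, h.lm j hj]
  rw [setOk]
  by_cases hc : j < D.k ∧ σ.var 22 ∈ D.l j
  · rw [den_ite_pos (e.2 hc), den, State.setArr_arr, eval_load, eval_const, eval_const, h.v]
    by_cases hx : x = D.v j
    · simp [hx, hc]
    · simp [hx, Ne.symm hx]
  · rw [den_ite_neg (fun h => hc (e.1 h)), den]
    tauto

theorem ok_spec (hD : D.Valid) (h : Base D cc σ) (x : ℕ) (hx : x < D.n) :
    ((setOk 2).den ((setOk 1).den ((setOk 0).den (fillOk.den σ)))).arr 24 x ≠ 0 ↔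
      D.ok x (σ.var 22) := by
  have hk := hD.k_le
  have h1 : Base D cc (fillOk.den σ) := h.den hk (by decide)
  have h2 : Base D cc ((setOk 0).den (fillOk.den σ)) := h1.den hk (by decide)
  have h3 : Base D cc ((setOk 1).den ((setOk 0).den (fillOk.den σ))) := h2.den hk (by decide)
  have c1 : (fillOk.den σ).var 22 = σ.var 22 := den_var _ (by decide) σ
  have c2 : ((setOk 0).den (fillOk.den σ)).var 22 = σ.var 22 := c1 ▸ den_var _ (by decide) _
  have c3 : ((setOk 1).den ((setOk 0).den (fillOk.den σ))).var 22 = σ.var 22 :=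
    c2 ▸ den_var _ (by decide) _
  rw [setOk_spec h3 2 (by omega), setOk_spec h2 1 (by omega), setOk_spec h1 0 (by omega), c1, c2,
    c3, fillOk, fill_spec σ rfl (by rw [h.n]; exact hx), tr_eval]
  simp only [T_mul, T_add, T_lt, T_eq, T_neg, T_load, T_var, eval_load, eval_var, eval_const,
      State.setVar_var, State.setVar_arr, ↓reduceIte,
      Nat.reduceEqDiff, OfNat.ofNat_eq_ofNat, eval]
  rw [h.inS x hx, h.s, Data.ok]
  constructor
  · rintro (((⟨h1, h2, h3⟩ | h) | h) | h)
    · exact .inl ⟨h1, h2, by omega⟩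
    · exact .inr ⟨0, h⟩
    · exact .inr ⟨1, h⟩
    · exact .inr ⟨2, h⟩
  · rintro (⟨h1, h2, h3⟩ | ⟨j, hj, h⟩)
    · exact .inl (.inl (.inl ⟨h1, h2, by omega⟩))
    · have : j < 3 := by omega
      interval_cases j
      · exact .inl (.inl (.inr ⟨hj, h⟩))
      · exact .inl (.inr ⟨hj, h⟩)
      · exact .inr ⟨hj, h⟩

theorem update_spec {p : ℕ → ℕ} (h : Mid D cc p σ) :
    (D.m ≤ σ.var 23 → (update.den σ).arr 19 = σ.arr 19 ∧ (update.den σ).var 22 = σ.var 22 + 1) ∧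
    (σ.var 23 < D.m → (update.den σ).var 22 = σ.var 22 ∧ ∀ i < D.m, (update.den σ).arr 19 i =
      if i = σ.var 23 then σ.var 22 else
      if σ.arr 19 i = σ.var 22 ∧ D.Y i = D.Y (σ.var 23) then 0 else σ.arr 19 i) := by
  have e : (lt (var 23) (var 1)).T σ ↔ σ.var 23 < D.m := by rw [T_lt, eval_var, eval_var, h.m]
  rw [update]
  refine ⟨fun hm => ?_, fun hm => ?_⟩
  · rw [den_ite_neg fun h => absurd (e.1 h) (by omega)]
    exact ⟨rfl, by rw [den, State.setVar_var, if_pos rfl]; rfl⟩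
  rw [den_ite_pos (e.2 hm)]
  simp only [den]
  obtain ⟨σ1, d1⟩ : ∃ τ, τ = fillKick.den σ := ⟨_, rfl⟩
  obtain ⟨σ2, d2⟩ : ∃ τ, τ = kick.den σ1 := ⟨_, rfl⟩
  rw [← d1, ← d2]
  have v1 : ∀ x, x ≠ 10 → σ1.var x = σ.var x := fun x hx =>
    d1 ▸ den_var _ (by simp [fillKick, fill, scatter, wv, hx]) σ
  have v2 : ∀ x, x ≠ 10 → σ2.var x = σ1.var x := fun x hx =>
    d2 ▸ den_var _ (by simp [kick, scatter, wv, hx]) σ1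
  have s1 : ∀ i < D.m, σ1.arr 25 i ≠ 0 ↔ σ.arr 19 i = σ.var 22 ∧ D.Y i = D.Y (σ.var 23) := by
    intro i hi
    rw [d1, fillKick, fill_spec σ rfl (by rw [h.m]; exact hi), tr_eval]
    simp only [T_mul, T_add, T_lt, T_eq, T_neg, T_load, T_var, eval_load, eval_var, eval_const,
      State.setVar_var, State.setVar_arr, ↓reduceIte,
      Nat.reduceEqDiff, OfNat.ofNat_eq_ofNat]
    rw [h.Y i hi, h.Y _ hm]
  have a1 : σ1.arr 19 = σ.arr 19 := d1 ▸ den_arr _ (by decide) σ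
  refine ⟨by rw [State.setArr_var, v2 _ (by decide), v1 _ (by decide)], fun i hi => ?_⟩
  rw [State.setArr_arr, eval_var, eval_var, v2 _ (by decide), v2 _ (by decide), v1 _ (by decide),
    v1 _ (by decide)]
  by_cases hig : i = σ.var 23
  · rw [if_pos ⟨rfl, hig⟩, if_pos hig]
  rw [if_neg fun h => hig h.2, if_neg hig]
  rcases den_scatter (i := 10) (b := 1) (a := 19) (cnd := load 25 I) (idx := I) (val := const 0)
    σ1 rfl rfl rfl i with ⟨j, h1, h2, h3, h4⟩ | ⟨h1, h2⟩
  · simp only [T_mul, T_add, T_lt, T_eq, T_neg, T_load, T_var, eval_load, eval_var, eval_const,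
      State.setVar_var, State.setVar_arr, ↓reduceIte, Expr.I] at h2 h3 h4
    subst h3
    rw [d2, kick]
    rw [if_pos ((s1 j hi).1 h2)]
    exact h4
  · rw [d2, kick, h2, a1, if_neg]
    intro h'
    refine h1 i (by rw [v1 _ (by decide), h.m]; exact hi) ?_ (by simp [eval, State.setVar_var])
    simp only [T_mul, T_add, T_lt, T_eq, T_neg, T_load, T_var, eval_load, eval_var, eval_const,
      State.setVar_var, State.setVar_arr, ↓reduceIte, Expr.I, eval]
    exact (s1 i hi).2 h'

theorem colourRound_spec (hD : D.Valid) {p : ℕ → ℕ} (h : Mid D cc p σ) :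
    Mid D cc p (colourRound.den σ) ∧ marked D 18 (colourRound.den σ) = marked D 18 σ ∧
      Galvin.Step D.X D.Y (D.R p) (marked D 18 σ) (D.A p) (σ.arr 19) (σ.var 22)
        ((colourRound.den σ).arr 19) ((colourRound.den σ).var 22) := by
  have hk := hD.k_le
  have hX : ∀ i < D.m, D.X i < D.n := fun i hi => hD.lt_of_inc hi (Data.inc_X i)
  have hY : ∀ i < D.m, D.Y i < D.n := fun i hi => hD.lt_of_inc hi (Data.inc_Y i)
  refine ⟨h.den hk (by decide), by
    unfold marked; rw [den_arr colourRound (a := 18) (by decide) σ], ?_⟩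
  set c := σ.var 22 with hc
  set q := σ.arr 19 with hq
  set E := marked D 18 σ with hE
  obtain ⟨σ1, d1⟩ : ∃ τ, τ = markUsedX.den σ := ⟨_, rfl⟩
  have h1 : Mid D cc p σ1 := d1 ▸ h.den hk (by decide)
  have s1 : ∀ x < D.n, σ1.arr 21 x ≠ 0 ↔ ∃ j, D.R p j ∧ q j = c ∧ D.X j = x := by
    intro x hx
    rw [d1, markUsedX, hasCur, mark_spec σ rfl rfl (by decide) (by rw [h.n]; exact hx), h.m]
    simp only [T_mul, T_add, T_lt, T_eq, T_neg, T_load, T_var, eval_load, eval_var, eval_const,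
      State.setVar_var, State.setVar_arr, ↓reduceIte,
      Nat.reduceEqDiff, OfNat.ofNat_eq_ofNat]
    constructor
    · rintro ⟨j, hj, ⟨h2, h3⟩, h4⟩
      exact ⟨j, (h.R j hj).1 h2, h3, by rw [← h.X j hj]; exact h4⟩
    · rintro ⟨j, h2, h3, h4⟩
      exact ⟨j, h2.1, ⟨(h.R j h2.1).2 h2, h3⟩, by rw [h.X j h2.1]; exact h4⟩
  have q1 : σ1.arr 19 = q := d1 ▸ den_arr _ (by decide) σ
  have c1 : σ1.var 22 = c := d1 ▸ den_var _ (by decide) σ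
  obtain ⟨σ2, d2⟩ : ∃ τ, τ = markUsedY.den σ1 := ⟨_, rfl⟩
  have h2 : Mid D cc p σ2 := d2 ▸ h1.den hk (by decide)
  have s2 : ∀ x < D.n, σ2.arr 22 x ≠ 0 ↔ ∃ j, D.R p j ∧ q j = c ∧ D.Y j = x := by
    intro x hx
    rw [d2, markUsedY, hasCur, mark_spec σ1 rfl rfl (by decide) (by rw [h1.n]; exact hx), h1.m]
    simp only [T_mul, T_add, T_lt, T_eq, T_neg, T_load, T_var, eval_load, eval_var, eval_const,
      State.setVar_var, State.setVar_arr, ↓reduceIte,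
      Nat.reduceEqDiff, OfNat.ofNat_eq_ofNat]
    rw [q1, c1]
    constructor
    · rintro ⟨j, hj, ⟨h2, h3⟩, h4⟩
      exact ⟨j, (h1.R j hj).1 h2, h3, by rw [← h1.Y j hj]; exact h4⟩
    · rintro ⟨j, h2, h3, h4⟩
      exact ⟨j, h2.1, ⟨(h1.R j h2.1).2 h2, h3⟩, by rw [h1.Y j h2.1]; exact h4⟩
  have c2 : σ2.var 22 = c := c1 ▸ d2 ▸ den_var _ (by decide) σ1
  obtain ⟨σ3, d3⟩ : ∃ τ, τ = markPre.den σ2 := ⟨_, rfl⟩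
  have h3 : Mid D cc p σ3 := d3 ▸ h2.den hk (by decide)
  have s3 : ∀ x < D.n, σ3.arr 23 x ≠ 0 ↔ ∃ j < D.m, p j = c ∧ D.inc j x := by
    intro x hx
    rw [d3, markPre, preCur, mark₂_spec σ2 rfl rfl rfl rfl (by decide) (by rw [h2.n]; exact hx),
      h2.m]
    simp only [T_mul, T_add, T_lt, T_eq, T_neg, T_load, T_var, eval_load, eval_var, eval_const,
      State.setVar_var, State.setVar_arr, ↓reduceIte,
      Nat.reduceEqDiff, OfNat.ofNat_eq_ofNat]
    rw [c2]
    refine exists_congr fun j => and_congr_right fun hj => ?_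
    rw [h2.pre j hj, h2.a j hj, h2.b j hj, Data.inc, and_or_left]
  have c3 : σ3.var 22 = c := c2 ▸ d3 ▸ den_var _ (by decide) σ2
  obtain ⟨σ4, d4⟩ : ∃ τ, τ = (block [fillOk, setOk 0, setOk 1, setOk 2]).den σ3 := ⟨_, rfl⟩
  have h4 : Mid D cc p σ4 := d4 ▸ h3.den hk (by decide)
  have s4 : ∀ x < D.n, σ4.arr 24 x ≠ 0 ↔ D.ok x c := by
    intro x hx
    rw [← c3, d4]
    exact ok_spec hD h3.toBase x hx
  have c4 : σ4.var 22 = c := c3 ▸ d4 ▸ den_var _ (by decide) σ3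
  have f4 : σ4 = (block [markUsedX, markUsedY, markPre, fillOk, setOk 0, setOk 1, setOk 2]).den σ := by
    rw [d4, d3, d2, d1]; rfl
  have q4 : σ4.arr 19 = q := f4 ▸ den_arr _ (by decide) σ
  have E4 : σ4.arr 18 = σ.arr 18 := f4 ▸ den_arr _ (by decide) σ
  have s1' : σ4.arr 21 = σ1.arr 21 := by
    have : σ4 = (block [markUsedY, markPre, fillOk, setOk 0, setOk 1, setOk 2]).den σ1 := by
      rw [d4, d3, d2]; rfl
    exact this ▸ den_arr _ (by decide) σ1
  have s2' : σ4.arr 22 = σ2.arr 22 := by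
    have : σ4 = (block [markPre, fillOk, setOk 0, setOk 1, setOk 2]).den σ2 := by
      rw [d4, d3]; rfl
    exact this ▸ den_arr _ (by decide) σ2
  have s3' : σ4.arr 23 = σ3.arr 23 := d4 ▸ den_arr _ (by decide) σ3
  rw [← s1'] at s1
  rw [← s2'] at s2
  rw [← s3'] at s3
  have cand : ∀ τ : State, Mid D cc p τ → τ.arr = σ4.arr → ∀ i < D.m,
      (candX.T (τ.setVar 10 i) ↔ D.R p i ∧ q i = 0 ∧ D.A p i c ∧
        ∀ j, D.R p j → q j = c → D.X j ≠ D.X i) := by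
    intro τ hτ ha i hi
    simp only [candX, T_mul, T_add, T_lt, T_eq, T_neg, T_load, T_var, eval_load, eval_var, eval_const,
      State.setVar_var, State.setVar_arr, ↓reduceIte,
      Nat.reduceEqDiff, OfNat.ofNat_eq_ofNat]
    rw [hτ.R i hi, hτ.X i hi, hτ.Y i hi, ha, q4, s4 _ (hX i hi), s3 _ (hX i hi), s3 _ (hY i hi),
      s1 _ (hX i hi), Data.A]
    constructor
    · rintro ⟨g1, g2, g3, g4, g5, g6⟩
      exact ⟨g1, g2, ⟨g3, fun j hj hjc => ⟨fun h => g4 ⟨j, hj, hjc, h⟩,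
        fun h => g5 ⟨j, hj, hjc, h⟩⟩⟩, fun j hj hjc h => g6 ⟨j, hj, hjc, h⟩⟩
    · rintro ⟨g1, g2, ⟨g3, g4⟩, g6⟩
      exact ⟨g1, g2, g3, fun ⟨j, hj, hjc, h⟩ => (g4 j hj hjc).1 h,
        fun ⟨j, hj, hjc, h⟩ => (g4 j hj hjc).2 h, fun ⟨j, hj, hjc, h⟩ => g6 j hj hjc h⟩
  obtain ⟨σ5, d5⟩ : ∃ τ, τ = findE.den σ4 := ⟨_, rfl⟩
  have h5 : Mid D cc p σ5 := d5 ▸ h4.den hk (by decide)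
  have a5 : σ5.arr = σ4.arr := funext fun a => d5 ▸ den_arr _ (by simp [findE, find, last, wa]) σ4
  have s5 := find_spec (i := 10) (b := 1) (x := 23) (cnd := mul candX (load 18 I)) σ4 rfl
    (by decide) (by decide)
  rw [← findE, ← d5, h4.m] at s5
  have t5 : ∀ j < D.m, (mul candX (load 18 I)).T (σ4.setVar 10 j) ↔
      Galvin.CandE D.X (D.R p) E (D.A p) q c j := by
    intro j hj
    rw [T_mul, cand σ4 h4 rfl j hj, T_load, State.setVar_arr, E4]
    simp only [T_mul, T_add, T_lt, T_eq, T_neg, T_load, T_var, eval_load, eval_var, eval_const,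
      State.setVar_var, State.setVar_arr, ↓reduceIte, Expr.I, Galvin.CandE, hE, marked, hj, true_and]
    tauto
  obtain ⟨σ6, d6⟩ : ∃ τ, τ = lastNotE.den σ5 := ⟨_, rfl⟩
  have h6 : Mid D cc p σ6 := d6 ▸ h5.den hk (by decide)
  have a6 : σ6.arr = σ4.arr :=
    a5 ▸ funext fun a => d6 ▸ den_arr _ (by simp [lastNotE, last, wa]) σ5
  have s6 := last_spec (i := 10) (b := 1) (x := 23)
    (cnd := mul candX (mul (neg (load 18 I)) (neg (load 22 (load 15 I))))) σ5 rfl (by decide)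
  rw [← lastNotE, ← d6, h5.m] at s6
  have t6 : ∀ j < D.m, (mul candX (mul (neg (load 18 I)) (neg (load 22 (load 15 I))))).T
      (σ5.setVar 10 j) ↔ Galvin.Cand D.X D.Y (D.R p) E (D.A p) q c j := by
    intro j hj
    rw [T_mul, cand σ5 h5 a5 j hj]
    simp only [T_mul, T_add, T_lt, T_eq, T_neg, T_load, T_var, eval_load, eval_var, eval_const,
      State.setVar_var, State.setVar_arr, ↓reduceIte, Expr.I]
    rw [h5.Y j hj, a5, E4, s2 _ (hY j hj)]
    simp only [Galvin.Cand, hE, marked, hj, true_and]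
    constructor
    · rintro ⟨⟨g1, g2, g3, g4⟩, g5, g6⟩
      exact ⟨g1, g5, g2, g3, fun i hi hic => ⟨g4 i hi hic, fun h => g6 ⟨i, hi, hic, h⟩⟩⟩
    · rintro ⟨g1, g5, g2, g3, g4⟩
      exact ⟨⟨g1, g2, g3, fun i hi hic => (g4 i hi hic).1⟩, g5,
        fun ⟨i, hi, hic, h⟩ => (g4 i hi hic).2 h⟩
  have c6 : σ6.var 22 = c := by
    rw [d6, den_var _ (by decide), d5, den_var _ (by decide), c4]
  have hτ : colourRound.den σ = update.den σ6 := by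
    rw [d6, d5, f4]; rfl
  obtain ⟨u1, u2⟩ := update_spec h6
  rw [hτ]
  rw [c6, a6, q4] at u1 u2
  rcases s6 with ⟨g, hg, hgC, hgv⟩ | ⟨hnC, h6v⟩
  · have hgC := (t6 g hg).1 hgC
    obtain ⟨u3, u4⟩ := u2 (by omega)
    refine .inl ⟨g, hgC, u3, fun i hi => ?_⟩
    rw [u4 i hi.1, hgv]
    -- A candidate outside the matching has no edge of the current colour at its right end, so the
    -- clearing of that end changes nothing.
    refine if_congr Iff.rfl rfl (if_neg fun h => (hgC.2.2.2.2 i hi h.1).2 h.2)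
  have hnC : ∀ g, ¬ Galvin.Cand D.X D.Y (D.R p) E (D.A p) q c g := fun g hg =>
    hnC g hg.1.1 ((t6 g hg.1.1).2 hg)
  rcases s5 with ⟨g, hg, hgC, hgv⟩ | ⟨hnE, h5v⟩
  · obtain ⟨u3, u4⟩ := u2 (by omega)
    refine .inr (.inl ⟨hnC, g, (t5 g hg).1 hgC, u3, fun i hi => ?_⟩)
    rw [u4 i hi.1, h6v, hgv]
  · obtain ⟨u3, u4⟩ := u1 (by omega)
    exact .inr (.inr ⟨hnC, fun g hg => hnE g hg.1.1 ((t5 g hg.1.1).2 hg), u4,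
      fun i _ => by rw [u3]⟩)

theorem _root_.Data.deg_le_m (x : ℕ) : D.deg x ≤ D.m := by
  classical
  exact (Finset.card_filter_le _ _).trans (Finset.card_range _).le

theorem _root_.Data.s_le_two_mul (hD : D.Valid) {p : ℕ → ℕ} {i : ℕ} (hi : D.R p i) :
    D.s ≤ 2 * D.m := by
  have := Data.deg_le_m (D := D) (D.X i)
  have := hD.two_le_deg _ (hD.lt_of_inc hi.1 (Data.inc_X i))
  refine max_le (by omega) (Finset.sup_le fun x _ => (Data.deg_le_m (D := D) x).trans (by omega))

def colour : Cmd := block [fill 10 1 19 (const 0), assign 22 (const 1), rounds 12 1 4 colourRound]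

/-- The potential grows in every round, so after `4 * m` rounds it exceeds `4 * m`. Coloured edges
contribute at most `2 * m`, so the current colour exceeds `2 * m` and with it `s`, and all colours
have been dealt with. -/
theorem colour_spec (hD : D.Valid) {p : ℕ → ℕ} (hp : D.IsPre p) (h : Mid D cc p σ) {E : ℕ → Prop}
    (hE : marked D 18 σ = E)
    (hinv : Peel.Inv D.m D.X D.Y (D.R p) (D.RY p) (D.Fr p) D.sl E)
    (hdone : ∀ i, D.R p i → D.sl (D.X i) ∨ ∃ j, E j ∧ D.X j = D.X i) :
    Mid D cc p (colour.den σ) ∧ ∃ c, Galvin.Inv D.X D.Y (D.R p) E (D.A p)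
      ((colour.den σ).arr 19) c ∧ ∀ i, D.R p i → (colour.den σ).arr 19 i ≠ 0 := by
  have hk := hD.k_le
  refine ⟨h.den hk (by decide), ?_⟩
  have hER : ∀ i, E i → D.R p i := fun i hi => by
    rcases hinv.sub i hi with h | h
    exacts [h.1, h.1]
  obtain ⟨σ1, d1⟩ : ∃ τ, τ = (block [fill 10 1 19 (const 0), assign 22 (const 1)]).den σ :=
    ⟨_, rfl⟩
  have h1 : Mid D cc p σ1 := d1 ▸ h.den hk (by decide)
  have c1 : σ1.var 22 = 1 := by
    rw [d1]
    simp [block, den, State.setVar_var, eval]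
  have q1 : ∀ i < D.m, σ1.arr 19 i = 0 := by
    intro i hi
    rw [d1]
    exact fill_spec σ rfl (by rw [h.m]; exact hi)
  have E1 : marked D 18 σ1 = E := by
    rw [← hE]
    unfold marked
    rw [d1, den_arr _ (by decide)]
  have key := rounds_spec (i := 12) (b := 1) (c := 4) (P := colourRound) (σ := σ1)
    (I := fun r τ => Mid D cc p τ ∧ marked D 18 τ = E ∧
      Galvin.Inv D.X D.Y (D.R p) E (D.A p) (τ.arr 19) (τ.var 22) ∧
      r + 1 ≤ Galvin.pot D.m (D.R p) E (τ.arr 19) (τ.var 22))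
    ?_ ⟨h1, E1, ?_, ?_⟩ ?_
  · have hτ : colour.den σ = (rounds 12 1 4 colourRound).den σ1 := by rw [d1]; rfl
    rw [hτ]
    obtain ⟨-, -, k3, k4⟩ := key
    refine ⟨_, k3, fun i hi => k3.complete (fun i hi => hi.1) (fun i hi => ?_) i hi⟩
    have := Galvin.pot_le (m := D.m) (R := D.R p) (E := E)
      (q := ((rounds 12 1 4 colourRound).den σ1).arr 19)
      (c := ((rounds 12 1 4 colourRound).den σ1).var 22)
    have hs := Data.s_le_two_mul hD hi
    rw [h1.m] at k4
    exact hp.count hD hinv.sub hdone (by omega) i hi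
  · rintro r τ w ⟨g1, g2, g3, g4⟩
    have : (τ.setVar 12 w).var 22 = τ.var 22 := by rw [State.setVar_var, if_neg (by decide)]
    refine ⟨g1.setVar hk (by decide) w, g2, ?_, ?_⟩
    · rw [this]; exact g3
    · rw [this]; exact g4
  · rw [c1]
    exact Galvin.inv_init (Data.A_pos hD) hER fun i hi => q1 i hi.1
  · rw [c1]
    exact Nat.le_add_right _ _
  · rintro r τ ⟨g1, g2, g3, g4⟩
    obtain ⟨j1, j2, j3⟩ := colourRound_spec hD g1
    rw [g2] at j2 j3
    refine ⟨j1, j2, g3.step (Data.A_pos hD) hER hinv.injX j3, ?_⟩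
    have := Galvin.pot_step (m := D.m) (fun i hi => hi.1) hinv.injY g3 j3
    omega

end RAM

set_option linter.unusedSimpArgs false

namespace RAM

open RAM.Expr RAM.Cmd

variable {D : Data} {cc : ℕ} {σ : State}

/-! ### The colouring of the other edges -/

/-- The edges `i` and `j` have a common end. -/
def Expr.meet (i j : Expr) : Expr := add (inc i (load 0 j)) (inc i (load 1 j))

def initCol : Cmd := fill 10 1 30 (load 13 I)

def addCol : Cmd := scatter 10 1 30 (load 16 I) I (load 19 I)

def findUnc : Cmd := find 10 1 23 (eq (load 30 I) (const 0))

/-- Only the cells of the colours 1, 2 and 3 are ever consulted. -/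
def clearUsed : Cmd := block [store 22 (const 1) (const 0), store 22 (const 2) (const 0),
  store 22 (const 3) (const 0)]

def scatterUsed : Cmd := scatter 10 1 22 (meet I (var 23)) (load 30 I) (const 1)

/-- Colour 3 is the default for the case that 1 and 2 occur nearby. -/
def pickCol : Cmd := block [assign 24 (const 3),
  ite (neg (load 22 (const 2))) (assign 24 (const 2)) skip,
  ite (neg (load 22 (const 1))) (assign 24 (const 1)) skip]

def finRound : Cmd := seq findUnc (ite (lt (var 23) (var 1))
  (block [clearUsed, scatterUsed, pickCol, store 30 (var 23) (var 24)]) skip)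

def finish : Cmd := block [initCol, addCol, rounds 12 1 1 finRound]

theorem _root_.Data.meet_iff {i j : ℕ} : D.Meet i j ↔ D.inc i (D.a j) ∨ D.inc i (D.b j) := by
  constructor
  · rintro ⟨x, h, rfl | rfl⟩
    exacts [.inl h, .inr h]
  · rintro (h | h)
    exacts [⟨_, h, .inl rfl⟩, ⟨_, h, .inr rfl⟩]

theorem pickCol_spec : (pickCol.den σ).arr = σ.arr ∧ ∃ d, (pickCol.den σ).var 24 = d ∧
    (d = 1 ∨ d = 2 ∨ d = 3) ∧
    ((∃ e, (e = 1 ∨ e = 2 ∨ e = 3) ∧ σ.arr 22 e = 0) → σ.arr 22 d = 0) := by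
  have a1 : (pickCol.den σ).arr = σ.arr :=
    funext fun a => den_arr pickCol (by simp [pickCol, block, wa]) σ
  refine ⟨a1, _, rfl, ?_⟩
  simp only [pickCol, block, den, neg, eval]
  by_cases h1 : σ.arr 22 1 = 0 <;> by_cases h2 : σ.arr 22 2 = 0 <;>
    simp [h1, h2, State.setVar_var, State.setVar_arr]

theorem finRound_spec (hD : D.Valid) (h : Base D cc σ) : Base D cc (finRound.den σ) ∧
    D.FinStep (σ.arr 30) ((finRound.den σ).arr 30) := by
  have hk := hD.k_le
  refine ⟨h.den hk (by decide), ?_⟩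
  obtain ⟨σ1, d1⟩ : ∃ τ, τ = findUnc.den σ := ⟨_, rfl⟩
  have h1 : Base D cc σ1 := d1 ▸ h.den hk (by decide)
  have a1 : σ1.arr = σ.arr :=
    funext fun a => d1 ▸ den_arr _ (by simp [findUnc, find, last, wa]) σ
  have s1 := find_spec (i := 10) (b := 1) (x := 23) (cnd := eq (load 30 I) (const 0)) σ rfl
    (by decide) (by decide)
  rw [← findUnc, ← d1, h.m] at s1
  simp only [T_mul, T_add, T_lt, T_eq, T_neg, T_load, T_var, eval_load, eval_var, eval_const,
      State.setVar_var, State.setVar_arr, ↓reduceIte,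
      Nat.reduceEqDiff, OfNat.ofNat_eq_ofNat] at s1
  have e : (lt (var 23) (var 1)).T σ1 ↔ σ1.var 23 < D.m := by rw [T_lt, eval_var, eval_var, h1.m]
  rw [finRound, den, ← d1]
  rcases s1 with ⟨g, hg, hg0, hgv⟩ | ⟨h0, hv⟩
  · left
    refine ⟨g, hg, hg0, ?_⟩
    rw [den_ite_pos (e.2 (by omega))]
    obtain ⟨σ2, d2⟩ : ∃ τ, τ = clearUsed.den σ1 := ⟨_, rfl⟩
    obtain ⟨σ3, d3⟩ : ∃ τ, τ = scatterUsed.den σ2 := ⟨_, rfl⟩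
    obtain ⟨σ4, d4⟩ : ∃ τ, τ = pickCol.den σ3 := ⟨_, rfl⟩
    have h2 : Base D cc σ2 := d2 ▸ h1.den hk (by decide)
    have a2 : σ2.arr 30 = σ.arr 30 := a1 ▸ d2 ▸ den_arr _ (by decide) σ1
    have v2 : σ2.var 23 = g := hgv ▸ d2 ▸ den_var _ (by decide) σ1
    have c2 : ∀ e, (e = 1 ∨ e = 2 ∨ e = 3) → σ2.arr 22 e = 0 := by
      rintro e (rfl | rfl | rfl) <;>
        simp [d2, clearUsed, block, den, State.setArr_arr, eval]
    have a3 : σ3.arr 30 = σ.arr 30 := a2 ▸ d3 ▸ den_arr _ (by decide) σ2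
    have v3 : σ3.var 23 = g := v2 ▸ d3 ▸ den_var _ (by decide) σ2
    have c3 : ∀ e, (e = 1 ∨ e = 2 ∨ e = 3) →
        (σ3.arr 22 e = 0 ↔ ∀ i < D.m, D.Meet i g → σ.arr 30 i ≠ e) := by
      intro e he
      rw [← not_iff_not, d3, scatterUsed, ← ne_eq, scatter_one_spec σ2 rfl rfl, c2 e he, h2.m]
      simp only [ne_eq, not_true_eq_false, false_or, not_forall, not_not, exists_prop]
      refine exists_congr fun i => and_congr_right fun hi => ?_
      simp only [meet, T_mul, T_add, T_lt, T_eq, T_neg, T_load, T_var, eval_load, eval_var, eval_const,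
      State.setVar_var, State.setVar_arr, ↓reduceIte,
      Nat.reduceEqDiff, OfNat.ofNat_eq_ofNat]
      rw [h2.a i hi, h2.b i hi, v2, h2.a g hg, h2.b g hg, a2, Data.meet_iff]
      exact Iff.rfl
    obtain ⟨a4, d, hd, hd3, hd4⟩ := pickCol_spec (σ := σ3)
    rw [← d4] at a4 hd
    have v4 : σ4.var 23 = g := v3 ▸ d4 ▸ den_var _ (by decide) σ3
    refine ⟨d, hd3, ?_, fun i _ => ?_⟩
    · rintro ⟨e, he, h⟩
      exact (c3 d hd3).1 (hd4 ⟨e, he, (c3 e he).2 h⟩)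
    · simp only [block, den, ← d2, ← d3, ← d4, State.setArr_arr, eval, v4, hd, a4, a3, true_and]
  · right
    rw [den_ite_neg fun h => absurd (e.1 h) (by omega), den, a1]
    exact ⟨h0, fun _ _ => rfl⟩

/-- Precolours and Galvin's colours form a partial solution; each round then colours one more edge
without center, so `m` rounds complete it. -/
theorem finish_spec (hD : D.Valid) {p : ℕ → ℕ} (hp : D.IsPre p) (h : Mid D cc p σ) {E : ℕ → Prop}
    {c : ℕ} (hq : Galvin.Inv D.X D.Y (D.R p) E (D.A p) (σ.arr 19) c)
    (h0 : ∀ i, D.R p i → σ.arr 19 i ≠ 0) : D.IsSol ((finish.den σ).arr 30) := by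
  classical
  have hk := hD.k_le
  obtain ⟨σ1, d1⟩ : ∃ τ, τ = initCol.den σ := ⟨_, rfl⟩
  obtain ⟨σ2, d2⟩ : ∃ τ, τ = addCol.den σ1 := ⟨_, rfl⟩
  have h1 : Mid D cc p σ1 := d1 ▸ h.den hk (by decide)
  have h2 : Base D cc σ2 := d2 ▸ h1.toBase.den hk (by decide)
  have s1 : ∀ i < D.m, σ1.arr 30 i = p i := by
    intro i hi
    rw [d1, initCol, fill_spec σ rfl (by rw [h.m]; exact hi)]
    simp only [T_mul, T_add, T_lt, T_eq, T_neg, T_load, T_var, eval_load, eval_var, eval_const,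
      State.setVar_var, State.setVar_arr, ↓reduceIte,
      Nat.reduceEqDiff, OfNat.ofNat_eq_ofNat]
    exact h.pre i hi
  have q1 : σ1.arr 19 = σ.arr 19 := d1 ▸ den_arr _ (by decide) σ
  have s2 : ∀ i < D.m, σ2.arr 30 i = if p i ≠ 0 then p i else
      if D.R p i then σ.arr 19 i else 0 := by
    intro i hi
    rw [d2, addCol]
    rcases den_scatter (i := 10) (b := 1) (a := 30) (cnd := load 16 I) (idx := I)
      (val := load 19 I) σ1 rfl rfl rfl i with ⟨j, h3, h4, h5, h6⟩ | ⟨h3, h4⟩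
    · rw [h6]
      simp only [T_mul, T_add, T_lt, T_eq, T_neg, T_load, T_var, eval_load, eval_var, eval_const,
      State.setVar_var, State.setVar_arr, ↓reduceIte,
      Nat.reduceEqDiff, OfNat.ofNat_eq_ofNat, Expr.I] at h4 h5 ⊢
      subst h5
      have hR := (h1.R j hi).1 h4
      rw [if_neg (not_not.2 hR.2.1), if_pos hR, q1]
    · have hR : ¬ D.R p i := fun hR => by
        refine h3 i (by rw [h1.m]; exact hi) ?_ (by simp [eval, State.setVar_var])
        simp only [T_mul, T_add, T_lt, T_eq, T_neg, T_load, T_var, eval_load, eval_var, eval_const,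
      State.setVar_var, State.setVar_arr, ↓reduceIte,
      Nat.reduceEqDiff, OfNat.ofNat_eq_ofNat, Expr.I]
        exact (h1.R i hi).2 hR
      rw [h4, s1 i hi, if_neg hR]
      split_ifs with hpi
      · rfl
      · exact not_not.1 hpi
  have key := rounds_spec (i := 12) (b := 1) (c := 1) (P := finRound) (σ := σ2)
    (I := fun r τ => Base D cc τ ∧ D.Part (τ.arr 30) ∧ ((∀ g < D.m, τ.arr 30 g ≠ 0) ∨
      r ≤ ((Finset.range D.m).filter (fun i => τ.arr 30 i ≠ 0)).card))
    (fun r τ w h => ⟨h.1.congr hk (fun x hx => by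
      rw [State.setVar_var, if_neg (by rintro rfl; revert hx; decide)]) fun _ _ => rfl, h.2⟩)
    ⟨h2, hp.part hD hq h0 s2, .inr (Nat.zero_le _)⟩ ?_
  · have hτ : finish.den σ = (rounds 12 1 1 finRound).den σ2 := by rw [d2, d1]; rfl
    rw [← hτ, h2.m, one_mul] at key
    obtain ⟨-, k2, k3⟩ := key
    refine k2.isSol ?_
    rcases k3 with k3 | k3
    · exact k3
    · intro g hg
      have : (Finset.range D.m).filter (fun i => (finish.den σ).arr 30 i ≠ 0) =
          Finset.range D.m :=
        Finset.eq_of_subset_of_card_le (Finset.filter_subset _ _)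
          (by rw [Finset.card_range]; exact k3)
      have hg := Finset.mem_range.2 hg
      rw [← this] at hg
      exact (Finset.mem_filter.1 hg).2
  · rintro r τ ⟨g1, g2, g3⟩
    obtain ⟨j1, j2⟩ := finRound_spec hD g1
    refine ⟨j1, g2.step j2, ?_⟩
    rcases j2.card with hc | hc
    · exact .inl hc
    · rcases g3 with g3 | g3
      · rcases j2 with ⟨g, hg, hg0, -⟩ | ⟨-, j3⟩
        · exact absurd hg0 (g3 g hg)
        · left
          intro g hg
          rw [j3 g hg]
          exact g3 g hg
      · exact .inr (by omega)

/-! ### The verification of a colouring -/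

abbrev Expr.J : Expr := .var 13

def checkRange : Cmd := flag 10 1 25 (add (eq (load 30 I) (const 0)) (lt (var 20) (load 30 I)))

def clearBad : Cmd := fill 10 1 26 (const 0)

def markBad : Cmd :=
  markEx 10 13 1 26 (mul (lt I J) (mul (eq (load 30 I) (load 30 J)) (meet I J)))

def checkProper : Cmd := flag 10 1 25 (load 26 I)

def checkList (j : ℕ) : Cmd := flag 10 1 25 (mul (lt (const j) (var 2))
  (mul (inc I (load 2 (const j))) (neg (load (27 + j) (load 30 I)))))

/-- Most trials start from meaningless precolours. The verification makes them harmless and records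
success in variable 26. -/
def check : Cmd := block [assign 25 (const 0), checkRange, clearBad, markBad, checkProper,
  checkList 0, checkList 1, checkList 2, ite (neg (var 25)) (assign 26 (const 1)) skip]

theorem checkList_spec (h : Base D cc σ) (j : ℕ) (hj : j < 3) :
    ((checkList j).den σ).var 25 ≠ 0 ↔ σ.var 25 ≠ 0 ∨
      (j < D.k ∧ ∃ i < D.m, D.inc i (D.v j) ∧ σ.arr 30 i ∉ D.l j) := by
  rw [checkList, flag_spec σ rfl (by decide), h.m]
  refine or_congr Iff.rfl ?_
  have e : ∀ i < D.m, (mul (lt (const j) (var 2)) (mul (inc I (load 2 (const j)))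
      (neg (load (27 + j) (load 30 I))))).T (σ.setVar 10 i) ↔
      j < D.k ∧ D.inc i (D.v j) ∧ σ.arr 30 i ∉ D.l j := by
    intro i hi
    simp only [T_mul, T_add, T_lt, T_eq, T_neg, T_load, T_var, eval_load, eval_var, eval_const,
      State.setVar_var, State.setVar_arr, ↓reduceIte,
      Nat.reduceEqDiff, OfNat.ofNat_eq_ofNat]
    rw [h.k, h.a i hi, h.b i hi, h.v, h.lm j hj, Data.inc]
  constructor
  · rintro ⟨i, hi, hT⟩
    exact ⟨((e i hi).1 hT).1, i, hi, ((e i hi).1 hT).2⟩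
  · rintro ⟨hjk, i, hi, h'⟩
    exact ⟨i, hi, (e i hi).2 ⟨hjk, h'⟩⟩

theorem check_spec (hD : D.Valid) (h : Base D cc σ) :
    (check.den σ).var 26 ≠ 0 ↔ σ.var 26 ≠ 0 ∨ D.IsSol (σ.arr 30) := by
  have hk := hD.k_le
  obtain ⟨σ0, d0⟩ : ∃ τ, τ = (assign 25 (const 0)).den σ := ⟨_, rfl⟩
  have h0 : Base D cc σ0 := d0 ▸ h.den hk (by decide)
  have c0 : σ0.arr 30 = σ.arr 30 := d0 ▸ rfl
  have z0 : σ0.var 25 = 0 := by rw [d0, den, State.setVar_var, if_pos rfl]; rfl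
  obtain ⟨σ1, d1⟩ : ∃ τ, τ = checkRange.den σ0 := ⟨_, rfl⟩
  have h1 : Base D cc σ1 := d1 ▸ h0.den hk (by decide)
  have c1 : σ1.arr 30 = σ.arr 30 := c0 ▸ d1 ▸ den_arr _ (by decide) σ0
  have z1 : σ1.var 25 ≠ 0 ↔ ∃ i < D.m, σ.arr 30 i = 0 ∨ D.s < σ.arr 30 i := by
    rw [d1, checkRange, flag_spec σ0 rfl (by decide), z0, h0.m]
    simp only [T_mul, T_add, T_lt, T_eq, T_neg, T_load, T_var, eval_load, eval_var, eval_const,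
      State.setVar_var, State.setVar_arr, ↓reduceIte,
      Nat.reduceEqDiff, OfNat.ofNat_eq_ofNat]
    rw [h0.s, c0]
    simp only [ne_eq, not_true_eq_false, false_or]
  obtain ⟨σ2, d2⟩ : ∃ τ, τ = clearBad.den σ1 := ⟨_, rfl⟩
  have h2 : Base D cc σ2 := d2 ▸ h1.den hk (by decide)
  have c2 : σ2.arr 30 = σ.arr 30 := c1 ▸ d2 ▸ den_arr _ (by decide) σ1
  have b2 : ∀ i < D.m, σ2.arr 26 i = 0 := by
    intro i hi
    rw [d2, clearBad, fill_spec σ1 rfl (by rw [h1.m]; exact hi)]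
    rfl
  obtain ⟨σ3, d3⟩ : ∃ τ, τ = markBad.den σ2 := ⟨_, rfl⟩
  have h3 : Base D cc σ3 := d3 ▸ h2.den hk (by decide)
  have c3 : σ3.arr 30 = σ.arr 30 := c2 ▸ d3 ▸ den_arr _ (by decide) σ2
  have b3 : ∀ i < D.m, σ3.arr 26 i ≠ 0 ↔
      ∃ j < D.m, i < j ∧ σ.arr 30 i = σ.arr 30 j ∧ D.Meet i j := by
    intro i hi
    rw [d3, markBad, markEx_spec σ2 rfl (by decide) (by decide) (by decide), b2 i hi, h2.m]
    simp only [ne_eq, not_true_eq_false, false_or, hi, true_and]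
    refine exists_congr fun j => and_congr_right fun hj => ?_
    simp only [meet, T_mul, T_add, T_lt, T_eq, T_neg, T_load, T_var, eval_load, eval_var, eval_const,
      State.setVar_var, State.setVar_arr, ↓reduceIte,
      Nat.reduceEqDiff, OfNat.ofNat_eq_ofNat]
    rw [h2.a i hi, h2.b i hi, h2.a j hj, h2.b j hj, c2, Data.meet_iff]
    exact Iff.rfl
  have z3 : σ3.var 25 = σ1.var 25 := by
    rw [d3, den_var _ (by decide), d2, den_var _ (by decide)]
  obtain ⟨σ4, d4⟩ : ∃ τ, τ = checkProper.den σ3 := ⟨_, rfl⟩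
  have h4 : Base D cc σ4 := d4 ▸ h3.den hk (by decide)
  have c4 : σ4.arr 30 = σ.arr 30 := c3 ▸ d4 ▸ den_arr _ (by decide) σ3
  have z4 : σ4.var 25 ≠ 0 ↔ σ1.var 25 ≠ 0 ∨
      ∃ i < D.m, ∃ j < D.m, i < j ∧ σ.arr 30 i = σ.arr 30 j ∧ D.Meet i j := by
    rw [d4, checkProper, flag_spec σ3 rfl (by decide), z3, h3.m]
    refine or_congr Iff.rfl (exists_congr fun i => and_congr_right fun hi => ?_)
    simp only [T_mul, T_add, T_lt, T_eq, T_neg, T_load, T_var, eval_load, eval_var, eval_const,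
      State.setVar_var, State.setVar_arr, ↓reduceIte,
      Nat.reduceEqDiff, OfNat.ofNat_eq_ofNat]
    exact b3 i hi
  obtain ⟨σ5, d5⟩ : ∃ τ, τ = (checkList 0).den σ4 := ⟨_, rfl⟩
  have h5 : Base D cc σ5 := d5 ▸ h4.den hk (by decide)
  have c5 : σ5.arr 30 = σ.arr 30 := c4 ▸ d5 ▸ den_arr _ (by decide) σ4
  obtain ⟨σ6, d6⟩ : ∃ τ, τ = (checkList 1).den σ5 := ⟨_, rfl⟩
  have h6 : Base D cc σ6 := d6 ▸ h5.den hk (by decide)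
  have c6 : σ6.arr 30 = σ.arr 30 := c5 ▸ d6 ▸ den_arr _ (by decide) σ5
  obtain ⟨σ7, d7⟩ : ∃ τ, τ = (checkList 2).den σ6 := ⟨_, rfl⟩
  have z7 : σ7.var 25 ≠ 0 ↔ σ4.var 25 ≠ 0 ∨
      ∃ j < D.k, ∃ i < D.m, D.inc i (D.v j) ∧ σ.arr 30 i ∉ D.l j := by
    rw [d7, checkList_spec h6 2 (by omega), d6, checkList_spec h5 1 (by omega), d5,
      checkList_spec h4 0 (by omega), ← d5, ← d6, c6, c5, c4, or_assoc, or_assoc]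
    refine or_congr Iff.rfl ⟨?_, ?_⟩
    · rintro (h | h | h)
      exacts [⟨0, h⟩, ⟨1, h⟩, ⟨2, h⟩]
    · rintro ⟨j, hj, h⟩
      have : j < 3 := by omega
      interval_cases j
      exacts [.inl ⟨hj, h⟩, .inr (.inl ⟨hj, h⟩), .inr (.inr ⟨hj, h⟩)]
  have hτ : check.den σ = (ite (neg (var 25)) (assign 26 (const 1)) skip).den σ7 := by
    rw [d7, d6, d5, d4, d3, d2, d1, d0]; rfl
  have f7 : σ7.var 26 = σ.var 26 := by
    have : σ7 = (block [assign 25 (const 0), checkRange, clearBad, markBad, checkProper,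
      checkList 0, checkList 1, checkList 2]).den σ := by
      rw [d7, d6, d5, d4, d3, d2, d1, d0]; rfl
    exact this ▸ den_var _ (by decide) σ
  have hsol : D.IsSol (σ.arr 30) ↔ σ7.var 25 = 0 := by
    rw [← not_iff_not, ← ne_eq (σ7.var 25), z7, z4, z1]
    constructor
    · intro hn
      by_contra hc
      push Not at hc
      obtain ⟨⟨r1, r2⟩, r3⟩ := hc
      refine hn ⟨fun i hi => ⟨Nat.one_le_iff_ne_zero.2 (r1 i hi).1, (r1 i hi).2⟩, ?_,
        fun i hi j hj hij => r3 j hj i hi hij⟩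
      intro i hi j hj hij x hx hx' he
      rcases Nat.lt_or_gt_of_ne hij with hlt | hlt
      · exact r2 i hi j hj hlt he ⟨x, hx, hx'⟩
      · exact r2 j hj i hi hlt he.symm ⟨x, hx', hx⟩
    · rintro ((⟨i, hi, hr⟩ | ⟨i, hi, j, hj, hij, he, x, hx, hx'⟩) | ⟨j, hj, i, hi, hij, hn⟩) hs
      · have := hs.range i hi
        omega
      · exact hs.proper i hi j hj hij.ne x hx hx' he
      · exact hn (hs.lists i hi j hj hij)
  rw [hτ, hsol]
  have e : (neg (var 25)).T σ7 ↔ σ7.var 25 = 0 := by rw [T_neg, T_var, not_not]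
  by_cases hb : σ7.var 25 = 0
  · rw [den_ite_pos (e.2 hb), den, State.setVar_var, if_pos rfl]
    simp [hb, eval]
  · rw [den_ite_neg (fun h => hb (e.1 h)), den, f7]
    simp [hb]

end RAM

set_option linter.unusedSimpArgs false

namespace RAM

open RAM.Expr RAM.Cmd

variable {D : Data} {cc : ℕ} {σ : State}

/-! ### The preparations for a precolouring -/

/-- Colour the edge in slot `r` as the digit says. -/
def slotCmd (r : ℕ) : ℕ → Cmd
  | 0 => skip
  | 1 => store 13 (var (40 + r)) (load (4 + r / 2) (const 0))
  | 2 => store 13 (var (40 + r)) (load (4 + r / 2) (const 1))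
  | 3 => store 13 (var (40 + r)) (load (4 + r / 2) (const 2))
  | _ => store 13 (var (40 + r)) (var 21)

def slots (t : ℕ → ℕ) : ℕ → Cmd
  | 0 => skip
  | r + 1 => seq (slots t r) (slotCmd r (t r))

/-- The colour that a digit means. -/
def digitCol (D : Data) (cc j : ℕ) : ℕ → ℕ
  | 0 => 0
  | 1 => (D.l j).getD 0 0
  | 2 => (D.l j).getD 1 0
  | 3 => (D.l j).getD 2 0
  | _ => cc

theorem _root_.Data.Code.exists_digit {j c : ℕ} (h : D.Code cc j c) :
    ∃ t < 5, t ≠ 0 ∧ digitCol D cc j t = c ∧ (t = 4 ∨ t ≤ (D.l j).length) := by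
  rcases h with rfl | h
  · exact ⟨4, by omega, by omega, rfl, .inl rfl⟩
  · obtain ⟨i, hi, rfl⟩ := List.mem_iff_getElem.1 h
    rw [List.length_take] at hi
    refine ⟨i + 1, by omega, by omega, ?_, .inr (by omega)⟩
    have : i < 3 := by omega
    have hl : i < (D.l j).length := by omega
    rw [List.getElem_take, ← List.getD_eq_getElem _ 0 hl]
    interval_cases i <;> rfl

theorem slotCmd_spec (h : Base D cc σ) {r t : ℕ} (hr : r < 6) (ht0 : t ≠ 0)
    (ht : t = 4 ∨ t ≤ (D.l (r / 2)).length) (ht5 : t < 5) :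
    (slotCmd r t).den σ = σ.setArr 13 (σ.var (40 + r)) (digitCol D cc (r / 2) t) := by
  have hl := h.l (r / 2) (by omega)
  have : t = 1 ∨ t = 2 ∨ t = 3 ∨ t = 4 := by omega
  rcases this with rfl | rfl | rfl | rfl
  · simp only [slotCmd, den, eval, digitCol, hl 0 (by omega)]
  · simp only [slotCmd, den, eval, digitCol, hl 1 (by omega)]
  · simp only [slotCmd, den, eval, digitCol, hl 2 (by omega)]
  · simp only [slotCmd, den, eval, digitCol, h.cc]

theorem keeps_seq {xs as : List ℕ} {P Q : Cmd} :
    (seq P Q).keeps xs as = true ↔ P.keeps xs as = true ∧ Q.keeps xs as = true := by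
  simp only [keeps_iff, wv, wa, List.mem_append, not_or]
  exact ⟨fun h => ⟨⟨fun x hx => (h.1 x hx).1, fun x hx => (h.2 x hx).1⟩,
    fun x hx => (h.1 x hx).2, fun x hx => (h.2 x hx).2⟩,
    fun h => ⟨fun x hx => ⟨h.1.1 x hx, h.2.1 x hx⟩, fun x hx => ⟨h.1.2 x hx, h.2.2 x hx⟩⟩⟩

theorem slotCmd_w (r t : ℕ) : (slotCmd r t).wv = [] ∧ (slotCmd r t).wa ⊆ [13] := by
  unfold slotCmd
  split <;> simp [wv, wa]

theorem slots_keeps (t : ℕ → ℕ) (r : ℕ) : (slots t r).keeps baseVars baseArrs := by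
  induction r with
  | zero => rfl
  | succ r ih =>
    obtain ⟨h1, h2⟩ := slotCmd_w r (t r)
    refine keeps_seq.2 ⟨ih, keeps_iff.2 ⟨fun x _ => by simp [h1], fun a ha h => ?_⟩⟩
    have := List.mem_singleton.1 (h2 h)
    subst this
    revert ha; decide

/-- An edge between two listed vertices may occupy two slots; all digits other than 0 agree with
`p`, so the order of the stores is irrelevant. A slot whose value is not below `D.m` writes outside
the cells that matter. -/
theorem slots_spec (hk : D.k ≤ 3) (h : Base D cc σ) {t : ℕ → ℕ} {p : ℕ → ℕ}
    (h13 : ∀ i < D.m, σ.arr 13 i = 0)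
    (ht : ∀ r < 6, t r ≠ 0 → t r < 5 ∧ (t r = 4 ∨ t r ≤ (D.l (r / 2)).length) ∧
      (σ.var (40 + r) < D.m → p (σ.var (40 + r)) = digitCol D cc (r / 2) (t r)))
    (r : ℕ) (hr : r ≤ 6) : ((slots t r).den σ).var = σ.var ∧ ∀ i < D.m,
      ((∃ r' < r, t r' ≠ 0 ∧ σ.var (40 + r') = i) → ((slots t r).den σ).arr 13 i = p i) ∧
      ((¬ ∃ r' < r, t r' ≠ 0 ∧ σ.var (40 + r') = i) → ((slots t r).den σ).arr 13 i = 0) := by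
  induction r with
  | zero =>
    refine ⟨rfl, fun i hi => ⟨?_, fun _ => h13 i hi⟩⟩
    rintro ⟨r, hr, -⟩
    omega
  | succ r ih =>
    obtain ⟨i1, i2⟩ := ih (by omega)
    have hB : Base D cc ((slots t r).den σ) := h.den hk (slots_keeps t r)
    rw [slots, den]
    by_cases h0 : t r = 0
    · rw [h0, slotCmd, den]
      have e : ∀ i, (∃ r' < r + 1, t r' ≠ 0 ∧ σ.var (40 + r') = i) ↔
          ∃ r' < r, t r' ≠ 0 ∧ σ.var (40 + r') = i := by
        intro i
        constructor
        · rintro ⟨r', h1, h2, h3⟩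
          refine ⟨r', ?_, h2, h3⟩
          rcases Nat.lt_succ_iff_lt_or_eq.1 h1 with h | rfl
          exacts [h, absurd h0 h2]
        · rintro ⟨r', h1, h2⟩
          exact ⟨r', by omega, h2⟩
      simp only [e]
      exact ⟨i1, i2⟩
    · obtain ⟨t1, t2, t3⟩ := ht r (by omega) h0
      rw [slotCmd_spec hB (by omega) h0 t2 t1, i1]
      refine ⟨i1, fun i hi => ?_⟩
      rw [State.setArr_arr]
      by_cases hir : i = σ.var (40 + r)
      · rw [if_pos ⟨rfl, hir⟩]
        subst hir
        exact ⟨fun _ => (t3 hi).symm, fun hn => absurd ⟨r, by omega, h0, rfl⟩ hn⟩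
      · rw [if_neg fun h => hir h.2]
        refine ⟨?_, fun hn => (i2 i hi).2 ?_⟩
        · rintro ⟨r', h1, h2, h3⟩
          refine (i2 i hi).1 ⟨r', ?_, h2, h3⟩
          rcases Nat.lt_succ_iff_lt_or_eq.1 h1 with h | rfl
          exacts [h, absurd h3.symm hir]
        · rintro ⟨r', h1, h2⟩
          exact hn ⟨r', by omega, h2⟩

/-- Digits for a precolouring. -/
theorem _root_.Data.Coded.exists_digits (hk : D.k ≤ 3) (h : Base D cc σ) {p : ℕ → ℕ}
    (hp : D.Coded cc p) : ∃ t : ℕ → ℕ, (∀ r, t r < 5) ∧ ∀ τ : State, Base D cc τ →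
      (∀ r < 6, τ.var (40 + r) = σ.var (40 + r)) → (∀ i < D.m, τ.arr 13 i = 0) →
      ∀ i < D.m, ((slots t 6).den τ).arr 13 i = p i := by
  have h1 : ∀ r, ∃ t < 5, (t ≠ 0 → (t = 4 ∨ t ≤ (D.l (r / 2)).length) ∧
      (σ.var (40 + r) < D.m → p (σ.var (40 + r)) = digitCol D cc (r / 2) t)) ∧
      (r / 2 < D.k → D.deg (D.v (r / 2)) = 2 → σ.var (40 + r) < D.m →
        p (σ.var (40 + r)) ≠ 0 → t ≠ 0) := by
    intro r
    by_cases hr : r / 2 < D.k ∧ D.deg (D.v (r / 2)) = 2 ∧ σ.var (40 + r) < D.m ∧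
        p (σ.var (40 + r)) ≠ 0
    · obtain ⟨r1, r2, r3, r4⟩ := hr
      have hinc : D.inc (σ.var (40 + r)) (D.v (r / 2)) := by
        rw [h.slot _ r1 r2 _ r3]
        have : r = 2 * (r / 2) ∨ r = 2 * (r / 2) + 1 := by omega
        rcases this with h | h
        · left; rw [← h]
        · right; rw [← h]
      obtain ⟨t, t1, t2, t3, t4⟩ := (hp.code _ r1 r2 _ r3 hinc r4).exists_digit
      exact ⟨t, t1, fun _ => ⟨t4, fun _ => t3.symm⟩, fun _ _ _ _ => t2⟩
    · exact ⟨0, by omega, fun h => absurd rfl h, fun a b c d => absurd ⟨a, b, c, d⟩ hr⟩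
  choose t ht using h1
  refine ⟨t, fun r => (ht r).1, fun τ hτ hv h13 i hi => ?_⟩
  have := ((slots_spec hk hτ (t := t) (p := p) h13 (fun r hr h0 => ⟨(ht r).1, ?_⟩) 6 le_rfl).2 i hi)
  · by_cases he : ∃ r' < 6, t r' ≠ 0 ∧ τ.var (40 + r') = i
    · exact this.1 he
    · rw [this.2 he]
      by_contra hpi
      obtain ⟨j, hj, hd, hij⟩ := hp.supp i hi (Ne.symm hpi)
      have hs := (h.slot j hj hd i hi).1 hij
      rcases hs with hs | hs
      · refine he ⟨2 * j, by omega, (ht (2 * j)).2.2 ?_ ?_ ?_ ?_, (hv _ (by omega)).trans hs.symm⟩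
        · rwa [show 2 * j / 2 = j by omega]
        · rwa [show 2 * j / 2 = j by omega]
        · rwa [← hs]
        · rw [← hs]; exact Ne.symm hpi
      · refine he ⟨2 * j + 1, by omega, (ht (2 * j + 1)).2.2 ?_ ?_ ?_ ?_, (hv _ (by omega)).trans hs.symm⟩
        · rwa [show (2 * j + 1) / 2 = j by omega]
        · rwa [show (2 * j + 1) / 2 = j by omega]
        · rwa [← hs]
        · rw [← hs]; exact Ne.symm hpi
  · rw [hv r hr]
    exact (ht r).2.1 h0

def markAdj (j a : ℕ) : Cmd := mark₂ 10 1 0 a (eq (load 0 I) (load 2 (const j))) (load 1 I)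
  (eq (load 1 I) (load 2 (const j))) (load 0 I)

/-- Common neighbours. -/
def Expr.com (x : Expr) : Expr := mul (load 21 x) (load 22 x)

def markNb : Cmd := mark₂ 10 1 0 23 (com (load 0 I)) (load 1 I) (com (load 1 I)) (load 0 I)

def Expr.nb (x : Expr) : Expr := mul (neg (eq x (load 2 (const 0))))
  (mul (neg (eq x (load 2 (const 1)))) (load 23 x))

def scatterExt (t : ℕ) : Cmd := scatter 10 1 13
  (add (mul (nb (load 0 I)) (neg (com (load 1 I)))) (mul (nb (load 1 I)) (neg (com (load 0 I)))))
  I (load 4 (const t))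

def ext (t : ℕ) : Cmd := block [markAdj 0 21, markAdj 1 22, markNb, scatterExt t]

theorem _root_.Data.adj_iff (hD : D.Valid) {x y : ℕ} :
    D.Adj x y ↔ ∃ i < D.m, (D.a i = x ∧ D.b i = y) ∨ (D.b i = x ∧ D.a i = y) := by
  constructor
  · rintro ⟨hxy, i, hi, rfl | rfl, h | h⟩
    exacts [absurd h hxy, ⟨i, hi, .inl ⟨rfl, h⟩⟩, ⟨i, hi, .inr ⟨rfl, h⟩⟩, absurd h hxy]
  · rintro ⟨i, hi, ⟨rfl, rfl⟩ | ⟨rfl, rfl⟩⟩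
    exacts [⟨hD.ne i hi, i, hi, .inl rfl, .inr rfl⟩, ⟨(hD.ne i hi).symm, i, hi, .inr rfl, .inl rfl⟩]

theorem markAdj_spec (hD : D.Valid) (h : Base D cc σ) (j a : ℕ) (ha : a ≠ 0 ∧ a ≠ 1 ∧ a ≠ 2)
    {x : ℕ} (hx : x < D.n) :
    ((markAdj j a).den σ).arr a x ≠ 0 ↔ D.Adj (D.v j) x := by
  have hc : ∀ i, (eq (load i I) (load 2 (const j))).noArr a = (decide (i ≠ a)) := by
    intro i
    simp [noArr, ha.2.2.symm]
  rw [markAdj, mark₂_spec σ (by simp [noArr, ha.1.symm, ha.2.2.symm])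
    (by simp [noArr, ha.2.1.symm]) (by simp [noArr, ha.2.1.symm, ha.2.2.symm])
    (by simp [noArr, ha.1.symm]) (by decide) (by rw [h.n]; exact hx), h.m, Data.adj_iff hD]
  refine exists_congr fun i => and_congr_right fun hi => ?_
  simp only [T_mul, T_add, T_lt, T_eq, T_neg, T_load, T_var, eval_load, eval_var, eval_const,
      State.setVar_var, State.setVar_arr, ↓reduceIte,
      Nat.reduceEqDiff, OfNat.ofNat_eq_ofNat]
  rw [h.a i hi, h.b i hi, h.v]

theorem ext_spec (hD : D.Valid) (h : Base D cc σ) {t : ℕ} (ht : t < (D.l 0).length) {i : ℕ}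
    (hi : i < D.m) :
    (D.Ext i → ((ext t).den σ).arr 13 i = (D.l 0).getD t 0) ∧
      (¬ D.Ext i → ((ext t).den σ).arr 13 i = σ.arr 13 i) := by
  have hk := hD.k_le
  obtain ⟨σ1, d1⟩ : ∃ τ, τ = (markAdj 0 21).den σ := ⟨_, rfl⟩
  obtain ⟨σ2, d2⟩ : ∃ τ, τ = (markAdj 1 22).den σ1 := ⟨_, rfl⟩
  obtain ⟨σ3, d3⟩ : ∃ τ, τ = markNb.den σ2 := ⟨_, rfl⟩
  have h1 : Base D cc σ1 := d1 ▸ h.den hk (by decide)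
  have h2 : Base D cc σ2 := d2 ▸ h1.den hk (by decide)
  have h3 : Base D cc σ3 := d3 ▸ h2.den hk (by decide)
  have com : ∀ x < D.n, (σ2.arr 21 x ≠ 0 ∧ σ2.arr 22 x ≠ 0 ↔ D.Com x) := by
    intro x hx
    have e : σ2.arr 21 = σ1.arr 21 := d2 ▸ den_arr _ (by decide) σ1
    rw [e, d2, markAdj_spec hD h1 1 22 (by decide) hx, d1,
      markAdj_spec hD h 0 21 (by decide) hx, Data.Com]
  have nb : ∀ x < D.n, (σ3.arr 23 x ≠ 0 ↔ ∃ u, D.Com u ∧ D.Adj u x) := by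
    intro x hx
    rw [d3, markNb, mark₂_spec σ2 rfl rfl rfl rfl (by decide) (by rw [h2.n]; exact hx), h2.m]
    have e : ∀ j < D.m, (((mul (load 21 (load 0 I)) (load 22 (load 0 I))).T (σ2.setVar 10 j) ∧
        (load 1 I).eval (σ2.setVar 10 j) = x ∨
        (mul (load 21 (load 1 I)) (load 22 (load 1 I))).T (σ2.setVar 10 j) ∧
        (load 0 I).eval (σ2.setVar 10 j) = x) ↔
        (D.Com (D.a j) ∧ D.b j = x ∨ D.Com (D.b j) ∧ D.a j = x)) := by
      intro j hj
      simp only [T_mul, T_add, T_lt, T_eq, T_neg, T_load, T_var, eval_load, eval_var, eval_const,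
      State.setVar_var, State.setVar_arr, ↓reduceIte,
      Nat.reduceEqDiff, OfNat.ofNat_eq_ofNat]
      rw [h2.a j hj, h2.b j hj, com _ (hD.a_lt j hj), com _ (hD.b_lt j hj)]
    constructor
    · rintro ⟨j, hj, hT⟩
      rcases (e j hj).1 hT with ⟨hc, hb⟩ | ⟨hc, hb⟩
      · exact ⟨_, hc, (Data.adj_iff hD).2 ⟨j, hj, .inl ⟨rfl, hb⟩⟩⟩
      · exact ⟨_, hc, (Data.adj_iff hD).2 ⟨j, hj, .inr ⟨rfl, hb⟩⟩⟩
    · rintro ⟨u, hu, hux⟩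
      obtain ⟨j, hj, ⟨rfl, hb⟩ | ⟨rfl, hb⟩⟩ := (Data.adj_iff hD).1 hux
      · exact ⟨j, hj, (e j hj).2 (.inl ⟨hu, hb⟩)⟩
      · exact ⟨j, hj, (e j hj).2 (.inr ⟨hu, hb⟩)⟩
  have com3 : ∀ x < D.n, (σ3.arr 21 x ≠ 0 ∧ σ3.arr 22 x ≠ 0 ↔ D.Com x) := by
    have e1 : σ3.arr 21 = σ2.arr 21 := d3 ▸ den_arr _ (by decide) σ2
    have e2 : σ3.arr 22 = σ2.arr 22 := d3 ▸ den_arr _ (by decide) σ2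
    rw [e1, e2]
    exact com
  have c13 : σ3.arr 13 = σ.arr 13 := by
    rw [d3, den_arr _ (by decide), d2, den_arr _ (by decide), d1, den_arr _ (by decide)]
  have hτ : (ext t).den σ = (scatterExt t).den σ3 := by rw [d3, d2, d1]; rfl
  have hcnd : ∀ j < D.m, ((add (mul (Expr.nb (load 0 I)) (neg (Expr.com (load 1 I))))
      (mul (Expr.nb (load 1 I)) (neg (Expr.com (load 0 I))))).T (σ3.setVar 10 j) ↔ D.Ext j) := by
    intro j hj
    simp only [Expr.com, Expr.nb, T_mul, T_add, T_lt, T_eq, T_neg, T_load, T_var, eval_load, eval_var, eval_const,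
      State.setVar_var, State.setVar_arr, ↓reduceIte,
      Nat.reduceEqDiff, OfNat.ofNat_eq_ofNat]
    rw [h3.a j hj, h3.b j hj, h3.v, h3.v, com3 _ (hD.a_lt j hj), com3 _ (hD.b_lt j hj),
      nb _ (hD.a_lt j hj), nb _ (hD.b_lt j hj), Data.Ext, Data.NbCom, Data.NbCom]
    simp only [hj, true_and, ne_eq]
  rw [hτ, scatterExt]
  rcases scatter_spec (i := 10) (b := 1) (a := 13) (cnd := _) (idx := I) (val := load 4 (const t))
    σ3 (show Expr.noArr 13 (add (mul (Expr.nb (load 0 I)) (neg (Expr.com (load 1 I))))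
      (mul (Expr.nb (load 1 I)) (neg (Expr.com (load 0 I))))) = true from rfl) rfl rfl i with
      ⟨j, g1, g2, g3, g4⟩ | ⟨g1, g2⟩
  · simp only [T_mul, T_add, T_lt, T_eq, T_neg, T_load, T_var, eval_load, eval_var, eval_const,
      State.setVar_var, State.setVar_arr, ↓reduceIte,
      Nat.reduceEqDiff, OfNat.ofNat_eq_ofNat, Expr.I] at g3
    subst g3
    refine ⟨fun _ => ?_, fun hn => absurd ((hcnd j hi).1 g2) hn⟩
    rw [g4]
    exact h3.l 0 (by omega) t ht
  · refine ⟨fun hE => absurd (by simp [eval, State.setVar_var])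
      (g1 i (by rw [h3.m]; exact hi) ((hcnd i hi).2 hE)), fun _ => ?_⟩
    rw [g2, c13]

def extCmd : ℕ → Cmd
  | 1 => ext 0
  | 2 => ext 1
  | 3 => ext 2
  | _ => skip

theorem extCmd_keeps (t : ℕ) : (extCmd t).keeps baseVars baseArrs := by
  unfold extCmd
  split <;> decide

def precolour (t : ℕ → ℕ) : Cmd :=
  seq (fill 10 1 13 (const 0)) (seq (slots t 6) (extCmd (t 6)))

theorem precolour_keeps (t : ℕ → ℕ) : (precolour t).keeps baseVars baseArrs :=
  keeps_seq.2 ⟨by decide, keeps_seq.2 ⟨slots_keeps t 6, extCmd_keeps _⟩⟩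

/-- Six digits describe the colours in the slots and the seventh one the colour of the edges in
`Ext`, with 0 for none. The digits depend only on the slots, which no trial changes, so they are
known before the trials begin. -/
theorem _root_.Data.Tried.exists_digits (hD : D.Valid) (h : Base D cc σ) {p : ℕ → ℕ}
    (hp : D.Tried cc p) : ∃ t : ℕ → ℕ, (∀ r, t r < 5) ∧ ∀ τ : State, Base D cc τ →
      (∀ r < 6, τ.var (40 + r) = σ.var (40 + r)) →
      ∀ i < D.m, ((precolour t).den τ).arr 13 i = p i := by
  have hk := hD.k_le
  obtain ⟨p₀, hp₀, hpe⟩ := hp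
  obtain ⟨t, ht5, ht⟩ := hp₀.exists_digits hk h
  set t' : ℕ → ℕ → ℕ := fun d r => if r = 6 then d else t r with ht'
  have key : ∀ d, ∀ τ : State, Base D cc τ → (∀ r < 6, τ.var (40 + r) = σ.var (40 + r)) →
      ∃ τ', Base D cc τ' ∧ (precolour (t' d)).den τ = (extCmd d).den τ' ∧
        ∀ i < D.m, τ'.arr 13 i = p₀ i := by
    intro d τ hτ hv
    have h1 : Base D cc ((fill 10 1 13 (const 0)).den τ) := hτ.den hk (by decide)
    refine ⟨(slots t 6).den ((fill 10 1 13 (const 0)).den τ), h1.den hk (slots_keeps t 6), ?_,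
      ht _ h1 (fun r hr => ?_) fun i hi => ?_⟩
    · rfl
    · rw [← hv r hr]
      exact den_var _ (by simp [fill, scatter, wv]; omega) τ
    · rw [fill_spec τ rfl (by rw [hτ.m]; exact hi)]
      rfl
  have h5 : ∀ d < 5, ∀ r, t' d r < 5 := by
    intro d hd r
    simp only [ht']
    split_ifs
    exacts [hd, ht5 r]
  rcases hpe with rfl | ⟨x, hx, rfl⟩
  · refine ⟨t' 0, h5 0 (by omega), fun τ hτ hv i hi => ?_⟩
    obtain ⟨τ', h1, h2, h3⟩ := key 0 τ hτ hv
    rw [h2]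
    exact h3 i hi
  · obtain ⟨e, he, rfl⟩ := List.mem_iff_getElem.1 hx
    rw [List.length_take] at he
    have hl : e < (D.l 0).length := by omega
    have he3 : e < 3 := by omega
    refine ⟨t' (e + 1), h5 _ (by omega), fun τ hτ hv i hi => ?_⟩
    obtain ⟨τ', h1, h2, h3⟩ := key (e + 1) τ hτ hv
    have h4 : extCmd (e + 1) = ext e := by interval_cases e <;> rfl
    obtain ⟨g1, g2⟩ := ext_spec hD h1 hl hi
    rw [h2, h4, List.getElem_take, ← List.getD_eq_getElem _ 0 hl]
    by_cases hE : D.Ext i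
    · exact (g1 hE).trans (if_pos hE).symm
    · exact ((g2 hE).trans (h3 i hi)).trans (if_neg hE).symm

/-! ### The edges that are to be coloured -/

def fillR : Cmd := fill 10 1 16 (tr (mul (eq (load 13 I) (const 0))
  (add (load 12 (load 0 I)) (load 12 (load 1 I)))))

def tallyR : Cmd := tally 10 1 0 26 (load 16 I) (load 15 I)

def fillRY : Cmd := fill 10 1 32 (tr (mul (load 16 I) (lt (const 1) (load 26 (load 15 I)))))

def other : Expr := mul (eq (load 13 I) (const 0)) (neg (load 16 I))

def markOther : Cmd := mark₂ 10 1 0 21 other (load 0 I) other (load 1 I)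

def clearPre : Cmd := fill 10 0 22 (const 0)

def scatterPreA : Cmd := scatter 10 1 22 (neg (eq (load 13 I) (const 0))) (load 0 I) (load 13 I)

def scatterPreB : Cmd := scatter 10 1 22 (neg (eq (load 13 I) (const 0))) (load 1 I) (load 13 I)

def fillFr : Cmd := fill 10 1 17 (tr (mul (load 16 I) (load 21 (load 15 I))))

def markFr : Cmd := markEx 10 13 1 17 (mul (mul (load 16 I) (load 22 (load 15 I)))
  (mul (inc J (load 14 I)) (eq (load 13 J) (load 22 (load 15 I)))))

def derive : Cmd := block [fillR, tallyR, fillRY, markOther, clearPre, scatterPreA, scatterPreB,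
  fillFr, markFr]

/-- Each vertex receives the colour of one precoloured edge at it. At the right end of an edge of
`R` there is at most one such edge, so nothing is lost. -/
theorem preScatter_spec (h : Base D cc σ) {p : ℕ → ℕ} (h13 : ∀ i < D.m, σ.arr 13 i = p i) {y : ℕ}
    (hy : y < D.n) :
    (((block [clearPre, scatterPreA, scatterPreB]).den σ).arr 22 y = 0 ∧
      ∀ j < D.m, p j ≠ 0 → ¬ D.inc j y) ∨
    ∃ j < D.m, p j ≠ 0 ∧ D.inc j y ∧
      ((block [clearPre, scatterPreA, scatterPreB]).den σ).arr 22 y = p j := by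
  obtain ⟨σ1, d1⟩ : ∃ τ, τ = clearPre.den σ := ⟨_, rfl⟩
  obtain ⟨σ2, d2⟩ : ∃ τ, τ = scatterPreA.den σ1 := ⟨_, rfl⟩
  obtain ⟨σ3, d3⟩ : ∃ τ, τ = scatterPreB.den σ2 := ⟨_, rfl⟩
  have e : (block [clearPre, scatterPreA, scatterPreB]).den σ = σ3 := by rw [d3, d2, d1]; rfl
  rw [e]
  have m1 : σ1.var 1 = D.m := h.m ▸ d1 ▸ den_var _ (by decide) σ
  have m2 : σ2.var 1 = D.m := m1 ▸ d2 ▸ den_var _ (by decide) σ1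
  have f1 : ∀ a, a ≠ 22 → σ1.arr a = σ.arr a := fun a ha =>
    d1 ▸ den_arr _ (by simp [clearPre, fill, scatter, wa, ha]) σ
  have f2 : ∀ a, a ≠ 22 → σ2.arr a = σ.arr a := fun a ha =>
    f1 a ha ▸ d2 ▸ den_arr _ (by simp [scatterPreA, scatter, wa, ha]) σ1
  have z1 : σ1.arr 22 y = 0 := by
    rw [d1, clearPre, fill_spec σ rfl (by rw [h.n]; exact hy)]
    rfl
  have s2 := scatter_spec (i := 10) (b := 1) (a := 22) (cnd := neg (eq (load 13 I) (const 0)))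
    (idx := load 0 I) (val := load 13 I) σ1 rfl rfl rfl y
  have s3 := scatter_spec (i := 10) (b := 1) (a := 22) (cnd := neg (eq (load 13 I) (const 0)))
    (idx := load 1 I) (val := load 13 I) σ2 rfl rfl rfl y
  rw [← scatterPreA, ← d2, m1] at s2
  rw [← scatterPreB, ← d3, m2] at s3
  simp only [T_mul, T_add, T_lt, T_eq, T_neg, T_load, T_var, eval_load, eval_var, eval_const,
      State.setVar_var, State.setVar_arr, ↓reduceIte,
      Nat.reduceEqDiff, OfNat.ofNat_eq_ofNat] at s2 s3
  rw [f2 13 (by decide), f2 1 (by decide)] at s3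
  rw [f1 13 (by decide), f1 0 (by decide)] at s2
  rcases s3 with ⟨j, hj, h1, h2, h3⟩ | ⟨h1, h2⟩
  · rw [h13 j hj] at h1 h3
    rw [h.b j hj] at h2
    exact .inr ⟨j, hj, h1, .inr h2, h3⟩
  · rcases s2 with ⟨j, hj, g1, g2, g3⟩ | ⟨g1, g2⟩
    · rw [h13 j hj] at g1 g3
      rw [h.a j hj] at g2
      exact .inr ⟨j, hj, g1, .inl g2, h2.trans g3⟩
    · refine .inl ⟨by rw [h2, g2, z1], fun j hj hpj => ?_⟩
      have h1 := h1 j hj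
      have g1 := g1 j hj
      rw [h13 j hj, h.b j hj] at h1
      rw [h13 j hj, h.a j hj] at g1
      rintro (h | h)
      exacts [g1 hpj h, h1 hpj h]

theorem derive_spec (hD : D.Valid) (h : Base D cc σ) {p : ℕ → ℕ} (hp : D.IsPre p)
    (h13 : ∀ i < D.m, σ.arr 13 i = p i) : Mid D cc p (derive.den σ) := by
  classical
  have hk := hD.k_le
  have hX : ∀ i < D.m, D.X i < D.n := fun i hi => hD.lt_of_inc hi (Data.inc_X i)
  have hY : ∀ i < D.m, D.Y i < D.n := fun i hi => hD.lt_of_inc hi (Data.inc_Y i)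
  obtain ⟨σ1, d1⟩ : ∃ τ, τ = fillR.den σ := ⟨_, rfl⟩
  have h1 : Base D cc σ1 := d1 ▸ h.den hk (by decide)
  have s1 : ∀ i < D.m, σ1.arr 16 i ≠ 0 ↔ D.R p i := by
    intro i hi
    rw [d1, fillR, fill_spec σ rfl (by rw [h.m]; exact hi), tr_eval]
    simp only [T_mul, T_add, T_lt, T_eq, T_neg, T_load, T_var, eval_load, eval_var, eval_const,
      State.setVar_var, State.setVar_arr, ↓reduceIte,
      Nat.reduceEqDiff, OfNat.ofNat_eq_ofNat]
    rw [h13 i hi, h.a i hi, h.b i hi, h.cen _ (hD.a_lt i hi), h.cen _ (hD.b_lt i hi), Data.R]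
    exact ⟨fun g => ⟨hi, g⟩, fun g => g.2⟩
  have p1 : σ1.arr 13 = σ.arr 13 := d1 ▸ den_arr _ (by decide) σ
  obtain ⟨σ2, d2⟩ : ∃ τ, τ = tallyR.den σ1 := ⟨_, rfl⟩
  have h2 : Base D cc σ2 := d2 ▸ h1.den hk (by decide)
  have s2 : ∀ y < D.n, σ2.arr 26 y =
      ((Finset.range D.m).filter (fun j => D.R p j ∧ D.Y j = y)).card := by
    intro y hy
    rw [d2, tallyR, tally_spec σ1 rfl rfl (by decide) (by rw [h1.n]; exact hy), h1.m]
    refine congrArg Finset.card (Finset.filter_congr fun j hj => ?_)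
    have hj := Finset.mem_range.1 hj
    simp only [T_mul, T_add, T_lt, T_eq, T_neg, T_load, T_var, eval_load, eval_var, eval_const,
      State.setVar_var, State.setVar_arr, ↓reduceIte,
      Nat.reduceEqDiff, OfNat.ofNat_eq_ofNat]
    rw [s1 j hj, h1.Y j hj]
  have r2 : σ2.arr 16 = σ1.arr 16 := d2 ▸ den_arr _ (by decide) σ1
  obtain ⟨σ3, d3⟩ : ∃ τ, τ = fillRY.den σ2 := ⟨_, rfl⟩
  have h3 : Base D cc σ3 := d3 ▸ h2.den hk (by decide)
  have s3 : ∀ i < D.m, σ3.arr 32 i ≠ 0 ↔ D.RY p i := by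
    intro i hi
    rw [d3, fillRY, fill_spec σ2 rfl (by rw [h2.m]; exact hi), tr_eval]
    simp only [T_mul, T_add, T_lt, T_eq, T_neg, T_load, T_var, eval_load, eval_var, eval_const,
      State.setVar_var, State.setVar_arr, ↓reduceIte,
      Nat.reduceEqDiff, OfNat.ofNat_eq_ofNat]
    -- More than one edge of `R` at the right end means an edge of `R` besides `i`.
    rw [r2, s1 i hi, h2.Y i hi, s2 _ (hY i hi), Data.RY, Finset.one_lt_card]
    refine and_congr_right fun hR => ⟨?_, ?_⟩
    · rintro ⟨a, ha, b, hb, hab⟩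
      simp only [Finset.mem_filter] at ha hb
      by_cases hai : a = i
      · exact ⟨b, by rintro rfl; exact hab hai, hb.2⟩
      · exact ⟨a, hai, ha.2⟩
    · rintro ⟨j, hj, hjR, hjY⟩
      exact ⟨i, by simp [hi, hR], j, by simp [hjR.1, hjR, hjY], hj.symm⟩
  have r3 : σ3.arr 16 = σ1.arr 16 := r2 ▸ d3 ▸ den_arr _ (by decide) σ2
  have p3 : σ3.arr 13 = σ.arr 13 := by
    rw [d3, den_arr _ (by decide), d2, den_arr _ (by decide), p1]
  obtain ⟨σ4, d4⟩ : ∃ τ, τ = markOther.den σ3 := ⟨_, rfl⟩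
  have h4 : Base D cc σ4 := d4 ▸ h3.den hk (by decide)
  have s4 : ∀ y < D.n, σ4.arr 21 y ≠ 0 ↔ ∃ j < D.m, p j = 0 ∧ ¬ D.R p j ∧ D.inc j y := by
    intro y hy
    rw [d4, markOther, other, mark₂_spec σ3 rfl rfl rfl rfl (by decide) (by rw [h3.n]; exact hy),
      h3.m]
    refine exists_congr fun j => and_congr_right fun hj => ?_
    simp only [T_mul, T_add, T_lt, T_eq, T_neg, T_load, T_var, eval_load, eval_var, eval_const,
      State.setVar_var, State.setVar_arr, ↓reduceIte,
      Nat.reduceEqDiff, OfNat.ofNat_eq_ofNat]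
    rw [p3, h13 j hj, r3, s1 j hj, h3.a j hj, h3.b j hj, ← and_or_left, and_assoc]
    exact Iff.rfl
  have p4 : σ4.arr 13 = σ.arr 13 := p3 ▸ d4 ▸ den_arr _ (by decide) σ3
  obtain ⟨σ5, d5⟩ : ∃ τ, τ = (block [clearPre, scatterPreA, scatterPreB]).den σ4 := ⟨_, rfl⟩
  have h5 : Base D cc σ5 := d5 ▸ h4.den hk (by decide)
  have s5 : ∀ y < D.n, _ := fun y hy => preScatter_spec h4 (p := p) (fun i hi => by
    rw [p4]; exact h13 i hi) (y := y) hy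
  rw [← d5] at s5
  have r5 : σ5.arr 16 = σ1.arr 16 := by
    rw [d5, den_arr _ (by decide), d4, den_arr _ (by decide), r3]
  have s45 : σ5.arr 21 = σ4.arr 21 := d5 ▸ den_arr _ (by decide) σ4
  have p5 : σ5.arr 13 = σ.arr 13 := p4 ▸ d5 ▸ den_arr _ (by decide) σ4
  obtain ⟨σ6, d6⟩ : ∃ τ, τ = fillFr.den σ5 := ⟨_, rfl⟩
  have h6 : Base D cc σ6 := d6 ▸ h5.den hk (by decide)
  have s6 : ∀ i < D.m, σ6.arr 17 i ≠ 0 ↔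
      D.R p i ∧ ∃ j < D.m, p j = 0 ∧ ¬ D.R p j ∧ D.inc j (D.Y i) := by
    intro i hi
    rw [d6, fillFr, fill_spec σ5 rfl (by rw [h5.m]; exact hi), tr_eval]
    simp only [T_mul, T_add, T_lt, T_eq, T_neg, T_load, T_var, eval_load, eval_var, eval_const,
      State.setVar_var, State.setVar_arr, ↓reduceIte,
      Nat.reduceEqDiff, OfNat.ofNat_eq_ofNat]
    rw [r5, s1 i hi, h5.Y i hi, s45, s4 _ (hY i hi)]
  have r6 : σ6.arr 16 = σ1.arr 16 := r5 ▸ d6 ▸ den_arr _ (by decide) σ5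
  have p6 : σ6.arr 13 = σ.arr 13 := p5 ▸ d6 ▸ den_arr _ (by decide) σ5
  have s56 : σ6.arr 22 = σ5.arr 22 := d6 ▸ den_arr _ (by decide) σ5
  obtain ⟨σ7, d7⟩ : ∃ τ, τ = markFr.den σ6 := ⟨_, rfl⟩
  have h7 : Base D cc σ7 := d7 ▸ h6.den hk (by decide)
  have s7 : ∀ i < D.m, σ7.arr 17 i ≠ 0 ↔ D.Fr p i := by
    intro i hi
    rw [d7, markFr, markEx_spec σ6 rfl (by decide) (by decide) (by decide), s6 i hi, h6.m, Data.Fr,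
      and_or_left]
    refine or_congr Iff.rfl ?_
    have e : ∀ j < D.m, ((mul (mul (load 16 I) (load 22 (load 15 I)))
        (mul (inc J (load 14 I)) (eq (load 13 J) (load 22 (load 15 I))))).T
        ((σ6.setVar 10 i).setVar 13 j) ↔ (D.R p i ∧ σ5.arr 22 (D.Y i) ≠ 0) ∧
          D.inc j (D.X i) ∧ p j = σ5.arr 22 (D.Y i)) := by
      intro j hj
      simp only [T_mul, T_add, T_lt, T_eq, T_neg, T_load, T_var, eval_load, eval_var, eval_const,
      State.setVar_var, State.setVar_arr, ↓reduceIte,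
      Nat.reduceEqDiff, OfNat.ofNat_eq_ofNat]
      rw [r6, s1 i hi, h6.Y i hi, s56, h6.a j hj, h6.b j hj, h6.X i hi, p6, h13 j hj, Data.inc]
    constructor
    · rintro ⟨-, j, hj, hT⟩
      obtain ⟨⟨g1, g2⟩, g3, g4⟩ := (e j hj).1 hT
      rcases s5 _ (hY i hi) with ⟨f1, -⟩ | ⟨l, f1, f2, f3, f4⟩
      · exact absurd f1 g2
      · exact ⟨g1, l, f1, f2, f3, j, hj, g3, g4.trans f4⟩
    · rintro ⟨g1, l, g2, g3, g4, j, hj, g5, g6⟩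
      refine ⟨hi, j, hj, (e j hj).2 ?_⟩
      rcases s5 _ (hY i hi) with ⟨-, f1⟩ | ⟨l', f1, f2, f3, f4⟩
      · exact absurd g4 (f1 l g2 g3)
      · have hll : l' = l := by
          by_contra hne
          have h3 := Data.card_three_le_deg hi g2 f1 (by rintro rfl; exact g3 g1.2.1)
            (by rintro rfl; exact f2 g1.2.1) (Ne.symm hne) (Data.inc_Y i) g4 f3
          have := hp.deg_Y g1
          omega
        subst hll
        rw [f4]
        exact ⟨⟨g1, f2⟩, g5, g6⟩
  have hτ : derive.den σ = σ7 := by rw [d7, d6, d5, d4, d3, d2, d1]; rfl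
  rw [hτ]
  have r7 : σ7.arr 16 = σ1.arr 16 := r6 ▸ d7 ▸ den_arr _ (by decide) σ6
  have p7 : σ7.arr 13 = σ.arr 13 := p6 ▸ d7 ▸ den_arr _ (by decide) σ6
  have y7 : σ7.arr 32 = σ3.arr 32 := by
    rw [d7, den_arr _ (by decide), d6, den_arr _ (by decide), d5, den_arr _ (by decide), d4,
      den_arr _ (by decide)]
  exact ⟨h7, fun i hi => by rw [p7]; exact h13 i hi, fun i hi => by rw [r7]; exact s1 i hi, s7,
    fun i hi => by rw [y7]; exact s3 i hi⟩

end RAM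

set_option linter.unusedSimpArgs false

namespace RAM

open RAM.Expr RAM.Cmd

variable {D : Data} {cc : ℕ} {σ : State}

/-! ### The trials -/

/-- Try the precolouring given by the digits `t`. -/
def attempt (t : ℕ → ℕ) : Cmd := ite (neg (var 26))
  (seq (precolour t) (block [derive, peel, colour, finish, check])) skip

def tryAll : ℕ → Cmd
  | 0 => skip
  | M + 1 => seq (tryAll M) (attempt fun r => M / 5 ^ r % 5)

theorem keeps_ite {xs as : List ℕ} {p : Expr} {P Q : Cmd} :
    (ite p P Q).keeps xs as = true ↔ P.keeps xs as = true ∧ Q.keeps xs as = true :=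
  keeps_seq (P := P) (Q := Q)

theorem attempt_keeps (t : ℕ → ℕ) : (attempt t).keeps baseVars baseArrs :=
  keeps_ite.2 ⟨keeps_seq.2 ⟨precolour_keeps t, by decide⟩, by decide⟩

theorem tryAll_keeps (M : ℕ) : (tryAll M).keeps baseVars baseArrs := by
  induction M with
  | zero => rfl
  | succ M ih => exact keeps_seq.2 ⟨ih, attempt_keeps _⟩

/-- The invariant is that array 30 holds a solution whenever variable 26 is set. Once it is set,
later trials do nothing, and a precolouring that satisfies `IsPre` is sure to set it. -/
theorem attempt_spec (hD : D.Valid) (h : Base D cc σ) (t : ℕ → ℕ)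
    (hs : σ.var 26 ≠ 0 → D.IsSol (σ.arr 30)) :
    (((attempt t).den σ).var 26 ≠ 0 → D.IsSol (((attempt t).den σ).arr 30)) ∧
    (σ.var 26 ≠ 0 → ((attempt t).den σ).var 26 ≠ 0) ∧
    (∀ p, D.IsPre p → (∀ i < D.m, ((precolour t).den σ).arr 13 i = p i) →
      ((attempt t).den σ).var 26 ≠ 0) := by
  have hk := hD.k_le
  have e : (neg (var 26)).T σ ↔ σ.var 26 = 0 := by rw [T_neg, T_var, not_not]
  by_cases hd : σ.var 26 = 0
  swap
  · rw [attempt, den_ite_neg fun h => hd (e.1 h), den]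
    exact ⟨hs, id, fun _ _ _ => hd⟩
  rw [attempt, den_ite_pos (e.2 hd)]
  have h1 : Base D cc ((precolour t).den σ) := h.den hk (precolour_keeps t)
  obtain ⟨σ1, d1⟩ : ∃ τ, τ = (precolour t).den σ := ⟨_, rfl⟩
  rw [← d1] at h1 ⊢
  obtain ⟨σ2, d2⟩ : ∃ τ, τ = derive.den σ1 := ⟨_, rfl⟩
  obtain ⟨σ3, d3⟩ : ∃ τ, τ = peel.den σ2 := ⟨_, rfl⟩
  obtain ⟨σ4, d4⟩ : ∃ τ, τ = colour.den σ3 := ⟨_, rfl⟩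
  obtain ⟨σ5, d5⟩ : ∃ τ, τ = finish.den σ4 := ⟨_, rfl⟩
  have h5 : Base D cc σ5 := by
    have : σ5 = (block [derive, peel, colour, finish]).den σ1 := by rw [d5, d4, d3, d2]; rfl
    exact this ▸ h1.den hk (by decide)
  have hτ : (seq (precolour t) (block [derive, peel, colour, finish, check])).den σ =
      check.den σ5 := by rw [d5, d4, d3, d2, d1]; rfl
  have v5 : σ5.var 26 = 0 := by
    have e1 : σ1.var 26 = σ.var 26 := by
      rw [d1]
      refine den_var _ ?_ σ
      have e2 : ∀ r, (slots t r).wv = [] := fun r => by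
        induction r with
        | zero => rfl
        | succ r ih => simp [slots, wv, ih, slotCmd_w]
      simp only [precolour, wv, e2, List.mem_append, not_or]
      refine ⟨by decide, by simp, ?_⟩
      unfold extCmd
      split <;> decide
    have : σ5 = (block [derive, peel, colour, finish]).den σ1 := by rw [d5, d4, d3, d2]; rfl
    rw [this, den_var _ (by decide), e1, hd]
  have c5 : (check.den σ5).arr 30 = σ5.arr 30 := den_arr _ (by decide) σ5
  have hc := check_spec hD h5
  rw [v5] at hc
  simp only [ne_eq, not_true_eq_false, false_or] at hc
  rw [hτ, c5]
  refine ⟨fun g => hc.1 g, fun g => absurd hd g, fun p hp hpi => hc.2 ?_⟩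
  have h2 : Mid D cc p σ2 := d2 ▸ derive_spec hD h1 hp hpi
  obtain ⟨h3, i3, t3⟩ := peel_spec hD hp h2
  rw [← d3] at h3 i3 t3
  obtain ⟨h4, c, i4, t4⟩ := colour_spec hD hp h3 rfl i3 t3
  rw [← d4] at h4 i4 t4
  exact d5 ▸ finish_spec hD hp h4 i4 t4

theorem exists_code (n : ℕ) (t : ℕ → ℕ) (ht : ∀ r, t r < 5) :
    ∃ M < 5 ^ n, ∀ r < n, M / 5 ^ r % 5 = t r := by
  induction n generalizing t with
  | zero => exact ⟨0, by simp, fun r hr => absurd hr (by omega)⟩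
  | succ n ih =>
    obtain ⟨M, hM, h⟩ := ih (fun r => t (r + 1)) fun r => ht _
    have h0 := ht 0
    refine ⟨t 0 + 5 * M, by rw [pow_succ]; omega, fun r hr => ?_⟩
    cases r with
    | zero => rw [pow_zero, Nat.div_one]; omega
    | succ r =>
      rw [pow_succ', ← Nat.div_div_eq_div_mul, ← h r (by omega)]
      congr 2
      omega

theorem slots_congr {t t' : ℕ → ℕ} (r : ℕ) (h : ∀ r' < r, t r' = t' r') :
    slots t r = slots t' r := by
  induction r with
  | zero => rfl
  | succ r ih => rw [slots, slots, ih fun r' hr => h r' (by omega), h r (by omega)]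

theorem tryAll_spec (hD : D.Valid) (h : Base D cc σ) (h26 : σ.var 26 = 0) {p : ℕ → ℕ}
    (hp : D.IsPre p) (ht : D.Tried cc p) (M : ℕ) (hM : M = 5 ^ 7) :
    D.IsSol (((tryAll M).den σ).arr 30) := by
  have hk := hD.k_le
  obtain ⟨t, t5, ht⟩ := ht.exists_digits hD h
  obtain ⟨M₀, hM₀, hc⟩ := exists_code 7 t t5
  have hpc : precolour (fun r => M₀ / 5 ^ r % 5) = precolour t := by
    simp only [precolour]
    rw [hc 6 (by omega), slots_congr 6 fun r hr => hc r (by omega)]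
  have key : ∀ M, (((tryAll M).den σ).var 26 ≠ 0 → D.IsSol (((tryAll M).den σ).arr 30)) ∧
      (M₀ < M → ((tryAll M).den σ).var 26 ≠ 0) := by
    intro M
    induction M with
    | zero => exact ⟨fun g => absurd h26 g, fun g => absurd g (by omega)⟩
    | succ M ih =>
      have hB : Base D cc ((tryAll M).den σ) := h.den hk (tryAll_keeps M)
      obtain ⟨a1, a2, a3⟩ := attempt_spec hD hB (fun r => M / 5 ^ r % 5) ih.1
      refine ⟨a1, fun hlt => ?_⟩
      rcases Nat.lt_succ_iff_lt_or_eq.1 hlt with hlt | rfl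
      · exact a2 (ih.2 hlt)
      · refine a3 p hp ?_
        rw [hpc]
        refine ht _ hB fun r hr => keeps_var (tryAll_keeps _) σ _ ?_
        interval_cases r <;> decide
  exact (key M).1 ((key M).2 (hM ▸ hM₀))

/-! ### The preparations -/

structure Init (D : Data) (σ : State) : Prop where
  n : σ.var 0 = D.n
  m : σ.var 1 = D.m
  k : σ.var 2 = D.k
  a : ∀ i < D.m, σ.arr 0 i = D.a i
  b : ∀ i < D.m, σ.arr 1 i = D.b i
  v : ∀ j, σ.arr 2 j = D.v j
  len : ∀ j < 3, σ.arr 3 j = (D.l j).length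
  l : ∀ j < 3, ∀ i < (D.l j).length, σ.arr (4 + j) i = (D.l j).getD i 0

theorem Init.den (h : Init D σ) {C : Cmd} (hC : C.keeps [0, 1, 2] [0, 1, 2, 3, 4, 5, 6]) :
    Init D (C.den σ) where
  n := (keeps_var hC σ 0 (by decide)).trans h.n
  m := (keeps_var hC σ 1 (by decide)).trans h.m
  k := (keeps_var hC σ 2 (by decide)).trans h.k
  a i hi := by rw [keeps_arr hC σ 0 (by decide)]; exact h.a i hi
  b i hi := by rw [keeps_arr hC σ 1 (by decide)]; exact h.b i hi
  v j := by rw [keeps_arr hC σ 2 (by decide)]; exact h.v j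
  len j hj := by rw [keeps_arr hC σ 3 (by decide)]; exact h.len j hj
  l j hj i hi := by
    rw [keeps_arr hC σ (4 + j) (by interval_cases j <;> decide)]; exact h.l j hj i hi

def listMarks (j : ℕ) : Cmd := scatter 10 1 (27 + j) (lt I (load 3 (const j))) (load (4 + j) I)
  (const 1)

def degrees : Cmd := seq (tally 10 1 0 10 (const 1) (load 0 I)) (count 10 1 10 (const 1) (load 1 I))

def maxDeg : Cmd := seq (assign 20 (const 3))
  (loop 10 0 (ite (lt (var 20) (load 10 I)) (assign 20 (load 10 I)) skip))

def markS : Cmd := mark 10 2 0 11 (const 1) (load 2 I)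

def fillCen : Cmd := fill 10 0 12 (tr (add (lt (const 2) (load 10 I)) (load 11 I)))

def fillSl : Cmd := fill 10 0 31 (tr (mul (neg (load 11 I)) (lt (load 10 I) (var 20))))

/-- Store in array `a` the ends in array `y`, and those in array `x` at the edges whose first
end is a center. -/
def endsAt (a x y : ℕ) : Cmd := seq (fill 10 1 a (load y I))
  (scatter 10 1 a (load 12 (load 0 I)) I (load x I))

def commonCol (i j : ℕ) : Cmd := block [assign 30 (const 0),
  flag 10 1 30 (mul (lt (const j) (var 2))
    (mul (inc I (load 2 (const i))) (inc I (load 2 (const j))))),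
  find 10 1 31 (mul (lt I (load 3 (const i))) (load (27 + j) (load (4 + i) I))),
  ite (var 30) (assign 21 (load (4 + i) (var 31))) skip]

def findSlots (j : ℕ) : Cmd := seq (find 10 1 (40 + 2 * j) (inc I (load 2 (const j))))
  (find 10 1 (40 + (2 * j + 1)) (mul (inc I (load 2 (const j))) (neg (eq I (var (40 + 2 * j))))))

theorem listMarks_spec (h : Init D σ) {j : ℕ} (hj : j < 3) (hl : (D.l j).length ≤ D.m)
    (hz : ∀ c, σ.arr (27 + j) c = 0) (c : ℕ) :
    ((listMarks j).den σ).arr (27 + j) c ≠ 0 ↔ c ∈ D.l j := by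
  have e1 : (lt I (load 3 (const j))).noArr (27 + j) = true := by simp [noArr]; omega
  have e2 : (load (4 + j) I).noArr (27 + j) = true := by simp [noArr]
  rw [listMarks, scatter_one_spec σ e1 e2, hz, h.m]
  simp only [T_mul, T_add, T_lt, T_eq, T_neg, T_load, T_var, eval_load, eval_var, eval_const,
      State.setVar_var, State.setVar_arr, ↓reduceIte,
      Nat.reduceEqDiff, OfNat.ofNat_eq_ofNat]
  rw [h.len j hj, List.mem_iff_getElem]
  simp only [ne_eq, not_true_eq_false, false_or]
  constructor
  · rintro ⟨i, -, h1, h2⟩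
    refine ⟨i, h1, ?_⟩
    rw [← h2, h.l j hj i h1, List.getD_eq_getElem _ 0 h1]
  · rintro ⟨i, h1, h2⟩
    refine ⟨i, by omega, h1, ?_⟩
    rw [← h2, h.l j hj i h1, List.getD_eq_getElem _ 0 h1]

theorem degrees_spec (hD : D.Valid) (h : Init D σ) {x : ℕ} (hx : x < D.n) :
    (degrees.den σ).arr 10 x = D.deg x := by
  classical
  have h1 : Init D ((tally 10 1 0 10 (const 1) (load 0 I)).den σ) := h.den (by decide)
  rw [degrees, den, count_spec _ rfl rfl, tally_spec σ rfl rfl (by decide) (by rw [h.n]; exact hx),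
    h1.m, h.m]
  simp only [T_one, T_mul, T_add, T_lt, T_eq, T_neg, T_load, T_var, eval_load, eval_var, eval_const,
      State.setVar_var, State.setVar_arr, ↓reduceIte,
      Nat.reduceEqDiff, OfNat.ofNat_eq_ofNat]
  rw [Data.deg, ← Finset.card_union_of_disjoint]
  · congr 1
    ext i
    simp only [Finset.mem_union, Finset.mem_filter, Finset.mem_range, true_and]
    constructor
    · rintro (⟨hi, he⟩ | ⟨hi, he⟩)
      · exact ⟨hi, .inl (by rw [← h.a i hi]; exact he)⟩
      · exact ⟨hi, .inr (by rw [← h1.b i hi]; exact he)⟩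
    · rintro ⟨hi, he | he⟩
      · exact .inl ⟨hi, by rw [h.a i hi]; exact he⟩
      · exact .inr ⟨hi, by rw [h1.b i hi]; exact he⟩
  · rw [Finset.disjoint_left]
    intro i hi hi'
    simp only [Finset.mem_filter, Finset.mem_range, true_and] at hi hi'
    rw [h.a i hi.1] at hi
    rw [h1.b i hi.1] at hi'
    exact hD.ne i hi.1 (hi.2.trans hi'.2.symm)

theorem maxDeg_spec (h : Init D σ) (hd : ∀ x < D.n, σ.arr 10 x = D.deg x) :
    (maxDeg.den σ).var 20 = D.s := by
  have key := den_loop_induction 10 0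
    (ite (lt (var 20) (load 10 I)) (assign 20 (load 10 I)) skip) ((assign 20 (const 3)).den σ)
    (fun r τ => τ.arr = σ.arr ∧ τ.var 20 = max 3 ((Finset.range r).sup D.deg)) ⟨rfl, rfl⟩ ?_
  · have e : ((assign 20 (const 3)).den σ).var 0 = D.n := h.n
    rw [e] at key
    exact key.2
  · rintro r hr τ ⟨h1, h2⟩ h3
    have hr : r < D.n := by rw [← h.n]; exact hr
    refine ⟨?_, ?_⟩
    · rw [State.setVar_arr, ← h1]
      exact funext fun a => den_arr _ (by simp [wa]) τ
    rw [State.setVar_var, if_neg (by decide), Finset.range_add_one, Finset.sup_insert]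
    have e : (load 10 I).eval τ = D.deg r := by
      rw [eval_load, eval_var, h3, h1, hd r hr]
    by_cases hlt : τ.var 20 < D.deg r
    · rw [den_ite_pos (by rw [T_lt, e]; exact hlt), den, State.setVar_var, if_pos rfl, e]
      omega
    · rw [den_ite_neg (by rw [T_lt, e]; exact hlt), den]
      omega

theorem endsAt_spec (hD : D.Valid) (h : Init D σ) {a x y : ℕ}
    (hc : ∀ x < D.n, σ.arr 12 x ≠ 0 ↔ D.cen x) (ha : a ≠ 12 ∧ a ≠ 0) (hx : x ≠ a) (hy : y ≠ a)
    {i : ℕ} (hi : i < D.m) : (D.cen (D.a i) → ((endsAt a x y).den σ).arr a i = σ.arr x i) ∧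
      (¬ D.cen (D.a i) → ((endsAt a x y).den σ).arr a i = σ.arr y i) := by
  obtain ⟨σ1, d1⟩ : ∃ τ, τ = (fill 10 1 a (load y I)).den σ := ⟨_, rfl⟩
  have f1 : ∀ b, b ≠ a → σ1.arr b = σ.arr b := fun b hb =>
    d1 ▸ den_arr _ (by simp [fill, scatter, wa, hb]) σ
  have m1 : σ1.var 1 = D.m := h.m ▸ d1 ▸ den_var _ (by simp [fill, scatter, wv]) σ
  have s1 : σ1.arr a i = σ.arr y i := by
    rw [d1, fill_spec σ (by simp [noArr, hy]) (by rw [h.m]; exact hi)]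
    simp only [T_mul, T_add, T_lt, T_eq, T_neg, T_load, T_var, eval_load, eval_var, eval_const,
      State.setVar_var, State.setVar_arr, ↓reduceIte,
      Nat.reduceEqDiff, OfNat.ofNat_eq_ofNat]
  rw [endsAt, den, ← d1]
  have hT : ∀ j < D.m, ((load 12 (load 0 I)).T (σ1.setVar 10 j) ↔ D.cen (D.a j)) := by
    intro j hj
    simp only [T_mul, T_add, T_lt, T_eq, T_neg, T_load, T_var, eval_load, eval_var, eval_const,
      State.setVar_var, State.setVar_arr, ↓reduceIte,
      Nat.reduceEqDiff, OfNat.ofNat_eq_ofNat]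
    rw [f1 12 ha.1.symm, f1 0 ha.2.symm, h.a j hj, hc _ (hD.a_lt j hj)]
  rcases scatter_spec (i := 10) (b := 1) (a := a) (cnd := load 12 (load 0 I)) (idx := I)
    (val := load x I) σ1 (by simp [noArr, ha.1.symm, ha.2.symm]) rfl (by simp [noArr, hx]) i with
    ⟨j, h1, h2, h3, h4⟩ | ⟨h1, h2⟩
  · simp only [T_mul, T_add, T_lt, T_eq, T_neg, T_load, T_var, eval_load, eval_var, eval_const,
      State.setVar_var, State.setVar_arr, ↓reduceIte,
      Nat.reduceEqDiff, OfNat.ofNat_eq_ofNat, Expr.I] at h3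
    subst h3
    refine ⟨fun _ => ?_, fun hn => absurd ((hT j hi).1 h2) hn⟩
    rw [h4]
    simp only [T_mul, T_add, T_lt, T_eq, T_neg, T_load, T_var, eval_load, eval_var, eval_const,
      State.setVar_var, State.setVar_arr, ↓reduceIte,
      Nat.reduceEqDiff, OfNat.ofNat_eq_ofNat]
    rw [f1 x hx]
  · refine ⟨fun hcen => absurd (by simp [eval, State.setVar_var])
      (h1 i (by rw [m1]; exact hi) ((hT i hi).2 hcen)), fun _ => ?_⟩
    rw [h2, s1]

theorem findSlots_spec (h : Init D σ) {j : ℕ} (hj : j < 3) (hd : D.deg (D.v j) = 2) {i : ℕ}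
    (hi : i < D.m) : D.inc i (D.v j) ↔ i = ((findSlots j).den σ).var (40 + 2 * j) ∨
      i = ((findSlots j).den σ).var (40 + (2 * j + 1)) := by
  classical
  obtain ⟨σ1, d1⟩ : ∃ τ, τ = (find 10 1 (40 + 2 * j) (inc I (load 2 (const j)))).den σ := ⟨_, rfl⟩
  have h1 : Init D σ1 := d1 ▸ h.den (by interval_cases j <;> decide)
  have e1 : ∀ τ, Init D τ → ∀ i < D.m, ((inc I (load 2 (const j))).T (τ.setVar 10 i) ↔
      D.inc i (D.v j)) := by
    intro τ hτ i hi
    simp only [T_mul, T_add, T_lt, T_eq, T_neg, T_load, T_var, eval_load, eval_var, eval_const,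
      State.setVar_var, State.setVar_arr, ↓reduceIte,
      Nat.reduceEqDiff, OfNat.ofNat_eq_ofNat]
    rw [hτ.a i hi, hτ.b i hi, hτ.v, Data.inc]
  have s1 := find_spec (i := 10) (b := 1) (x := 40 + 2 * j) (cnd := inc I (load 2 (const j))) σ
    (by simp [noVar]; omega) (by omega) (by omega)
  rw [← d1, h.m] at s1
  have s2 := find_spec (i := 10) (b := 1) (x := 40 + (2 * j + 1)) (cnd := mul (inc I
    (load 2 (const j))) (neg (eq I (var (40 + 2 * j))))) σ1
    (by simp [noVar, neg]; omega) (by omega) (by omega)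
  rw [findSlots, den, ← d1]
  obtain ⟨σ2, d2⟩ : ∃ τ, τ = (find 10 1 (40 + (2 * j + 1)) (mul (inc I (load 2 (const j)))
    (neg (eq I (var (40 + 2 * j)))))).den σ1 := ⟨_, rfl⟩
  rw [← d2]
  rw [← d2, h1.m] at s2
  have k2 : σ2.var (40 + 2 * j) = σ1.var (40 + 2 * j) :=
    d2 ▸ den_var _ (by simp [find, last, wv]; omega) σ1
  have e2 : ∀ i < D.m, ((mul (inc I (load 2 (const j))) (neg (eq I (var (40 + 2 * j))))).T
      (σ1.setVar 10 i) ↔ D.inc i (D.v j) ∧ i ≠ σ1.var (40 + 2 * j)) := by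
    intro i hi
    rw [T_mul, e1 σ1 h1 i hi, T_neg, T_eq, eval_var, eval_var, State.setVar_var, if_pos rfl,
      State.setVar_var, if_neg (by omega)]
  rw [k2]
  have hd' := hd
  rw [Data.deg, Finset.card_eq_two] at hd
  obtain ⟨g, g', hgg, hset⟩ := hd
  have hmem : ∀ i, (i < D.m ∧ D.inc i (D.v j)) ↔ i = g ∨ i = g' := by
    intro i
    have := Finset.ext_iff.1 hset i
    simpa using this
  obtain ⟨hg, hgi⟩ := (hmem g).2 (.inl rfl)
  obtain ⟨hg', hgi'⟩ := (hmem g').2 (.inr rfl)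
  rcases s1 with ⟨u, hu, hu1, hu2⟩ | ⟨hn, -⟩
  swap
  · exact absurd ((e1 σ h g hg).2 hgi) (hn g hg)
  have hu1 := (e1 σ h u hu).1 hu1
  rcases s2 with ⟨w, hw, hw1, hw2⟩ | ⟨hn, -⟩
  · have hw1 := (e2 w hw).1 hw1
    rw [hu2] at hw1 ⊢
    rw [hw2]
    have a1 := (hmem u).1 ⟨hu, hu1⟩
    have a2 := (hmem w).1 ⟨hw, hw1.1⟩
    have a3 := hmem i
    have a4 := hw1.2
    constructor
    · intro hinc
      have := a3.1 ⟨hi, hinc⟩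
      omega
    · intro hor
      exact (a3.2 (by omega)).2
  · exfalso
    rw [hu2] at e2
    have b1 := fun hne => hn g hg ((e2 g hg).2 ⟨hgi, hne⟩)
    have b2 := fun hne => hn g' hg' ((e2 g' hg').2 ⟨hgi', hne⟩)
    have := not_not.1 b1
    have := not_not.1 b2
    omega

/-- The positions of a list are searched by a loop of length `m`, which is possible because no list
is longer than `m`. -/
theorem commonCol_spec (h : Init D σ) {i j : ℕ} (hi : i < 3) (hj : j < 3)
    (hl : ∀ j < 3, (D.l j).length ≤ D.m)
    (hm : ∀ j < 3, ∀ c, σ.arr (27 + j) c ≠ 0 ↔ c ∈ D.l j)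
    (hcom : j < D.k → D.Adj (D.v i) (D.v j) → ∃ c, c ∈ D.l i ∧ c ∈ D.l j)
    (hne : j < D.k → D.v i ≠ D.v j) :
    (j < D.k ∧ D.Adj (D.v i) (D.v j) → ((commonCol i j).den σ).var 21 ∈ D.l i ∧
      ((commonCol i j).den σ).var 21 ∈ D.l j) ∧
    (¬ (j < D.k ∧ D.Adj (D.v i) (D.v j)) → ((commonCol i j).den σ).var 21 = σ.var 21) := by
  obtain ⟨σ1, d1⟩ : ∃ τ, τ = (assign 30 (const 0)).den σ := ⟨_, rfl⟩
  have h1 : Init D σ1 := d1 ▸ h.den (by decide)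
  have z1 : σ1.var 30 = 0 := by rw [d1, den, State.setVar_var, if_pos rfl]; rfl
  have v1 : σ1.var 21 = σ.var 21 := d1 ▸ den_var _ (by decide) σ
  have a1 : σ1.arr = σ.arr := d1 ▸ rfl
  obtain ⟨σ2, d2⟩ : ∃ τ, τ = (flag 10 1 30 (mul (lt (const j) (var 2))
    (mul (inc I (load 2 (const i))) (inc I (load 2 (const j)))))).den σ1 := ⟨_, rfl⟩
  have h2 : Init D σ2 := d2 ▸ h1.den (by simp [keeps, flag, wv, wa])
  have a2 : σ2.arr = σ.arr :=
    a1 ▸ funext fun a => d2 ▸ den_arr _ (by simp [flag, wa]) σ1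
  have v2 : σ2.var 21 = σ.var 21 := v1 ▸ d2 ▸ den_var _ (by simp [flag, wv]) σ1
  have s2 : σ2.var 30 ≠ 0 ↔ j < D.k ∧ D.Adj (D.v i) (D.v j) := by
    rw [d2, flag_spec σ1 (by simp [noVar]) (by decide), z1, h1.m]
    simp only [ne_eq, not_true_eq_false, false_or]
    have e : ∀ g < D.m, ((mul (lt (const j) (var 2)) (mul (inc I (load 2 (const i)))
        (inc I (load 2 (const j))))).T (σ1.setVar 10 g) ↔
        j < D.k ∧ D.inc g (D.v i) ∧ D.inc g (D.v j)) := by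
      intro g hg
      simp only [T_mul, T_add, T_lt, T_eq, T_neg, T_load, T_var, eval_load, eval_var, eval_const,
      State.setVar_var, State.setVar_arr, ↓reduceIte,
      Nat.reduceEqDiff, OfNat.ofNat_eq_ofNat]
      rw [h1.k, h1.a g hg, h1.b g hg, h1.v, h1.v, Data.inc, Data.inc]
    constructor
    · rintro ⟨g, hg, hT⟩
      obtain ⟨g1, g2⟩ := (e g hg).1 hT
      exact ⟨g1, hne g1, g, hg, g2⟩
    · rintro ⟨g1, -, g, hg, g2⟩
      exact ⟨g, hg, (e g hg).2 ⟨g1, g2⟩⟩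
  obtain ⟨σ3, d3⟩ : ∃ τ, τ = (find 10 1 31 (mul (lt I (load 3 (const i)))
    (load (27 + j) (load (4 + i) I)))).den σ2 := ⟨_, rfl⟩
  have h3 : Init D σ3 := d3 ▸ h2.den (by simp [keeps, find, last, wv, wa])
  have s3 := find_spec (i := 10) (b := 1) (x := 31) (cnd := mul (lt I (load 3 (const i)))
    (load (27 + j) (load (4 + i) I))) σ2 (by simp [noVar]) (by decide) (by decide)
  rw [← d3, h2.m] at s3
  have w3 : σ3.var 30 = σ2.var 30 := d3 ▸ den_var _ (by simp [find, last, wv]) σ2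
  have v3 : σ3.var 21 = σ.var 21 := v2 ▸ d3 ▸ den_var _ (by simp [find, last, wv]) σ2
  have e3 : ∀ g, ((mul (lt I (load 3 (const i))) (load (27 + j) (load (4 + i) I))).T
      (σ2.setVar 10 g) ↔ g < (D.l i).length ∧ (D.l i).getD g 0 ∈ D.l j) := by
    intro g
    simp only [T_mul, T_add, T_lt, T_eq, T_neg, T_load, T_var, eval_load, eval_var, eval_const,
      State.setVar_var, State.setVar_arr, ↓reduceIte,
      Nat.reduceEqDiff, OfNat.ofNat_eq_ofNat]
    rw [h2.len i hi]
    refine and_congr_right fun hg => ?_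
    rw [h2.l i hi g hg, a2, hm j hj]
  have hτ : (commonCol i j).den σ =
      (ite (var 30) (assign 21 (load (4 + i) (var 31))) skip).den σ3 := by
    rw [d3, d2, d1]; rfl
  rw [hτ]
  have e4 : (var 30).T σ3 ↔ j < D.k ∧ D.Adj (D.v i) (D.v j) := by rw [T_var, w3, s2]
  refine ⟨fun hA => ?_, fun hA => ?_⟩
  · rw [den_ite_pos (e4.2 hA), den, State.setVar_var, if_pos rfl, eval_load, eval_var]
    rcases s3 with ⟨g, hg, hT, hv⟩ | ⟨hn, -⟩
    · obtain ⟨g1, g2⟩ := (e3 g).1 hT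
      rw [hv, h3.l i hi g g1]
      refine ⟨?_, g2⟩
      rw [List.getD_eq_getElem _ 0 g1]
      exact List.getElem_mem g1
    · obtain ⟨c, hc, hc'⟩ := hcom hA.1 hA.2
      obtain ⟨g, hg, rfl⟩ := List.mem_iff_getElem.1 hc
      exact absurd ((e3 g).2 ⟨hg, by rwa [List.getD_eq_getElem _ 0 hg]⟩)
        (hn g (hg.trans_le (hl i hi)))
  · rw [den_ite_neg fun h => hA (e4.1 h), den, v3]

/-- A vertex has two edges, and the other end of one of them has one more. -/
theorem _root_.Data.Valid.three_le_m (hD : D.Valid) {x : ℕ} (hx : x < D.n) : 3 ≤ D.m := by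
  classical
  have hd := hD.two_le_deg x hx
  obtain ⟨i, hi, j, hj, hij⟩ := Finset.one_lt_card.1 (show 1 < _ from hd)
  simp only [Finset.mem_filter, Finset.mem_range] at hi hj
  have hlt := hD.ne i hi.1
  obtain ⟨y, hy, hyx⟩ : ∃ y, D.inc i y ∧ y ≠ x := by
    by_cases h : D.a i = x
    · exact ⟨D.b i, .inr rfl, fun h' => hlt (h.trans h'.symm)⟩
    · exact ⟨D.a i, .inl rfl, h⟩
  obtain ⟨g, hg, hgi⟩ : ∃ g, (g < D.m ∧ D.inc g y) ∧ g ≠ i := by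
    obtain ⟨g, hg, g', hg', hgg⟩ := Finset.one_lt_card.1
      (show 1 < _ from hD.two_le_deg y (hD.lt_of_inc hi.1 hy))
    simp only [Finset.mem_filter, Finset.mem_range] at hg hg'
    by_cases h : g = i
    · exact ⟨g', hg', fun h' => hgg (h.trans h'.symm)⟩
    · exact ⟨g, hg, h⟩
  have hgj : g ≠ j := by
    rintro rfl
    exact hgi (hD.simple _ hg.1 _ hi.1 x y hyx.symm hj.2 hg.2 hi.2 hy)
  have := hi.1
  have := hj.1
  have := hg.1
  omega

def prepare : Cmd := block [listMarks 0, listMarks 1, listMarks 2, degrees, maxDeg, markS, fillCen,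
  fillSl, endsAt 14 0 1, endsAt 15 1 0, commonCol 0 1, commonCol 0 2, commonCol 1 2, findSlots 0,
  findSlots 1, findSlots 2]

theorem prepare_spec (hD : D.Valid) (h : Init D σ) (hl : ∀ j < 3, (D.l j).length ≤ D.m)
    (hz : ∀ j < 3, ∀ c, σ.arr (27 + j) c = 0) :
    ∃ cc, D.IsCommon cc ∧ Base D cc (prepare.den σ) := by
  have hk := hD.k_le
  obtain ⟨σ1, d1⟩ : ∃ τ, τ = (block [listMarks 0, listMarks 1, listMarks 2]).den σ := ⟨_, rfl⟩
  have h1 : Init D σ1 := d1 ▸ h.den (by decide)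
  have s1 : ∀ j < 3, ∀ c, σ1.arr (27 + j) c ≠ 0 ↔ c ∈ D.l j := by
    obtain ⟨ρ, e⟩ : ∃ ρ, ρ = (listMarks 0).den σ := ⟨_, rfl⟩
    obtain ⟨ρ', e'⟩ : ∃ ρ', ρ' = (listMarks 1).den ρ := ⟨_, rfl⟩
    have hρ : Init D ρ := e ▸ h.den (by decide)
    have hρ' : Init D ρ' := e' ▸ hρ.den (by decide)
    have e2 : σ1 = (listMarks 2).den ρ' := by rw [d1, e', e]; rfl
    intro j hj c
    interval_cases j
    · rw [e2, den_arr _ (by decide), e', den_arr _ (by decide), e]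
      exact listMarks_spec h hj (hl 0 hj) (hz 0 hj) c
    · rw [e2, den_arr _ (by decide), e']
      exact listMarks_spec hρ hj (hl 1 hj) (by rw [e, den_arr _ (by decide)]; exact hz 1 hj) c
    · rw [e2]
      exact listMarks_spec hρ' hj (hl 2 hj)
        (by rw [e', den_arr _ (by decide), e, den_arr _ (by decide)]; exact hz 2 hj) c
  obtain ⟨σ2, d2⟩ : ∃ τ, τ = degrees.den σ1 := ⟨_, rfl⟩
  have h2 : Init D σ2 := d2 ▸ h1.den (by decide)
  have s2 : ∀ x < D.n, σ2.arr 10 x = D.deg x := fun x hx => d2 ▸ degrees_spec hD h1 hx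
  obtain ⟨σ3, d3⟩ : ∃ τ, τ = maxDeg.den σ2 := ⟨_, rfl⟩
  have h3 : Init D σ3 := d3 ▸ h2.den (by decide)
  have s3 : σ3.var 20 = D.s := d3 ▸ maxDeg_spec h2 s2
  obtain ⟨σ4, d4⟩ : ∃ τ, τ = markS.den σ3 := ⟨_, rfl⟩
  have h4 : Init D σ4 := d4 ▸ h3.den (by decide)
  have s4 : ∀ x < D.n, σ4.arr 11 x ≠ 0 ↔ D.S x := by
    intro x hx
    rw [d4, markS, mark_spec σ3 rfl rfl (by decide) (by rw [h3.n]; exact hx), h3.k]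
    simp only [T_one, T_mul, T_add, T_lt, T_eq, T_neg, T_load, T_var, eval_load, eval_var, eval_const,
      State.setVar_var, State.setVar_arr, ↓reduceIte,
      Nat.reduceEqDiff, OfNat.ofNat_eq_ofNat, true_and]
    simp only [h3.v, Data.S]
  have f4 : σ4.arr 10 = σ2.arr 10 := by
    rw [d4, den_arr _ (by decide), d3, den_arr _ (by decide)]
  rw [← f4] at s2
  have v4 : σ4.var 20 = D.s := s3 ▸ d4 ▸ den_var _ (by decide) σ3
  obtain ⟨σ5, d5⟩ : ∃ τ, τ = fillCen.den σ4 := ⟨_, rfl⟩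
  have h5 : Init D σ5 := d5 ▸ h4.den (by decide)
  have s5 : ∀ x < D.n, σ5.arr 12 x ≠ 0 ↔ D.cen x := by
    intro x hx
    rw [d5, fillCen, fill_spec σ4 rfl (by rw [h4.n]; exact hx), tr_eval]
    simp only [T_mul, T_add, T_lt, T_eq, T_neg, T_load, T_var, eval_load, eval_var, eval_const,
      State.setVar_var, State.setVar_arr, ↓reduceIte,
      Nat.reduceEqDiff, OfNat.ofNat_eq_ofNat]
    rw [s2 x hx, s4 x hx]
    exact Iff.rfl
  have f5 : σ5.arr 10 = σ4.arr 10 ∧ σ5.arr 11 = σ4.arr 11 :=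
    ⟨d5 ▸ den_arr _ (by decide) σ4, d5 ▸ den_arr _ (by decide) σ4⟩
  rw [← f5.1] at s2
  rw [← f5.2] at s4
  have v5 : σ5.var 20 = D.s := v4 ▸ d5 ▸ den_var _ (by decide) σ4
  obtain ⟨σ6, d6⟩ : ∃ τ, τ = fillSl.den σ5 := ⟨_, rfl⟩
  have h6 : Init D σ6 := d6 ▸ h5.den (by decide)
  have s6 : ∀ x < D.n, σ6.arr 31 x ≠ 0 ↔ D.sl x := by
    intro x hx
    rw [d6, fillSl, fill_spec σ5 rfl (by rw [h5.n]; exact hx), tr_eval]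
    simp only [T_mul, T_add, T_lt, T_eq, T_neg, T_load, T_var, eval_load, eval_var, eval_const,
      State.setVar_var, State.setVar_arr, ↓reduceIte,
      Nat.reduceEqDiff, OfNat.ofNat_eq_ofNat]
    rw [s2 x hx, s4 x hx, v5]
    exact Iff.rfl
  have f6 : σ6.arr 12 = σ5.arr 12 := d6 ▸ den_arr _ (by decide) σ5
  rw [← f6] at s5
  obtain ⟨σ7, d7⟩ : ∃ τ, τ = (endsAt 14 0 1).den σ6 := ⟨_, rfl⟩
  have h7 : Init D σ7 := d7 ▸ h6.den (by decide)
  have s7 : ∀ i < D.m, σ7.arr 14 i = D.X i := by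
    intro i hi
    obtain ⟨g1, g2⟩ := endsAt_spec (a := 14) (x := 0) (y := 1) hD h6 s5 (by decide) (by decide)
      (by decide) hi
    rw [d7, Data.X]
    split_ifs with hc
    · rw [g1 hc, h6.a i hi]
    · rw [g2 hc, h6.b i hi]
  have f7 : σ7.arr 12 = σ6.arr 12 := d7 ▸ den_arr _ (by decide) σ6
  rw [← f7] at s5
  obtain ⟨σ8, d8⟩ : ∃ τ, τ = (endsAt 15 1 0).den σ7 := ⟨_, rfl⟩
  have h8 : Init D σ8 := d8 ▸ h7.den (by decide)
  have s8 : ∀ i < D.m, σ8.arr 15 i = D.Y i := by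
    intro i hi
    obtain ⟨g1, g2⟩ := endsAt_spec (a := 15) (x := 1) (y := 0) hD h7 s5 (by decide) (by decide)
      (by decide) hi
    rw [d8, Data.Y]
    split_ifs with hc
    · rw [g1 hc, h7.b i hi]
    · rw [g2 hc, h7.a i hi]
  have f8 : ∀ a ∈ [27, 28, 29], σ8.arr a = σ1.arr a := by
    have e : σ8 = (block [degrees, maxDeg, markS, fillCen, fillSl, endsAt 14 0 1,
      endsAt 15 1 0]).den σ1 := by rw [d8, d7, d6, d5, d4, d3, d2]; rfl
    intro a ha
    rw [e]
    refine den_arr _ ?_ σ1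
    revert a
    decide
  have m8 : ∀ j < 3, ∀ c, σ8.arr (27 + j) c ≠ 0 ↔ c ∈ D.l j := fun j hj c => by
    rw [f8 _ (by interval_cases j <;> decide)]
    exact s1 j hj c
  obtain ⟨σ9, d9⟩ : ∃ τ, τ = (commonCol 0 1).den σ8 := ⟨_, rfl⟩
  have h9 : Init D σ9 := d9 ▸ h8.den (by decide)
  obtain ⟨σ10, d10⟩ : ∃ τ, τ = (commonCol 0 2).den σ9 := ⟨_, rfl⟩
  have h10 : Init D σ10 := d10 ▸ h9.den (by decide)
  obtain ⟨σ11, d11⟩ : ∃ τ, τ = (commonCol 1 2).den σ10 := ⟨_, rfl⟩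
  have h11 : Init D σ11 := d11 ▸ h10.den (by decide)
  have f9 : ∀ a ∈ [27, 28, 29], σ9.arr a = σ8.arr a ∧ σ10.arr a = σ8.arr a := by
    intro a ha
    have e1 : ∀ a ∈ [27, 28, 29], a ∉ (commonCol 0 1).wa ∧ a ∉ (commonCol 0 2).wa := by decide
    have e2 : σ9.arr a = σ8.arr a := d9 ▸ den_arr _ (e1 a ha).1 σ8
    exact ⟨e2, e2 ▸ d10 ▸ den_arr _ (e1 a ha).2 σ9⟩
  have com : ∀ i j, i < j → (j < D.k → D.Adj (D.v i) (D.v j) → ∃ c, c ∈ D.l i ∧ c ∈ D.l j) ∧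
      (j < D.k → D.v i ≠ D.v j) := fun i j hij =>
    ⟨fun hj hA => hD.l_common i (by omega) j hj hA,
      fun hj he => hij.ne (hD.v_inj i (by omega) j hj he)⟩
  have c9 := commonCol_spec h8 (i := 0) (j := 1) (by omega) (by omega) hl m8
    (com 0 1 (by omega)).1 (com 0 1 (by omega)).2
  have c10 := commonCol_spec h9 (i := 0) (j := 2) (by omega) (by omega) hl (fun j hj c => by
    rw [(f9 _ (by interval_cases j <;> decide)).1]; exact m8 j hj c)
    (com 0 2 (by omega)).1 (com 0 2 (by omega)).2
  have c11 := commonCol_spec h10 (i := 1) (j := 2) (by omega) (by omega) hl (fun j hj c => by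
    rw [(f9 _ (by interval_cases j <;> decide)).2]; exact m8 j hj c)
    (com 1 2 (by omega)).1 (com 1 2 (by omega)).2
  rw [← d9] at c9
  rw [← d10] at c10
  rw [← d11] at c11
  have sym : ∀ x y, D.Adj x y → D.Adj y x := fun x y ⟨h, i, hi, h', h''⟩ => ⟨h.symm, i, hi, h'', h'⟩
  -- At most one pair of listed vertices is adjacent, since two would form a path; the searches for
  -- the other pairs leave the colour as it is.
  have hcc : ∀ i j, i < j → j < D.k → D.Adj (D.v i) (D.v j) →
      σ11.var 21 ∈ D.l i ∧ σ11.var 21 ∈ D.l j := by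
    intro i j hij hj hA
    have np := hD.no_path
    have hcase : (i = 0 ∧ j = 1) ∨ (i = 0 ∧ j = 2) ∨ (i = 1 ∧ j = 2) := by omega
    rcases hcase with ⟨rfl, rfl⟩ | ⟨rfl, rfl⟩ | ⟨rfl, rfl⟩
    · rw [c11.2 fun g => np 0 (by omega) 1 hj 2 g.1 (by omega) hA g.2,
        c10.2 fun g => np 2 g.1 0 (by omega) 1 hj (by omega) (sym _ _ g.2) hA]
      exact c9.1 ⟨hj, hA⟩
    · rw [c11.2 fun g => np 0 (by omega) 2 hj 1 (by omega) (by omega) hA (sym _ _ g.2)]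
      exact c10.1 ⟨hj, hA⟩
    · exact c11.1 ⟨hj, hA⟩
  refine ⟨σ11.var 21, ?_, ?_⟩
  · intro i hi j hj hA
    rcases Nat.lt_trichotomy i j with hlt | rfl | hlt
    · exact (hcc i j hlt hj hA).1
    · exact absurd rfl hA.1
    · exact (hcc j i hlt hi (sym _ _ hA)).2
  obtain ⟨σ12, d12⟩ : ∃ τ, τ = (findSlots 0).den σ11 := ⟨_, rfl⟩
  have h12 : Init D σ12 := d12 ▸ h11.den (by decide)
  obtain ⟨σ13, d13⟩ : ∃ τ, τ = (findSlots 1).den σ12 := ⟨_, rfl⟩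
  have h13 : Init D σ13 := d13 ▸ h12.den (by decide)
  obtain ⟨σ14, d14⟩ : ∃ τ, τ = (findSlots 2).den σ13 := ⟨_, rfl⟩
  have h14 : Init D σ14 := d14 ▸ h13.den (by decide)
  have hτ : prepare.den σ = σ14 := by
    rw [d14, d13, d12, d11, d10, d9, d8, d7, d6, d5, d4, d3, d2, d1]; rfl
  rw [hτ]
  have tail : ∀ a ∈ [27, 28, 29, 14, 15, 31, 12, 11],
      σ14.arr a = σ8.arr a ∧ (a ≠ 15 → σ8.arr a = σ7.arr a) ∧
      (a ≠ 15 → a ≠ 14 → σ7.arr a = σ6.arr a) ∧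
      (a ≠ 31 → a ≠ 15 → a ≠ 14 → σ6.arr a = σ5.arr a) := by
    have e : σ14 = (block [commonCol 0 1, commonCol 0 2, commonCol 1 2, findSlots 0, findSlots 1,
      findSlots 2]).den σ8 := by rw [d14, d13, d12, d11, d10, d9]; rfl
    have e' : ∀ a ∈ [27, 28, 29, 14, 15, 31, 12, 11], a ∉ (block [commonCol 0 1, commonCol 0 2,
      commonCol 1 2, findSlots 0, findSlots 1, findSlots 2]).wa ∧
      (a ≠ 15 → a ∉ (endsAt 15 1 0).wa) ∧ (a ≠ 15 → a ≠ 14 → a ∉ (endsAt 14 0 1).wa) ∧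
      (a ≠ 31 → a ≠ 15 → a ≠ 14 → a ∉ fillSl.wa) := by decide
    intro a ha
    obtain ⟨g1, g2, g3, g4⟩ := e' a ha
    refine ⟨e ▸ den_arr _ g1 σ8, fun h => ?_, fun h h' => ?_, fun h h' h'' => ?_⟩
    · rw [d8, den_arr _ (g2 h)]
    · rw [d7, den_arr _ (g3 h h')]
    · rw [d6, den_arr _ (g4 h h' h'')]
  have tv : σ14.var 20 = D.s ∧ σ14.var 21 = σ11.var 21 := by
    have e : σ14 = (block [fillSl, endsAt 14 0 1, endsAt 15 1 0, commonCol 0 1, commonCol 0 2,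
      commonCol 1 2, findSlots 0, findSlots 1, findSlots 2]).den σ5 := by
      rw [d14, d13, d12, d11, d10, d9, d8, d7, d6]; rfl
    refine ⟨v5 ▸ e ▸ den_var _ (by decide) σ5, ?_⟩
    rw [d14, den_var _ (by decide), d13, den_var _ (by decide), d12, den_var _ (by decide)]
  refine ⟨h14.n, h14.m, h14.k, tv.1, tv.2, h14.a, h14.b, h14.v, h14.l, fun j hj c => ?_,
    fun x hx => ?_, fun x hx => ?_, fun i hi => ?_, fun i hi => ?_, fun x hx => ?_,
    fun j hj hd i hi => ?_⟩
  · rw [(tail _ (by interval_cases j <;> decide)).1]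
    exact m8 j hj c
  · obtain ⟨t1, t2, t3, t4⟩ := tail 11 (by decide)
    rw [t1, t2 (by decide), t3 (by decide) (by decide), t4 (by decide) (by decide) (by decide)]
    exact s4 x hx
  · obtain ⟨t1, t2, -⟩ := tail 12 (by decide)
    rw [t1, t2 (by decide)]
    exact s5 x hx
  · obtain ⟨t1, t2, -⟩ := tail 14 (by decide)
    rw [t1, t2 (by decide)]
    exact s7 i hi
  · rw [(tail 15 (by decide)).1]
    exact s8 i hi
  · obtain ⟨t1, t2, t3, -⟩ := tail 31 (by decide)
    rw [t1, t2 (by decide), t3 (by decide) (by decide)]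
    exact s6 x hx
  · have hj3 : j < 3 := by omega
    interval_cases j
    · have e : σ14.var 40 = σ12.var 40 ∧ σ14.var 41 = σ12.var 41 := by
        rw [d14, den_var _ (by decide), den_var _ (by decide), d13, den_var _ (by decide),
          den_var _ (by decide)]
        exact ⟨rfl, rfl⟩
      have := findSlots_spec h11 (j := 0) (by omega) hd hi
      rw [← d12] at this
      rw [e.1, e.2]
      exact this
    · have e : σ14.var 42 = σ13.var 42 ∧ σ14.var 43 = σ13.var 43 := by
        rw [d14, den_var _ (by decide), den_var _ (by decide)]
        exact ⟨rfl, rfl⟩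
      have := findSlots_spec h12 (j := 1) (by omega) hd hi
      rw [← d13] at this
      rw [e.1, e.2]
      exact this
    · exact d14 ▸ findSlots_spec h13 (j := 2) (by omega) hd hi

end RAM

set_option linter.unusedSimpArgs false

/-! ### Linear bounds between the numbers of vertices, edges and colours -/

namespace Data

open Finset

open scoped Classical

variable {D : Data}

theorem sum_deg (D : Data) (P : ℕ → Prop) [DecidablePred P] :
    ∑ x ∈ (range D.n).filter P, D.deg x =
      ∑ i ∈ range D.m, (((range D.n).filter P).filter (fun x => D.inc i x)).card :=
  sum_card_bipartiteAbove_eq_sum_card_bipartiteBelow (fun x i => D.inc i x)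

/-- All degrees are at least 2, and every edge has two ends. -/
theorem Valid.n_le_m (hD : D.Valid) : D.n ≤ D.m := by
  have h1 : (range D.n).card • 2 ≤ ∑ x ∈ range D.n, D.deg x :=
    card_nsmul_le_sum _ _ _ fun x hx => hD.two_le_deg x (mem_range.1 hx)
  have h2 := D.sum_deg fun _ => True
  rw [filter_true] at h2
  have h3 : ∑ i ∈ range D.m, ((range D.n).filter (fun x => D.inc i x)).card ≤
      (range D.m).card • 2 := by
    refine sum_le_card_nsmul _ _ _ fun i _ => ?_
    refine (card_le_card (t := {D.a i, D.b i}) fun x hx => ?_).trans card_le_two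
    rw [mem_filter] at hx
    rcases hx.2 with h | h <;> simp [h]
  simp only [card_range, smul_eq_mul] at h1 h3
  omega

/-- By sparsity every edge has an end of degree 2, and such a vertex accounts for two edges only. -/
theorem Valid.m_le (hD : D.Valid) : D.m ≤ 2 * D.n := by
  have h1 : ∑ x ∈ (range D.n).filter (fun x => D.deg x = 2), D.deg x ≤
      ((range D.n).filter (fun x => D.deg x = 2)).card • 2 :=
    sum_le_card_nsmul _ _ _ fun x hx => (mem_filter.1 hx).2.le
  have h2 := card_filter_le (range D.n) (fun x => D.deg x = 2)
  have h3 : (range D.m).card • 1 ≤ ∑ i ∈ range D.m,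
      (((range D.n).filter (fun x => D.deg x = 2)).filter (fun x => D.inc i x)).card := by
    refine card_nsmul_le_sum _ _ _ fun i hi => card_pos.2 ?_
    have hi := mem_range.1 hi
    rcases hD.sparse i hi with h | h
    · exact ⟨D.a i, mem_filter.2 ⟨mem_filter.2 ⟨mem_range.2 (hD.a_lt i hi), h⟩, .inl rfl⟩⟩
    · exact ⟨D.b i, mem_filter.2 ⟨mem_filter.2 ⟨mem_range.2 (hD.b_lt i hi), h⟩, .inr rfl⟩⟩
  rw [D.sum_deg fun x => D.deg x = 2] at h1
  simp only [card_range, smul_eq_mul] at h1 h2 h3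
  omega

theorem Valid.s_le (hD : D.Valid) {x : ℕ} (hx : x < D.n) : D.s ≤ D.m :=
  max_le (hD.three_le_m hx) (Finset.sup_le fun _ _ => deg_le_m _)

end Data

/-! ### The complete program and its running time -/

namespace RAM

open RAM.Expr RAM.Cmd

variable {D : Data} {σ : State}

/-- Loops are bounded by variables that are not written and nested at most twice, and the values
in memory grow slowly. -/
def Cmd.fine (C : Cmd) : Bool := C.wf [0, 1, 2] && (C.toProg.slow && decide (C.depth ≤ 2))

theorem fine_iff {C : Cmd} : C.fine ↔ C.wf [0, 1, 2] ∧ C.toProg.slow ∧ C.depth ≤ 2 := by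
  simp [fine]

theorem fine_seq {P Q : Cmd} (hP : P.fine) (hQ : Q.fine) : (seq P Q).fine := by
  rw [fine_iff] at *
  simp only [wf, toProg, Prog.slow, depth, Bool.and_eq_true, max_le_iff]
  tauto

theorem fine_ite {p : Expr} {P Q : Cmd} (hP : P.fine) (hQ : Q.fine) : (ite p P Q).fine := by
  rw [fine_iff] at *
  simp only [wf, toProg, Prog.slow, depth, Bool.and_eq_true, max_le_iff]
  tauto

theorem slots_fine (t : ℕ → ℕ) (r : ℕ) : (slots t r).fine := by
  induction r with
  | zero => rfl
  | succ r ih =>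
    refine fine_seq ih ?_
    unfold slotCmd
    split <;> rfl

theorem attempt_fine (t : ℕ → ℕ) : (attempt t).fine := by
  refine fine_ite (fine_seq (fine_seq (by decide) (fine_seq (slots_fine t 6) ?_)) (by decide))
    (by decide)
  unfold extCmd
  split <;> decide

theorem tryAll_fine (M : ℕ) : (tryAll M).fine := by
  induction M with
  | zero => rfl
  | succ M ih => exact fine_seq ih (attempt_fine _)

/-- The program, with `M` trials. -/
def program (M : ℕ) : Cmd := seq prepare (seq (tryAll M) (fill 10 1 0 (load 30 I)))

theorem program_fine (M : ℕ) : (program M).fine :=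
  fine_seq (by decide) (fine_seq (tryAll_fine M) (by decide))

theorem program_spec (hD : D.Valid) (hC : D.Cases) (h : Init D σ)
    (hl : ∀ j < 3, (D.l j).length ≤ D.m) (hz : ∀ j < 3, ∀ c, σ.arr (27 + j) c = 0)
    (h26 : σ.var 26 = 0) {M : ℕ} (hM : M = 5 ^ 7) :
    D.IsSol (((program M).den σ).arr 0) := by
  have hk := hD.k_le
  obtain ⟨cc, hcc, h1⟩ := prepare_spec hD h hl hz
  obtain ⟨p, hp, ht⟩ := Data.exists_pre hD hC hcc
  have v1 : (prepare.den σ).var 26 = 0 := h26 ▸ den_var _ (by decide) σ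
  have hs := tryAll_spec hD h1 v1 hp ht M hM
  have h2 : Base D cc ((tryAll M).den (prepare.den σ)) := h1.den hk (tryAll_keeps M)
  have e : ∀ i < D.m, ((program M).den σ).arr 0 i =
      ((tryAll M).den (prepare.den σ)).arr 30 i := by
    intro i hi
    rw [program, den, den, fill_spec _ rfl (by rw [h2.m]; exact hi)]
    simp only [T_mul, T_add, T_lt, T_eq, T_neg, T_load, T_var, eval_load, eval_var, eval_const,
      State.setVar_var, State.setVar_arr, ↓reduceIte,
      Nat.reduceEqDiff, OfNat.ofNat_eq_ofNat]
  refine ⟨fun i hi => ?_, fun i hi j hj => ?_, fun i hi => ?_⟩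
  · rw [e i hi]; exact hs.range i hi
  · rw [e i hi, e j hj]; exact hs.proper i hi j hj
  · rw [e i hi]; exact hs.lists i hi

/-- Two nested loops of length at most `m` take time of order `m ^ 2`, which is of order `n * m`
because `m ≤ 2 * n`. Values stay below the size of the input plus the running time, hence below a
constant times `n ^ 2`. -/
theorem Cmd.fine.run {P : Cmd} (hP : P.fine) : ∃ C b, ∀ (D : Data) (σ : State), D.Valid → 0 < D.k → Init D σ →
    Bdd (2 * D.n + 8) σ →
    ∃ t, Run (D.n ^ b) P.toProg σ t (P.den σ) ∧ t ≤ C * (D.n * D.m) := by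
  obtain ⟨T, hT⟩ : ∃ T, T = P.tb 1 := ⟨_, rfl⟩
  refine ⟨2 * T, 4 * T + 7, fun D σ hD hk h hb => ?_⟩
  obtain ⟨h1, h2, h3⟩ := fine_iff.1 hP
  have hm3 : 3 ≤ D.m := hD.three_le_m (hD.v_lt 0 hk)
  have hnm := hD.n_le_m
  have hmn := hD.m_le
  have hk3 := hD.k_le
  have htb : P.tb D.m ≤ T * D.m ^ 2 := hT ▸ P.tb_le (by omega) h3
  have hmm : D.m ^ 2 ≤ 2 * (D.n * D.m) := by nlinarith
  have ht : P.tb D.m ≤ 2 * T * (D.n * D.m) := by nlinarith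
  have hn2 : 2 ≤ D.n := by omega
  have hW : 2 * D.n + 8 + P.tb D.m ≤ D.n ^ (4 * T + 7) := by
    have e1 : 2 * T * (D.n * D.m) ≤ 4 * T * D.n ^ 2 := by
      have : D.n * D.m ≤ 2 * D.n ^ 2 := by nlinarith
      nlinarith
    have e2 : 2 * D.n + 8 ≤ 5 * D.n ^ 2 := by nlinarith
    -- The constant is absorbed into the exponent, which is possible since `n` is at least 2.
    have e3 : 4 * T + 5 ≤ D.n ^ (4 * T + 5) :=
      (Nat.lt_two_pow_self).le.trans (Nat.pow_le_pow_left hn2 _)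
    calc _ ≤ (4 * T + 5) * D.n ^ 2 := by nlinarith
      _ ≤ D.n ^ (4 * T + 5) * D.n ^ 2 := Nat.mul_le_mul_right _ e3
      _ = D.n ^ (4 * T + 7) := by rw [← pow_add]
  obtain ⟨t, r1, r2⟩ := P.run_bdd (B := [0, 1, 2]) (N := D.m) (M := 2 * D.n + 8) h1 h2 σ
    (fun b hb => by
      simp only [List.mem_cons, List.not_mem_nil, or_false] at hb
      rcases hb with rfl | rfl | rfl
      · rw [h.n]; exact hnm
      · rw [h.m]
      · rw [h.k]; omega) (by omega) hb hW
  exact ⟨t, r1, r2.trans ht⟩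

end RAM

/-! ## Instances in numbered form -/

namespace SparseGraph

variable {V : Type*} {n m k : ℕ}

/-- The data of an instance whose vertices are numbered by `φ`. -/
def toData (φ : V ≃ Fin n) (e : Fin m → V × V) (v : Fin k → V) (l : Fin k → List ℕ) : Data where
  n := n
  m := m
  k := k
  a i := if h : i < m then φ (e ⟨i, h⟩).1 else 0
  b i := if h : i < m then φ (e ⟨i, h⟩).2 else 0
  v j := if h : j < k then φ (v ⟨j, h⟩) else 0
  l j := if h : j < k then l ⟨j, h⟩ else []

section

variable {φ : V ≃ Fin n} {e : Fin m → V × V} {v : Fin k → V} {l : Fin k → List ℕ}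

local notation "𝒟" => toData φ e v l

theorem exists_num {y : ℕ} (hy : y < n) : ∃ x, (φ x : ℕ) = y :=
  ⟨φ.symm ⟨y, hy⟩, by simp⟩

theorem num_inj {x y : V} : (φ x : ℕ) = φ y ↔ x = y := by
  rw [Fin.val_inj, φ.injective.eq_iff]

theorem v_eq {j : ℕ} (hj : j < k) : (𝒟).v j = φ (v ⟨j, hj⟩) := dif_pos hj

theorem l_eq {j : ℕ} (hj : j < k) : (𝒟).l j = l ⟨j, hj⟩ := dif_pos hj

theorem inc_num {i : ℕ} (hi : i < m) (x : V) :
    (𝒟).inc i (φ x) ↔ x ∈ s((e ⟨i, hi⟩).1, (e ⟨i, hi⟩).2) := by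
  have ha : (𝒟).a i = φ (e ⟨i, hi⟩).1 := dif_pos hi
  have hb : (𝒟).b i = φ (e ⟨i, hi⟩).2 := dif_pos hi
  rw [Data.inc, ha, hb, num_inj, num_inj, Sym2.mem_iff]
  exact or_congr eq_comm eq_comm

theorem a_lt {i : ℕ} (hi : i < m) : (𝒟).a i < n := by
  simp only [toData, dif_pos hi]
  exact Fin.is_lt _

theorem b_lt {i : ℕ} (hi : i < m) : (𝒟).b i < n := by
  simp only [toData, dif_pos hi]
  exact Fin.is_lt _

theorem exists_of_adj {y z : ℕ} (h : (𝒟).Adj y z) :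
    (∃ x, (φ x : ℕ) = y) ∧ ∃ x, (φ x : ℕ) = z := by
  obtain ⟨-, i, hi, h1, h2⟩ := h
  have : ∀ y, (𝒟).inc i y → y < n := by
    rintro y (rfl | rfl)
    exacts [a_lt hi, b_lt hi]
  exact ⟨exists_num (this y h1), exists_num (this z h2)⟩

variable {G : SimpleGraph V}

theorem IsEdgeList.mem_edgeSet (he : IsEdgeList G e) (i : Fin m) :
    s((e i).1, (e i).2) ∈ G.edgeSet := he.2 ▸ Set.mem_range_self i

theorem adj_num (he : IsEdgeList G e) {x y : V} : (𝒟).Adj (φ x) (φ y) ↔ G.Adj x y := by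
  rw [← SimpleGraph.mem_edgeSet]
  constructor
  · rintro ⟨hne, i, hi, h1, h2⟩
    have hne : x ≠ y := fun h => hne (by rw [h])
    have hi : i < m := hi
    have := he.mem_edgeSet ⟨i, hi⟩
    rwa [(Sym2.mem_and_mem_iff hne).1 ⟨(inc_num hi x).1 h1, (inc_num hi y).1 h2⟩] at this
  · intro h
    have hne : x ≠ y := G.ne_of_adj h
    rw [← he.2] at h
    obtain ⟨i, hi⟩ := h
    simp only at hi
    refine ⟨fun h => hne (num_inj.1 h), i, i.2, (inc_num i.2 x).2 ?_, (inc_num i.2 y).2 ?_⟩ <;>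
      rw [hi] <;> simp

theorem no_triangle (h : G.CliqueFree 3) {x y z : V} (h1 : G.Adj x y) (h2 : G.Adj y z)
    (h3 : G.Adj x z) : False := by
  classical
  exact h {x, y, z} (SimpleGraph.is3Clique_triple_iff.2 ⟨h1, h3, h2⟩)

/-- An edge within one of the two sides would close a triangle, so the copy of `K_{2,3}` is induced.
-/
theorem inSmallTheta_of_theta (he : IsEdgeList G e) (hG : G.CliqueFree 3) (hk : k = 2)
    (hv : Function.Injective v) (h : (𝒟).Theta) : InSmallTheta G (Set.range v) := by
  subst hk
  obtain ⟨u, u', y, huu, hy, h1, h2, h3⟩ := h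
  obtain ⟨⟨u, rfl⟩, y, rfl⟩ := exists_of_adj h1
  obtain ⟨⟨u', rfl⟩, -⟩ := exists_of_adj h2
  have huu : u ≠ u' := fun h => huu (by rw [h])
  rw [adj_num he] at h1 h2
  have h3 : ∀ j, G.Adj (v j) u ∧ G.Adj (v j) u' := fun j => by
    have := h3 j j.2
    rwa [v_eq j.2, adj_num he, adj_num he] at this
  have hy : ∀ j, y ≠ v j := fun j h => hy j j.2 (by rw [v_eq j.2, h])
  have a0 := h3 0
  have a1 := h3 1
  have hv01 : v 0 ≠ v 1 := fun h => absurd (hv h) (by decide)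
  set g : Fin 2 ⊕ Fin 3 → V := Sum.elim ![u, u'] ![v 0, v 1, y] with hg
  have n1 : ¬ G.Adj u u' := fun h => no_triangle hG h h2 h1
  have n2 : ¬ G.Adj (v 0) (v 1) := fun h => no_triangle hG h a1.1 a0.1
  have n3 : ∀ j, ¬ G.Adj (v j) y := fun j h => no_triangle hG (h3 j).1 h1 h
  have hgi : Function.Injective g := by
    rintro (a | a) (b | b) hab <;> fin_cases a <;> fin_cases b <;>
      simp_all [huu.symm, hv01.symm, (hy 0).symm, (hy 1).symm, a0.1.ne, a0.2.ne, a1.1.ne,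
        a1.2.ne, a0.1.ne', a0.2.ne', a1.1.ne', a1.2.ne', h1.ne, h1.ne', h2.ne, h2.ne']
  refine ⟨Set.range g, ?_, ⟨SimpleGraph.Iso.symm ⟨Equiv.ofInjective g hgi, ?_⟩⟩⟩
  · rintro x ⟨j, rfl⟩
    fin_cases j
    exacts [⟨.inr 0, rfl⟩, ⟨.inr 1, rfl⟩]
  · intro a b
    change G.Adj (g a) (g b) ↔ _
    rcases a with a | a <;> rcases b with b | b <;> fin_cases a <;> fin_cases b <;>
      simp [hg, completeBipartiteGraph, h1, h2, h1.symm, h2.symm, a0, a1, a0.1.symm, a0.2.symm,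
        a1.1.symm, a1.2.symm, n1, n2, n3, G.adj_comm u' u, G.adj_comm (v 1) (v 0), G.adj_comm y]

variable [Fintype V] [DecidableRel G.Adj]

theorem deg_num (he : IsEdgeList G e) (x : V) : (𝒟).deg (φ x) = G.degree x := by
  classical
  rw [← G.card_incidenceFinset_eq_degree, Data.deg]
  refine Finset.card_bij (fun i hi => s((e ⟨i, Finset.mem_range.1 (Finset.mem_filter.1 hi).1⟩).1,
    (e ⟨i, Finset.mem_range.1 (Finset.mem_filter.1 hi).1⟩).2)) ?_ ?_ ?_
  · intro i hi
    rw [SimpleGraph.mem_incidenceFinset]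
    exact ⟨he.mem_edgeSet _, (inc_num _ x).1 (Finset.mem_filter.1 hi).2⟩
  · intro i _ j _ hij
    exact congrArg Fin.val (he.1 hij)
  · intro s hs
    rw [SimpleGraph.mem_incidenceFinset] at hs
    have h1 := hs.1
    rw [← he.2] at h1
    obtain ⟨i, rfl⟩ := h1
    exact ⟨i, Finset.mem_filter.2 ⟨Finset.mem_range.2 i.2, (inc_num i.2 x).2 hs.2⟩, rfl⟩

theorem s_eq (he : IsEdgeList G e) : (𝒟).s = numColors G := by
  refine congrArg (max 3) (le_antisymm (Finset.sup_le fun y hy => ?_)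
    (G.maxDegree_le_of_forall_degree_le _ fun x => ?_))
  · obtain ⟨x, rfl⟩ := exists_num (φ := φ) (Finset.mem_range.1 hy)
    rw [deg_num he]
    exact G.degree_le_maxDegree x
  · rw [← deg_num (φ := φ) (v := v) (l := l) he]
    exact Finset.le_sup (f := (𝒟).deg) (Finset.mem_range.2 (φ x).2)

/-- The three vertices of such a path are distinct, so they are all the listed vertices, and an edge
between its ends would close a triangle. -/
theorem not_path (hI : IsInstance G v (fun j => (l j).toFinset)) {i j h : Fin k} (hih : i ≠ h)
    (h1 : G.Adj (v i) (v j)) : ¬ G.Adj (v j) (v h) := by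
  intro h2
  have h3 : ¬ G.Adj (v i) (v h) := fun h3 => no_triangle hI.triangleFree h1 h2 h3
  have hij : i ≠ j := fun h => h1.ne (congrArg v h)
  have hjh : j ≠ h := fun h => h2.ne (congrArg v h)
  set w : Fin 3 → Fin k := ![i, j, h] with hw
  have hwi : Function.Injective w := by
    intro a b hab
    fin_cases a <;> fin_cases b <;> simp_all [eq_comm]
  have hk : 3 = k := le_antisymm (by simpa using Fintype.card_le_of_injective w hwi) hI.le_three
  have hwb : Function.Bijective w :=
    (Fintype.bijective_iff_injective_and_card w).2 ⟨hwi, by simpa using hk⟩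
  have hr : Set.range (v ∘ w) = Set.range v := hwb.2.range_comp v
  refine hI.not_inducesPathTwo ?_
  rw [← hr]
  refine ⟨SimpleGraph.Iso.symm ⟨Equiv.ofInjective (v ∘ w) (hI.injective.comp hwi), ?_⟩⟩
  intro a b
  change G.Adj (v (w a)) (v (w b)) ↔ _
  rw [SimpleGraph.pathGraph_adj]
  fin_cases a <;> fin_cases b <;> simp [hw, h1, h1.symm, h2, h2.symm, h3, G.adj_comm (v h) (v i)]

theorem valid (he : IsEdgeList G e) (hnd : ∀ j, (l j).Nodup)
    (hI : IsInstance G v (fun j => (l j).toFinset)) : (𝒟).Valid where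
  a_lt i hi := a_lt hi
  b_lt i hi := b_lt hi
  ne i hi h := by
    have h' := he.mem_edgeSet ⟨i, hi⟩
    simp only [toData, dif_pos (show i < m from hi), num_inj] at h
    exact G.ne_of_adj h' h
  simple i hi j hj x y hxy hix hiy hjx hjy := by
    have hx : ∀ z, (𝒟).inc i z → ∃ x, (φ x : ℕ) = z := by
      rintro z (rfl | rfl)
      exacts [exists_num (a_lt hi), exists_num (b_lt hi)]
    obtain ⟨x, rfl⟩ := hx x hix
    obtain ⟨y, rfl⟩ := hx y hiy
    have hi : i < m := hi
    have hj : j < m := hj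
    have hxy : x ≠ y := fun h => hxy (by rw [h])
    have h1 := (Sym2.mem_and_mem_iff hxy).1
      ⟨(inc_num hi x).1 hix, (inc_num hi y).1 hiy⟩
    have h2 := (Sym2.mem_and_mem_iff hxy).1
      ⟨(inc_num hj x).1 hjx, (inc_num hj y).1 hjy⟩
    exact congrArg Fin.val (he.1 (h1.trans h2.symm))
  two_le_deg y hy := by
    obtain ⟨x, rfl⟩ := exists_num (φ := φ) hy
    rw [deg_num he, ← hI.minDegree_eq]
    exact G.minDegree_le_degree x
  sparse i hi := by
    have hi : i < m := hi
    have h' := hI.sparse (he.mem_edgeSet ⟨i, hi⟩)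
    have ha : (𝒟).a i = φ (e ⟨i, hi⟩).1 := dif_pos hi
    have hb : (𝒟).b i = φ (e ⟨i, hi⟩).2 := dif_pos hi
    have h2 := fun x => hI.minDegree_eq ▸ G.minDegree_le_degree x
    rw [ha, hb, deg_num he, deg_num he]
    exact h'.imp (fun h => le_antisymm h (h2 _)) fun h => le_antisymm h (h2 _)
  triangleFree x y z h1 h2 h3 := by
    obtain ⟨⟨x, rfl⟩, y, rfl⟩ := exists_of_adj h1
    obtain ⟨-, z, rfl⟩ := exists_of_adj h2
    rw [adj_num he] at h1 h2 h3
    exact no_triangle hI.triangleFree h1 h2 h3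
  v_lt j hj := by
    have hj : j < k := hj
    rw [v_eq hj]
    exact Fin.is_lt _
  v_inj i hi j hj h := by
    have hi : i < k := hi
    have hj : j < k := hj
    rw [v_eq hi, v_eq hj, num_inj] at h
    exact congrArg Fin.val (hI.injective h)
  k_le := hI.le_three
  l_nodup j hj := by
    have hj : j < k := hj
    rw [l_eq hj]
    exact hnd _
  l_mem j hj c hc := by
    have hj : j < k := hj
    rw [l_eq hj] at hc
    rw [s_eq he]
    exact Finset.mem_Icc.1 (hI.list_subset ⟨j, hj⟩ (List.mem_toFinset.2 hc))
  l_len j hj := by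
    have hj : j < k := hj
    rw [l_eq hj, v_eq hj, deg_num he, ← List.toFinset_card_of_nodup (hnd _)]
    exact hI.degree_le_card ⟨j, hj⟩
  l_common i hi j hj h := by
    have hi : i < k := hi
    have hj : j < k := hj
    rw [v_eq hi, v_eq hj, adj_num he] at h
    obtain ⟨c, hc⟩ := hI.inter_nonempty ⟨i, hi⟩ ⟨j, hj⟩ h
    rw [Finset.mem_inter, List.mem_toFinset, List.mem_toFinset] at hc
    exact ⟨c, by rw [l_eq hi]; exact hc.1, by rw [l_eq hj]; exact hc.2⟩
  no_path i hi j hj h hh hih h1 h2 := by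
    have hi : i < k := hi
    have hj : j < k := hj
    have hh : h < k := hh
    rw [v_eq hi, v_eq hj, adj_num he] at h1
    rw [v_eq hj, v_eq hh, adj_num he] at h2
    exact not_path hI (fun h => hih (congrArg Fin.val h)) h1 h2

theorem inRing_of_inRingFive (he : IsEdgeList G e) (h : InRingFive G (Set.range v)) :
    (𝒟).InRing := by
  obtain ⟨u, p, hp, hlen, hv⟩ := h
  have hinj := hp.isHole.isCycle.getVert_injOn'
  rw [hlen] at hinj
  have inj : ∀ i j : Fin 5, p.getVert i = p.getVert j → i = j := fun i j h =>
    Fin.ext (hinj (show (i : ℕ) ≤ 4 by omega) (show (j : ℕ) ≤ 4 by omega) h)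
  refine ⟨fun i => φ (p.getVert i), fun i j h => inj i j (num_inj.1 h), fun i => ?_,
    fun i j hi hj => inj i j ?_, fun j (hj : j < k) => ?_⟩
  · rw [adj_num he]
    -- The walk is closed, so the last of the five edges returns to position 0.
    have h5 : p.getVert 5 = p.getVert 0 := by
      rw [← hlen, p.getVert_length, p.getVert_zero]
    have := fun i hi => p.adj_getVert_succ (i := i) (hlen ▸ hi)
    fin_cases i
    exacts [this 0 (by omega), this 1 (by omega), this 2 (by omega), this 3 (by omega),
      h5 ▸ this 4 (by omega)]
  · rw [deg_num he] at hi hj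
    exact hp.atMostOne (p.getVert_mem_support _) (p.getVert_mem_support _) hi hj
  · obtain ⟨i, hi, hle⟩ := SimpleGraph.Walk.mem_support_iff_exists_getVert.1
      (hv _ (Set.mem_range_self ⟨j, hj⟩))
    rw [v_eq hj]
    rw [hlen] at hle
    rcases Nat.lt_or_ge i 5 with h | h
    · exact ⟨⟨i, h⟩, by rw [← hi]⟩
    · obtain rfl : i = 5 := by omega
      refine ⟨0, ?_⟩
      have h5 : p.getVert 5 = p.getVert 0 := by
        rw [← hlen, p.getVert_length, p.getVert_zero]
      rw [← hi, h5]
      rfl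

/-- A chord of a cycle of length 5 joins two vertices at distance 2 on the cycle and would close a
triangle. -/
theorem inRingFive_of_inRing (he : IsEdgeList G e) (hG : G.CliqueFree 3) (h : (𝒟).InRing) :
    InRingFive G (Set.range v) := by
  obtain ⟨z, hz, hadj, hbig, hv⟩ := h
  choose w hw using fun i => (exists_of_adj (hadj i)).1
  have hne : ∀ i j, w i = w j ↔ i = j := fun i j =>
    ⟨fun h => hz (by rw [← hw, ← hw, h]), congrArg w⟩
  have ha : ∀ i, G.Adj (w i) (w (i + 1)) := fun i => by
    rw [← adj_num (φ := φ) (v := v) (l := l) he, hw, hw]; exact hadj i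
  set p : G.Walk (w 0) (w 0) := .cons (ha 0) (.cons (ha 1) (.cons (ha 2) (.cons (ha 3)
    (.cons (ha 4) .nil)))) with hp
  have hs : ∀ x, x ∈ p.support ↔ ∃ i, w i = x := by
    intro x
    simp only [hp, SimpleGraph.Walk.support_cons, SimpleGraph.Walk.support_nil, List.mem_cons,
      List.not_mem_nil, or_false]
    constructor
    · rintro (h | h | h | h | h | h)
      exacts [⟨_, h.symm⟩, ⟨_, h.symm⟩, ⟨_, h.symm⟩, ⟨_, h.symm⟩, ⟨_, h.symm⟩, ⟨_, h.symm⟩]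
    · rintro ⟨i, rfl⟩
      fin_cases i <;> simp
  have hc : p.IsCycle := by
    simp [hp, SimpleGraph.Walk.cons_isCycle_iff, SimpleGraph.Walk.cons_isPath_iff, hne]
  have he' : ∀ i, s(w i, w (i + 1)) ∈ p.edges := by
    intro i
    fin_cases i <;> simp [hp]
  refine ⟨w 0, p, ⟨⟨hc, by simp [hp], ?_⟩, ?_⟩, by simp [hp], ?_⟩
  · rw [SimpleGraph.Walk.isChordless_iff_forall_mem_edges]
    intro x y hx hy hxy
    obtain ⟨i, rfl⟩ := (hs x).1 hx
    obtain ⟨j, rfl⟩ := (hs y).1 hy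
    have : ∀ i j : Fin 5, i = j ∨ j = i + 1 ∨ i = j + 1 ∨ j = i + 1 + 1 ∨ i = j + 1 + 1 := by
      decide
    rcases this i j with rfl | rfl | rfl | rfl | rfl
    · exact absurd hxy (G.irrefl)
    · exact he' i
    · rw [Sym2.eq_swap]; exact he' j
    · exact (no_triangle hG (ha i) (ha (i + 1)) hxy).elim
    · exact (no_triangle hG (ha j) (ha (j + 1)) hxy.symm).elim
  · intro x hx y hy h1 h2
    obtain ⟨i, rfl⟩ := (hs x).1 hx
    obtain ⟨j, rfl⟩ := (hs y).1 hy
    rw [hbig i j (by rw [← hw, deg_num he]; exact h1) (by rw [← hw, deg_num he]; exact h2)]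
  · rintro x ⟨j, rfl⟩
    obtain ⟨i, hi⟩ := hv j j.2
    rw [← hw, v_eq j.2, num_inj] at hi
    exact (hs _).2 ⟨i, hi⟩

theorem nf_iff (he : IsEdgeList G e) {j : ℕ} (hj : j < k) :
    (𝒟).NF ((𝒟).v j) ↔ G.degree (v ⟨j, hj⟩) = 2 ∧ ¬ IsFree G (v ⟨j, hj⟩) := by
  rw [Data.NF, v_eq hj, deg_num he]
  refine and_congr_right fun hd => ?_
  simp only [IsFree, hd, true_and, not_forall]
  constructor
  · rintro ⟨y, h1, h2⟩
    obtain ⟨-, y, rfl⟩ := exists_of_adj h1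
    rw [adj_num he] at h1
    rw [deg_num he] at h2
    exact ⟨y, h1, h2⟩
  · rintro ⟨y, h1, h2⟩
    exact ⟨φ y, (adj_num he).2 h1, by rwa [deg_num he]⟩

theorem cases (he : IsEdgeList G e) (hI : IsInstance G v (fun j => (l j).toFinset)) :
    (𝒟).Cases := by
  have hnc : (Set.range v).ncard = k := by
    rw [← Set.image_univ, Set.ncard_image_of_injective _ hI.injective, Set.ncard_univ, Nat.card_fin]
  rcases hI.cases with ⟨hk, hr, hc⟩ | hg | ⟨hk, hc⟩
  · refine .inl ⟨hk, inRing_of_inRingFive he hr, hc.trans (Finset.card_le_card fun c h => ?_)⟩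
    rw [Finset.mem_biUnion] at h ⊢
    obtain ⟨j, -, h⟩ := h
    exact ⟨j, Finset.mem_range.2 (by omega), by rwa [l_eq j.2]⟩
  · refine .inr (.inl ⟨fun i (hi : i < k) j (hj : j < k) h1 h2 => ?_,
      fun hk h => hg.not_inRingFive (hnc.trans hk) (inRingFive_of_inRing he hI.triangleFree h),
      fun hk w (hw : w < k) hN i (hi : i < k) j (hj : j < k) hiw hjw hA => ?_⟩)
    · have := hg.atMostOne (Set.mem_range_self ⟨i, hi⟩) (Set.mem_range_self ⟨j, hj⟩)
        ((nf_iff he hi).1 h1) ((nf_iff he hj).1 h2)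
      exact congrArg Fin.val (hI.injective this)
    · obtain ⟨d, f⟩ := (nf_iff he hw).1 hN
      rw [v_eq hi, v_eq hj, adj_num he] at hA
      have hne : ∀ i (hi : i < k), i ≠ w → v ⟨i, hi⟩ ∈ Set.range v \ {v ⟨w, hw⟩} := fun i hi h =>
        ⟨Set.mem_range_self _, fun h' => h (congrArg Fin.val (hI.injective h'))⟩
      exact hg.not_adj (hnc.trans hk) (Set.mem_range_self ⟨w, hw⟩) d f (hne i hi hiw)
        (hne j hj hjw) hA
  · refine .inr (.inr ⟨hk, fun hd hθ => hc (fun i => ?_)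
      (inSmallTheta_of_theta he hI.triangleFree hk hI.injective hθ)⟩)
    rw [← deg_num (φ := φ) (v := v) (l := l) he, ← v_eq (e := e) (l := l) i.2]
    exact hd i i.2

/-- The edge-colouring of `G` given by the colours of the numbered edges. -/
theorem exists_coloring (he : IsEdgeList G e) {c : ℕ → ℕ} (hc : (𝒟).IsSol c) :
    ∃ c' : Sym2 V → ℕ, (∀ i : Fin m, c' s((e i).1, (e i).2) = c i) ∧
      IsEdgeColoring G (numColors G) c' ∧ RespectsLists G v (fun j => (l j).toFinset) c' := by
  -- The value 0 away from the edges of `G` is of no importance.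
  set c' : Sym2 V → ℕ := Function.extend (fun i => s((e i).1, (e i).2)) (fun i : Fin m => c i) 0
  have h1 : ∀ i : Fin m, c' s((e i).1, (e i).2) = c i := fun i => he.1.extend_apply _ _ i
  have h2 : ∀ s ∈ G.edgeSet, ∃ i : Fin m, s((e i).1, (e i).2) = s := fun s hs => by
    rw [← he.2] at hs; exact hs
  refine ⟨c', h1, ⟨fun s hs => ?_, fun x y z hy hz hyz h => ?_⟩, fun j w hw => ?_⟩
  · obtain ⟨i, rfl⟩ := h2 s hs
    rw [h1, Finset.mem_Icc, ← s_eq (φ := φ) (v := v) (l := l) he]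
    exact hc.range i i.2
  · obtain ⟨i, hi⟩ := h2 s(x, y) hy
    obtain ⟨j, hj⟩ := h2 s(x, z) hz
    rw [← hi, ← hj, h1, h1] at h
    refine hc.proper i i.2 j j.2 (fun hij => hyz ?_) (φ x) ((inc_num i.2 x).2 ?_)
      ((inc_num j.2 x).2 ?_) h
    · have := Fin.ext hij
      rw [this, hj, Sym2.congr_right] at hi
      exact hi.symm
    · rw [hi]; simp
    · rw [hj]; simp
  · obtain ⟨i, hi⟩ := h2 s(v j, w) hw
    rw [← hi, h1, List.mem_toFinset, ← show (𝒟).l j = l j from l_eq j.2]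
    refine hc.lists i i.2 j j.2 ?_
    rw [v_eq j.2, inc_num i.2, hi]
    simp

end

end SparseGraph

/-! ## Running the program on an instance -/

namespace RAM

/-- The memory that holds the data `D`. -/
def ofData (D : Data) : State where
  var x := match x with
    | 0 => D.n
    | 1 => D.m
    | 2 => D.k
    | _ => 0
  arr a i := match a with
    | 0 => D.a i
    | 1 => D.b i
    | 2 => D.v i
    | 3 => (D.l i).length
    | j + 4 => (D.l j).getD i 0

theorem init_ofData (D : Data) : Init D (ofData D) where
  n := rfl
  m := rfl
  k := rfl
  a _ _ := rfl
  b _ _ := rfl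
  v _ := rfl
  len _ _ := rfl
  l j _ i _ := by rw [Nat.add_comm]; rfl

end RAM

namespace SparseGraph

open RAM

section

variable {V : Type*} {n m k : ℕ} {φ : V ≃ Fin n} {e : Fin m → V × V} {v : Fin k → V}
  {l : Fin k → List ℕ}

local notation "𝒟" => toData φ e v l

theorem a_le (i : ℕ) : (𝒟).a i ≤ n := by
  by_cases h : i < m
  · exact (a_lt h).le
  · exact (dif_neg h).trans_le (Nat.zero_le n)

theorem b_le (i : ℕ) : (𝒟).b i ≤ n := by
  by_cases h : i < m
  · exact (b_lt h).le
  · exact (dif_neg h).trans_le (Nat.zero_le n)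

theorem v_le (j : ℕ) : (𝒟).v j ≤ n := by
  by_cases h : j < k
  · rw [v_eq h]; exact (Fin.is_lt _).le
  · exact (dif_neg h).trans_le (Nat.zero_le n)

theorem l_eq_nil {j : ℕ} (h : k ≤ j) : (𝒟).l j = [] := dif_neg (by omega)

theorem color_le_m (hD : (𝒟).Valid) {j c : ℕ} (hc : c ∈ (𝒟).l j) :
    1 ≤ c ∧ c ≤ (𝒟).s ∧ (𝒟).s ≤ m := by
  rcases Nat.lt_or_ge j k with h | h
  · exact ⟨(hD.l_mem j h c hc).1, (hD.l_mem j h c hc).2, hD.s_le (hD.v_lt j h)⟩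
  · rw [l_eq_nil h] at hc
    simp at hc

theorem length_le_m (hD : (𝒟).Valid) (j : ℕ) : ((𝒟).l j).length ≤ m := by
  rcases Nat.lt_or_ge j k with h | h
  · rw [← List.toFinset_card_of_nodup (hD.l_nodup j h)]
    refine (Finset.card_le_card fun c hc => ?_ : _ ≤ (Finset.Icc 1 m).card).trans (by simp)
    have := color_le_m hD (List.mem_toFinset.1 hc)
    exact Finset.mem_Icc.2 ⟨this.1, this.2.1.trans this.2.2⟩
  · rw [l_eq_nil h]
    exact Nat.zero_le _

theorem bdd_ofData (hD : (𝒟).Valid) : Bdd (2 * n + 8) (ofData 𝒟) := by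
  have hm : m ≤ 2 * n := hD.m_le
  have hk : k ≤ 3 := hD.k_le
  constructor
  · intro x
    match x with
    | 0 => change n ≤ _; omega
    | 1 => change m ≤ _; omega
    | 2 => change k ≤ _; omega
    | _ + 3 => exact Nat.zero_le _
  · intro a i
    match a with
    | 0 => exact (a_le (e := e) (v := v) (l := l) i).trans (by omega)
    | 1 => exact (b_le (e := e) (v := v) (l := l) i).trans (by omega)
    | 2 => exact (v_le (e := e) (v := v) (l := l) i).trans (by omega)
    | 3 => exact (length_le_m hD i).trans (by omega)
    | j + 4 =>
      change ((𝒟).l j).getD i 0 ≤ _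
      rcases Nat.lt_or_ge i ((𝒟).l j).length with h | h
      · rw [List.getD_eq_getElem _ _ h]
        have := color_le_m hD (List.getElem_mem h)
        omega
      · rw [List.getD_eq_default _ _ h]
        exact Nat.zero_le _

variable [Fintype V] {G : SimpleGraph V} [DecidableRel G.Adj]

theorem program_isSol {M : ℕ} (hM : M = 5 ^ 7) (he : IsEdgeList G e)
    (hnd : ∀ j, (l j).Nodup) (hI : IsInstance G v (fun j => (l j).toFinset)) :
    (𝒟).IsSol (((program M).den (ofData 𝒟)).arr 0) := by
  have hD : (𝒟).Valid := valid he hnd hI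
  refine program_spec hD (cases he hI) (init_ofData _) (fun j _ => length_le_m hD j)
    (fun j _ c => ?_) rfl hM
  -- Arrays 27 to 29, which have to be empty at the start, are the places of the lists 23 to 25;
  -- there are at most three lists.
  have h : (𝒟).l (23 + j) = [] := l_eq_nil (hI.le_three.trans (by omega))
  rw [show 27 + j = 23 + j + 4 by omega]
  change ((𝒟).l (23 + j)).getD c 0 = 0
  rw [h]
  rfl

end

theorem ofData_toData {n m k : ℕ} (e : Fin m → Fin n × Fin n) (v : Fin k → Fin n)
    (l : Fin k → List ℕ) : ofData (toData (Equiv.refl _) e v l) = input e v l := by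
  refine congrArg₂ State.mk (funext fun x => ?_) (funext fun a => funext fun i => ?_)
  · match x with
    | 0 | 1 | 2 => rfl
    | _ + 3 => rfl
  · match a with
    | 0 | 1 | 2 => rfl
    | 3 =>
      change List.length (dite _ _ _) = dite _ _ _
      split_ifs <;> rfl
    | j + 4 =>
      change List.getD (dite _ _ _) i 0 = dite _ _ _
      split_ifs <;> rfl

theorem exists_isEdgeList {V : Type*} [Fintype V] (G : SimpleGraph V) :
    ∃ (m : ℕ) (e : Fin m → V × V), IsEdgeList G e := by
  classical
  let f := (Fintype.equivFin G.edgeSet).symm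
  have h : ∀ i, s((f i).1.out.1, (f i).1.out.2) = (f i).1 := fun i => Quot.out_eq _
  refine ⟨_, fun i => (f i).1.out, ?_, ?_⟩
  · simp only [h]
    exact Subtype.val_injective.comp f.injective
  · simp only [h]
    ext s
    exact ⟨fun ⟨i, hi⟩ => hi ▸ (f i).2, fun hs => ⟨f.symm ⟨s, hs⟩, by simp⟩⟩

end SparseGraph

theorem mainTheorem8 :
    -- existence of the edge-colouring
    (∀ (V : Type*) [Fintype V] (G : SimpleGraph V) [DecidableRel G.Adj] (k : ℕ)
        (v : Fin k → V) (L : Fin k → Finset ℕ),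
      SparseGraph.IsInstance G v L →
        ∃ c : Sym2 V → ℕ,
          SparseGraph.IsEdgeColoring G (SparseGraph.numColors G) c ∧
          SparseGraph.RespectsLists G v L c) ∧
    -- one program finds such a colouring in at most `C * (n * m)` steps on words of
    -- `O(log n)` bits
    (∃ (P : RAM.Prog) (C b : ℕ),
      ∀ (n m k : ℕ) (G : SimpleGraph (Fin n)) [DecidableRel G.Adj]
        (e : Fin m → Fin n × Fin n) (v : Fin k → Fin n) (l : Fin k → List ℕ),
        SparseGraph.IsEdgeList G e →
        (∀ j, (l j).Nodup) →
        SparseGraph.IsInstance G v (fun j => (l j).toFinset) →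
          ∃ (t : ℕ) (σ : RAM.State) (c : Sym2 (Fin n) → ℕ),
            RAM.Run (n ^ b) P (RAM.input e v l) t σ ∧
            t ≤ C * (n * m) ∧
            RAM.Outputs σ e c ∧
            SparseGraph.IsEdgeColoring G (SparseGraph.numColors G) c ∧
            SparseGraph.RespectsLists G v (fun j => (l j).toFinset) c) := by
  -- There is one trial for each choice of seven digits to base 5. The number is kept behind an
  -- equation so that the sequence of trials is never expanded.
  obtain ⟨M, hM⟩ : ∃ M : ℕ, M = 5 ^ 7 := ⟨_, rfl⟩
  constructor
  · intro V _ G _ k v L hI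
    -- Existence comes from the same program, applied to an arbitrary numbering of the vertices and
    -- edges.
    obtain ⟨m, e, he⟩ := SparseGraph.exists_isEdgeList G
    have hL : (fun j => ((L j).toList).toFinset) = L := funext fun j => (L j).toList_toFinset
    obtain ⟨c, -, h⟩ := SparseGraph.exists_coloring he (SparseGraph.program_isSol
      (φ := Fintype.equivFin V) (v := v) (l := fun j => (L j).toList) hM he
      (fun j => (L j).nodup_toList) (by rwa [hL]))
    rw [hL] at h
    exact ⟨c, h⟩
  · obtain ⟨C, b, hC⟩ := RAM.Cmd.fine.run (RAM.program_fine M)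
    refine ⟨(RAM.program M).toProg, C, b, fun n m k G _ e v l he hnd hI => ?_⟩
    have hD : (SparseGraph.toData (Equiv.refl _) e v l).Valid := SparseGraph.valid he hnd hI
    obtain ⟨t, hrun, ht⟩ := hC _ _ hD hI.one_le (RAM.init_ofData _) (SparseGraph.bdd_ofData hD)
    obtain ⟨c, hc, h⟩ := SparseGraph.exists_coloring he
      (SparseGraph.program_isSol (φ := Equiv.refl _) hM he hnd hI)
    rw [SparseGraph.ofData_toData] at hrun hc
    exact ⟨t, _, c, hrun, ht, fun i => (hc i).symm, h⟩
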